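/- **Lemma 4.1 (boundary Morrey bound).** Let $n\ge 5$, let $\Omega\subset\mathbb R^n$ be a bounded smooth domain and let $N\subset\mathbb R^L$ be a compact $l$-dimensional embedded $C^3$ submanifold without boundary. *Setting.* Put $W^{2,2}(\Omega,N)=\{v\in W^{2,2}(\Omega,\mathbb R^L): v(x)\in N \text{ for a.e. }x\in\Omega\}$ and, for $\delta>0$, $\Omega_\delta=\{x\in\overline\Omega:\operatorname{dist}(x,\partial\Omega)<\delta\}$. A map $u\in W^{2,2}(\Omega,N)$ is *biharmonic* if it is a critical point of $E_2(v)=\int_\Omega|\Delta v|^2$ on $W^{2,2}(\Omega,N)$ with respect to compactly supported variations: $\frac{d}{dt}\big|_{t=0}E_2(v_t)=0$ for every curve $t\mapsto v_t\in W^{2,2}(\Omega,N)$ with $v_0=u$ that is differentiable at $t=0$ in $W^{2,2}$ and satisfies $v_t=u$ outside a fixed compact subset of $\Omega$. It is *stationary* if moreover $\frac{d}{dt}\big|_{t=0}\int_\Omega|\Delta(u(x+tY(x)))|^2dx=0$ for all $Y\in C_0^\infty(\Omega,\mathbb R^n)$. Let $\phi\in C^\infty(\Omega_\delta,N)$, $0<R_0\le\delta$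 and $C_0\in\mathbb R$. A stationary biharmonic map $u\in W^{2,2}(\Omega,N)$ is *globally stationary with boundary data $\phi$ and constants $R_0,C_0$* if $(u,\partial u/\partial\nu)=(\phi,\partial\phi/\partial\nu)$ on $\partial\Omega$ in the sense of traces and, with $w=u-\phi$, for every $x_0\in\partial\Omega$ and almost all $0<r\le R\le R_0$, $$r^{4-n}\int_{\Omega\cap B_r(x_0)}|\nabla^2w|^2+A(r,R)+e^{C_0r}B(r)+e^{C_0r}C(r)\le C_0Re^{C_0R}+e^{C_0R}R^{4-n}\int_{\Omega\cap B_R(x_0)}|\nabla^2w|^2+e^{C_0R}B(R)+e^{C_0R}C(R),$$ where (subscripts are partial derivatives, repeated indices are summed, a squared norm is summed over its free index) $$A(r,R)=4\int_{\Omega\cap(B_R(x_0)\setminus B_r(x_0))}\left(\frac{|w_j+(y-x_0)^iw_{ij}|^2}{|y-x_0|^{n-2}}+(n-2)\frac{|(y-x_0)^iw_i|^2}{|y-x_0|^n}\right)dy,$$ $$B(\rho)=2\int_{\Omega\cap\partial B_\rho(x_0)}\left(2\frac{|(y-x_0)^kw_k|^2}{\rho^{n-1}}-\frac{\langle w_i,w_{ij}\rangle(y-x_0)^j}{\rho^{n-3}}-2\frac{|\nabla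 w|^2}{\rho^{n-3}}\right),$$ $$C(\rho)=2\rho^{4-n}\int_{\Omega\cap\partial B_\rho(x_0)}\left[\Big\langle\Delta w,\frac{\partial w}{\partial r}\Big\rangle-\Big\langle\nabla w,\frac{\partial}{\partial r}(\nabla w)\Big\rangle\right].$$ For $O\subset\mathbb R^n$ open, $1\le p<\infty$ and $0<\lambda\le n$, the Morrey space $M^{p,\lambda}(O)$ is the set of $f\in L^p(O)$ for which $\|f\|_{M^{p,\lambda}(O)}=\big(\sup_{B_r\subset O}r^{\lambda-n}\int_{B_r}|f|^p\big)^{1/p}$ is finite, the supremum being over all balls contained in $O$. *Claim.* There exist $\epsilon_1>0$, $\theta_0\in(0,1)$ and $C>0$, depending only on $n$, $\Omega$ and $N$, such that the following holds. For all $\delta>0$, $\phi\in C^\infty(\Omega_\delta,N)$, $0<R_0\le\delta$, $C_0\in\mathbb R$ and $0<\epsilon_0\le\epsilon_1$ there is $R_1>0$, depending only on $n,\Omega,N,\delta,\phi,R_0,C_0,\epsilon_0$, such that for every globally stationary biharmonic map $u\in W^{2,2}(\Omega,N)$ with boundary data $\phi$ and constants $R_0,C_0$, every $x_0\in\partial\Omega$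 and every $0<R\le R_1$: if $$R^{4-n}\int_{\Omega\cap B_R(x_0)}\left(|\nabla^2u|^2+R^{-2}|\nabla u|^2\right)\le\epsilon_0^2,$$ then $\nabla u\in M^{4,4}(\Omega\cap B_{\theta_0R}(x_0))$, $\nabla^2u\in M^{2,4}(\Omega\cap B_{\theta_0R}(x_0))$ and $$\|\nabla u\|_{M^{4,4}(\Omega\cap B_{\theta_0R}(x_0))}+\|\nabla^2u\|_{M^{2,4}(\Omega\cap B_{\theta_0R}(x_0))}\le C\epsilon_0.$$ -/

import Mathlib

open Filter Topology MeasureTheory Set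
open scoped ContDiff ENNReal

noncomputable section

namespace Biharmonic

/-- Euclidean space `ℝᵈ` with its Euclidean norm. -/
abbrev E (d : ℕ) : Type := EuclideanSpace ℝ (Fin d)

/-- The `i`-th standard basis vector of `ℝᵈ`. -/
def e {d : ℕ} (i : Fin d) : E d := EuclideanSpace.single i (1 : ℝ)

/-! ### Domains and target manifolds -/

/-- A bounded smooth domain: open, connected, bounded, and near each boundary point equal to
the sublevel set of a smooth function with non-vanishing differential. -/
structure IsBoundedSmoothDomain {n : ℕ} (Ω : Set (E n)) : Prop where
  isOpen : IsOpen Ω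
  isConnected : IsConnected Ω
  isBounded : Bornology.IsBounded Ω
  smooth_boundary : ∀ x ∈ frontier Ω, ∃ (U : Set (E n)) (ρ : E n → ℝ),
    IsOpen U ∧ x ∈ U ∧ ContDiffOn ℝ ∞ ρ U ∧ (∀ y ∈ U, fderiv ℝ ρ y ≠ 0) ∧
      Ω ∩ U = {y | y ∈ U ∧ ρ y < 0}

/-- A compact `l`-dimensional embedded `C³` submanifold (without boundary) of `ℝᴸ`: near each of
its points it is the zero set of a `C³` submersion into `ℝᵐ`, where `l + m = L`. -/
structure IsCompactSubmanifold {L : ℕ} (l : ℕ) (N : Set (E L)) : Prop where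
  isCompact : IsCompact N
  locally_level_set : ∃ m : ℕ, l + m = L ∧ ∀ p ∈ N, ∃ (U : Set (E L)) (g : E L → E m),
    IsOpen U ∧ p ∈ U ∧ ContDiffOn ℝ 3 g U ∧
      (∀ y ∈ U, Function.Surjective (fderiv ℝ g y)) ∧ N ∩ U = {y | y ∈ U ∧ g y = 0}

/-- The one-sided closed neighbourhood `Ω_δ = {x ∈ closure Ω : dist(x, ∂Ω) < δ}` of `∂Ω`. -/
def closedCollar {n : ℕ} (Ω : Set (E n)) (δ : ℝ) : Set (E n) :=
  {x | x ∈ closure Ω ∧ Metric.infDist x (frontier Ω) < δ}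

/-- The open part `{x ∈ Ω : dist(x, ∂Ω) < δ}` of `Ω_δ`. -/
def collar {n : ℕ} (Ω : Set (E n)) (δ : ℝ) : Set (E n) :=
  {x | x ∈ Ω ∧ Metric.infDist x (frontier Ω) < δ}

/-! ### Weak derivatives and `W^{2,2}` -/

/-- Smooth functions with compact support in `Ω`. -/
structure IsTestFunction {n : ℕ} {F : Type*} [NormedAddCommGroup F] [NormedSpace ℝ F]
    (Ω : Set (E n)) (ψ : E n → F) : Prop where
  contDiff : ContDiff ℝ ∞ ψ
  hasCompactSupport : HasCompactSupport ψ
  tsupport_subset : tsupport ψ ⊆ Ω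

/-- `g` is the weak `i`-th partial derivative of `f` in the open set `Ω`. -/
structure HasWeakPartial {n L : ℕ} (Ω : Set (E n)) (i : Fin n) (f g : E n → E L) : Prop where
  locallyIntegrable : LocallyIntegrableOn f Ω
  locallyIntegrable' : LocallyIntegrableOn g Ω
  integral_eq : ∀ ψ : E n → ℝ, IsTestFunction Ω ψ →
    ∫ x in Ω, (fderiv ℝ ψ x (e i)) • f x = - ∫ x in Ω, ψ x • g x

open Classical in
/-- A representative of the weak partial derivative `∂ᵢ f` in `Ω` (it is unique up to a null set
of `Ω`; the value is `0` if there is none). -/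
def weakPartial {n L : ℕ} (Ω : Set (E n)) (i : Fin n) (f : E n → E L) : E n → E L :=
  if h : ∃ g, HasWeakPartial Ω i f g then h.choose else 0

theorem hasWeakPartial_weakPartial {n L : ℕ} {Ω : Set (E n)} {i : Fin n} {f g : E n → E L}
    (h : HasWeakPartial Ω i f g) : HasWeakPartial Ω i f (weakPartial Ω i f) := by
  have h' : ∃ g, HasWeakPartial Ω i f g := ⟨g, h⟩
  rw [weakPartial, dif_pos h']
  exact h'.choose_spec

/-- The second weak derivative `f_{ij}` in `Ω`. -/
def weakPartial₂ {n L : ℕ} (Ω : Set (E n)) (i j : Fin n) (f : E n → E L) : E n → E L :=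
  weakPartial Ω j (weakPartial Ω i f)

/-- The weak gradient, with `|∇f|² = ∑ᵢ |fᵢ|²`. -/
def weakGrad {n L : ℕ} (Ω : Set (E n)) (f : E n → E L) (x : E n) : PiLp 2 fun _ : Fin n => E L :=
  WithLp.toLp 2 fun i => weakPartial Ω i f x

/-- The weak Hessian, with `|∇²f|² = ∑ᵢⱼ |f_{ij}|²`. -/
def weakHess {n L : ℕ} (Ω : Set (E n)) (f : E n → E L) (x : E n) :
    PiLp 2 fun _ : Fin n × Fin n => E L :=
  WithLp.toLp 2 fun p => weakPartial₂ Ω p.1 p.2 f x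

/-- The weak Laplacian. -/
def weakLaplacian {n L : ℕ} (Ω : Set (E n)) (f : E n → E L) (x : E n) : E L :=
  ∑ i, weakPartial₂ Ω i i f x

/-- The Sobolev space `W^{2,2}(Ω, ℝᴸ)`. -/
structure MemW22 {n L : ℕ} (Ω : Set (E n)) (f : E n → E L) : Prop where
  memLp : MemLp f 2 (volume.restrict Ω)
  hasWeakPartial : ∀ i, HasWeakPartial Ω i f (weakPartial Ω i f)
  hasWeakPartial₂ : ∀ i j, HasWeakPartial Ω j (weakPartial Ω i f) (weakPartial₂ Ω i j f)
  memLp_grad : MemLp (weakGrad Ω f) 2 (volume.restrict Ω)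
  memLp_hess : MemLp (weakHess Ω f) 2 (volume.restrict Ω)

/-- The `W^{2,2}(Ω)` norm (for `f` in that space). -/
def w22Norm {n L : ℕ} (Ω : Set (E n)) (f : E n → E L) : ℝ≥0∞ :=
  eLpNorm f 2 (volume.restrict Ω) + eLpNorm (weakGrad Ω f) 2 (volume.restrict Ω)
    + eLpNorm (weakHess Ω f) 2 (volume.restrict Ω)

/-- The maps in `W^{2,2}(Ω, N)`. -/
def MemW22Into {n L : ℕ} (Ω : Set (E n)) (N : Set (E L)) (f : E n → E L) : Prop :=
  MemW22 Ω f ∧ ∀ᵐ x ∂(volume.restrict Ω), f x ∈ N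

/-! ### Stationary biharmonic maps -/

/-- The energy `E₂(v) = ∫_Ω |Δv|²`. -/
def hessianEnergy {n L : ℕ} (Ω : Set (E n)) (v : E n → E L) : ℝ :=
  ∫ x in Ω, ‖weakLaplacian Ω v x‖ ^ 2

/-- Extrinsic biharmonic maps: critical points of `E₂` on `W^{2,2}(Ω, N)`. The energy has
derivative zero along every curve `t ↦ v t` in `W^{2,2}(Ω, N)` through `u` which is constant
outside a compact subset of `Ω` and is differentiable at `t = 0` in the `W^{2,2}` norm. -/
def IsBiharmonicMap {n L : ℕ} (Ω : Set (E n)) (N : Set (E L)) (u : E n → E L) : Prop :=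
  MemW22Into Ω N u ∧
    ∀ (v : ℝ → E n → E L) (η : E n → E L) (K : Set (E n)),
      v 0 = u → (∀ t, MemW22Into Ω N (v t)) →
      IsCompact K → K ⊆ Ω → (∀ t, ∀ x ∉ K, v t x = u x) →
      MemW22 Ω η →
      Tendsto (fun t : ℝ => w22Norm Ω fun x => t⁻¹ • (v t x - u x) - η x) (𝓝[≠] 0) (𝓝 0) →
      HasDerivAt (fun t => hessianEnergy Ω (v t)) 0 0

/-- Stationary biharmonic maps: biharmonic maps that are also critical for the domain variations
`u_t(x) = u(x + t Y(x))`, where `Y` is a smooth vector field with compact support in `Ω`. -/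
def IsStationaryBiharmonicMap {n L : ℕ} (Ω : Set (E n)) (N : Set (E L)) (u : E n → E L) : Prop :=
  IsBiharmonicMap Ω N u ∧
    ∀ Y : E n → E n, IsTestFunction Ω Y →
      HasDerivAt (fun t : ℝ => hessianEnergy Ω fun x => u (x + t • Y x)) 0 0

/-- The Dirichlet condition `(u, ∂u/∂ν) = (φ, ∂φ/∂ν)` on `∂Ω` in the sense of traces: near `∂Ω`
the difference `u - φ` belongs to `W₀^{2,2}`, that is, it is a limit in `W^{2,2}` of smooth
functions with compact support in `Ω`. -/
def HasDirichletData {n L : ℕ} (Ω : Set (E n)) (δ : ℝ) (φ u : E n → E L) : Prop :=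
  ∃ δ' : ℝ, 0 < δ' ∧ δ' < δ ∧ ∀ η : ℝ≥0∞, 0 < η → ∃ v : E n → E L, IsTestFunction Ω v ∧
    w22Norm (collar Ω δ') (fun x => u x - φ x - v x) < η

/-! ### The boundary monotonicity inequality -/

/-- `∫_{Ω ∩ ∂B_ρ(x₀)} f dσ`, where `σ` is the surface measure of the sphere. -/
def sphereIntegral {n : ℕ} (Ω : Set (E n)) (x₀ : E n) (ρ : ℝ) (f : E n → ℝ) : ℝ :=
  ρ ^ ((n : ℤ) - 1) *
    ∫ ξ : Metric.sphere (0 : E n) 1, Ω.indicator f (x₀ + ρ • (ξ : E n))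
      ∂((volume : Measure (E n)).toSphere)

section Monotonicity

/- In this section `w` stands for `u - φ`, whose weak derivatives are taken in the open set `O`,
a one-sided neighbourhood of `∂Ω` on which `φ` is defined. -/

/-- `(y - x₀)ⁱ wᵢ`. -/
def radialDeriv {n L : ℕ} (O : Set (E n)) (w : E n → E L) (x₀ y : E n) : E L :=
  ∑ i, (y - x₀) i • weakPartial O i w y

/-- `(y - x₀)ⁱ w_{ji}`, the `j`-th component of `((y - x₀)·∇)∇w`. -/
def radialDerivGrad {n L : ℕ} (O : Set (E n)) (w : E n → E L) (x₀ y : E n) (j : Fin n) : E L :=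
  ∑ i, (y - x₀) i • weakPartial₂ O j i w y

/-- `r^{4-n} ∫_{Ω ∩ B_r(x₀)} |∇²w|²`. -/
def monoE {n L : ℕ} (Ω O : Set (E n)) (w : E n → E L) (x₀ : E n) (r : ℝ) : ℝ :=
  r ^ (4 - (n : ℤ)) * ∫ y in Ω ∩ Metric.ball x₀ r, ‖weakHess O w y‖ ^ 2

/-- The term `A(r, R)`. -/
def monoA {n L : ℕ} (Ω O : Set (E n)) (w : E n → E L) (x₀ : E n) (r R : ℝ) : ℝ :=
  4 * ∫ y in Ω ∩ (Metric.ball x₀ R \ Metric.ball x₀ r),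
    ((∑ j, ‖weakPartial O j w y + radialDerivGrad O w x₀ y j‖ ^ 2) / ‖y - x₀‖ ^ ((n : ℤ) - 2)
      + ((n : ℝ) - 2) * (‖radialDeriv O w x₀ y‖ ^ 2 / ‖y - x₀‖ ^ (n : ℤ)))

/-- The term `B(ρ)`. -/
def monoB {n L : ℕ} (Ω O : Set (E n)) (w : E n → E L) (x₀ : E n) (ρ : ℝ) : ℝ :=
  2 * sphereIntegral Ω x₀ ρ fun y =>
    2 * (‖radialDeriv O w x₀ y‖ ^ 2 / ρ ^ ((n : ℤ) - 1))
      - (∑ i, inner ℝ (weakPartial O i w y) (radialDerivGrad O w x₀ y i)) / ρ ^ ((n : ℤ) - 3)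
      - 2 * (‖weakGrad O w y‖ ^ 2 / ρ ^ ((n : ℤ) - 3))

/-- The term `C(ρ)`; here `∂/∂r = ρ⁻¹ (y - x₀)·∇` on `∂B_ρ(x₀)`. -/
def monoC {n L : ℕ} (Ω O : Set (E n)) (w : E n → E L) (x₀ : E n) (ρ : ℝ) : ℝ :=
  2 * ρ ^ (4 - (n : ℤ)) * sphereIntegral Ω x₀ ρ fun y =>
    inner ℝ (weakLaplacian O w y) (ρ⁻¹ • radialDeriv O w x₀ y)
      - ∑ i, inner ℝ (weakPartial O i w y) (ρ⁻¹ • radialDerivGrad O w x₀ y i)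

/-- The boundary monotonicity inequality with constants `R₀` and `C`, at all boundary points. As
the second derivatives of a `W^{2,2}` map are defined only up to null sets, the integrals over
spheres make sense for almost every radius. -/
def BoundaryMonotonicity {n L : ℕ} (Ω O : Set (E n)) (w : E n → E L) (R₀ C : ℝ) : Prop :=
  ∀ x₀ ∈ frontier Ω, ∀ᵐ r : ℝ, ∀ᵐ R : ℝ, 0 < r → r ≤ R → R ≤ R₀ →
    monoE Ω O w x₀ r + monoA Ω O w x₀ r R
        + Real.exp (C * r) * monoB Ω O w x₀ r + Real.exp (C * r) * monoC Ω O w x₀ r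
      ≤ C * R * Real.exp (C * R) + Real.exp (C * R) * monoE Ω O w x₀ R
        + Real.exp (C * R) * monoB Ω O w x₀ R + Real.exp (C * R) * monoC Ω O w x₀ R

end Monotonicity

/-- `φ ∈ C^∞(Ω_δ, N)`. -/
def IsSmoothBoundaryMap {n L : ℕ} (Ω : Set (E n)) (N : Set (E L)) (δ : ℝ) (φ : E n → E L) : Prop :=
  ContDiffOn ℝ ∞ φ (closedCollar Ω δ) ∧ ∀ x ∈ closedCollar Ω δ, φ x ∈ N

/-- Globally stationary biharmonic maps with boundary data `φ ∈ C^∞(Ω_δ, N)`, with `R₀` and `C`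
the constants of the boundary monotonicity inequality. -/
structure IsGloballyStationary {n L : ℕ} (Ω : Set (E n)) (N : Set (E L)) (δ : ℝ) (φ : E n → E L)
    (R₀ C : ℝ) (u : E n → E L) : Prop where
  stationary : IsStationaryBiharmonicMap Ω N u
  dirichlet : HasDirichletData Ω δ φ u
  monotonicity : BoundaryMonotonicity Ω (collar Ω δ) (fun x => u x - φ x) R₀ C

/-! ### Morrey spaces -/

/-- The Morrey norm `(sup_{B_r ⊆ O} r^{lam-n} ∫_{B_r} |f|^p)^{1/p}`. -/
def morreyNorm {n : ℕ} {F : Type*} [NormedAddCommGroup F] (p lam : ℝ) (O : Set (E n))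
    (f : E n → F) : ℝ≥0∞ :=
  (⨆ (y : E n) (r : ℝ) (_ : 0 < r) (_ : Metric.ball y r ⊆ O),
    ENNReal.ofReal (r ^ (lam - (n : ℝ))) * ∫⁻ x in Metric.ball y r, ‖f x‖ₑ ^ p) ^ (1 / p)

/-- The Morrey space `M^{p,lam}(O)`. -/
def MemMorrey {n : ℕ} {F : Type*} [NormedAddCommGroup F] (p lam : ℝ) (O : Set (E n))
    (f : E n → F) : Prop :=
  MemLp f (ENNReal.ofReal p) (volume.restrict O) ∧ morreyNorm p lam O f < ⊤

end Biharmonic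

end

open Filter Topology MeasureTheory Set
open scoped ContDiff ENNReal

noncomputable section

namespace Biharmonic

open Metric
open ENNReal (ofReal ofReal_mul ofReal_le_ofReal ofReal_ne_top ofReal_pow ofReal_lt_top ofReal_add
  toReal_ofReal ofReal_sum_of_nonneg)
open Finset (mul_sum sum_congr sum_add_distrib smul_sum sum_le_sum sum_comm sum_nonneg sum_const
  sum_sub_distrib card_univ single_le_sum sum_insert sum_empty)
open Real (norm_eq_abs sq_sqrt sqrt_nonneg sqrt_mul sqrt_le_sqrt)

local notation "∇" => fderiv ℝ

set_option maxHeartbeats 1000000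

variable {n L : ℕ}

/-- First derivatives of a map `ℝⁿ → ℝᴸ`. -/
abbrev Grad (n L : ℕ) : Type := Fin n → E n → E L

/-- Second derivatives of a map `ℝⁿ → ℝᴸ`. -/
abbrev Hess (n L : ℕ) : Type := Fin n → Fin n → E n → E L

section WeakDerivatives

theorem IsTestFunction.exists_norm_le {F : Type*} [NormedAddCommGroup F] [NormedSpace ℝ F] {Ω : Set (E n)}
    {ψ : E n → F} (h : IsTestFunction Ω ψ) : ∃ C, ∀ x, ‖ψ x‖ ≤ C :=
  h.contDiff.continuous.bounded_above_of_compact_support h.hasCompactSupport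

variable {O : Set (E n)} {i : Fin n} {f g f' g' : E n → E L}

theorem IsTestFunction.fderiv_apply {F : Type*} [NormedAddCommGroup F] [NormedSpace ℝ F]
    {ψ : E n → F} (h : IsTestFunction O ψ) (v : E n) :
    IsTestFunction O (fun x => ∇ ψ x v) where
  contDiff := (h.contDiff.fderiv_right (m := ∞) (by simp)).clm_apply contDiff_const
  hasCompactSupport := h.hasCompactSupport.fderiv_apply (𝕜 := ℝ) v
  tsupport_subset := (tsupport_fderiv_apply_subset ℝ v).trans h.tsupport_subset

theorem IsTestFunction.mono {F : Type*} [NormedAddCommGroup F] [NormedSpace ℝ F] {O' : Set (E n)}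
    {ψ : E n → F} (h : IsTestFunction O ψ) (hO : O ⊆ O') : IsTestFunction O' ψ :=
  ⟨h.contDiff, h.hasCompactSupport, h.tsupport_subset.trans hO⟩

theorem IsTestFunction.eq_zero {F : Type*} [NormedAddCommGroup F] [NormedSpace ℝ F]
    {ψ : E n → F} (h : IsTestFunction O ψ) {x : E n} (hx : x ∉ O) : ψ x = 0 :=
  image_eq_zero_of_notMem_tsupport fun hx' => hx (h.tsupport_subset hx')

theorem IsTestFunction.mul_left {ψ : E n → ℝ} (h : IsTestFunction O ψ) {η : E n → ℝ}
    (hη : ContDiff ℝ ∞ η) : IsTestFunction O (fun x => η x * ψ x) where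
  contDiff := hη.mul h.contDiff
  hasCompactSupport := h.hasCompactSupport.mul_left
  tsupport_subset := (tsupport_mul_subset_right (f := η)).trans h.tsupport_subset

theorem setIntegral_smul_of_isTestFunction {ψ : E n → ℝ} (h : IsTestFunction O ψ)
    (f : E n → E L) : ∫ x in O, ψ x • f x = ∫ x, ψ x • f x :=
  setIntegral_eq_integral_of_forall_compl_eq_zero fun x hx => by simp [h.eq_zero hx]

theorem IsTestFunction.integrable_smul {ψ : E n → ℝ} (h : IsTestFunction O ψ)
    (hf : LocallyIntegrableOn f O) : Integrable fun x => ψ x • f x := by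
  have h1 : IntegrableOn f (tsupport ψ) :=
    hf.integrableOn_compact_subset h.tsupport_subset h.hasCompactSupport
  have h2 : IntegrableOn (fun x => ψ x • f x) (tsupport ψ) := by
    obtain ⟨C, hC⟩ := h.exists_norm_le
    exact h1.bdd_smul C h.contDiff.continuous.aestronglyMeasurable (Eventually.of_forall hC)
  refine (integrableOn_iff_integrable_of_support_subset ?_).1 h2
  intro x hx
  refine subset_tsupport ψ fun h0 => hx ?_
  simp [h0]

theorem hasWeakPartial_unique (hO : IsOpen O) (h : HasWeakPartial O i f g)
    (h' : HasWeakPartial O i f g') : g =ᵐ[volume.restrict O] g' := by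
  have key := hO.ae_eq_zero_of_integral_contDiff_smul_eq_zero (μ := volume)
    (h.locallyIntegrable'.sub h'.locallyIntegrable') ?_
  · rw [Filter.EventuallyEq, ae_restrict_iff' hO.measurableSet]
    filter_upwards [key] with x hx hxO
    exact sub_eq_zero.1 (hx hxO)
  · intro ψ h1 h2 h3
    have hψ : IsTestFunction O ψ := ⟨h1, h2, h3⟩
    have e1 := h.integral_eq ψ hψ
    have e2 := h'.integral_eq ψ hψ
    rw [setIntegral_smul_of_isTestFunction hψ] at e1 e2
    simp only [Pi.sub_apply, smul_sub]
    rw [integral_sub (hψ.integrable_smul h.locallyIntegrable')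
      (hψ.integrable_smul h'.locallyIntegrable'), sub_eq_zero]
    exact neg_injective (e1.symm.trans e2)

theorem locallyIntegrableOn_congr (hO : IsOpen O) (h : LocallyIntegrableOn f O)
    (e : f =ᵐ[volume.restrict O] f') : LocallyIntegrableOn f' O := by
  rw [locallyIntegrableOn_iff hO.isLocallyClosed] at h ⊢
  intro k hk hkc
  exact (h k hk hkc).congr (ae_restrict_of_ae_restrict_of_subset hk e)

theorem HasWeakPartial.congr (hO : IsOpen O) (h : HasWeakPartial O i f g)
    (ef : f =ᵐ[volume.restrict O] f') (eg : g =ᵐ[volume.restrict O] g') :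
    HasWeakPartial O i f' g' where
  locallyIntegrable := locallyIntegrableOn_congr hO h.locallyIntegrable ef
  locallyIntegrable' := locallyIntegrableOn_congr hO h.locallyIntegrable' eg
  integral_eq ψ hψ := by
    have e1 : ∫ x in O, ∇ ψ x (e i) • f x = ∫ x in O, ∇ ψ x (e i) • f' x :=
      integral_congr_ae (ef.mono fun x hx => by simp only [hx])
    have e2 : ∫ x in O, ψ x • g x = ∫ x in O, ψ x • g' x :=
      integral_congr_ae (eg.mono fun x hx => by simp only [hx])
    rw [← e1, ← e2, h.integral_eq ψ hψ]

theorem HasWeakPartial.mono {O' : Set (E n)} (h : HasWeakPartial O i f g) (hO : O' ⊆ O) :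
    HasWeakPartial O' i f g where
  locallyIntegrable := h.locallyIntegrable.mono_set hO
  locallyIntegrable' := h.locallyIntegrable'.mono_set hO
  integral_eq ψ hψ := by
    have := h.integral_eq ψ (hψ.mono hO)
    rw [setIntegral_smul_of_isTestFunction (hψ.mono hO),
      setIntegral_smul_of_isTestFunction ((hψ.mono hO).fderiv_apply _)] at this
    rw [setIntegral_smul_of_isTestFunction hψ,
      setIntegral_smul_of_isTestFunction (hψ.fderiv_apply _)]
    exact this

theorem HasWeakPartial.sub (h : HasWeakPartial O i f g) (h' : HasWeakPartial O i f' g') :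
    HasWeakPartial O i (fun x => f x - f' x) (fun x => g x - g' x) where
  locallyIntegrable := h.locallyIntegrable.sub h'.locallyIntegrable
  locallyIntegrable' := h.locallyIntegrable'.sub h'.locallyIntegrable'
  integral_eq ψ hψ := by
    have e1 := h.integral_eq ψ hψ
    have e2 := h'.integral_eq ψ hψ
    simp only [smul_sub]
    rw [integral_sub ((hψ.fderiv_apply _).integrable_smul h.locallyIntegrable).integrableOn
      ((hψ.fderiv_apply _).integrable_smul h'.locallyIntegrable).integrableOn, e1, e2,
      integral_sub (hψ.integrable_smul h.locallyIntegrable').integrableOn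
      (hψ.integrable_smul h'.locallyIntegrable').integrableOn]
    abel

theorem HasWeakPartial.add (h : HasWeakPartial O i f g) (h' : HasWeakPartial O i f' g') :
    HasWeakPartial O i (fun x => f x + f' x) (fun x => g x + g' x) where
  locallyIntegrable := h.locallyIntegrable.add h'.locallyIntegrable
  locallyIntegrable' := h.locallyIntegrable'.add h'.locallyIntegrable'
  integral_eq ψ hψ := by
    have e1 := h.integral_eq ψ hψ
    have e2 := h'.integral_eq ψ hψ
    simp only [smul_add]
    rw [integral_add ((hψ.fderiv_apply _).integrable_smul h.locallyIntegrable).integrableOn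
      ((hψ.fderiv_apply _).integrable_smul h'.locallyIntegrable).integrableOn, e1, e2,
      integral_add (hψ.integrable_smul h.locallyIntegrable').integrableOn
      (hψ.integrable_smul h'.locallyIntegrable').integrableOn]
    abel

theorem HasWeakPartial.sum {ι : Type*} (s : Finset ι) {f g : ι → E n → E L}
    (h : ∀ k ∈ s, HasWeakPartial O i (f k) (g k)) :
    HasWeakPartial O i (fun x => ∑ k ∈ s, f k x) (fun x => ∑ k ∈ s, g k x) := by
  classical
  induction s using Finset.induction_on with
  | empty =>
    simp only [sum_empty]
    exact ⟨locallyIntegrableOn_const 0, locallyIntegrableOn_const 0, fun ψ _ => by simp⟩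
  | insert a s ha ih =>
    simp only [sum_insert ha]
    exact (h a (Finset.mem_insert_self _ _)).add (ih fun k hk => h k (Finset.mem_insert_of_mem hk))

theorem integral_fderiv_apply_eq_zero {F : Type*} [NormedAddCommGroup F] [NormedSpace ℝ F]
    [CompleteSpace F] {f : E n → F} (hf : ContDiff ℝ 1 f) (hc : HasCompactSupport f) (v : E n) :
    ∫ x, ∇ f x v = 0 := by
  have h := integral_bilinear_hasLineDerivAt_right_eq_neg_left_of_integrable (μ := volume)
    (f := fun _ : E n => (1 : ℝ)) (f' := fun _ => 0) (g := f) (g' := fun x => ∇ f x v)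
    (v := v) (B := ContinuousLinearMap.lsmul ℝ ℝ) (by simp) ?_ ?_ ?_ ?_
  · simpa using h
  · simpa using ((hf.continuous_fderiv (by simp)).clm_apply
      continuous_const).integrable_of_hasCompactSupport (hc.fderiv_apply (𝕜 := ℝ) v)
  · simpa using hf.continuous.integrable_of_hasCompactSupport hc
  · intro x _
    exact (hasFDerivAt_const _ x).hasLineDerivAt v
  · intro x _
    exact ((hf.differentiable (by simp)) x).hasFDerivAt.hasLineDerivAt v

/-- A test function times a function which is `C¹` on the open set is globally `C¹`. -/
theorem IsTestFunction.contDiff_smul {F : Type*} [NormedAddCommGroup F] [NormedSpace ℝ F]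
    (hO : IsOpen O) {ψ : E n → ℝ} (hψ : IsTestFunction O ψ) {m : ℕ∞} {f : E n → F}
    (hf : ContDiffOn ℝ m f O) : ContDiff ℝ m fun x => ψ x • f x := by
  rw [contDiff_iff_contDiffAt]
  intro x
  by_cases hx : x ∈ tsupport ψ
  · exact (hψ.contDiff.contDiffAt.of_le (by exact_mod_cast le_top)).smul
      (hf.contDiffAt (hO.mem_nhds (hψ.tsupport_subset hx)))
  · refine (contDiffAt_const (c := 0)).congr_of_eventuallyEq ?_
    filter_upwards [(isClosed_tsupport ψ).isOpen_compl.mem_nhds hx] with y hy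
    simp [image_eq_zero_of_notMem_tsupport hy]

theorem hasWeakPartial_of_contDiffOn (hO : IsOpen O) (hf : ContDiffOn ℝ 1 f O) (i : Fin n) :
    HasWeakPartial O i f (fun x => ∇ f x (e i)) where
  locallyIntegrable := hf.continuousOn.locallyIntegrableOn hO.measurableSet
  locallyIntegrable' := ((hf.continuousOn_fderiv_of_isOpen hO le_rfl).clm_apply
    continuousOn_const).locallyIntegrableOn hO.measurableSet
  integral_eq ψ hψ := by
    have h0 := integral_fderiv_apply_eq_zero (hψ.contDiff_smul hO (m := 1) hf)
      hψ.hasCompactSupport.smul_right (e i)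
    have h1 : ∀ x, ∇ (fun x => ψ x • f x) x (e i) = ∇ ψ x (e i) • f x + ψ x • ∇ f x (e i) := by
      intro x
      by_cases hx : x ∈ tsupport ψ
      · have d1 := (hψ.contDiff.differentiable (by simp)) x
        have d2 := (hf.contDiffAt (hO.mem_nhds (hψ.tsupport_subset hx))).differentiableAt (by simp)
        rw [fderiv_fun_smul d1 d2]
        simp [add_comm]
      · have : (fun x => ψ x • f x) =ᶠ[𝓝 x] fun _ => 0 := by
          filter_upwards [(isClosed_tsupport ψ).isOpen_compl.mem_nhds hx] with y hy
          simp [image_eq_zero_of_notMem_tsupport hy]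
        rw [this.fderiv_eq]
        have h2 : ∇ ψ x = 0 := by
          by_contra h
          exact hx (support_fderiv_subset ℝ h)
        simp [image_eq_zero_of_notMem_tsupport hx, h2]
    simp only [h1] at h0
    have i1 := (hψ.fderiv_apply (e i)).integrable_smul
      (hf.continuousOn.locallyIntegrableOn hO.measurableSet (μ := volume))
    have i2 := hψ.integrable_smul (((hf.continuousOn_fderiv_of_isOpen hO le_rfl).clm_apply
      (continuousOn_const (c := e i))).locallyIntegrableOn hO.measurableSet (μ := volume))
    rw [setIntegral_smul_of_isTestFunction hψ,
      setIntegral_smul_of_isTestFunction (hψ.fderiv_apply _)]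
    rw [integral_add i1 i2] at h0
    exact eq_neg_of_add_eq_zero_left h0

theorem locallyIntegrableOn_of_memLp (h : MemLp f 2 (volume.restrict O)) :
    LocallyIntegrableOn f O :=
  locallyIntegrableOn_of_locallyIntegrable_restrict (h.locallyIntegrable (by norm_num))

theorem HasWeakPartial.integral_smul_smul (h : HasWeakPartial O i f g) {η ψ : E n → ℝ}
    (hη : ContDiff ℝ ∞ η) (hψ : ContDiff ℝ ∞ ψ) (h0 : IsTestFunction O fun x => η x * ψ x)
    (h1 : IsTestFunction O fun x => η x * ∇ ψ x (e i))
    (h2 : IsTestFunction O fun x => ∇ η x (e i) * ψ x) :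
    ∫ x, ∇ ψ x (e i) • (η x • f x) = - ∫ x, ψ x • (η x • g x + ∇ η x (e i) • f x) := by
  have e1 := h.integral_eq _ h0
  rw [setIntegral_smul_of_isTestFunction h0,
    setIntegral_smul_of_isTestFunction (h0.fderiv_apply _)] at e1
  have e2 : ∀ x, ∇ (fun x => η x * ψ x) x (e i) = η x * ∇ ψ x (e i) + ∇ η x (e i) * ψ x := by
    intro x
    rw [fderiv_fun_mul (hη.differentiable (by simp) x) (hψ.differentiable (by simp) x)]
    simp [mul_comm]
  simp only [e2, add_smul] at e1
  rw [integral_add (h1.integrable_smul h.locallyIntegrable)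
    (h2.integrable_smul h.locallyIntegrable)] at e1
  have e3 : ∀ x, ψ x • (η x • g x + ∇ η x (e i) • f x)
      = (η x * ψ x) • g x + (∇ η x (e i) * ψ x) • f x := by
    intro x; rw [smul_add, smul_smul, smul_smul, mul_comm, mul_comm (ψ x)]
  have e4 : ∀ x, ∇ ψ x (e i) • η x • f x = (η x * ∇ ψ x (e i)) • f x := by
    intro x; rw [smul_smul, mul_comm]
  simp only [e3, e4]
  rw [integral_add (h0.integrable_smul h.locallyIntegrable')
    (h2.integrable_smul h.locallyIntegrable), neg_add, ← e1]
  abel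

theorem contDiff_fderiv_apply {F : Type*} [NormedAddCommGroup F] [NormedSpace ℝ F] {f : E n → F}
    (hf : ContDiff ℝ ∞ f) (v : E n) : ContDiff ℝ ∞ fun x => ∇ f x v :=
  (hf.fderiv_right (m := ∞) (by simp)).clm_apply contDiff_const

/-- The product of a weakly differentiable function with a smooth function. -/
theorem HasWeakPartial.smul_left (h : HasWeakPartial O i f g) (hO : IsOpen O) {η : E n → ℝ}
    (hη : ContDiff ℝ ∞ η) :
    HasWeakPartial O i (fun x => η x • f x) (fun x => η x • g x + ∇ η x (e i) • f x) where
  locallyIntegrable := h.locallyIntegrable.continuousOn_smul hO.isLocallyClosed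
    hη.continuous.continuousOn
  locallyIntegrable' := by
    refine LocallyIntegrableOn.add ?_ ?_
    · exact h.locallyIntegrable'.continuousOn_smul hO.isLocallyClosed hη.continuous.continuousOn
    · exact h.locallyIntegrable.continuousOn_smul hO.isLocallyClosed
        (contDiff_fderiv_apply hη (e i)).continuous.continuousOn
  integral_eq ψ hψ := by
    rw [setIntegral_smul_of_isTestFunction hψ,
      setIntegral_smul_of_isTestFunction (hψ.fderiv_apply _)]
    exact h.integral_smul_smul hη hψ.contDiff (hψ.mul_left hη)
      ((hψ.fderiv_apply (e i)).mul_left hη) (hψ.mul_left (contDiff_fderiv_apply hη (e i)))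

/-- Cutting off extends weak derivatives by zero. -/
theorem HasWeakPartial.cutoff (h : HasWeakPartial O i f g) {η : E n → ℝ} (hη : IsTestFunction O η) :
    HasWeakPartial univ i (fun x => η x • f x) (fun x => η x • g x + ∇ η x (e i) • f x) where
  locallyIntegrable :=
    (hη.integrable_smul h.locallyIntegrable).locallyIntegrable.locallyIntegrableOn _
  locallyIntegrable' := ((hη.integrable_smul h.locallyIntegrable').add
      ((hη.fderiv_apply _).integrable_smul h.locallyIntegrable)).locallyIntegrable.locallyIntegrableOn _
  integral_eq ψ hψ := by
    have key : ∀ {a b : E n → ℝ}, IsTestFunction O a → ContDiff ℝ ∞ b →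
        IsTestFunction O fun x => a x * b x := fun ha hb => by
      simpa only [mul_comm] using ha.mul_left hb
    rw [setIntegral_univ, setIntegral_univ]
    exact h.integral_smul_smul hη.contDiff hψ.contDiff (key hη hψ.contDiff)
      (key hη (contDiff_fderiv_apply hψ.contDiff _)) (key (hη.fderiv_apply _) hψ.contDiff)

end WeakDerivatives

theorem eLpNorm_two_sq {α F : Type*} [MeasurableSpace α] [NormedAddCommGroup F] (μ : Measure α)
    (f : α → F) : eLpNorm f 2 μ ^ 2 = ∫⁻ x, ‖f x‖ₑ ^ 2 ∂μ := by
  rw [eLpNorm_eq_lintegral_rpow_enorm_toReal (by norm_num) (by norm_num), ← ENNReal.rpow_natCast,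
    ← ENNReal.rpow_mul]
  norm_num

open scoped Convolution

/-- A sequence of bump functions concentrating at the origin. -/
def bump (n m : ℕ) : ContDiffBump (0 : E n) where
  rIn := 1 / (2 * (m + 1))
  rOut := 1 / (m + 1)
  rIn_pos := by positivity
  rIn_lt_rOut := by
    apply one_div_lt_one_div_of_lt <;> nlinarith [(Nat.cast_nonneg m : (0 : ℝ) ≤ m)]

/-- The mollifying probability measures. -/
def bumpMeasure (n m : ℕ) : Measure (E n) :=
  volume.withDensity fun t => ofReal ((bump n m).normed volume t)

instance (n m : ℕ) : IsProbabilityMeasure (bumpMeasure n m) where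
  measure_univ := by
    rw [bumpMeasure, withDensity_apply _ MeasurableSet.univ, Measure.restrict_univ,
      ← ofReal_integral_eq_lintegral_ofReal (bump n m).integrable_normed
        (.of_forall (bump n m).nonneg_normed), (bump n m).integral_normed]
    simp

theorem ae_bumpMeasure_norm_lt (n m : ℕ) : ∀ᵐ t ∂(bumpMeasure n m), ‖t‖ < 1 / ((m : ℝ) + 1) := by
  rw [bumpMeasure, ae_withDensity_iff (by
    exact (bump n m).continuous_normed.measurable.ennreal_ofReal)]
  refine .of_forall fun t ht => ?_
  have : t ∈ Function.support ((bump n m).normed volume) := by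
    intro h0; simp [h0] at ht
  rw [(bump n m).support_normed_eq] at this
  simpa [bump] using this

/-- Mollification. -/
def mollify (m : ℕ) (f : E n → E L) : E n → E L :=
  (bump n m).normed volume ⋆[ContinuousLinearMap.lsmul ℝ ℝ, volume] f

theorem mollify_apply (m : ℕ) (f : E n → E L) (x : E n) :
    mollify m f x = ∫ t, f (x - t) ∂(bumpMeasure n m) := by
  rw [bumpMeasure, integral_withDensity_eq_integral_toReal_smul
    (bump n m).continuous_normed.measurable.ennreal_ofReal
    (.of_forall fun t => ofReal_lt_top)]
  simp only [mollify, convolution_def, ContinuousLinearMap.lsmul_apply,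
    toReal_ofReal ((bump n m).nonneg_normed _)]

theorem contDiff_mollify (m : ℕ) {f : E n → E L} (hf : LocallyIntegrable f) :
    ContDiff ℝ ∞ (mollify m f) :=
  (bump n m).hasCompactSupport_normed.contDiff_convolution_left _ ((bump n m).contDiff_normed) hf

theorem hasCompactSupport_mollify (m : ℕ) {f : E n → E L} (hf : HasCompactSupport f) :
    HasCompactSupport (mollify m f) :=
  (bump n m).hasCompactSupport_normed.convolution _ hf

theorem mollify_congr (m : ℕ) {f g : E n → E L} (h : f =ᵐ[volume] g) : mollify m f = mollify m g :=
  convolution_congr _ EventuallyEq.rfl h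

theorem fderiv_mollify (m : ℕ) {i : Fin n} {f g : E n → E L}
    (h : HasWeakPartial univ i f g) (x : E n) :
    ∇ (mollify m f) x (e i) = mollify m g x := by
  have hf : LocallyIntegrable f := locallyIntegrableOn_univ.1 h.locallyIntegrable
  have hg : LocallyIntegrable g := locallyIntegrableOn_univ.1 h.locallyIntegrable'
  set ρ := (bump n m).normed (volume : Measure (E n))
  have hρs : ContDiff ℝ ∞ ρ := (bump n m).contDiff_normed
  have hρc : HasCompactSupport ρ := (bump n m).hasCompactSupport_normed
  rw [mollify, (hρc.hasFDerivAt_convolution_left (ContinuousLinearMap.lsmul ℝ ℝ)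
    (hρs.of_le (by simp)) hf x).fderiv]
  have hint : Integrable fun t => ((ContinuousLinearMap.lsmul ℝ ℝ (E := E L)).precompL (E n)
      (∇ ρ t)) (f (x - t)) := by
    exact (hρc.fderiv ℝ).convolutionExists_left _ (hρs.continuous_fderiv (by simp)) hf x
  rw [convolution_def, ContinuousLinearMap.integral_apply hint]
  simp only [ContinuousLinearMap.precompL_apply, ContinuousLinearMap.lsmul_apply]
  rw [mollify, convolution_def]
  simp only [ContinuousLinearMap.lsmul_apply]
  rw [← integral_sub_left_eq_self (fun t => (∇ ρ t) (e i) • f (x - t)) volume x,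
    ← integral_sub_left_eq_self (fun t => ρ t • g (x - t)) volume x]
  simp only [sub_sub_cancel]
  have hψ : IsTestFunction univ (fun y : E n => ρ (x - y)) := by
    refine ⟨hρs.comp (contDiff_const.sub contDiff_id), ?_, subset_univ _⟩
    exact hρc.comp_homeomorph (Homeomorph.subLeft x)
  have key := h.integral_eq _ hψ
  rw [setIntegral_univ, setIntegral_univ] at key
  have e1 : ∀ y, ∇ (fun y : E n => ρ (x - y)) y (e i) = - ∇ ρ (x - y) (e i) := by
    intro y
    have d1 : HasFDerivAt (fun y : E n => x - y) (-ContinuousLinearMap.id ℝ (E n)) y :=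
      (hasFDerivAt_id y).const_sub x
    have d2 := ((hρs.differentiable (by simp) (x - y)).hasFDerivAt).comp y d1
    have := d2.fderiv
    simp only [Function.comp_def] at this
    rw [this]; simp
  simp only [e1, neg_smul, integral_neg, neg_inj] at key
  exact key

theorem sq_lintegral_enorm_le {α : Type*} [MeasurableSpace α] (μ : Measure α)
    [IsProbabilityMeasure μ] {f : α → E L} (hf : AEStronglyMeasurable f μ) :
    (∫⁻ x, ‖f x‖ₑ ∂μ) ^ 2 ≤ ∫⁻ x, ‖f x‖ₑ ^ 2 ∂μ := by
  have h := eLpNorm_le_eLpNorm_of_exponent_le (p := 1) (q := 2) (by norm_num) hf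
  rw [eLpNorm_one_eq_lintegral_enorm, eLpNorm_eq_lintegral_rpow_enorm_toReal (by norm_num)
    (by norm_num)] at h
  calc (∫⁻ x, ‖f x‖ₑ ∂μ) ^ 2 ≤ _ := pow_le_pow_left' h 2
    _ = _ := by
      rw [← ENNReal.rpow_natCast, ← ENNReal.rpow_mul]
      norm_num

theorem enorm_integral_sq_le {α : Type*} [MeasurableSpace α] (μ : Measure α)
    [IsProbabilityMeasure μ] {f : α → E L} (hf : AEStronglyMeasurable f μ) :
    ‖∫ x, f x ∂μ‖ₑ ^ 2 ≤ ∫⁻ x, ‖f x‖ₑ ^ 2 ∂μ :=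
  (pow_le_pow_left' (enorm_integral_le_lintegral_enorm _) 2).trans (sq_lintegral_enorm_le μ hf)

/-- Mollification does not increase the supremum over translates of the `L²` norm. -/
theorem lintegral_mollify_le (m : ℕ) {f : E n → E L} (hf : AEStronglyMeasurable f) (s : Set (E n))
    {A : ℝ≥0∞} (hA : ∀ t, ∫⁻ x in s, ‖f (x - t)‖ₑ ^ 2 ≤ A) :
    ∫⁻ x in s, ‖mollify m f x‖ₑ ^ 2 ≤ A := by
  have hm := hf.stronglyMeasurable_mk
  rw [mollify_congr m hf.ae_eq_mk]
  have hA' : ∀ t, ∫⁻ x in s, ‖hf.mk f (x - t)‖ₑ ^ 2 ≤ A := fun t => by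
    refine le_trans (le_of_eq (lintegral_congr_ae (ae_restrict_of_ae ?_))) (hA t)
    filter_upwards [(measurePreserving_sub_right volume t).quasiMeasurePreserving.ae hf.ae_eq_mk]
      with x hx
    rw [hx]
  set f' := hf.mk f
  calc ∫⁻ x in s, ‖mollify m f' x‖ₑ ^ 2
      ≤ ∫⁻ x in s, ∫⁻ t, ‖f' (x - t)‖ₑ ^ 2 ∂(bumpMeasure n m) := by
        refine lintegral_mono fun x => ?_
        rw [mollify_apply]
        exact enorm_integral_sq_le _
          (hm.comp_measurable (measurable_const.sub measurable_id)).aestronglyMeasurable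
    _ = ∫⁻ t, (∫⁻ x in s, ‖f' (x - t)‖ₑ ^ 2) ∂(bumpMeasure n m) := by
        refine lintegral_lintegral_swap (Measurable.aemeasurable ?_)
        exact (hm.comp_measurable (measurable_fst.sub measurable_snd)).enorm.pow_const 2
    _ ≤ ∫⁻ _, A ∂(bumpMeasure n m) := lintegral_mono hA'
    _ = A := by simp

theorem tendsto_lintegral_translate {f : E n → E L} (hf : MemLp f 2 volume) :
    Tendsto (fun t => ∫⁻ x, ‖f (x - t) - f x‖ₑ ^ 2) (𝓝 0) (𝓝 0) := by
  let G : C(E n, C(E n, E n)) := ContinuousMap.curry ⟨fun p : E n × E n => p.2 - p.1, by fun_prop⟩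
  have hG : ∀ t, MeasurePreserving (G t) volume volume := fun t =>
    measurePreserving_sub_right volume t
  have h1 := Filter.Tendsto.compMeasurePreservingLp (l := 𝓝 (0 : E n)) (p := 2)
    (f := fun _ => hf.toLp f) (f₀ := hf.toLp f) tendsto_const_nhds (G.continuous.tendsto 0) hG
    (hG 0) (by norm_num)
  have h2 : Tendsto (fun t => eLpNorm (fun x => f (x - t) - f x) 2 volume) (𝓝 0) (𝓝 0) := by
    refine (tendsto_iff_edist_tendsto_0.1 h1).congr fun t => ?_
    rw [Lp.edist_def]
    refine eLpNorm_congr_ae ?_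
    have e : ∀ t, ⇑(Lp.compMeasurePreserving (G t) (hG t) (hf.toLp f))
        =ᵐ[volume] fun x => f (x - t) := fun t => by
      refine (Lp.coeFn_compMeasurePreserving _ (hG t)).trans ?_
      exact (hG t).quasiMeasurePreserving.ae_eq_comp hf.coeFn_toLp
    filter_upwards [e t, e 0] with x h1 h2
    rw [Pi.sub_apply, h1, h2, sub_zero]
  have h3 := ENNReal.Tendsto.pow (n := 2) h2
  rw [zero_pow two_ne_zero] at h3
  refine h3.congr fun t => ?_
  exact eLpNorm_two_sq volume fun x => f (x - t) - f x

theorem tendsto_eLpNorm_mollify {f : E n → E L} (hf : MemLp f 2 volume) :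
    Tendsto (fun m => eLpNorm (fun x => mollify m f x - f x) 2 volume) atTop (𝓝 0) := by
  rw [ENNReal.tendsto_nhds_zero]
  intro ε hε
  have h1 := (ENNReal.tendsto_nhds_zero.1 (tendsto_lintegral_translate hf)) (ε ^ 2) (by positivity)
  obtain ⟨δ, hδ, hδ'⟩ := Metric.eventually_nhds_iff.1 h1
  obtain ⟨M, hM⟩ := exists_nat_one_div_lt hδ
  filter_upwards [eventually_ge_atTop M] with m hm
  have hmδ : 1 / ((m : ℝ) + 1) < δ := lt_of_le_of_lt
    (one_div_le_one_div_of_le (by positivity) (by exact_mod_cast Nat.succ_le_succ hm)) hM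
  have hms := hf.1.stronglyMeasurable_mk
  have hfg := hf.1.ae_eq_mk
  set g := hf.1.mk f
  have key : eLpNorm (fun x => mollify m f x - f x) 2 volume ^ 2 ≤ ε ^ 2 := by
    rw [eLpNorm_two_sq]
    calc ∫⁻ x, ‖mollify m f x - f x‖ₑ ^ 2
        = ∫⁻ x, ‖mollify m g x - g x‖ₑ ^ 2 := by
          refine lintegral_congr_ae ?_
          filter_upwards [hfg] with x hx
          rw [hx, mollify_congr m hfg]
      _ ≤ ∫⁻ x, ∫⁻ t, ‖g (x - t) - g x‖ₑ ^ 2 ∂(bumpMeasure n m) := by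
          refine lintegral_mono_ae ?_
          have hloc : LocallyIntegrable g := (hf.ae_eq hfg).locallyIntegrable (by norm_num)
          refine .of_forall fun x => ?_
          have hi : Integrable (fun t => g (x - t)) (bumpMeasure n m) := by
            rw [bumpMeasure, integrable_withDensity_iff_integrable_smul'
              (bump n m).continuous_normed.measurable.ennreal_ofReal
              (.of_forall fun t => ofReal_lt_top)]
            simp only [toReal_ofReal ((bump n m).nonneg_normed _)]
            exact (bump n m).hasCompactSupport_normed.convolutionExists_left
              (ContinuousLinearMap.lsmul ℝ ℝ) (bump n m).continuous_normed hloc x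
          have e : mollify m g x - g x = ∫ t, (g (x - t) - g x) ∂(bumpMeasure n m) := by
            rw [integral_sub hi (integrable_const _), mollify_apply]
            simp
          simp only [e]
          exact enorm_integral_sq_le _ (hi.1.sub aestronglyMeasurable_const)
      _ = ∫⁻ t, (∫⁻ x, ‖g (x - t) - g x‖ₑ ^ 2) ∂(bumpMeasure n m) := by
          refine lintegral_lintegral_swap (Measurable.aemeasurable ?_)
          exact ((hms.comp_measurable (measurable_fst.sub measurable_snd)).sub
            (hms.comp_measurable measurable_fst)).enorm.pow_const 2
      _ = ∫⁻ t, (∫⁻ x, ‖f (x - t) - f x‖ₑ ^ 2) ∂(bumpMeasure n m) := by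
          refine lintegral_congr fun t => lintegral_congr_ae ?_
          filter_upwards [hfg,
            (measurePreserving_sub_right volume t).quasiMeasurePreserving.ae hfg] with x h1 h2
          rw [h1, h2]
      _ ≤ ∫⁻ _, ε ^ 2 ∂(bumpMeasure n m) := by
          refine lintegral_mono_ae ?_
          filter_upwards [ae_bumpMeasure_norm_lt n m] with t ht
          exact hδ' (by simpa using ht.trans hmδ)
      _ = ε ^ 2 := by simp
  exact (ENNReal.pow_le_pow_left_iff (by norm_num)).1 key

theorem exists_cutoff {O K : Set (E n)} (hO : IsOpen O) (hK : IsCompact K) (hKO : K ⊆ O) :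
    ∃ η : E n → ℝ, IsTestFunction O η ∧ (∀ x ∈ K, ∀ᶠ y in 𝓝 x, η y = 1) ∧
      ∀ x, η x ∈ Icc (0 : ℝ) 1 := by
  obtain ⟨K', hK', h1, h2⟩ := exists_compact_between hK hO hKO
  obtain ⟨K'', hK'', h3, h4⟩ := exists_compact_between hK isOpen_interior h1
  obtain ⟨η, hη1, hη0, hη⟩ := exists_contMDiffMap_one_nhds_of_subset_interior
    (modelWithCornersSelf ℝ (E n)) (n := ⊤) hK.isClosed h3
  have hsub : tsupport η ⊆ K'' := by
    refine closure_minimal (fun x hx => ?_) hK''.isClosed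
    by_contra h
    exact hx (hη0 x h)
  refine ⟨η, ⟨contMDiff_iff_contDiff.1 η.contMDiff, ?_, ?_⟩, ?_, hη⟩
  · exact hK''.of_isClosed_subset (isClosed_tsupport _) hsub
  · exact hsub.trans (h4.trans (interior_subset.trans h2))
  · exact fun x hx => (eventually_nhdsSet_iff_forall.1 hη1) x hx

theorem memLp_testFunction_smul {O : Set (E n)} {η : E n → ℝ} (hO : MeasurableSet O)
    (hη : IsTestFunction O η) {f : E n → E L} (hf : MemLp f 2 (volume.restrict O)) :
    MemLp (fun x => η x • f x) 2 volume := by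
  obtain ⟨C, hC⟩ := hη.exists_norm_le
  have e : (fun x => η x • f x) = O.indicator fun x => η x • f x := by
    funext x
    by_cases hx : x ∈ O
    · rw [indicator_of_mem hx]
    · rw [indicator_of_notMem hx, hη.eq_zero hx, zero_smul]
  rw [e, memLp_indicator_iff_restrict hO]
  refine MemLp.of_le_mul (c := C) hf
    (hη.contDiff.continuous.aestronglyMeasurable.smul hf.1) (.of_forall fun x => ?_)
  rw [norm_smul]
  exact mul_le_mul_of_nonneg_right (hC x) (norm_nonneg _)

/-- The `W^{2,2}` functions on `O`, with prescribed representatives of the derivatives. -/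
structure SobolevTwo (O : Set (E n)) (w : E n → E L) (p : Grad n L)
    (h : Hess n L) : Prop where
  memLp : MemLp w 2 (volume.restrict O)
  memLp_grad : ∀ i, MemLp (p i) 2 (volume.restrict O)
  memLp_hess : ∀ i j, MemLp (h i j) 2 (volume.restrict O)
  weak_grad : ∀ i, HasWeakPartial O i w (p i)
  weak_hess : ∀ i j, HasWeakPartial O j (p i) (h i j)

theorem SobolevTwo.mono {O O' : Set (E n)} {w : E n → E L} {p : Grad n L}
    {h : Hess n L} (S : SobolevTwo O w p h) (hO : O' ⊆ O) :
    SobolevTwo O' w p h where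
  memLp := S.memLp.mono_measure (Measure.restrict_mono hO le_rfl)
  memLp_grad i := (S.memLp_grad i).mono_measure (Measure.restrict_mono hO le_rfl)
  memLp_hess i j := (S.memLp_hess i j).mono_measure (Measure.restrict_mono hO le_rfl)
  weak_grad i := (S.weak_grad i).mono hO
  weak_hess i j := (S.weak_hess i j).mono hO

theorem SobolevTwo.congr {O : Set (E n)} (hO : IsOpen O) {w w' : E n → E L}
    {p p' : Grad n L} {h h' : Hess n L} (S : SobolevTwo O w p h)
    (ew : w =ᵐ[volume.restrict O] w') (ep : ∀ i, p i =ᵐ[volume.restrict O] p' i)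
    (eh : ∀ i j, h i j =ᵐ[volume.restrict O] h' i j) : SobolevTwo O w' p' h' where
  memLp := S.memLp.ae_eq ew
  memLp_grad i := (S.memLp_grad i).ae_eq (ep i)
  memLp_hess i j := (S.memLp_hess i j).ae_eq (eh i j)
  weak_grad i := (S.weak_grad i).congr hO ew (ep i)
  weak_hess i j := (S.weak_hess i j).congr hO (ep i) (eh i j)

theorem tendsto_eLpNorm_restrict_of_eqOn {K : Set (E n)} (hK : MeasurableSet K)
    {f g : E n → E L} {v : ℕ → E n → E L}
    (h : Tendsto (fun m => eLpNorm (fun x => v m x - f x) 2 volume) atTop (𝓝 0))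
    (e : ∀ x ∈ K, f x = g x) :
    Tendsto (fun m => eLpNorm (fun x => v m x - g x) 2 (volume.restrict K)) atTop (𝓝 0) := by
  refine tendsto_of_tendsto_of_tendsto_of_le_of_le tendsto_const_nhds h (fun _ => zero_le)
    fun m => ?_
  refine le_trans (le_of_eq (eLpNorm_congr_ae ?_)) (eLpNorm_restrict_le _ _ _ K)
  filter_upwards [ae_restrict_mem hK] with x hx
  rw [e x hx]

theorem exists_smooth_approx_one {O K : Set (E n)} (hO : IsOpen O) (hK : IsCompact K)
    (hKO : K ⊆ O) {f : E n → E L} {g : Grad n L}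
    (hf : MemLp f 2 (volume.restrict O)) (hg : ∀ i, MemLp (g i) 2 (volume.restrict O))
    (h : ∀ i, HasWeakPartial O i f (g i)) :
    ∃ v : ℕ → E n → E L, (∀ m, ContDiff ℝ ∞ (v m)) ∧ (∀ m, HasCompactSupport (v m)) ∧
      Tendsto (fun m => eLpNorm (fun x => v m x - f x) 2 (volume.restrict K)) atTop (𝓝 0) ∧
      ∀ i, Tendsto (fun m => eLpNorm (fun x => ∇ (v m) x (e i) - g i x) 2
        (volume.restrict K)) atTop (𝓝 0) := by
  obtain ⟨η, hη, hη1, -⟩ := exists_cutoff hO hK hKO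
  have hf' := memLp_testFunction_smul hO.measurableSet hη hf
  have hg' : ∀ i, MemLp (fun x => η x • g i x + ∇ η x (e i) • f x) 2 volume := fun i =>
    (memLp_testFunction_smul hO.measurableSet hη (hg i)).add
      (memLp_testFunction_smul hO.measurableSet (hη.fderiv_apply (e i)) hf)
  refine ⟨fun m => mollify m fun x => η x • f x, fun m => ?_, fun m => ?_, ?_, fun i => ?_⟩
  · exact contDiff_mollify m (hf'.locallyIntegrable (by norm_num))
  · exact hasCompactSupport_mollify m hη.hasCompactSupport.smul_right
  · refine tendsto_eLpNorm_restrict_of_eqOn hK.measurableSet (tendsto_eLpNorm_mollify hf') ?_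
    intro x hx
    simp [(hη1 x hx).self_of_nhds]
  · simp only [fun m => fderiv_mollify m ((h i).cutoff hη)]
    refine tendsto_eLpNorm_restrict_of_eqOn hK.measurableSet (tendsto_eLpNorm_mollify (hg' i)) ?_
    intro x hx
    have h1 : ∇ η x = 0 := by
      rw [Filter.EventuallyEq.fderiv_eq (hη1 x hx : η =ᶠ[𝓝 x] fun _ => 1)]; simp
    simp [(hη1 x hx).self_of_nhds, h1]

/-- `W^{2,2}` functions are locally limits of smooth functions. -/
theorem SobolevTwo.exists_smooth_approx {O K : Set (E n)} (hO : IsOpen O) (hK : IsCompact K)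
    (hKO : K ⊆ O) {w : E n → E L} {p : Grad n L} {h : Hess n L}
    (S : SobolevTwo O w p h) :
    ∃ v : ℕ → E n → E L, (∀ m, ContDiff ℝ ∞ (v m)) ∧ (∀ m, HasCompactSupport (v m)) ∧
      Tendsto (fun m => eLpNorm (fun x => v m x - w x) 2 (volume.restrict K)) atTop (𝓝 0) ∧
      (∀ i, Tendsto (fun m => eLpNorm (fun x => ∇ (v m) x (e i) - p i x) 2
        (volume.restrict K)) atTop (𝓝 0)) ∧
      ∀ i j, Tendsto (fun m => eLpNorm (fun x => ∇ (fun y => ∇ (v m) y (e i)) x (e j) - h i j x) 2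
        (volume.restrict K)) atTop (𝓝 0) := by
  obtain ⟨η, hη, hη1, -⟩ := exists_cutoff hO hK hKO
  have hm := hO.measurableSet
  have hη' := fun i => hη.fderiv_apply (e i)
  have hf' := memLp_testFunction_smul hm hη S.memLp
  have hg' : ∀ i, MemLp (fun x => η x • p i x + ∇ η x (e i) • w x) 2 volume := fun i =>
    (memLp_testFunction_smul hm hη (S.memLp_grad i)).add (memLp_testFunction_smul hm (hη' i) S.memLp)
  have hh' : ∀ i j, MemLp (fun x => (η x • h i j x + ∇ η x (e j) • p i x) + (∇ η x (e i) • p j x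
        + ∇ (fun y => ∇ η y (e i)) x (e j) • w x)) 2 volume := fun i j =>
    ((memLp_testFunction_smul hm hη (S.memLp_hess i j)).add
      (memLp_testFunction_smul hm (hη' j) (S.memLp_grad i))).add
      ((memLp_testFunction_smul hm (hη' i) (S.memLp_grad j)).add
      (memLp_testFunction_smul hm ((hη' i).fderiv_apply (e j)) S.memLp))
  have w1 := fun i => (S.weak_grad i).cutoff hη
  have w2 := fun i j => ((S.weak_hess i j).cutoff hη).add ((S.weak_grad j).cutoff (hη' i))
  have hd0 : ∀ x ∈ K, ∀ i, ∀ᶠ y in 𝓝 x, ∇ η y (e i) = 0 := fun x hx i => by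
    filter_upwards [eventually_eventually_nhds.2 (hη1 x hx)] with y hy
    rw [Filter.EventuallyEq.fderiv_eq (hy : η =ᶠ[𝓝 y] fun _ => 1)]; simp
  refine ⟨fun m => mollify m fun x => η x • w x, fun m => ?_, fun m => ?_, ?_, fun i => ?_,
    fun i j => ?_⟩
  · exact contDiff_mollify m (hf'.locallyIntegrable (by norm_num))
  · exact hasCompactSupport_mollify m hη.hasCompactSupport.smul_right
  · refine tendsto_eLpNorm_restrict_of_eqOn hK.measurableSet (tendsto_eLpNorm_mollify hf') ?_
    intro x hx
    simp [(hη1 x hx).self_of_nhds]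
  · simp only [fun m => fderiv_mollify m (w1 i)]
    refine tendsto_eLpNorm_restrict_of_eqOn hK.measurableSet (tendsto_eLpNorm_mollify (hg' i)) ?_
    intro x hx
    simp [(hη1 x hx).self_of_nhds, (hd0 x hx i).self_of_nhds]
  · have e1 : ∀ m, (fun y => ∇ (mollify m fun x => η x • w x) y (e i))
        = mollify m fun x => η x • p i x + ∇ η x (e i) • w x :=
      fun m => funext fun y => fderiv_mollify m (w1 i) y
    simp only [e1, fun m => fderiv_mollify m (w2 i j)]
    refine tendsto_eLpNorm_restrict_of_eqOn hK.measurableSet (tendsto_eLpNorm_mollify (hh' i j)) ?_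
    intro x hx
    have h2 : ∇ (fun y => ∇ η y (e i)) x = 0 := by
      rw [Filter.EventuallyEq.fderiv_eq (hd0 x hx i :
        (fun y => ∇ η y (e i)) =ᶠ[𝓝 x] fun _ => 0)]; simp
    simp [(hη1 x hx).self_of_nhds, (hd0 x hx i).self_of_nhds, (hd0 x hx j).self_of_nhds, h2]

theorem tendsto_integral_of_eLpNorm_two {K : Set (E n)} (hK : volume K ≠ ⊤)
    {a : ℕ → E n → E L} {f : E n → E L} {c : E n → ℝ} (hc : Continuous c)
    (hc0 : ∀ x ∉ K, c x = 0) {C : ℝ} (hC : ∀ x, ‖c x‖ ≤ C)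
    (hf : MemLp f 2 (volume.restrict K)) (ha : ∀ m, MemLp (a m) 2 (volume.restrict K))
    (h : Tendsto (fun m => eLpNorm (fun x => a m x - f x) 2 (volume.restrict K)) atTop (𝓝 0)) :
    Tendsto (fun m => ∫ x, c x • a m x) atTop (𝓝 (∫ x, c x • f x)) := by
  have e : ∀ g : E n → E L, ∫ x, c x • g x = ∫ x in K, c x • g x := fun g =>
    (setIntegral_eq_integral_of_forall_compl_eq_zero fun x hx => by simp [hc0 x hx]).symm
  simp only [e]
  have : IsFiniteMeasure (volume.restrict K) := ⟨by simpa using hK.lt_top⟩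
  have hi : ∀ g : E n → E L, MemLp g 2 (volume.restrict K) →
      Integrable (fun x => c x • g x) (volume.restrict K) := fun g hg =>
    (hg.integrable (by norm_num)).bdd_smul C hc.aestronglyMeasurable (Eventually.of_forall hC)
  refine tendsto_integral_of_L1' _ (hi f hf).1 (.of_forall fun m => hi _ (ha m)) ?_
  have h1 : Tendsto (fun m => ofReal C * (eLpNorm (fun x => a m x - f x) 2
      (volume.restrict K) * (volume.restrict K) univ ^ (1 / (1 : ℝ≥0∞).toReal
        - 1 / (2 : ℝ≥0∞).toReal))) atTop (𝓝 0) := by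
    have := ENNReal.Tendsto.const_mul (a := ofReal C) (ENNReal.Tendsto.mul_const (b := (volume.restrict K) univ ^
      (1 / (1 : ℝ≥0∞).toReal - 1 / (2 : ℝ≥0∞).toReal)) h (Or.inr ?_)) (Or.inr ofReal_ne_top)
    · simpa using this
    · refine ENNReal.rpow_ne_top_of_nonneg (by norm_num) (measure_ne_top _ _)
  refine tendsto_of_tendsto_of_tendsto_of_le_of_le tendsto_const_nhds h1 (fun _ => zero_le)
    fun m => ?_
  refine le_trans ?_ (mul_le_mul_right (eLpNorm_le_eLpNorm_mul_rpow_measure_univ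
    (p := 1) (q := 2) (by norm_num) ((ha m).1.sub hf.1)) _)
  refine (eLpNorm_le_mul_eLpNorm_of_ae_le_mul (c := C) (.of_forall fun x => ?_) 1)
  simp only [Pi.sub_apply, ← smul_sub, norm_smul]
  exact mul_le_mul_of_nonneg_right (hC x) (norm_nonneg _)

section ChangeOfVariables

variable {Ω : Set (E n)} {F : E n → E n}

/-- Diffeomorphisms of `Ω` onto itself with Jacobian bounded below. -/
structure IsDomainVariation (Ω : Set (E n)) (F : E n → E n) : Prop where
  contDiff : ContDiff ℝ ∞ F
  injective : Function.Injective F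
  image_eq : F '' Ω = Ω
  half_le_det : ∀ x, 1 / 2 ≤ |(∇ F x).det|

theorem IsDomainVariation.lintegral_comp_le (hF : IsDomainVariation Ω F) {s : Set (E n)}
    (hs : MeasurableSet s) (g : E n → ℝ≥0∞) :
    ∫⁻ x in s, g (F x) ≤ 2 * ∫⁻ x in F '' s, g x := by
  rw [lintegral_image_eq_lintegral_abs_det_fderiv_mul volume hs
    (fun x _ => ((hF.contDiff.differentiable (by simp)) x).hasFDerivAt.hasFDerivWithinAt)
    hF.injective.injOn, ← lintegral_const_mul' _ _ (by norm_num)]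
  refine lintegral_mono fun x => ?_
  rw [← mul_assoc]
  refine le_mul_of_one_le_left zero_le ?_
  have : (1 : ℝ≥0∞) = 2 * ofReal (1 / 2) := by
    rw [ENNReal.ofReal_div_of_pos (by norm_num)]
    simp [ENNReal.mul_inv_cancel]
  rw [this]
  exact mul_le_mul_right (ofReal_le_ofReal (hF.half_le_det x)) _

theorem IsDomainVariation.quasiMeasurePreserving (hF : IsDomainVariation Ω F)
    {s : Set (E n)} (hs : MeasurableSet s) :
    Measure.QuasiMeasurePreserving F (volume.restrict s) (volume.restrict (F '' s)) := by
  refine ⟨hF.contDiff.continuous.measurable, ?_⟩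
  refine Measure.AbsolutelyContinuous.mk fun A hA h0 => ?_
  rw [Measure.map_apply hF.contDiff.continuous.measurable hA]
  have h := hF.lintegral_comp_le hs (A.indicator 1)
  rw [lintegral_indicator_one hA, h0, mul_zero] at h
  have e : ∀ x, A.indicator (1 : E n → ℝ≥0∞) (F x) = (F ⁻¹' A).indicator 1 x := fun x => rfl
  simp only [e] at h
  rw [lintegral_indicator_one (hF.contDiff.continuous.measurable hA)] at h
  exact le_antisymm h zero_le

theorem IsDomainVariation.eLpNorm_comp_le (hF : IsDomainVariation Ω F) {s : Set (E n)}
    (hs : MeasurableSet s) (f : E n → E L) :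
    eLpNorm (fun x => f (F x)) 2 (volume.restrict s)
      ≤ 2 * eLpNorm f 2 (volume.restrict (F '' s)) := by
  refine (ENNReal.pow_le_pow_left_iff (n := 2) (by norm_num)).1 ?_
  rw [eLpNorm_two_sq, mul_pow, eLpNorm_two_sq]
  refine (hF.lintegral_comp_le hs fun y => ‖f y‖ₑ ^ 2).trans (mul_le_mul_left ?_ _)
  norm_num

theorem IsDomainVariation.memLp_comp (hF : IsDomainVariation Ω F) {s : Set (E n)}
    (hs : MeasurableSet s) {f : E n → E L} (hf : MemLp f 2 (volume.restrict (F '' s))) :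
    MemLp (fun x => f (F x)) 2 (volume.restrict s) :=
  ⟨hf.1.comp_quasiMeasurePreserving (hF.quasiMeasurePreserving hs),
    (hF.eLpNorm_comp_le hs f).trans_lt (ENNReal.mul_lt_top (by norm_num) hf.2)⟩

theorem IsDomainVariation.integrable_comp {F' : Type*} [NormedAddCommGroup F']
    (hF : IsDomainVariation Ω F) (hΩ : MeasurableSet Ω) {f : E n → F'} (hf : IntegrableOn f Ω) :
    IntegrableOn (fun x => f (F x)) Ω := by
  have hq := hF.quasiMeasurePreserving hΩ
  have h := hF.lintegral_comp_le hΩ fun y => ‖f y‖ₑ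
  rw [hF.image_eq] at hq h
  exact ⟨hf.1.comp_quasiMeasurePreserving hq, h.trans_lt (ENNReal.mul_lt_top (by norm_num) hf.2)⟩

theorem apply_eq_sum_smul {W : Type*} [AddCommGroup W] [Module ℝ W] [TopologicalSpace W]
    (A : E n →L[ℝ] W) (v : E n) : A v = ∑ k, v k • A (e k) := by
  have h : v = ∑ k, v k • (e k : E n) := by
    have := (EuclideanSpace.basisFun (Fin n) ℝ).sum_repr v
    simpa [e] using this.symm
  conv_lhs => rw [h]
  simp

/-- The chain rule for the composition of a Sobolev function with a diffeomorphism. -/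
theorem HasWeakPartial.comp (hF : IsDomainVariation Ω F) (hΩ : IsOpen Ω) {f : E n → E L}
    {g : Grad n L} (hf : MemLp f 2 (volume.restrict Ω))
    (hg : ∀ k, MemLp (g k) 2 (volume.restrict Ω)) (h : ∀ k, HasWeakPartial Ω k f (g k))
    (i : Fin n) :
    HasWeakPartial Ω i (fun x => f (F x)) (fun x => ∑ k, (∇ F x (e i)) k • g k (F x)) := by
  have hm := hΩ.measurableSet
  have hc : ∀ k, ContDiff ℝ ∞ fun x => (∇ F x (e i)) k := fun k =>
    contDiff_euclidean.1 (contDiff_fderiv_apply hF.contDiff (e i)) k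
  have hfF : MemLp (fun x => f (F x)) 2 (volume.restrict Ω) :=
    hF.memLp_comp hm (by rwa [hF.image_eq])
  have hgF : ∀ k, MemLp (fun x => g k (F x)) 2 (volume.restrict Ω) := fun k =>
    hF.memLp_comp hm (by rw [hF.image_eq]; exact hg k)
  have hgl : ∀ k, LocallyIntegrableOn (fun x => (∇ F x (e i)) k • g k (F x)) Ω := fun k =>
    (locallyIntegrableOn_of_memLp (hgF k)).continuousOn_smul hΩ.isLocallyClosed
      (hc k).continuous.continuousOn
  refine ⟨locallyIntegrableOn_of_memLp hfF, ?_, fun ψ hψ => ?_⟩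
  · have : ∀ s : Finset (Fin n), LocallyIntegrableOn
        (fun x => ∑ k ∈ s, (∇ F x (e i)) k • g k (F x)) Ω := by
      intro s
      induction s using Finset.induction_on with
      | empty => simpa using locallyIntegrableOn_const 0
      | insert a s ha ih =>
        simp only [sum_insert ha]
        exact (hgl a).add ih
    exact this Finset.univ
  set K := tsupport ψ
  have hKc : IsCompact K := hψ.hasCompactSupport
  have hKm := hKc.measurableSet
  have hFK : F '' K ⊆ Ω := by
    rw [← hF.image_eq]; exact image_mono hψ.tsupport_subset
  obtain ⟨v, hv, -, hv0, hv1⟩ := exists_smooth_approx_one hΩ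
    (hKc.image hF.contDiff.continuous) hFK hf hg h
  have hlim : ∀ {a : ℕ → E n → E L} {b : E n → E L} {c : E n → ℝ}, (∀ m, Continuous (a m)) →
      MemLp b 2 (volume.restrict Ω) → IsTestFunction Ω c → tsupport c ⊆ K →
      Tendsto (fun m => eLpNorm (fun x => a m x - b x) 2 (volume.restrict (F '' K))) atTop (𝓝 0) →
      Tendsto (fun m => ∫ x, c x • a m (F x)) atTop (𝓝 (∫ x, c x • b (F x))) := by
    intro a b c ha hb hc hcK hab
    obtain ⟨C, hC⟩ := hc.exists_norm_le
    refine tendsto_integral_of_eLpNorm_two hKc.measure_ne_top hc.contDiff.continuous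
      (fun x hx => image_eq_zero_of_notMem_tsupport fun h => hx (hcK h)) hC
      (hF.memLp_comp hKm (hb.mono_measure (Measure.restrict_mono hFK le_rfl))) (fun m => ?_) ?_
    · refine hF.memLp_comp hKm ?_
      have hc' := (hKc.image hF.contDiff.continuous)
      have : IsFiniteMeasure (volume.restrict (F '' K)) := ⟨by simpa using hc'.measure_lt_top⟩
      obtain ⟨D, hD⟩ := hc'.exists_bound_of_continuousOn (ha m).continuousOn
      exact MemLp.of_bound (ha m).aestronglyMeasurable D
        ((ae_restrict_mem hc'.measurableSet).mono fun x hx => hD x hx)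
    · have h2 := ENNReal.Tendsto.const_mul (a := 2) hab (Or.inr (by norm_num))
      rw [mul_zero] at h2
      exact tendsto_of_tendsto_of_tendsto_of_le_of_le tendsto_const_nhds h2 (fun _ => zero_le)
        fun m => hF.eLpNorm_comp_le hKm fun y => a m y - b y
  have hck : ∀ k, IsTestFunction Ω fun x => (∇ F x (e i)) k * ψ x := fun k => hψ.mul_left (hc k)
  have l1 := hlim (fun m => (hv m).continuous) hf (hψ.fderiv_apply (e i))
    (tsupport_fderiv_apply_subset ℝ (e i)) hv0
  have l2 := tendsto_finsetSum Finset.univ fun k _ =>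
    hlim (fun m => (contDiff_fderiv_apply (hv m) (e k)).continuous) (hg k) (hck k)
    (tsupport_mul_subset_right (f := fun x => (∇ F x (e i)) k)) (hv1 k)
  have e1 : ∀ m, ∫ x, ∇ ψ x (e i) • v m (F x) = - ∑ k, ∫ x,
      ((∇ F x (e i)) k * ψ x) • ∇ (v m) (F x) (e k) := by
    intro m
    have := (hasWeakPartial_of_contDiffOn hΩ (((hv m).comp hF.contDiff).of_le
      (by simp : (1 : ℕ∞ω) ≤ ((⊤ : ℕ∞) : ℕ∞ω))).contDiffOn i).integral_eq ψ hψ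
    rw [setIntegral_smul_of_isTestFunction hψ,
      setIntegral_smul_of_isTestFunction (hψ.fderiv_apply _)] at this
    simp only [Function.comp_apply] at this
    rw [this, ← integral_finsetSum]
    · congr 2
      funext x
      rw [fderiv_comp x ((hv m).differentiable (by simp) _) (hF.contDiff.differentiable (by simp) _),
        ContinuousLinearMap.comp_apply, apply_eq_sum_smul (∇ (v m) (F x)), smul_sum]
      refine sum_congr rfl fun k _ => ?_
      rw [smul_smul, mul_comm]
    · intro k _
      exact (hck k).integrable_smul (((contDiff_fderiv_apply (hv m) (e k)).comp
        hF.contDiff).continuous.locallyIntegrable.locallyIntegrableOn _)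
  rw [setIntegral_smul_of_isTestFunction hψ, setIntegral_smul_of_isTestFunction (hψ.fderiv_apply _)]
  have e2 : ∫ x, ψ x • ∑ k, (∇ F x (e i)) k • g k (F x)
      = ∑ k, ∫ x, ((∇ F x (e i)) k * ψ x) • g k (F x) := by
    rw [← integral_finsetSum]
    · congr 1
      funext x
      rw [smul_sum]
      refine sum_congr rfl fun k _ => ?_
      rw [smul_smul, mul_comm]
    · intro k _
      exact (hck k).integrable_smul (locallyIntegrableOn_of_memLp (hgF k))
  rw [e2]
  simp only [e1] at l1
  exact tendsto_nhds_unique l1 l2.neg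

end ChangeOfVariables

theorem hasFDerivAt_det_one_add (n : ℕ) :
    ∃ A : (Fin n → Fin n → ℝ) →L[ℝ] ℝ, (∀ M, A M = ∑ i, M i i) ∧
      HasFDerivAt (fun M : Fin n → Fin n → ℝ => (1 + Matrix.of M).det) A 0 := by
  have hd : Differentiable ℝ fun M : Fin n → Fin n → ℝ => (1 + Matrix.of M).det := by
    simp only [Matrix.det_apply]
    refine Differentiable.fun_sum fun σ _ => ?_
    refine Differentiable.const_smul ?_ _
    refine (contDiff_prod (n := 1) fun i _ => ?_).differentiable one_ne_zero
    simp only [Matrix.add_apply, Matrix.of_apply]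
    fun_prop
  refine ⟨∇ (fun M : Fin n → Fin n → ℝ => (1 + Matrix.of M).det) 0, fun M => ?_, (hd 0).hasFDerivAt⟩
  have h1 : HasDerivAt (fun t : ℝ => (1 + Matrix.of (t • M)).det)
      (∇ (fun M : Fin n → Fin n → ℝ => (1 + Matrix.of M).det) 0 M) 0 := by
    have h2 : HasDerivAt (fun t : ℝ => t • M) M 0 := by
      simpa using (hasDerivAt_id (0 : ℝ)).smul_const M
    have h3 : HasFDerivAt (fun M : Fin n → Fin n → ℝ => (1 + Matrix.of M).det)
      (∇ (fun M : Fin n → Fin n → ℝ => (1 + Matrix.of M).det) 0) ((0 : ℝ) • M) := by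
      rw [zero_smul]; exact (hd 0).hasFDerivAt
    exact h3.comp_hasDerivAt (0 : ℝ) h2
  have h2 : HasDerivAt (fun t : ℝ => (1 + Matrix.of (t • M)).det) (∑ i, M i i) 0 := by
    have hexp : ∀ t : ℝ, (1 + Matrix.of (t • M)).det = 1 + Matrix.trace (Matrix.of M) * t
        + Polynomial.eval t
          (1 + (Polynomial.X : Polynomial ℝ) • (Matrix.of M).map Polynomial.C).det.divX.divX
          * t ^ 2 := fun t => Matrix.det_one_add_smul t (Matrix.of M)
    rw [funext hexp]
    set P := (1 + (Polynomial.X : Polynomial ℝ) • (Matrix.of M).map Polynomial.C).det.divX.divX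
    have h3 := (((hasDerivAt_id (0 : ℝ)).const_mul (Matrix.trace (Matrix.of M))).const_add 1).add
      ((P.hasDerivAt 0).mul (hasDerivAt_pow 2 (0 : ℝ)))
    exact h3.congr_deriv (by simp [Matrix.trace])
  exact h1.unique h2

theorem det_one_add_expansion (n : ℕ) {ε : ℝ} (hε : 0 < ε) :
    ∃ δ > 0, ∀ M : Fin n → Fin n → ℝ, ‖M‖ ≤ δ →
      |(1 + Matrix.of M).det - 1 - ∑ i, M i i| ≤ ε * ‖M‖ := by
  obtain ⟨A, hA, h⟩ := hasFDerivAt_det_one_add n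
  have h1 := (hasFDerivAt_iff_isLittleO_nhds_zero.1 h).def hε
  obtain ⟨δ, hδ, hδ'⟩ := Metric.eventually_nhds_iff.1 h1
  refine ⟨δ / 2, by positivity, fun M hM => ?_⟩
  have := hδ' (y := M) (by rw [dist_zero_right]; linarith)
  have h0 : (1 + Matrix.of (0 : Fin n → Fin n → ℝ)).det = 1 := by
    have : Matrix.of (0 : Fin n → Fin n → ℝ) = 0 := rfl
    rw [this]; simp
  rw [zero_add, h0, hA, norm_eq_abs] at this
  exact this

section FlowMaps

variable {Ω : Set (E n)} {Y : E n → E n}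

/-- The partial derivative `∂ᵢ Yᵏ`. -/
def jac (Y : E n → E n) (x : E n) (i k : Fin n) : ℝ := (∇ Y x (e i)) k

theorem isTestFunction_jac (hY : IsTestFunction Ω Y) (i k : Fin n) :
    IsTestFunction Ω fun x => jac Y x i k := by
  have h := hY.fderiv_apply (e i)
  refine ⟨contDiff_euclidean.1 h.contDiff k, ?_, ?_⟩
  · exact h.hasCompactSupport.comp_left (g := fun y : E n => y k) rfl
  · exact (tsupport_comp_subset (g := fun y : E n => y k) rfl _).trans h.tsupport_subset

theorem fderiv_id_add_smul (hY : ContDiff ℝ ∞ Y) (t : ℝ) (x : E n) :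
    ∇ (fun x => x + t • Y x) x = ContinuousLinearMap.id ℝ (E n) + t • ∇ Y x :=
  ((hasFDerivAt_id x).add (((hY.differentiable (by simp)) x).hasFDerivAt.const_smul t)).fderiv

theorem det_fderiv_id_add_smul (hY : ContDiff ℝ ∞ Y) (t : ℝ) (x : E n) :
    (∇ (fun x => x + t • Y x) x).det = (1 + Matrix.of fun k i => t * jac Y x i k).det := by
  rw [ContinuousLinearMap.det, ← LinearMap.det_toMatrix (EuclideanSpace.basisFun (Fin n) ℝ).toBasis]
  congr 1
  ext k i
  rw [LinearMap.toMatrix_apply, fderiv_id_add_smul hY]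
  simp [jac, e, Matrix.one_apply]

theorem det_fderiv_id_add_smul_expansion (hY : IsTestFunction Ω Y) {ε : ℝ} (hε : 0 < ε) :
    ∃ t₀ > 0, ∀ t : ℝ, |t| ≤ t₀ → ∀ x,
      |(∇ (fun x => x + t • Y x) x).det - 1 - t * ∑ i, jac Y x i i| ≤ ε * |t| := by
  obtain ⟨B, hB⟩ : ∃ B, ∀ x, ‖fun k i => jac Y x i k‖ ≤ B := by
    refine Continuous.bounded_above_of_compact_support (f := fun x => fun k i => jac Y x i k) ?_ ?_
    · exact continuous_pi fun k => continuous_pi fun i =>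
        (isTestFunction_jac hY i k).contDiff.continuous
    · refine (hY.hasCompactSupport.fderiv ℝ).mono fun x hx h0 => hx ?_
      funext k i
      simp [jac, h0]
  have hB0 : 0 ≤ B := (norm_nonneg _).trans (hB 0)
  obtain ⟨δ, hδ, h⟩ := det_one_add_expansion n (ε := ε / (B + 1)) (by positivity)
  refine ⟨δ / (B + 1), by positivity, fun t ht x => ?_⟩
  have h1 : ‖t • fun k i => jac Y x i k‖ ≤ |t| * B := by
    rw [norm_smul, norm_eq_abs]
    exact mul_le_mul_of_nonneg_left (hB x) (abs_nonneg t)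
  have h2 : |t| * B ≤ δ := by
    calc |t| * B ≤ (δ / (B + 1)) * (B + 1) := by
          apply mul_le_mul ht (by linarith) hB0 (by positivity)
      _ = δ := by field_simp
  have h3 := h _ (h1.trans h2)
  rw [det_fderiv_id_add_smul hY.contDiff, mul_sum]
  refine h3.trans ?_
  calc ε / (B + 1) * ‖t • fun k i => jac Y x i k‖ ≤ ε / (B + 1) * (|t| * (B + 1)) := by
        gcongr
        exact h1.trans (by gcongr; linarith)
    _ = ε * |t| := by field_simp

theorem exists_fixedPoint_sub {Λ : NNReal} (hΛ : LipschitzWith Λ Y)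
    {t : ℝ} (ht : |t| * Λ ≤ 1 / 2) (y : E n) : ∃ x, x + t • Y x = y := by
  have h1 : ContractingWith (1 / 2) fun x => y - t • Y x := by
    refine ⟨by norm_num, LipschitzWith.of_dist_le_mul fun a b => ?_⟩
    rw [dist_sub_left, dist_smul₀, norm_eq_abs]
    calc |t| * dist (Y a) (Y b) ≤ |t| * (Λ * dist a b) := by
          gcongr; exact hΛ.dist_le_mul a b
      _ = (|t| * Λ) * dist a b := by ring
      _ ≤ (1 / 2) * dist a b := by gcongr
      _ = _ := by norm_num
  obtain ⟨x, hx, -⟩ := h1.exists_fixedPoint 0 (edist_ne_top _ _)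
  refine ⟨x, ?_⟩
  have : y - t • Y x = x := hx
  calc x + t • Y x = (y - t • Y x) + t • Y x := by rw [this]
    _ = y := sub_add_cancel _ _

theorem image_id_add_smul (hY : IsTestFunction Ω Y) {Λ : NNReal} (hΛ : LipschitzWith Λ Y)
    {t : ℝ} (ht : |t| * Λ ≤ 1 / 2) :
    Function.Injective (fun x => x + t • Y x) ∧ (fun x => x + t • Y x) '' Ω = Ω := by
  have hinj : Function.Injective fun x => x + t • Y x := by
    intro a b hab
    have h0 : a - b = t • (Y b - Y a) := by
      have : a + t • Y a = b + t • Y b := hab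
      rw [smul_sub, sub_eq_sub_iff_add_eq_add, add_comm (t • Y b), this]
    have h1 : ‖a - b‖ ≤ 1 / 2 * ‖a - b‖ := by
      calc ‖a - b‖ = |t| * ‖Y b - Y a‖ := by
            conv_lhs => rw [h0]
            rw [norm_smul, norm_eq_abs]
        _ ≤ |t| * (Λ * ‖b - a‖) := by
            gcongr
            simpa [dist_eq_norm] using hΛ.dist_le_mul b a
        _ = (|t| * Λ) * ‖a - b‖ := by rw [norm_sub_rev b a]; ring
        _ ≤ _ := by gcongr
    have h2 : ‖a - b‖ = 0 := by nlinarith [norm_nonneg (a - b)]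
    exact sub_eq_zero.1 (norm_eq_zero.1 h2)
  refine ⟨hinj, ?_⟩
  ext y
  constructor
  · rintro ⟨x, hx, rfl⟩
    by_contra hF
    have h1 : Y (x + t • Y x) = 0 := hY.eq_zero hF
    have h2 : x + t • Y x = x := hinj (by simp [h1])
    exact hF (by simpa only [h2] using hx)
  · intro hy
    obtain ⟨x, hx⟩ := exists_fixedPoint_sub hΛ ht y
    by_cases hxΩ : x ∈ Ω
    · exact ⟨x, hxΩ, hx⟩
    · rw [hY.eq_zero hxΩ, smul_zero, add_zero] at hx
      exact absurd (hx ▸ hy) hxΩ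

theorem isDomainVariation_id_add_smul (hY : IsTestFunction Ω Y) :
    ∃ C : ℝ, 0 ≤ C ∧ ∃ t₀ > 0, t₀ ≤ 1 ∧ ∀ t : ℝ, |t| ≤ t₀ →
      IsDomainVariation Ω (fun x => x + t • Y x) ∧
      (∀ x, 0 ≤ (∇ (fun x => x + t • Y x) x).det) ∧
      ∀ x, |(∇ (fun x => x + t • Y x) x).det - 1| ≤ C * |t| := by
  obtain ⟨Λ, hΛ⟩ := (hY.contDiff.of_le (by simp : (1 : ℕ∞ω) ≤ ((⊤ : ℕ∞) : ℕ∞ω))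
    ).lipschitzWith_of_hasCompactSupport hY.hasCompactSupport (by simp)
  obtain ⟨B, hB⟩ : ∃ B, ∀ x, ‖∑ i, jac Y x i i‖ ≤ B := by
    refine Continuous.bounded_above_of_compact_support (f := fun x => ∑ i, jac Y x i i) ?_ ?_
    · exact continuous_finsetSum _ fun i _ => (isTestFunction_jac hY i i).contDiff.continuous
    · refine (hY.hasCompactSupport.fderiv ℝ).mono fun x hx h0 => hx ?_
      simp [jac, h0]
  have hB0 : 0 ≤ B := (norm_nonneg _).trans (hB 0)
  obtain ⟨t₁, ht₁, h⟩ := det_fderiv_id_add_smul_expansion hY one_pos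
  have hd : ∀ t : ℝ, |t| ≤ t₁ → ∀ x, |(∇ (fun x => x + t • Y x) x).det - 1| ≤ (B + 1) * |t| := by
    intro t ht x
    have h1 := abs_le.1 (h t ht x)
    have h2 : |t * ∑ i, jac Y x i i| ≤ |t| * B := by
      rw [abs_mul]
      exact mul_le_mul_of_nonneg_left (hB x) (abs_nonneg t)
    have h3 := abs_le.1 h2
    rw [abs_le]
    constructor <;> nlinarith
  refine ⟨B + 1, by linarith, min (min t₁ 1) (min (1 / (2 * (Λ + 1))) (1 / (2 * (B + 1)))),
    by positivity, (min_le_left _ _).trans (min_le_right _ _), fun t ht => ?_⟩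
  have ha : |t| ≤ t₁ := ht.trans ((min_le_left _ _).trans (min_le_left _ _))
  have hb : |t| ≤ 1 / (2 * (Λ + 1)) := ht.trans ((min_le_right _ _).trans (min_le_left _ _))
  have hc : |t| ≤ 1 / (2 * (B + 1)) := ht.trans ((min_le_right _ _).trans (min_le_right _ _))
  have hb' : |t| * Λ ≤ 1 / 2 := by
    have h0 : (0 : ℝ) ≤ Λ := Λ.2
    rw [le_div_iff₀ (by positivity)] at hb
    nlinarith [abs_nonneg t]
  have hc' : (B + 1) * |t| ≤ 1 / 2 := by
    rw [le_div_iff₀ (by positivity)] at hc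
    nlinarith [abs_nonneg t]
  have hhalf : ∀ x, 1 / 2 ≤ (∇ (fun x => x + t • Y x) x).det := fun x => by
    have := (abs_le.1 (hd t ha x)).1
    linarith
  obtain ⟨i1, i2⟩ := image_id_add_smul hY hΛ hb'
  exact ⟨⟨contDiff_id.add (hY.contDiff.const_smul t), i1, i2,
    fun x => (hhalf x).trans (le_abs_self _)⟩, fun x => by linarith [hhalf x], hd t ha⟩

end FlowMaps

section Differentiation

variable {Ω : Set (E n)} {Y : E n → E n}

theorem IsDomainVariation.norm_integral_mul_comp_le {F : E n → E n} (hF : IsDomainVariation Ω F)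
    (hΩ : IsOpen Ω) {a c : E n → ℝ} {A : ℝ} (hA : 0 ≤ A) (ha : ∀ x, ‖a x‖ ≤ A)
    (hc : IntegrableOn c Ω) :
    ‖∫ x in Ω, a x * c (F x)‖ ≤ A * (2 * ∫ x in Ω, ‖c x‖) := by
  have hcF := hF.integrable_comp hΩ.measurableSet hc
  have h2 : ∫ x in Ω, ‖c (F x)‖ ≤ 2 * ∫ x in Ω, ‖c x‖ := by
    rw [integral_norm_eq_lintegral_enorm hcF.1, integral_norm_eq_lintegral_enorm hc.1]
    have h := hF.lintegral_comp_le hΩ.measurableSet fun y => ‖c y‖ₑ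
    rw [hF.image_eq] at h
    have h3 := ENNReal.toReal_mono (ENNReal.mul_ne_top (by norm_num) hc.2.ne) h
    simpa using h3
  calc ‖∫ x in Ω, a x * c (F x)‖ ≤ ∫ x in Ω, A * ‖c (F x)‖ := by
        refine norm_integral_le_of_norm_le (hcF.norm.const_mul A) (.of_forall fun x => ?_)
        rw [norm_mul]
        exact mul_le_mul_of_nonneg_right (ha x) (norm_nonneg _)
    _ = A * ∫ x in Ω, ‖c (F x)‖ := integral_const_mul _ _
    _ ≤ _ := by gcongr

theorem IsDomainVariation.setIntegral_eq {F : E n → E n} (hF : IsDomainVariation Ω F)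
    (hΩ : IsOpen Ω) (hdet : ∀ x, 0 ≤ (∇ F x).det) (c : E n → ℝ) :
    ∫ x in Ω, c x = ∫ x in Ω, (∇ F x).det * c (F x) := by
  conv_lhs => rw [← hF.image_eq]
  rw [integral_image_eq_integral_abs_det_fderiv_smul volume hΩ.measurableSet
    (fun x _ => ((hF.contDiff.differentiable (by simp)) x).hasFDerivAt.hasFDerivWithinAt)
    hF.injective.injOn]
  simp only [smul_eq_mul, abs_of_nonneg (hdet _)]

theorem IsDomainVariation.continuous_det {F : E n → E n} (hF : IsDomainVariation Ω F) :
    Continuous fun x => (∇ F x).det :=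
  ContinuousLinearMap.continuous_det.comp (hF.contDiff.continuous_fderiv (by simp))

theorem integrableOn_mul_of_bound {a c : E n → ℝ} {s : Set (E n)} (ha : Continuous a) {A : ℝ}
    (hA : ∀ x, ‖a x‖ ≤ A) (hc : IntegrableOn c s) : IntegrableOn (fun x => a x * c x) s :=
  Integrable.bdd_mul hc ha.aestronglyMeasurable (Eventually.of_forall hA)

theorem tendsto_integral_comp_id_add_smul (hΩ : IsOpen Ω) (hY : IsTestFunction Ω Y)
    {b c : E n → ℝ} (hb : IsTestFunction Ω b) (hc : IntegrableOn c Ω) :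
    Tendsto (fun t : ℝ => ∫ x in Ω, b x * c (x + t • Y x)) (𝓝 0) (𝓝 (∫ x in Ω, b x * c x)) := by
  obtain ⟨C, hC0, t₀, ht₀, ht₁, h⟩ := isDomainVariation_id_add_smul hY
  obtain ⟨B, hB⟩ := hb.exists_norm_le
  obtain ⟨D, hD⟩ := hY.exists_norm_le
  obtain ⟨Λ, hΛ⟩ := (hb.contDiff.of_le (by simp : (1 : ℕ∞ω) ≤ ((⊤ : ℕ∞) : ℕ∞ω))
    ).lipschitzWith_of_hasCompactSupport hb.hasCompactSupport (by simp)
  have hB0 : 0 ≤ B := (norm_nonneg _).trans (hB 0)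
  have hD0 : 0 ≤ D := (norm_nonneg _).trans (hD 0)
  have hm := hΩ.measurableSet
  have key : ∀ t : ℝ, |t| ≤ t₀ → ‖(∫ x in Ω, b x * c (x + t • Y x)) - ∫ x in Ω, b x * c x‖
      ≤ |t| * ((Λ * D + C * B) * (2 * ∫ x in Ω, ‖c x‖)) := by
    intro t ht
    rw [← mul_assoc]
    obtain ⟨hF, hdet, hd⟩ := h t ht
    have hcF : IntegrableOn (fun x => c (x + t • Y x)) Ω := hF.integrable_comp hm hc
    have hJ : ∀ x, ‖(∇ (fun x => x + t • Y x) x).det‖ ≤ C + 1 := fun x => by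
      have h1 := abs_le.1 (hd x)
      rw [norm_eq_abs, abs_of_nonneg (hdet x)]
      nlinarith
    have hbF : ∀ x, ‖(∇ (fun x => x + t • Y x) x).det * b (x + t • Y x)‖
        ≤ (C + 1) * B := fun x => by
      rw [norm_mul]
      exact mul_le_mul (hJ x) (hB _) (norm_nonneg _) (by linarith)
    rw [hF.setIntegral_eq hΩ hdet fun x => b x * c x]
    have e2 : ∀ x, (∇ (fun x => x + t • Y x) x).det * (b (x + t • Y x) * c (x + t • Y x))
        = (∇ (fun x => x + t • Y x) x).det * b (x + t • Y x) * c (x + t • Y x) :=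
      fun x => (mul_assoc _ _ _).symm
    simp only [e2]
    have i1 : IntegrableOn (fun x => (∇ (fun x => x + t • Y x) x).det * b (x + t • Y x)
        * c (x + t • Y x)) Ω := integrableOn_mul_of_bound (hF.continuous_det.mul
        (hb.contDiff.continuous.comp hF.contDiff.continuous)) hbF hcF
    rw [← integral_sub (integrableOn_mul_of_bound hb.contDiff.continuous hB hcF) i1]
    simp only [← sub_mul]
    refine (hF.norm_integral_mul_comp_le hΩ (A := |t| * (Λ * D + C * B)) (by positivity)
      (fun x => ?_) hc).trans (le_of_eq (by ring))
    have h1 : ‖b x - b (x + t • Y x)‖ ≤ Λ * (|t| * D) := by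
      have := hΛ.dist_le_mul x (x + t • Y x)
      rw [dist_eq_norm, dist_eq_norm] at this
      refine this.trans ?_
      gcongr
      rw [sub_add_cancel_left, norm_neg, norm_smul, norm_eq_abs]
      gcongr
      exact hD x
    have h2 : ‖((∇ (fun x => x + t • Y x) x).det - 1) * b (x + t • Y x)‖ ≤ (C * |t|) * B := by
      rw [norm_mul]
      exact mul_le_mul (hd x) (hB _) (norm_nonneg _) (by positivity)
    calc ‖b x - (∇ (fun x => x + t • Y x) x).det * b (x + t • Y x)‖
        = ‖(b x - b (x + t • Y x))
          - ((∇ (fun x => x + t • Y x) x).det - 1) * b (x + t • Y x)‖ := by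
          congr 1; ring
      _ ≤ Λ * (|t| * D) + (C * |t|) * B := (norm_sub_le _ _).trans (add_le_add h1 h2)
      _ = _ := by ring
  rw [tendsto_iff_norm_sub_tendsto_zero]
  have h0 : Tendsto (fun t : ℝ => |t| * ((Λ * D + C * B) * (2 * ∫ x in Ω, ‖c x‖))) (𝓝 0) (𝓝 0) := by
    have : Continuous fun t : ℝ => |t| * ((Λ * D + C * B) * (2 * ∫ x in Ω, ‖c x‖)) := by fun_prop
    simpa using this.tendsto 0
  refine tendsto_of_tendsto_of_tendsto_of_le_of_le' tendsto_const_nhds h0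
    (.of_forall fun _ => norm_nonneg _) ?_
  filter_upwards [closedBall_mem_nhds (0 : ℝ) ht₀] with t ht
  exact key t (by simpa using ht)

theorem hasDerivAt_integral_comp_id_add_smul (hΩ : IsOpen Ω) (hY : IsTestFunction Ω Y)
    {c : E n → ℝ} (hc : IntegrableOn c Ω) :
    HasDerivAt (fun t : ℝ => ∫ x in Ω, c (x + t • Y x))
      (- ∫ x in Ω, (∑ i, jac Y x i i) * c x) 0 := by
  have hdiv : IsTestFunction Ω fun x => ∑ i, jac Y x i i := by
    refine ⟨ContDiff.sum fun i _ => (isTestFunction_jac hY i i).contDiff, ?_, ?_⟩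
    · refine (hY.hasCompactSupport.fderiv ℝ).mono fun x hx h0 => hx ?_
      simp [jac, h0]
    · refine Subset.trans (closure_mono (t := Function.support (∇ Y))
        fun x hx h0 => hx ?_) ((tsupport_fderiv_subset ℝ).trans hY.tsupport_subset)
      simp [jac, h0]
  obtain ⟨C, hC0, t₀, ht₀, ht₁, h⟩ := isDomainVariation_id_add_smul hY
  obtain ⟨B, hB⟩ := hdiv.exists_norm_le
  have hm := hΩ.measurableSet
  set I := 2 * ∫ x in Ω, ‖c x‖ with hI
  have hI0 : 0 ≤ I := mul_nonneg zero_le_two (integral_nonneg fun _ => norm_nonneg _)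
  have hT := tendsto_integral_comp_id_add_smul hΩ hY hdiv hc
  rw [hasDerivAt_iff_isLittleO_nhds_zero, Asymptotics.isLittleO_iff]
  intro ε hε
  obtain ⟨t₁, ht₁', hexp⟩ := det_fderiv_id_add_smul_expansion hY
    (show 0 < ε / (2 * (I + 1)) by positivity)
  have hT' := (tendsto_iff_norm_sub_tendsto_zero.1 hT).eventually (gt_mem_nhds (half_pos hε))
  filter_upwards [hT', closedBall_mem_nhds (0 : ℝ) ht₀,
    closedBall_mem_nhds (0 : ℝ) ht₁'] with t h1 h2 h3
  have h2' : |t| ≤ t₀ := by simpa using h2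
  have h3' : |t| ≤ t₁ := by simpa using h3
  obtain ⟨hF, hdet, hd⟩ := h t h2'
  have hcF : IntegrableOn (fun x => c (x + t • Y x)) Ω := hF.integrable_comp hm hc
  have hJ : ∀ x, ‖(∇ (fun x => x + t • Y x) x).det‖ ≤ C + 1 := fun x => by
    have h1 := abs_le.1 (hd x)
    rw [norm_eq_abs, abs_of_nonneg (hdet x)]
    nlinarith
  have i1 := integrableOn_mul_of_bound hF.continuous_det hJ hcF
  have i2 := integrableOn_mul_of_bound hdiv.contDiff.continuous hB hcF
  simp only [zero_add, zero_smul, add_zero, smul_eq_mul]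
  have e0 : ∫ x in Ω, ((∇ (fun x => x + t • Y x) x).det - 1 - t * ∑ i, jac Y x i i)
      * c (x + t • Y x) = (∫ x in Ω, c x) - (∫ x in Ω, c (x + t • Y x))
        - t * ∫ x in Ω, (∑ i, jac Y x i i) * c (x + t • Y x) := by
    rw [hF.setIntegral_eq hΩ hdet c, ← integral_const_mul, ← integral_sub i1 hcF]
    have i3 : IntegrableOn (fun x => (∇ (fun x => x + t • Y x) x).det * c (x + t • Y x)
      - c (x + t • Y x)) Ω := i1.sub hcF
    rw [← integral_sub i3 (i2.const_mul t)]
    congr 1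
    funext x
    ring
  have e1 := hF.norm_integral_mul_comp_le hΩ (A := ε / (2 * (I + 1)) * |t|) (by positivity)
    (fun x => hexp t h3' x) hc
  rw [e0, ← hI] at e1
  have e2 : ε / (2 * (I + 1)) * |t| * I ≤ ε / 2 * |t| := by
    have : ε / (2 * (I + 1)) * |t| * I = (ε / 2 * |t|) * (I / (I + 1)) := by field_simp
    rw [this]
    refine mul_le_of_le_one_right (by positivity) ?_
    rw [div_le_one (by positivity)]; linarith
  set P := ∫ x in Ω, c (x + t • Y x)
  set Q := ∫ x in Ω, (∑ i, jac Y x i i) * c (x + t • Y x)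
  set Q0 := ∫ x in Ω, (∑ i, jac Y x i i) * c x
  calc ‖P - (∫ x in Ω, c x) - t * -Q0‖
      = ‖-((∫ x in Ω, c x) - P - t * Q) - t * (Q - Q0)‖ := by congr 1; ring
    _ ≤ ε / 2 * |t| + |t| * (ε / 2) := by
        refine (norm_sub_le _ _).trans (add_le_add ?_ ?_)
        · rw [norm_neg]; exact e1.trans e2
        · rw [norm_mul, norm_eq_abs]; gcongr
    _ = ε * ‖t‖ := by rw [norm_eq_abs]; ring

end Differentiation

section FirstVariation

variable {Ω : Set (E n)} {u : E n → E L} {p : Grad n L}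
  {h : Hess n L}

theorem SobolevTwo.weakPartial_ae_eq (hΩ : IsOpen Ω) (S : SobolevTwo Ω u p h) (i : Fin n) :
    weakPartial Ω i u =ᵐ[volume.restrict Ω] p i :=
  hasWeakPartial_unique hΩ (hasWeakPartial_weakPartial (S.weak_grad i)) (S.weak_grad i)

theorem weakPartial₂_ae_eq (hΩ : IsOpen Ω) {i j : Fin n} {f g k : E n → E L}
    (h1 : HasWeakPartial Ω i f g) (h2 : HasWeakPartial Ω j g k) :
    weakPartial₂ Ω i j f =ᵐ[volume.restrict Ω] k := by
  have e1 := hasWeakPartial_unique hΩ h1 (hasWeakPartial_weakPartial h1)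
  have h3 := h2.congr hΩ e1 EventuallyEq.rfl
  exact hasWeakPartial_unique hΩ (hasWeakPartial_weakPartial h3) h3

theorem SobolevTwo.weakLaplacian_comp_ae_eq (hΩ : IsOpen Ω) (S : SobolevTwo Ω u p h)
    {F : E n → E n} (hF : IsDomainVariation Ω F) :
    weakLaplacian Ω (fun x => u (F x)) =ᵐ[volume.restrict Ω] fun x =>
      ∑ i, ∑ k, (jac F x i k • (∑ l, jac F x i l • h k l (F x))
        + ∇ (fun y => jac F y i k) x (e i) • p k (F x)) := by
  have h1 : ∀ i, HasWeakPartial Ω i (fun x => u (F x)) (fun x => ∑ k, jac F x i k • p k (F x)) :=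
    fun i => HasWeakPartial.comp hF hΩ S.memLp S.memLp_grad S.weak_grad i
  have h2 : ∀ i, HasWeakPartial Ω i (fun x => ∑ k, jac F x i k • p k (F x))
      (fun x => ∑ k, (jac F x i k • (∑ l, jac F x i l • h k l (F x))
        + ∇ (fun y => jac F y i k) x (e i) • p k (F x))) := fun i => by
    refine HasWeakPartial.sum Finset.univ fun k _ => ?_
    exact (HasWeakPartial.comp hF hΩ (S.memLp_grad k) (S.memLp_hess k) (S.weak_hess k) i).smul_left
      hΩ (contDiff_euclidean.1 (contDiff_fderiv_apply hF.contDiff (e i)) k)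
  have h3 : ∀ᵐ x ∂(volume.restrict Ω), ∀ i, weakPartial₂ Ω i i (fun x => u (F x)) x
      = ∑ k, (jac F x i k • (∑ l, jac F x i l • h k l (F x))
        + ∇ (fun y => jac F y i k) x (e i) • p k (F x)) :=
    ae_all_iff.2 fun i => weakPartial₂_ae_eq hΩ (h1 i) (h2 i)
  filter_upwards [h3] with x hx
  simp only [weakLaplacian, hx]

theorem jac_id_add_smul {Y : E n → E n} (hY : ContDiff ℝ ∞ Y) (t : ℝ) (x : E n) (i k : Fin n) :
    jac (fun x => x + t • Y x) x i k = (if i = k then 1 else 0) + t * jac Y x i k := by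
  rw [jac, fderiv_id_add_smul hY]
  simp [jac, e, eq_comm]

theorem fderiv_jac_id_add_smul {Y : E n → E n} (hY : ContDiff ℝ ∞ Y) (t : ℝ) (x v : E n)
    (i k : Fin n) : ∇ (fun y => jac (fun x => x + t • Y x) y i k) x v
      = t * ∇ (fun y => jac Y y i k) x v := by
  simp only [jac_id_add_smul hY]
  have hd : DifferentiableAt ℝ (fun y => jac Y y i k) x :=
    ((contDiff_euclidean.1 (contDiff_fderiv_apply hY (e i)) k).differentiable (by simp)) x
  rw [fderiv_const_add, fderiv_const_mul hd]
  simp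

theorem sum_variation_expansion (t : ℝ) (y : Fin n → Fin n → ℝ) (z : Fin n → Fin n → ℝ)
    (H : Fin n → Fin n → E L) (P : Fin n → E L) :
    ∑ i, ∑ k, (((if i = k then 1 else 0) + t * y i k) •
        (∑ l, ((if i = l then 1 else 0) + t * y i l) • H k l) + (t * z i k) • P k)
      = (∑ i, H i i) + t • ((∑ k, ∑ l, (y k l + y l k) • H k l) + ∑ k, (∑ i, z i k) • P k)
        + t ^ 2 • ∑ i, ∑ k, ∑ l, (y i k * y i l) • H k l := by
  have e0 : ∀ (G : Fin n → E L) (i : Fin n), ∑ l, ((if i = l then (1 : ℝ) else 0) + t * y i l) • G l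
      = G i + t • ∑ l, y i l • G l := fun G i => by
    simp [add_smul, sum_add_distrib, ite_smul, smul_sum, smul_smul]
  have e2 : ∀ i, ∑ k, (((if i = k then (1 : ℝ) else 0) + t * y i k) •
        (∑ l, ((if i = l then (1 : ℝ) else 0) + t * y i l) • H k l) + (t * z i k) • P k)
      = H i i + (t • ∑ l, y i l • H i l) + (t • ∑ k, y i k • H k i)
        + (t ^ 2 • ∑ k, ∑ l, (y i k * y i l) • H k l) + t • ∑ k, z i k • P k := fun i => by
    have e5 : ∀ k l, t * (y i k * (t * y i l)) = t ^ 2 * (y i k * y i l) := fun k l => by ring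
    rw [sum_add_distrib, e0 fun k => ∑ l, ((if i = l then (1 : ℝ) else 0) + t * y i l) • H k l]
    simp only [e0]
    simp only [sum_add_distrib, smul_add, smul_sum, smul_smul, e5]
    abel
  simp only [e2, sum_add_distrib]
  rw [smul_add, smul_sum, smul_sum, smul_sum]
  have e3 : ∑ i, t • ∑ k, z i k • P k = ∑ k, t • (∑ i, z i k) • P k := by
    simp only [← smul_sum, Finset.sum_smul]
    rw [sum_comm]
  have e4 : ∑ i, t • ∑ k, y i k • H k i = ∑ k, t • ∑ l, y l k • H k l := by
    simp only [← smul_sum]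
    rw [sum_comm]
  rw [e3, e4]
  simp only [add_smul, sum_add_distrib, smul_add]
  abel

theorem norm_sq_expansion (a b c : E L) (t : ℝ) :
    ‖a + t • b + t ^ 2 • c‖ ^ 2 = ‖a‖ ^ 2 + t * (2 * inner ℝ a b)
      + t ^ 2 * (‖b‖ ^ 2 + 2 * inner ℝ a c + t * (2 * inner ℝ b c) + t ^ 2 * ‖c‖ ^ 2) := by
  rw [norm_add_sq_real, norm_add_sq_real, inner_add_left, norm_smul, norm_smul, mul_pow, mul_pow]
  simp only [inner_smul_left, inner_smul_right, norm_eq_abs, sq_abs, abs_pow]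
  simp
  ring

theorem abs_remainder_le (a b c : E L) {t : ℝ} (ht : |t| ≤ 1) :
    |‖b‖ ^ 2 + 2 * inner ℝ a c + t * (2 * inner ℝ b c) + t ^ 2 * ‖c‖ ^ 2|
      ≤ 3 * (‖a‖ ^ 2 + ‖b‖ ^ 2 + ‖c‖ ^ 2) := by
  have h1 := abs_real_inner_le_norm a c
  have h2 := abs_real_inner_le_norm b c
  have h3 : |t * (2 * inner ℝ b c)| ≤ 2 * (‖b‖ * ‖c‖) := by
    rw [abs_mul, abs_mul, abs_two]
    calc |t| * (2 * |inner ℝ b c|) ≤ 1 * (2 * (‖b‖ * ‖c‖)) := by gcongr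
      _ = _ := one_mul _
  have h4 : t ^ 2 * ‖c‖ ^ 2 ≤ ‖c‖ ^ 2 := by
    refine mul_le_of_le_one_left (by positivity) ?_
    rw [← sq_abs]; nlinarith [abs_nonneg t]
  have h5 : 0 ≤ t ^ 2 * ‖c‖ ^ 2 := by positivity
  have h1' := abs_le.1 h1
  have h3' := abs_le.1 h3
  rw [abs_le]
  constructor <;> nlinarith [sq_nonneg (‖a‖ - ‖c‖), sq_nonneg (‖b‖ - ‖c‖), sq_nonneg ‖a‖,
    sq_nonneg ‖b‖, sq_nonneg ‖c‖]

theorem norm_sum_smul_le {ι : Type*} [Fintype ι] {b : ι → ℝ} {B : ℝ} (hb : ∀ m, |b m| ≤ B)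
    (v : ι → E L) : ‖∑ m, b m • v m‖ ≤ B * ∑ m, ‖v m‖ := by
  rw [mul_sum]
  refine (norm_sum_le _ _).trans (sum_le_sum fun m _ => ?_)
  rw [norm_smul, norm_eq_abs]
  exact mul_le_mul_of_nonneg_right (hb m) (norm_nonneg _)

theorem exists_forall_bound {ι : Type*} [Finite ι] {b : ι → E n → ℝ}
    (hb : ∀ m, IsTestFunction Ω (b m)) : ∃ B, 0 ≤ B ∧ ∀ m x, |b m x| ≤ B := by
  cases nonempty_fintype ι
  choose B hB using fun m =>
    (hb m).contDiff.continuous.bounded_above_of_compact_support (hb m).hasCompactSupport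
  refine ⟨∑ m, |B m|, sum_nonneg fun _ _ => abs_nonneg _, fun m x => ?_⟩
  exact ((hB m x).trans (le_abs_self _)).trans
    (single_le_sum (f := fun m => |B m|) (fun _ _ => abs_nonneg _) (Finset.mem_univ m))

theorem IsTestFunction.sum {ι : Type*} (s : Finset ι) {b : ι → E n → ℝ}
    (hb : ∀ m ∈ s, IsTestFunction Ω (b m)) : IsTestFunction Ω fun x => ∑ m ∈ s, b m x := by
  classical
  induction s using Finset.induction_on with
  | empty =>
    simp only [sum_empty]
    exact ⟨contDiff_const, HasCompactSupport.zero, by simp [tsupport]⟩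
  | insert a s ha ih =>
    simp only [sum_insert ha]
    have h1 := hb a (Finset.mem_insert_self _ _)
    have h2 := ih fun k hk => hb k (Finset.mem_insert_of_mem hk)
    exact ⟨h1.contDiff.add h2.contDiff, h1.hasCompactSupport.add h2.hasCompactSupport,
      (tsupport_add _ _).trans (union_subset h1.tsupport_subset h2.tsupport_subset)⟩

theorem memLp_sum_smul_comp {ι : Type*} [Fintype ι] (hΩ : IsOpen Ω) {F : E n → E n}
    (hF : IsDomainVariation Ω F) {b : ι → E n → ℝ} (hb : ∀ m, IsTestFunction Ω (b m))
    {v : ι → E n → E L} (hv : ∀ m, MemLp (v m) 2 (volume.restrict Ω)) :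
    MemLp (fun x => ∑ m, b m x • v m (F x)) 2 (volume.restrict Ω) := by
  refine memLp_finsetSum _ fun m _ => ?_
  have h1 : MemLp (fun x => v m (F x)) 2 (volume.restrict Ω) :=
    hF.memLp_comp hΩ.measurableSet (by rw [hF.image_eq]; exact hv m)
  exact (memLp_testFunction_smul hΩ.measurableSet (hb m) h1).restrict Ω

theorem integrable_inner_of_memLp {α : Type*} [MeasurableSpace α] {μ : Measure α} {f g : α → E L}
    (hf : MemLp f 2 μ) (hg : MemLp g 2 μ) : Integrable (fun x => inner ℝ (f x) (g x)) μ := by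
  refine (hf.norm.integrable_sq.add hg.norm.integrable_sq).mono
    (hf.1.inner hg.1) (.of_forall fun x => ?_)
  have h1 := norm_inner_le_norm (𝕜 := ℝ) (f x) (g x)
  refine h1.trans (le_trans ?_ (le_abs_self _))
  simp only [Pi.add_apply]
  nlinarith [sq_nonneg (‖f x‖ - ‖g x‖), sq_nonneg (‖f x‖ + ‖g x‖)]

/-- The derivative of an energy of the form `∫ |D + t V + t² Q|²`, where the fields are composed
with `id + t Y`. -/
theorem hasDerivAt_energy {ι κ : Type*} [Fintype ι] [Fintype κ] (hΩ : IsOpen Ω) {Y : E n → E n}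
    (hY : IsTestFunction Ω Y) {D : E n → E L} (hD : MemLp D 2 (volume.restrict Ω))
    {b : ι → E n → ℝ} (hb : ∀ m, IsTestFunction Ω (b m)) {v : ι → E n → E L}
    (hv : ∀ m, MemLp (v m) 2 (volume.restrict Ω))
    {d : κ → E n → ℝ} (hd : ∀ m, IsTestFunction Ω (d m)) {q : κ → E n → E L}
    (hq : ∀ m, MemLp (q m) 2 (volume.restrict Ω)) {W : ℝ → ℝ} {t₁ : ℝ} (ht₁ : 0 < t₁)
    (hW : ∀ t : ℝ, |t| ≤ t₁ → W t = ∫ x in Ω, ‖D (x + t • Y x) + t • ∑ m, b m x • v m (x + t • Y x)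
      + t ^ 2 • ∑ m, d m x • q m (x + t • Y x)‖ ^ 2) :
    HasDerivAt W ((∫ x in Ω, 2 * inner ℝ (D x) (∑ m, b m x • v m x))
      - ∫ x in Ω, (∑ i, jac Y x i i) * ‖D x‖ ^ 2) 0 := by
  have hm := hΩ.measurableSet
  obtain ⟨C, -, t₀, ht₀, ht₀1, hvar⟩ := isDomainVariation_id_add_smul hY
  obtain ⟨B₁, hB₁, hbB⟩ := exists_forall_bound hb
  obtain ⟨B₂, hB₂, hdB⟩ := exists_forall_bound hd
  set H : E n → ℝ := fun z => ‖D z‖ + ∑ m, ‖v m z‖ + ∑ m, ‖q m z‖ with hHdef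
  have hHm : MemLp H 2 (volume.restrict Ω) :=
    (hD.norm.add (memLp_finsetSum _ fun m _ => (hv m).norm)).add
      (memLp_finsetSum _ fun m _ => (hq m).norm)
  have hHi : IntegrableOn (fun z => H z ^ 2) Ω := hHm.integrable_sq
  have hD2 : IntegrableOn (fun z => ‖D z‖ ^ 2) Ω := hD.norm.integrable_sq
  have hDv : ∀ m, IntegrableOn (fun z => 2 * inner ℝ (D z) (v m z)) Ω := fun m =>
    (integrable_inner_of_memLp hD (hv m)).const_mul 2
  set E₀ : ℝ → ℝ := fun t => ∫ x in Ω, ‖D (x + t • Y x)‖ ^ 2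
  set E₁ : ℝ → ℝ := fun t => ∑ m, ∫ x in Ω, b m x
    * (2 * inner ℝ (D (x + t • Y x)) (v m (x + t • Y x)))
  have hsum : ∀ t : ℝ, (∀ m, IntegrableOn (fun x => b m x
      * (2 * inner ℝ (D (x + t • Y x)) (v m (x + t • Y x)))) Ω) →
      E₁ t = ∫ x in Ω, 2 * inner ℝ (D (x + t • Y x)) (∑ m, b m x • v m (x + t • Y x)) := by
    intro t ht
    simp only [E₁]
    rw [← integral_finsetSum _ fun m _ => ht m]
    congr 1
    funext x
    rw [inner_sum, mul_sum]
    refine sum_congr rfl fun m _ => ?_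
    rw [real_inner_smul_right]; ring
  have hE₀ : HasDerivAt E₀ (- ∫ x in Ω, (∑ i, jac Y x i i) * ‖D x‖ ^ 2) 0 :=
    hasDerivAt_integral_comp_id_add_smul hΩ hY hD2
  have hE₁ : Tendsto E₁ (𝓝 0) (𝓝 (∫ x in Ω, 2 * inner ℝ (D x) (∑ m, b m x • v m x))) := by
    have h1 : Tendsto E₁ (𝓝 0) (𝓝 (∑ m, ∫ x in Ω, b m x * (2 * inner ℝ (D x) (v m x)))) :=
      tendsto_finsetSum _ fun m _ => tendsto_integral_comp_id_add_smul hΩ hY (hb m) (hDv m)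
    have h2 := hsum 0 fun m => by
      simp only [zero_smul, add_zero]
      exact integrableOn_mul_of_bound (hb m).contDiff.continuous (hbB m) (hDv m)
    simp only [zero_smul, add_zero, E₁] at h2
    rwa [h2] at h1
  set M : ℝ := 3 * (1 + B₁ ^ 2 + B₂ ^ 2) * (2 * ∫ x in Ω, ‖H x ^ 2‖)
  have key : ∀ t : ℝ, |t| ≤ min t₀ t₁ → |W t - E₀ t - t * E₁ t| ≤ M * t ^ 2 := by
    intro t ht
    have ht0 : |t| ≤ t₀ := ht.trans (min_le_left _ _)
    obtain ⟨hF, -, -⟩ := hvar t ht0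
    have hDF : MemLp (fun x => D (x + t • Y x)) 2 (volume.restrict Ω) :=
      hF.memLp_comp hm (by rw [hF.image_eq]; exact hD)
    have hVF := memLp_sum_smul_comp hΩ hF hb hv
    have hQF := memLp_sum_smul_comp hΩ hF hd hq
    have hHF : IntegrableOn (fun x => H (x + t • Y x) ^ 2) Ω := hF.integrable_comp hm hHi
    rw [hW t (ht.trans (min_le_right _ _)), hsum t fun m => integrableOn_mul_of_bound
      (hb m).contDiff.continuous (hbB m) (hF.integrable_comp hm (hDv m))]
    simp only [norm_sq_expansion]
    set V : E n → E L := fun x => ∑ m, b m x • v m (x + t • Y x)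
    set Q : E n → E L := fun x => ∑ m, d m x • q m (x + t • Y x)
    set D' : E n → E L := fun x => D (x + t • Y x)
    set G : E n → ℝ := fun x => ‖V x‖ ^ 2 + 2 * inner ℝ (D' x) (Q x)
      + t * (2 * inner ℝ (V x) (Q x)) + t ^ 2 * ‖Q x‖ ^ 2
    have i0 : IntegrableOn (fun x => ‖D' x‖ ^ 2) Ω := hDF.norm.integrable_sq
    have i1 : IntegrableOn (fun x => 2 * inner ℝ (D' x) (V x)) Ω :=
      (integrable_inner_of_memLp hDF hVF).const_mul 2
    have iG : IntegrableOn G Ω :=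
      ((hVF.norm.integrable_sq.add ((integrable_inner_of_memLp hDF hQF).const_mul 2)).add
        (((integrable_inner_of_memLp hVF hQF).const_mul 2).const_mul t)).add
        (hQF.norm.integrable_sq.const_mul (t ^ 2))
    have e1 : ∫ x in Ω, (‖D' x‖ ^ 2 + t * (2 * inner ℝ (D' x) (V x)) + t ^ 2 * G x)
        = E₀ t + t * (∫ x in Ω, 2 * inner ℝ (D' x) (V x)) + t ^ 2 * ∫ x in Ω, G x := by
      have i2 : IntegrableOn (fun x => ‖D' x‖ ^ 2 + t * (2 * inner ℝ (D' x) (V x))) Ω :=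
        i0.add (i1.const_mul t)
      rw [integral_add i2 (iG.const_mul _), integral_add i0 (i1.const_mul t), integral_const_mul t,
        integral_const_mul (t ^ 2)]
    rw [e1]
    have e2 : |∫ x in Ω, G x| ≤ M := by
      have hle : ∀ x, ‖G x‖ ≤ 3 * (1 + B₁ ^ 2 + B₂ ^ 2) * H (x + t • Y x) ^ 2 := by
        intro x
        have hs1 : 0 ≤ ∑ m, ‖v m (x + t • Y x)‖ := sum_nonneg fun _ _ => norm_nonneg _
        have hs2 : 0 ≤ ∑ m, ‖q m (x + t • Y x)‖ := sum_nonneg fun _ _ => norm_nonneg _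
        have n0 : ‖D' x‖ ≤ H (x + t • Y x) := by
          simp only [hHdef]; linarith
        have n1 : ‖V x‖ ≤ B₁ * H (x + t • Y x) := by
          refine (norm_sum_smul_le (fun m => hbB m x) _).trans ?_
          gcongr
          simp only [hHdef]; linarith [norm_nonneg (D (x + t • Y x))]
        have n2 : ‖Q x‖ ≤ B₂ * H (x + t • Y x) := by
          refine (norm_sum_smul_le (fun m => hdB m x) _).trans ?_
          gcongr
          simp only [hHdef]; linarith [norm_nonneg (D (x + t • Y x))]
        have hrem := abs_remainder_le (D' x) (V x) (Q x) (ht0.trans ht₀1)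
        rw [norm_eq_abs]
        refine hrem.trans ?_
        have m0 := pow_le_pow_left₀ (norm_nonneg _) n0 2
        have m1 := pow_le_pow_left₀ (norm_nonneg _) n1 2
        have m2 := pow_le_pow_left₀ (norm_nonneg _) n2 2
        nlinarith
      have h1 : ‖∫ x in Ω, G x‖ ≤ ∫ x in Ω, 3 * (1 + B₁ ^ 2 + B₂ ^ 2) * H (x + t • Y x) ^ 2 :=
        norm_integral_le_of_norm_le (hHF.const_mul _) (Eventually.of_forall hle)
      have h2 := hF.norm_integral_mul_comp_le hΩ (a := fun _ => 3 * (1 + B₁ ^ 2 + B₂ ^ 2))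
        (A := 3 * (1 + B₁ ^ 2 + B₂ ^ 2)) (by positivity)
        (fun _ => by rw [Real.norm_of_nonneg (by positivity)]) hHi
      exact h1.trans ((le_abs_self _).trans h2)
    rw [show E₀ t + t * (∫ x in Ω, 2 * inner ℝ (D' x) (V x)) + t ^ 2 * (∫ x in Ω, G x) - E₀ t
      - t * (∫ x in Ω, 2 * inner ℝ (D' x) (V x)) = (∫ x in Ω, G x) * t ^ 2 by ring, abs_mul,
      abs_of_nonneg (sq_nonneg t)]
    gcongr
  have hmin : 0 < min t₀ t₁ := lt_min ht₀ ht₁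
  have hW0 : W 0 = E₀ 0 := by
    have := key 0 (by simpa using hmin.le)
    simp at this
    linarith
  have hE₁' : HasDerivAt (fun t => t * E₁ t) (∫ x in Ω, 2 * inner ℝ (D x) (∑ m, b m x • v m x)) 0 := by
    rw [hasDerivAt_iff_tendsto_slope]
    refine (hE₁.mono_left nhdsWithin_le_nhds).congr' ?_
    filter_upwards [self_mem_nhdsWithin] with t ht
    rw [slope_def_field, zero_mul, sub_zero, sub_zero, mul_div_cancel_left₀ _ ht]
  have hR : HasDerivAt (fun t => W t - E₀ t - t * E₁ t) 0 0 := by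
    rw [hasDerivAt_iff_isLittleO_nhds_zero]
    have hbig : (fun t => W t - E₀ t - t * E₁ t) =O[𝓝 0] fun t : ℝ => t ^ 2 := by
      refine Asymptotics.IsBigO.of_bound M ?_
      filter_upwards [closedBall_mem_nhds (0 : ℝ) hmin] with t ht
      rw [norm_eq_abs, norm_eq_abs, abs_of_nonneg (sq_nonneg t)]
      exact key t (by simpa using ht)
    have hlit : (fun t : ℝ => t ^ 2) =o[𝓝 0] fun t : ℝ => t := by
      simpa using Asymptotics.isLittleO_pow_pow (𝕜 := ℝ) (m := 1) (n := 2) (by norm_num)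
    refine (hbig.trans_isLittleO hlit).congr_left fun t => ?_
    simp [hW0]
  have hall := (hR.add hE₀).add hE₁'
  refine (hall.congr_deriv (by ring)).congr_of_eventuallyEq (.of_forall fun t => ?_)
  simp only [Pi.add_apply]
  ring

/-- The integrand of the first variation of the energy along the vector field `Y`. -/
def variationTerm (Y : E n → E n) (p : Grad n L) (h : Hess n L) (x z : E n) : E L :=
  (∑ k, ∑ l, (jac Y x k l + jac Y x l k) • h k l z)
    + ∑ k, (∑ i, ∇ (fun y => jac Y y i k) x (e i)) • p k z

/-- The first variation formula for domain variations. -/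
theorem SobolevTwo.first_variation (hΩ : IsOpen Ω) (S : SobolevTwo Ω u p h) {Y : E n → E n}
    (hY : IsTestFunction Ω Y)
    (hst : HasDerivAt (fun t : ℝ => hessianEnergy Ω fun x => u (x + t • Y x)) 0 0) :
    ∫ x in Ω, 2 * inner ℝ (∑ i, h i i x) (variationTerm Y p h x x)
      = ∫ x in Ω, (∑ i, jac Y x i i) * ‖∑ i, h i i x‖ ^ 2 := by
  have hjac := isTestFunction_jac hY
  let b : (Fin n × Fin n) ⊕ Fin n → E n → ℝ := Sum.elim
    (fun m x => ∑ r : Fin 2, if r = 0 then jac Y x m.1 m.2 else jac Y x m.2 m.1)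
    fun k x => ∑ i, ∇ (fun y => jac Y y i k) x (e i)
  let v : (Fin n × Fin n) ⊕ Fin n → E n → E L := Sum.elim (fun m => h m.1 m.2) p
  let d : Fin n × Fin n × Fin n → E n → ℝ := fun m x => jac Y x m.1 m.2.1 * jac Y x m.1 m.2.2
  let q : Fin n × Fin n × Fin n → E n → E L := fun m => h m.2.1 m.2.2
  have hb : ∀ m, IsTestFunction Ω (b m) := by
    rintro (m | k)
    · refine IsTestFunction.sum Finset.univ fun r _ => ?_
      split_ifs
      exacts [hjac _ _, hjac _ _]
    · exact IsTestFunction.sum Finset.univ fun i _ => (hjac i k).fderiv_apply (e i)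
  have hv : ∀ m, MemLp (v m) 2 (volume.restrict Ω) := by
    rintro (m | k)
    exacts [S.memLp_hess _ _, S.memLp_grad _]
  have hd : ∀ m, IsTestFunction Ω (d m) := fun m =>
    (hjac m.1 m.2.2).mul_left (hjac m.1 m.2.1).contDiff
  have hq : ∀ m, MemLp (q m) 2 (volume.restrict Ω) := fun m => S.memLp_hess _ _
  have hV : ∀ x z, ∑ m, b m x • v m z = variationTerm Y p h x z := fun x z => by
    simp [b, v, variationTerm, Fintype.sum_sum_type, Fintype.sum_prod_type]
  have hQ : ∀ x z, ∑ m, d m x • q m z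
      = ∑ i, ∑ k, ∑ l, (jac Y x i k * jac Y x i l) • h k l z := fun x z => by
    simp [d, q, Fintype.sum_prod_type]
  obtain ⟨C, -, t₀, ht₀, -, hvar⟩ := isDomainVariation_id_add_smul hY
  have key := hasDerivAt_energy hΩ hY (D := fun x => ∑ i, h i i x)
    (memLp_finsetSum _ fun i _ => S.memLp_hess i i) hb hv hd hq
    (W := fun t : ℝ => hessianEnergy Ω fun x => u (x + t • Y x)) ht₀ fun t ht => by
      refine integral_congr_ae ?_
      filter_upwards [S.weakLaplacian_comp_ae_eq hΩ (hvar t ht).1] with x hx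
      rw [hx, hV, hQ]
      simp only [fderiv_jac_id_add_smul hY.contDiff]
      simp only [jac_id_add_smul hY.contDiff]
      rw [sum_variation_expansion]
      rfl
  have h0 := key.unique hst
  simp only [hV] at h0
  exact sub_eq_zero.1 h0

end FirstVariation

section QuadraticForms

variable {F : Type*} [NormedAddCommGroup F] [InnerProductSpace ℝ F]

/-- `xᵏ pₖ`. -/
def radP (X : Fin n → ℝ) (p : Fin n → F) : F := ∑ k, X k • p k

/-- `∂ⱼ(xᵏ pₖ) = pⱼ + xᵏ hⱼₖ`. -/
def radV (X : Fin n → ℝ) (p : Fin n → F) (h : Fin n → Fin n → F) (j : Fin n) : F :=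
  p j + ∑ k, X k • h j k

/-- `hᵢᵢ`. -/
def lapH (h : Fin n → Fin n → F) : F := ∑ i, h i i

/-- `xᵏ xˡ hₖₗ`. -/
def radH (X : Fin n → ℝ) (h : Fin n → Fin n → F) : F := ∑ k, ∑ l, (X k * X l) • h k l

/-- The first variation integrand for the vector field `T(|x|²) x`, in terms of
`M = (4 - n) T + |x|² Z` and `Z = -2 T'`. -/
def variationForm (M Z Z' : ℝ) (X : Fin n → ℝ) (p : Fin n → F) (h : Fin n → Fin n → F) : ℝ :=
  M * inner ℝ (lapH h) (lapH h) - 4 * Z * inner ℝ (lapH h) (radH X h)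
    - (4 * (∑ k, X k ^ 2) * Z' + (2 * n + 4) * Z) * inner ℝ (lapH h) (radP X p)

/-- The integrand of the monotonicity identity. -/
def monotonicityForm (M Z Z' Z'' : ℝ) (X : Fin n → ℝ) (p : Fin n → F) (h : Fin n → Fin n → F) : ℝ :=
  M * ∑ i, ∑ j, inner ℝ (h i j) (h i j)
    - 4 * Z * ∑ j, inner ℝ (radV X p h j) (radV X p h j)
    - (4 * (n - 2) * Z' + 8 * (∑ k, X k ^ 2) * Z'') * inner ℝ (radP X p) (radP X p)
    - 3 * ((n - 2) * Z + 2 * (∑ k, X k ^ 2) * Z') * (inner ℝ (lapH h) (radP X p)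
      + ∑ j, inner ℝ (p j) (radV X p h j) + ∑ j, inner ℝ (p j) (p j))

/-- The divergence of the vector field relating the two forms, as a function of the `2`-jet
of the coefficients and the `3`-jet of the function. -/
theorem divergence_identity (M Z Z' Z'' : ℝ) (X p : Fin n → ℝ) (h : Fin n → Fin n → ℝ)
    (t : Fin n → Fin n → Fin n → ℝ) (hs : ∀ i j, h i j = h j i)
    (ts : ∀ i j k, t i j k = t j i k) (ts' : ∀ i j k, t i j k = t i k j) :
    ∑ i, (((((n - 2) * Z + 2 * (∑ k, X k ^ 2) * Z') * X i) * (p i * lapH h)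
          + M * (h i i * lapH h + p i * ∑ k, t k k i))
      - ((((n - 2) * Z + 2 * (∑ k, X k ^ 2) * Z') * X i) * (∑ k, p k * h k i)
          + M * ∑ k, (h k i * h k i + p k * t k i i))
      - 4 * ((2 * Z' * X i) * (p i * ∑ k, X k * radV X p h k)
          + Z * (h i i * (∑ k, X k * radV X p h k)
            + p i * (radV X p h i + ∑ k, X k * (2 * h k i + ∑ l, X l * t k l i))))
      + 4 * ((2 * Z' * X i) * (X i * ∑ k, p k * radV X p h k) + Z * ((∑ k, p k * radV X p h k)
            + X i * ∑ k, (h k i * radV X p h k + p k * (2 * h k i + ∑ l, X l * t k l i))))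
      - 4 * ((2 * Z' * X i) * (p i * radP X p) + Z * (h i i * radP X p + p i * radV X p h i))
      + 2 * ((2 * Z' * X i) * (X i * ∑ k, p k * p k)
          + Z * ((∑ k, p k * p k) + X i * ∑ k, (2 * (p k * h k i))))
      + 4 * ((2 * Z'' * X i) * (X i * (radP X p * radP X p))
          + Z' * (radP X p * radP X p + X i * (2 * (radP X p * radV X p h i)))))
    = variationForm M Z Z' X p h - monotonicityForm M Z Z' Z'' X p h := by
  set q := ∑ k, X k ^ 2 with hq
  set V := radV X p h with hV
  set r := radP X p with hr
  set D := lapH h with hD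
  set a := ∑ k, X k * V k with ha
  set b := ∑ k, p k * V k with hb
  set c := ∑ k, p k * p k with hc
  have eX : ∑ i, X i * X i = q := by simp only [hq, sq]
  have er : ∑ i, X i * p i = r := rfl
  have eD : ∑ i, h i i = D := rfl
  have eXh : ∀ k, ∑ i, X i * h k i = V k - p k := fun k => by
    simp [hV, radV]
  have eXh' : ∀ k, ∑ i, X i * h i k = V k - p k := fun k => by
    simp only [← eXh, hs k]
  have s1 : ∑ i, p i * ∑ k, t k k i = ∑ i, ∑ k, p k * t k i i := by
    rw [sum_comm]
    refine sum_congr rfl fun i _ => ?_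
    rw [mul_sum]
    refine sum_congr rfl fun k _ => ?_
    rw [ts' k k i, ts k i k, ts' i k k]
  have s2 : ∑ i, X i * ∑ k, p k * h k i = b - c := by
    simp only [mul_sum]
    rw [sum_comm, hb, hc, ← sum_sub_distrib]
    refine sum_congr rfl fun k _ => ?_
    rw [← mul_sub, ← eXh, mul_sum]
    exact sum_congr rfl fun i _ => by ring
  have s3 : ∑ i, p i * ∑ k, X k * (2 * h k i + ∑ l, X l * t k l i)
      = ∑ i, X i * ∑ k, p k * (2 * h k i + ∑ l, X l * t k l i) := by
    simp only [mul_sum]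
    rw [sum_comm]
    refine sum_congr rfl fun k _ => sum_congr rfl fun i _ => ?_
    rw [hs k i]
    have : ∑ l, X l * t k l i = ∑ l, X l * t i l k := by
      refine sum_congr rfl fun l _ => ?_
      rw [ts' k l i, ts k i l, ts' i k l]
    rw [this]; ring
  have s4 : ∑ i, X i * ∑ k, h k i * V k = (∑ k, V k * V k) - b := by
    simp only [mul_sum]
    rw [sum_comm, hb, ← sum_sub_distrib]
    refine sum_congr rfl fun k _ => ?_
    rw [← sub_mul, ← eXh, Finset.sum_mul]
    exact sum_congr rfl fun i _ => by ring
  have s5 : ∑ i, X i * V i = a := rfl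
  have s6 : ∑ i, p i * V i = b := rfl
  have s7 : radH X h = a - r := by
    rw [radH, ha, ← er, ← sum_sub_distrib]
    refine sum_congr rfl fun k _ => ?_
    rw [← mul_sub, ← eXh, mul_sum]
    exact sum_congr rfl fun i _ => by simp; ring
  have s8 : ∑ i, X i * ∑ k, 2 * (p k * h k i) = 2 * (b - c) := by
    simp only [← mul_sum, ← s2]
    rw [mul_sum]
    exact sum_congr rfl fun i _ => by ring
  have key : ∀ i, (((((n - 2) * Z + 2 * q * Z') * X i) * (p i * D)
          + M * (h i i * D + p i * ∑ k, t k k i))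
      - ((((n - 2) * Z + 2 * q * Z') * X i) * (∑ k, p k * h k i)
          + M * ∑ k, (h k i * h k i + p k * t k i i))
      - 4 * ((2 * Z' * X i) * (p i * a) + Z * (h i i * a
            + p i * (V i + ∑ k, X k * (2 * h k i + ∑ l, X l * t k l i))))
      + 4 * ((2 * Z' * X i) * (X i * b)
          + Z * (b + X i * ∑ k, (h k i * V k + p k * (2 * h k i + ∑ l, X l * t k l i))))
      - 4 * ((2 * Z' * X i) * (p i * r) + Z * (h i i * r + p i * V i))
      + 2 * ((2 * Z' * X i) * (X i * c) + Z * (c + X i * ∑ k, (2 * (p k * h k i))))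
      + 4 * ((2 * Z'' * X i) * (X i * (r * r)) + Z' * (r * r + X i * (2 * (r * V i)))))
    = (((n - 2) * Z + 2 * q * Z') * D - 8 * Z' * a - 8 * Z' * r) * (X i * p i)
      + (M * D - 4 * Z * a - 4 * Z * r) * h i i
      + M * (p i * ∑ k, t k k i)
      + (-((n - 2) * Z + 2 * q * Z')) * (X i * ∑ k, p k * h k i)
      + (-M) * (∑ k, h k i * h k i) + (-M) * (∑ k, p k * t k i i)
      + (-8 * Z) * (p i * V i)
      + (-4 * Z) * (p i * ∑ k, X k * (2 * h k i + ∑ l, X l * t k l i))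
      + (8 * Z' * b + 4 * Z' * c + 8 * Z'' * (r * r)) * (X i * X i)
      + (4 * Z * b + 2 * Z * c + 4 * Z' * (r * r))
      + (4 * Z) * (X i * ∑ k, h k i * V k)
      + (4 * Z) * (X i * ∑ k, p k * (2 * h k i + ∑ l, X l * t k l i))
      + (2 * Z) * (X i * ∑ k, 2 * (p k * h k i))
      + (8 * Z' * r) * (X i * V i) := fun i => by
    rw [sum_add_distrib (f := fun k => h k i * h k i), sum_add_distrib (f := fun k => h k i * V k)]
    ring
  rw [sum_congr rfl fun i _ => key i]
  simp only [sum_add_distrib, ← mul_sum]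
  have s9 : ∑ i, X i * (2 * ∑ k, p k * h k i) = 2 * (b - c) := by
    simpa only [mul_sum] using s8
  rw [s1, s2, s3, s4, s5, s6, s9, er, eD, eX]
  simp only [variationForm, monotonicityForm, s7, ← hD, ← hr, ← hV, ← hq, Real.inner_apply,
    sum_const, card_univ, Fintype.card_fin, nsmul_eq_mul, ← hb, ← hc]
  rw [sum_comm (f := fun i j => h j i * h j i)]
  ring

end QuadraticForms

theorem hasDerivAt_line {f : E n → ℝ} (hf : ContDiff ℝ ∞ f) (x v : E n) :
    HasDerivAt (fun s : ℝ => f (x + s • v)) (∇ f x v) 0 := by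
  have h := ((hf.differentiable (by simp)) x).hasFDerivAt.hasLineDerivAt v
  exact h

theorem fderiv_apply_comm {f : E n → ℝ} (hf : ContDiff ℝ ∞ f) (x v w : E n) :
    ∇ (fun y => ∇ f y v) x w = ∇ (fun y => ∇ f y w) x v := by
  have hd : DifferentiableAt ℝ (∇ f) x :=
    ((hf.fderiv_right (m := ∞) (by simp)).differentiable (by simp)) x
  have key : ∀ v w : E n, ∇ (fun y => ∇ f y v) x w = ∇ (∇ f) x w v := fun v w => by
    rw [fderiv_clm_apply hd (differentiableAt_const v)]
    simp
  rw [key, key]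
  refine (hf.contDiffAt.isSymmSndFDerivAt ?_) w v
  rw [minSmoothness_of_isRCLikeNormedField]
  exact WithTop.coe_le_coe.2 le_top

/-- `|x - z|²` in coordinates. -/
def sqDist (z x : E n) : ℝ := ∑ k, (x k - z k) ^ 2

theorem sqDist_eq (z x : E n) : sqDist z x = ‖x - z‖ ^ 2 := by
  rw [EuclideanSpace.real_norm_sq_eq]; rfl

theorem contDiff_sqDist (z : E n) : ContDiff ℝ ∞ (sqDist z) := by
  unfold sqDist
  refine ContDiff.sum fun k _ => ContDiff.pow (ContDiff.sub ?_ contDiff_const) 2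
  exact contDiff_euclidean.1 contDiff_id k

theorem integral_variationForm_scalar {Z M : ℝ → ℝ} (hZ : ContDiff ℝ ∞ Z) (hMs : ContDiff ℝ ∞ M)
    (hM : ∀ q, deriv M q = ((n - 2) * Z q + 2 * q * deriv Z q) / 2) (z : E n) {v : E n → ℝ}
    (hv : ContDiff ℝ ∞ v) (hc : HasCompactSupport v) :
    ∃ Φ : E n → ℝ, Integrable Φ ∧ ∫ x, Φ x = 0 ∧ ∀ x,
      variationForm (M (sqDist z x)) (Z (sqDist z x)) (deriv Z (sqDist z x))
        (fun k => x k - z k) (fun i => ∇ v x (e i))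
        (fun i j => ∇ (fun y => ∇ v y (e i)) x (e j))
      - monotonicityForm (M (sqDist z x)) (Z (sqDist z x)) (deriv Z (sqDist z x))
        (deriv (deriv Z) (sqDist z x))
        (fun k => x k - z k) (fun i => ∇ v x (e i))
        (fun i j => ∇ (fun y => ∇ v y (e i)) x (e j)) = Φ x := by
  set p : Fin n → E n → ℝ := fun i x => ∇ v x (e i) with hp
  set h : Fin n → Fin n → E n → ℝ := fun i j x => ∇ (p i) x (e j)
  set t : Fin n → Fin n → Fin n → E n → ℝ := fun i j k x => ∇ (h i j) x (e k) with ht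
  set Q := sqDist z
  set X : Fin n → E n → ℝ := fun k x => x k - z k with hX
  have hZ' : ContDiff ℝ ∞ (deriv Z) := (contDiff_infty_iff_deriv.1 hZ).2
  have cp : ∀ i, ContDiff ℝ ∞ (p i) := fun i => contDiff_fderiv_apply hv _
  have ch : ∀ i j, ContDiff ℝ ∞ (h i j) := fun i j => contDiff_fderiv_apply (cp i) _
  have cQ : ContDiff ℝ ∞ Q := contDiff_sqDist z
  have cX : ∀ k, ContDiff ℝ ∞ (X k) := fun k =>
    (contDiff_euclidean.1 contDiff_id k).sub contDiff_const
  have hsymm : ∀ i j x, h i j x = h j i x := fun i j x => fderiv_apply_comm hv x _ _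
  have tsymm : ∀ i j k x, t i j k x = t j i k x := fun i j k x => by
    have : h i j = h j i := funext (hsymm i j)
    simp only [ht, this]
  have tsymm' : ∀ i j k x, t i j k x = t i k j x := fun i j k x => fderiv_apply_comm (cp i) x _ _
  set D : E n → ℝ := fun y => ∑ i, h i i y
  set r : E n → ℝ := fun y => ∑ k, X k y * p k y with hr
  set V : Fin n → E n → ℝ := fun j y => p j y + ∑ k, X k y * h j k y with hV
  have cD : ContDiff ℝ ∞ D := ContDiff.sum fun i _ => ch i i
  have cr : ContDiff ℝ ∞ r := ContDiff.sum fun i _ => (cX i).mul (cp i)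
  have cV : ∀ j, ContDiff ℝ ∞ (V j) := fun j =>
    (cp j).add (ContDiff.sum fun i _ => (cX i).mul (ch j i))
  let G : Fin n → E n → ℝ := fun i y => M (Q y) * (p i y * D y) - M (Q y) * (∑ k, p k y * h k i y)
      - 4 * (Z (Q y) * (p i y * ∑ k, X k y * V k y))
      + 4 * (Z (Q y) * (X i y * ∑ k, p k y * V k y))
      - 4 * (Z (Q y) * (p i y * r y))
      + 2 * (Z (Q y) * (X i y * ∑ k, p k y * p k y))
      + 4 * (deriv Z (Q y) * (X i y * (r y * r y)))
  have cG : ∀ i, ContDiff ℝ ∞ (G i) := fun i => by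
    have a1 := hMs.comp cQ
    have a2 := hZ.comp cQ
    have a3 := hZ'.comp cQ
    have a4 : ContDiff ℝ ∞ fun y => ∑ k, X k y * V k y := ContDiff.sum fun k _ => (cX k).mul (cV k)
    have a5 : ContDiff ℝ ∞ fun y => ∑ k, p k y * V k y := ContDiff.sum fun k _ => (cp k).mul (cV k)
    have a6 : ContDiff ℝ ∞ fun y => ∑ k, p k y * p k y := ContDiff.sum fun k _ => (cp k).mul (cp k)
    have a7 : ContDiff ℝ ∞ fun y => ∑ k, p k y * h k i y :=
      ContDiff.sum fun k _ => (cp k).mul (ch k i)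
    exact ((((((a1.mul ((cp i).mul cD)).sub (a1.mul a7)).sub
      (contDiff_const.mul (a2.mul ((cp i).mul a4)))).add
      (contDiff_const.mul (a2.mul ((cX i).mul a5)))).sub
      (contDiff_const.mul (a2.mul ((cp i).mul cr)))).add
      (contDiff_const.mul (a2.mul ((cX i).mul a6)))).add
      (contDiff_const.mul (a3.mul ((cX i).mul (cr.mul cr))))
  have sG : ∀ i, HasCompactSupport (G i) := fun i => by
    refine hc.mono' fun x hx => ?_
    by_contra h0
    refine hx ?_
    have e0 : ∀ k, p k x = 0 := fun k => by
      simp [hp, fderiv_of_notMem_tsupport (𝕜 := ℝ) h0]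
    simp [G, hr, e0]
  have dX : ∀ i k x, HasDerivAt (fun s : ℝ => X k (x + s • (e i : E n)))
      (if k = i then 1 else 0) 0 := fun i k x => by
    have h1 : (fun s : ℝ => X k (x + s • (e i : E n)))
        = fun s => s * (if k = i then 1 else 0) + (x k - z k) := by
      funext s; simp [hX, e]; ring
    rw [h1]
    simpa using ((hasDerivAt_id (0 : ℝ)).mul_const (if k = i then (1 : ℝ) else 0)).add_const
      (x k - z k)
  have dp : ∀ i k x, HasDerivAt (fun s : ℝ => p k (x + s • (e i : E n))) (h k i x) 0 :=
    fun i k x => hasDerivAt_line (cp k) x _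
  have dh : ∀ i j k x, HasDerivAt (fun s : ℝ => h j k (x + s • (e i : E n))) (t j k i x) 0 :=
    fun i j k x => hasDerivAt_line (ch j k) x _
  have dr : ∀ i x, HasDerivAt (fun s : ℝ => r (x + s • (e i : E n))) (V i x) 0 := fun i x => by
    refine (HasDerivAt.fun_sum fun k (_ : k ∈ Finset.univ) => (dX i k x).mul (dp i k x)).congr_deriv ?_
    simp [sum_add_distrib, hV, hsymm]
  have dV : ∀ i k x, HasDerivAt (fun s : ℝ => V k (x + s • (e i : E n)))
      (2 * h k i x + ∑ l, X l x * t k l i x) 0 := fun i k x => by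
    refine ((dp i k x).add (HasDerivAt.fun_sum fun l (_ : l ∈ Finset.univ) =>
      (dX i l x).mul (dh i k l x))).congr_deriv ?_
    simp [sum_add_distrib]; ring
  have dQ : ∀ i x, HasDerivAt (fun s : ℝ => Q (x + s • (e i : E n))) (2 * X i x) 0 := fun i x => by
    refine (HasDerivAt.fun_sum fun k (_ : k ∈ Finset.univ) => (dX i k x).pow 2).congr_deriv ?_
    simp [hX]
  have dcoef : ∀ (f : ℝ → ℝ), ContDiff ℝ ∞ f → ∀ i x,
      HasDerivAt (fun s : ℝ => f (Q (x + s • (e i : E n)))) (deriv f (Q x) * (2 * X i x)) 0 :=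
    fun f hf i x => by
      have h1 : HasDerivAt f (deriv f (Q x)) (Q (x + (0 : ℝ) • (e i : E n))) := by
        simpa using ((hf.differentiable (by simp)) (Q x)).hasDerivAt
      exact h1.comp 0 (dQ i x)
  have dD : ∀ i x, HasDerivAt (fun s : ℝ => D (x + s • (e i : E n))) (∑ k, t k k i x) 0 :=
    fun i x => HasDerivAt.fun_sum fun k _ => dh i k k x
  have hint : ∀ i, Integrable fun x => ∇ (G i) x (e i) := fun i =>
    (((cG i).continuous_fderiv (by simp)).clm_apply
      continuous_const).integrable_of_hasCompactSupport ((sG i).fderiv_apply (𝕜 := ℝ) (e i))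
  refine ⟨fun x => ∑ i, ∇ (G i) x (e i), integrable_finsetSum _ fun i _ => hint i, ?_, fun x => ?_⟩
  · rw [integral_finsetSum _ fun i _ => hint i]
    exact Finset.sum_eq_zero fun i _ =>
      integral_fderiv_apply_eq_zero ((cG i).of_le (by simp)) (sG i) _
  refine (divergence_identity (M (Q x)) (Z (Q x)) (deriv Z (Q x)) (deriv (deriv Z) (Q x))
    (fun k => X k x) (fun i => p i x) (fun i j => h i j x) (fun i j k => t i j k x)
    (fun i j => hsymm i j x) (fun i j k => tsymm i j k x)
    (fun i j k => tsymm' i j k x)).symm.trans ?_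
  refine sum_congr rfl fun i _ => ?_
  have b1 := dcoef M hMs i x
  have b2 := dcoef Z hZ i x
  have b3 := dcoef _ hZ' i x
  have b4 := HasDerivAt.fun_sum fun k (_ : k ∈ Finset.univ) => (dX i k x).mul (dV i k x)
  have b5 := HasDerivAt.fun_sum fun k (_ : k ∈ Finset.univ) => (dp i k x).mul (dV i k x)
  have b6 := HasDerivAt.fun_sum fun k (_ : k ∈ Finset.univ) => (dp i k x).mul (dp i k x)
  have b7 := HasDerivAt.fun_sum fun k (_ : k ∈ Finset.univ) => (dp i k x).mul (dh i k i x)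
  have d1 := ((((((b1.mul ((dp i i x).mul (dD i x))).sub (b1.mul b7)).sub
    ((b2.mul ((dp i i x).mul b4)).const_mul 4)).add
    ((b2.mul ((dX i i x).mul b5)).const_mul 4)).sub
    ((b2.mul ((dp i i x).mul (dr i x))).const_mul 4)).add
    ((b2.mul ((dX i i x).mul b6)).const_mul 2)).add
    ((b3.mul ((dX i i x).mul ((dr i x).mul (dr i x)))).const_mul 4)
  have dG := (hasDerivAt_line (cG i) x (e i)).unique d1
  rw [dG]
  have q0 : ∑ k, X k x ^ 2 = Q x := rfl
  have r0 : radP (fun k => X k x) (fun i => p i x) = r x := rfl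
  have V0 : radV (fun k => X k x) (fun i => p i x) (fun i j => h i j x) = fun j => V j x := rfl
  have D0 : lapH (fun i j => h i j x) = D x := rfl
  simp only [Pi.mul_apply, q0, r0, V0, D0, hM, zero_smul, add_zero, if_true]
  simp only [sum_add_distrib, ite_mul, one_mul, zero_mul, Finset.sum_ite_eq',
    Finset.mem_univ, if_true, mul_comm (h _ _ x) (p _ x), two_mul (_ : ℝ)]
  ring

section LimitCalculus

variable {K : Set (E n)}

/-- Convergence in `L²(K)`. -/
structure TendstoLTwo (K : Set (E n)) (a : ℕ → E n → E L) (f : E n → E L) : Prop where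
  memLp : ∀ m, MemLp (a m) 2 (volume.restrict K)
  memLp_lim : MemLp f 2 (volume.restrict K)
  tendsto : Tendsto (fun m => eLpNorm (fun x => a m x - f x) 2 (volume.restrict K)) atTop (𝓝 0)

/-- Convergence of the integrals over `K` of integrable functions. -/
structure TendstoIntegral (K : Set (E n)) (G : ℕ → E n → ℝ) (g : E n → ℝ) : Prop where
  integrable : ∀ m, IntegrableOn (G m) K
  integrable_lim : IntegrableOn g K
  tendsto : Tendsto (fun m => ∫ x in K, G m x) atTop (𝓝 (∫ x in K, g x))

theorem TendstoLTwo.add {a b : ℕ → E n → E L} {f g : E n → E L} (h1 : TendstoLTwo K a f)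
    (h2 : TendstoLTwo K b g) : TendstoLTwo K (fun m x => a m x + b m x) fun x => f x + g x where
  memLp m := (h1.memLp m).add (h2.memLp m)
  memLp_lim := h1.memLp_lim.add h2.memLp_lim
  tendsto := by
    have h := h1.tendsto.add h2.tendsto
    rw [add_zero] at h
    refine tendsto_of_tendsto_of_tendsto_of_le_of_le tendsto_const_nhds h (fun _ => zero_le)
      fun m => ?_
    refine le_trans (le_of_eq ?_) (eLpNorm_add_le ((h1.memLp m).sub h1.memLp_lim).1
      ((h2.memLp m).sub h2.memLp_lim).1 (by norm_num))
    congr 1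
    funext x
    simp only [Pi.add_apply]
    abel

theorem TendstoLTwo.sum {ι : Type*} (s : Finset ι) {a : ι → ℕ → E n → E L} {f : ι → E n → E L}
    (h : ∀ i ∈ s, TendstoLTwo K (a i) (f i)) :
    TendstoLTwo K (fun m x => ∑ i ∈ s, a i m x) fun x => ∑ i ∈ s, f i x := by
  classical
  induction s using Finset.induction_on with
  | empty =>
    simp only [sum_empty]
    exact ⟨fun _ => MemLp.zero', MemLp.zero', by simp⟩
  | insert i s hi ih =>
    simp only [sum_insert hi]
    exact (h i (Finset.mem_insert_self i s)).add (ih fun k hk => h k (Finset.mem_insert_of_mem hk))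

theorem TendstoLTwo.smul (hK : IsCompact K) {a : ℕ → E n → E L} {f : E n → E L}
    (h : TendstoLTwo K a f) {c : E n → ℝ} (hc : Continuous c) :
    TendstoLTwo K (fun m x => c x • a m x) fun x => c x • f x := by
  obtain ⟨C, hC⟩ := hK.exists_bound_of_continuousOn hc.continuousOn
  have hC' : ∀ᵐ x ∂(volume.restrict K), ‖c x‖ ≤ C :=
    (ae_restrict_iff' hK.measurableSet).2 (Eventually.of_forall hC)
  have key : ∀ g : E n → E L, MemLp g 2 (volume.restrict K) →
      MemLp (fun x => c x • g x) 2 (volume.restrict K) := fun g hg => by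
    refine MemLp.of_le_mul hg (hc.aestronglyMeasurable.smul hg.1) (c := C) ?_
    filter_upwards [hC'] with x hx
    rw [norm_smul]
    exact mul_le_mul_of_nonneg_right hx (norm_nonneg _)
  refine ⟨fun m => key _ (h.memLp m), key _ h.memLp_lim, ?_⟩
  have h1 := ENNReal.Tendsto.const_mul h.tendsto (a := ofReal C) (Or.inr ofReal_ne_top)
  rw [mul_zero] at h1
  refine tendsto_of_tendsto_of_tendsto_of_le_of_le tendsto_const_nhds h1 (fun _ => zero_le)
    fun m => ?_
  refine eLpNorm_le_mul_eLpNorm_of_ae_le_mul ?_ 2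
  filter_upwards [hC'] with x hx
  rw [← smul_sub, norm_smul]
  exact mul_le_mul_of_nonneg_right hx (norm_nonneg _)

theorem TendstoLTwo.integral_inner {a b : ℕ → E n → E L} {f g : E n → E L} (h1 : TendstoLTwo K a f)
    (h2 : TendstoLTwo K b g) :
    TendstoIntegral K (fun m x => inner ℝ (a m x) (b m x)) fun x => inner ℝ (f x) (g x) where
  integrable m := integrable_inner_of_memLp (h1.memLp m) (h2.memLp m)
  integrable_lim := integrable_inner_of_memLp h1.memLp_lim h2.memLp_lim
  tendsto := by
    have t1 := (Lp.tendsto_Lp_iff_tendsto_eLpNorm'' a h1.memLp f h1.memLp_lim).2 h1.tendsto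
    have t2 := (Lp.tendsto_Lp_iff_tendsto_eLpNorm'' b h2.memLp g h2.memLp_lim).2 h2.tendsto
    have key : ∀ (u v : E n → E L) (hu : MemLp u 2 (volume.restrict K))
        (hv : MemLp v 2 (volume.restrict K)),
        inner ℝ (hu.toLp u) (hv.toLp v) = ∫ x in K, inner ℝ (u x) (v x) := fun u v hu hv => by
      rw [L2.inner_def]
      refine integral_congr_ae ?_
      filter_upwards [hu.coeFn_toLp, hv.coeFn_toLp] with x e1 e2
      rw [e1, e2]
    have t3 := t1.inner (𝕜 := ℝ) t2
    simpa only [key] using t3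

theorem TendstoIntegral.add {G H : ℕ → E n → ℝ} {g h : E n → ℝ} (h1 : TendstoIntegral K G g)
    (h2 : TendstoIntegral K H h) :
    TendstoIntegral K (fun m x => G m x + H m x) fun x => g x + h x where
  integrable m := (h1.integrable m).add (h2.integrable m)
  integrable_lim := h1.integrable_lim.add h2.integrable_lim
  tendsto := by
    have e1 := fun m => integral_add (h1.integrable m) (h2.integrable m)
    have e2 := integral_add h1.integrable_lim h2.integrable_lim
    simp only [e1, e2]
    exact h1.tendsto.add h2.tendsto

theorem TendstoIntegral.sub {G H : ℕ → E n → ℝ} {g h : E n → ℝ} (h1 : TendstoIntegral K G g)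
    (h2 : TendstoIntegral K H h) :
    TendstoIntegral K (fun m x => G m x - H m x) fun x => g x - h x where
  integrable m := (h1.integrable m).sub (h2.integrable m)
  integrable_lim := h1.integrable_lim.sub h2.integrable_lim
  tendsto := by
    have e1 := fun m => integral_sub (h1.integrable m) (h2.integrable m)
    have e2 := integral_sub h1.integrable_lim h2.integrable_lim
    simp only [e1, e2]
    exact h1.tendsto.sub h2.tendsto

theorem TendstoIntegral.sum {ι : Type*} (s : Finset ι) {G : ι → ℕ → E n → ℝ} {g : ι → E n → ℝ}
    (h : ∀ i ∈ s, TendstoIntegral K (G i) (g i)) :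
    TendstoIntegral K (fun m x => ∑ i ∈ s, G i m x) fun x => ∑ i ∈ s, g i x := by
  classical
  induction s using Finset.induction_on with
  | empty =>
    simp only [sum_empty]
    exact ⟨fun _ => integrableOn_zero, integrableOn_zero, by simp⟩
  | insert i s hi ih =>
    simp only [sum_insert hi]
    exact (h i (Finset.mem_insert_self i s)).add (ih fun k hk => h k (Finset.mem_insert_of_mem hk))

theorem TendstoLTwo.mul_inner (hK : IsCompact K) {a b : ℕ → E n → E L} {f g : E n → E L}
    (h1 : TendstoLTwo K a f) (h2 : TendstoLTwo K b g) {c : E n → ℝ} (hc : Continuous c) :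
    TendstoIntegral K (fun m x => c x * inner ℝ (a m x) (b m x))
      fun x => c x * inner ℝ (f x) (g x) := by
  simpa only [inner_smul_left, RCLike.conj_to_real] using (h1.smul hK hc).integral_inner h2

theorem TendstoLTwo.mul_sum_inner {ι : Type*} [Fintype ι] (hK : IsCompact K)
    {a b : ι → ℕ → E n → E L} {f g : ι → E n → E L}
    (h1 : ∀ i, TendstoLTwo K (a i) (f i)) (h2 : ∀ i, TendstoLTwo K (b i) (g i)) {c : E n → ℝ}
    (hc : Continuous c) :
    TendstoIntegral K (fun m x => c x * ∑ i, inner ℝ (a i m x) (b i m x))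
      fun x => c x * ∑ i, inner ℝ (f i x) (g i x) := by
  simp only [mul_sum]
  exact TendstoIntegral.sum _ fun i _ => (h1 i).mul_inner hK (h2 i) hc

end LimitCalculus

theorem variationForm_eq_sum (M Z Z' : ℝ) (X : Fin n → ℝ) (p : Fin n → E L)
    (h : Fin n → Fin n → E L) : variationForm M Z Z' X p h
      = ∑ c, variationForm M Z Z' X (fun i => p i c) (fun i j => h i j c) := by
  simp only [variationForm, sum_sub_distrib, ← mul_sum, PiLp.inner_apply]
  simp [lapH, radH, radP]

theorem monotonicityForm_eq_sum (M Z Z' Z'' : ℝ) (X : Fin n → ℝ) (p : Fin n → E L)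
    (h : Fin n → Fin n → E L) : monotonicityForm M Z Z' Z'' X p h
      = ∑ c, monotonicityForm M Z Z' Z'' X (fun i => p i c) (fun i j => h i j c) := by
  have e1 : ∀ f : Fin n → Fin L → ℝ, ∑ c, ∑ i, f i c = ∑ i, ∑ c, f i c := fun f => sum_comm
  simp only [monotonicityForm, sum_sub_distrib, ← mul_sum, PiLp.inner_apply, sum_add_distrib, e1]
  simp [lapH, radV, radP]

theorem tendstoIntegral_forms {K : Set (E n)} (hK : IsCompact K) {Z M : ℝ → ℝ}
    (hZ : ContDiff ℝ ∞ Z) (hMs : ContDiff ℝ ∞ M) (z : E n) {p' : ℕ → Grad n L}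
    {h' : ℕ → Hess n L} {p : Grad n L} {h : Hess n L}
    (hp : ∀ i, TendstoLTwo K (fun m => p' m i) (p i))
    (hh : ∀ i j, TendstoLTwo K (fun m => h' m i j) (h i j)) :
    TendstoIntegral K (fun m x => variationForm (M (sqDist z x)) (Z (sqDist z x))
        (deriv Z (sqDist z x)) (fun k => x k - z k) (fun i => p' m i x) (fun i j => h' m i j x))
      (fun x => variationForm (M (sqDist z x)) (Z (sqDist z x))
        (deriv Z (sqDist z x)) (fun k => x k - z k) (fun i => p i x) (fun i j => h i j x)) ∧
    TendstoIntegral K (fun m x => monotonicityForm (M (sqDist z x)) (Z (sqDist z x))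
        (deriv Z (sqDist z x)) (deriv (deriv Z) (sqDist z x))
        (fun k => x k - z k) (fun i => p' m i x) (fun i j => h' m i j x))
      (fun x => monotonicityForm (M (sqDist z x)) (Z (sqDist z x))
        (deriv Z (sqDist z x)) (deriv (deriv Z) (sqDist z x))
        (fun k => x k - z k) (fun i => p i x) (fun i j => h i j x)) := by
  have hZ' : ContDiff ℝ ∞ (deriv Z) := (contDiff_infty_iff_deriv.1 hZ).2
  have hZ'' : ContDiff ℝ ∞ (deriv (deriv Z)) := (contDiff_infty_iff_deriv.1 hZ').2
  have cQ := (contDiff_sqDist z).continuous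
  have c1 : Continuous fun x => M (sqDist z x) := hMs.continuous.comp cQ
  have c2 : Continuous fun x => Z (sqDist z x) := hZ.continuous.comp cQ
  have c3 : Continuous fun x => deriv Z (sqDist z x) := hZ'.continuous.comp cQ
  have c4 : Continuous fun x => deriv (deriv Z) (sqDist z x) := hZ''.continuous.comp cQ
  have cX : ∀ k, Continuous fun x : E n => x k - z k := fun k => by fun_prop
  have cq : Continuous fun x : E n => ∑ k, (x k - z k) ^ 2 := cQ
  have tD : TendstoLTwo K (fun m x => lapH fun i j => h' m i j x) fun x => lapH fun i j => h i j x :=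
    TendstoLTwo.sum _ fun i _ => hh i i
  have tr : TendstoLTwo K (fun m x => radP (fun k => x k - z k) fun i => p' m i x)
      fun x => radP (fun k => x k - z k) fun i => p i x :=
    TendstoLTwo.sum _ fun i _ => (hp i).smul hK (cX i)
  have tH : TendstoLTwo K (fun m x => radH (fun k => x k - z k) fun i j => h' m i j x)
      fun x => radH (fun k => x k - z k) fun i j => h i j x :=
    TendstoLTwo.sum _ fun i _ => TendstoLTwo.sum _ fun j _ => (hh i j).smul hK ((cX i).mul (cX j))
  have tV : ∀ j, TendstoLTwo K
      (fun m x => radV (fun k => x k - z k) (fun i => p' m i x) (fun i j => h' m i j x) j)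
      fun x => radV (fun k => x k - z k) (fun i => p i x) (fun i j => h i j x) j := fun j =>
    (hp j).add (TendstoLTwo.sum _ fun i _ => (hh j i).smul hK (cX i))
  constructor
  · exact ((tD.mul_inner hK tD c1).sub (tD.mul_inner hK tH (continuous_const.mul c2))).sub
      (tD.mul_inner hK tr (((continuous_const.mul cq).mul c3).add (continuous_const.mul c2)))
  · have u1 := TendstoIntegral.sum Finset.univ fun i _ =>
      TendstoLTwo.mul_sum_inner hK (hh i) (hh i) c1
    simp only [← mul_sum] at u1
    have c5 : Continuous fun x => 3 * ((n - 2) * Z (sqDist z x)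
        + 2 * (∑ k, (x k - z k) ^ 2) * deriv Z (sqDist z x)) :=
      continuous_const.mul ((continuous_const.mul c2).add ((continuous_const.mul cq).mul c3))
    have u2 := ((tD.mul_inner hK tr c5).add (TendstoLTwo.mul_sum_inner hK hp tV c5)).add
      (TendstoLTwo.mul_sum_inner hK hp hp c5)
    simp only [← mul_add] at u2
    exact ((u1.sub (TendstoLTwo.mul_sum_inner hK tV tV (continuous_const.mul c2))).sub
      (tr.mul_inner hK tr ((continuous_const.mul c3).add
        ((continuous_const.mul cq).mul c4)))).sub u2

theorem SobolevTwo.exists_tendstoLTwo {O K : Set (E n)} (hO : IsOpen O) (hK : IsCompact K)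
    (hKO : K ⊆ O) {w : E n → E L} {p : Grad n L} {h : Hess n L}
    (S : SobolevTwo O w p h) :
    ∃ v : ℕ → E n → E L, (∀ m, ContDiff ℝ ∞ (v m)) ∧ (∀ m, HasCompactSupport (v m)) ∧
      TendstoLTwo K v w ∧
      (∀ i, TendstoLTwo K (fun m x => ∇ (v m) x (e i)) (p i)) ∧
      ∀ i j, TendstoLTwo K (fun m x => ∇ (fun y => ∇ (v m) y (e i)) x (e j)) (h i j) := by
  obtain ⟨v, v1, v2, v3, v4, v5⟩ := S.exists_smooth_approx hO hK hKO
  have key : ∀ f : E n → E L, ContDiff ℝ ∞ f → MemLp f 2 (volume.restrict K) := fun f hf => by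
    obtain ⟨C, hC⟩ := hK.exists_bound_of_continuousOn hf.continuous.continuousOn
    have : IsFiniteMeasure (volume.restrict K) := ⟨by simpa using hK.measure_lt_top⟩
    exact MemLp.of_bound hf.continuous.aestronglyMeasurable C
      ((ae_restrict_iff' hK.measurableSet).2 (Eventually.of_forall hC))
  have le := Measure.restrict_mono hKO (le_rfl : (volume : Measure (E n)) ≤ volume)
  refine ⟨v, v1, v2, ⟨fun m => key _ (v1 m), S.memLp.mono_measure le, v3⟩, fun i => ⟨fun m =>
    key _ (contDiff_fderiv_apply (v1 m) _), (S.memLp_grad i).mono_measure le, v4 i⟩,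
    fun i j => ⟨fun m => key _ (contDiff_fderiv_apply (contDiff_fderiv_apply (v1 m) _) _),
    (S.memLp_hess i j).mono_measure le, v5 i j⟩⟩

theorem SobolevTwo.integral_forms_eq {O : Set (E n)} (hO : IsOpen O) {w : E n → E L}
    {p : Grad n L} {h : Hess n L} (S : SobolevTwo O w p h) {Z M : ℝ → ℝ}
    (hZ : ContDiff ℝ ∞ Z) (hMs : ContDiff ℝ ∞ M)
    (hM : ∀ q, deriv M q = ((n - 2) * Z q + 2 * q * deriv Z q) / 2) {z : E n} {ρ : ℝ} (hρ : 0 < ρ)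
    (hz : closedBall z ρ ⊆ O) (hZ0 : ∀ q, ρ ^ 2 < q → Z q = 0)
    (hM0 : ∀ q, ρ ^ 2 < q → M q = 0) :
    IntegrableOn (fun x => monotonicityForm (M (sqDist z x)) (Z (sqDist z x))
        (deriv Z (sqDist z x)) (deriv (deriv Z) (sqDist z x))
        (fun k => x k - z k) (fun i => p i x) (fun i j => h i j x)) (closedBall z ρ) ∧
    ∫ x in closedBall z ρ, variationForm (M (sqDist z x)) (Z (sqDist z x))
        (deriv Z (sqDist z x)) (fun k => x k - z k) (fun i => p i x) (fun i j => h i j x)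
      = ∫ x in closedBall z ρ, monotonicityForm (M (sqDist z x)) (Z (sqDist z x))
        (deriv Z (sqDist z x)) (deriv (deriv Z) (sqDist z x))
        (fun k => x k - z k) (fun i => p i x) (fun i j => h i j x) := by
  set K := closedBall z ρ with hKd
  have hK : IsCompact K := isCompact_closedBall z ρ
  obtain ⟨v, v1, v2, -, v4, v5⟩ := S.exists_tendstoLTwo hO hK hz
  obtain ⟨t1, t2⟩ := tendstoIntegral_forms hK hZ hMs z v4 v5
  refine ⟨t2.integrable_lim, tendsto_nhds_unique t1.tendsto (t2.tendsto.congr fun m => ?_)⟩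
  have z1 : ∀ q, ρ ^ 2 < q → deriv Z q = 0 := fun q hq => by
    have : Z =ᶠ[𝓝 q] fun _ => 0 := by
      filter_upwards [isOpen_Ioi.mem_nhds hq] with s hs using hZ0 s hs
    rw [this.deriv_eq]; simp
  have z2 : ∀ q, ρ ^ 2 < q → deriv (deriv Z) q = 0 := fun q hq => by
    have : deriv Z =ᶠ[𝓝 q] fun _ => 0 := by
      filter_upwards [isOpen_Ioi.mem_nhds hq] with s hs using z1 s hs
    rw [this.deriv_eq]; simp
  have hq : ∀ x ∉ K, ρ ^ 2 < sqDist z x := fun x hx => by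
    rw [sqDist_eq]
    rw [hKd, mem_closedBall, dist_eq_norm, not_le] at hx
    exact pow_lt_pow_left₀ hx hρ.le (by norm_num)
  have hcomp : ∀ (f : E n → E L), ContDiff ℝ ∞ f → ∀ x u c,
      (∇ f x u) c = ∇ (fun y => f y c) x u := fun f hf x u c => by
    have h1 := (EuclideanSpace.proj (𝕜 := ℝ) c : E L →L[ℝ] ℝ).hasFDerivAt.comp x
      ((hf.differentiable (by simp)) x).hasFDerivAt
    exact (congrArg (fun A : E n →L[ℝ] ℝ => A u) h1.fderiv).symm
  have vc : ∀ c, ContDiff ℝ ∞ fun y => v m y c := fun c => contDiff_euclidean.1 (v1 m) c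
  have vs : ∀ c, HasCompactSupport fun y => v m y c := fun c =>
    (v2 m).comp_left (g := fun y : E L => y c) rfl
  choose Φ Φ1 Φ2 Φ3 using fun c => integral_variationForm_scalar hZ hMs hM z (vc c) (vs c)
  symm
  rw [← sub_eq_zero, ← integral_sub (t1.integrable m) (t2.integrable m),
    setIntegral_eq_integral_of_forall_compl_eq_zero fun x hx => by
      simp [variationForm, monotonicityForm, hZ0 _ (hq x hx), hM0 _ (hq x hx), z1 _ (hq x hx),
        z2 _ (hq x hx)]]
  have hΦ : ∀ x, variationForm (M (sqDist z x)) (Z (sqDist z x)) (deriv Z (sqDist z x))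
        (fun k => x k - z k) (fun i => ∇ (v m) x (e i))
        (fun i j => ∇ (fun y => ∇ (v m) y (e i)) x (e j))
      - monotonicityForm (M (sqDist z x)) (Z (sqDist z x)) (deriv Z (sqDist z x))
        (deriv (deriv Z) (sqDist z x)) (fun k => x k - z k) (fun i => ∇ (v m) x (e i))
        (fun i j => ∇ (fun y => ∇ (v m) y (e i)) x (e j)) = ∑ c, Φ c x := fun x => by
    rw [variationForm_eq_sum, monotonicityForm_eq_sum, ← sum_sub_distrib]
    refine sum_congr rfl fun c _ => ?_
    rw [← Φ3]
    simp only [hcomp _ (v1 m), hcomp _ (contDiff_fderiv_apply (v1 m) _)]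
  simp only [hΦ]
  rw [integral_finsetSum _ fun c _ => Φ1 c]
  exact Finset.sum_eq_zero fun c _ => Φ2 c

section RadialVariation

theorem hasFDerivAt_coord_sub (z : E n) (k : Fin n) (x : E n) :
    HasFDerivAt (fun y : E n => y k - z k) (EuclideanSpace.proj (𝕜 := ℝ) k : E n →L[ℝ] ℝ) x :=
  (EuclideanSpace.proj (𝕜 := ℝ) k : E n →L[ℝ] ℝ).hasFDerivAt.sub_const _

theorem fderiv_coord_sub (z : E n) (k i : Fin n) (x : E n) :
    ∇ (fun y : E n => y k - z k) x (e i) = if k = i then 1 else 0 := by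
  rw [(hasFDerivAt_coord_sub z k x).fderiv]
  simp [e]

theorem fderiv_comp_sqDist_of_hasDerivAt {f : ℝ → ℝ} {a : ℝ} {z x : E n}
    (hf : HasDerivAt f a (sqDist z x)) (i : Fin n) :
    ∇ (fun y => f (sqDist z y)) x (e i) = a * (2 * (x i - z i)) := by
  have h1 : HasFDerivAt (sqDist z)
      (∑ k, (2 • (x k - z k) ^ (2 - 1)) • (EuclideanSpace.proj (𝕜 := ℝ) k : E n →L[ℝ] ℝ)) x := by
    unfold sqDist
    exact HasFDerivAt.fun_sum fun k _ => (hasFDerivAt_coord_sub z k x).pow 2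
  have h3 : ∇ (fun y => f (sqDist z y)) x = _ := (hf.comp_hasFDerivAt x h1).fderiv
  rw [h3]
  simp [e]

theorem fderiv_comp_sqDist {f : ℝ → ℝ} (hf : ContDiff ℝ ∞ f) (z x : E n) (i : Fin n) :
    ∇ (fun y => f (sqDist z y)) x (e i) = deriv f (sqDist z x) * (2 * (x i - z i)) :=
  fderiv_comp_sqDist_of_hasDerivAt ((hf.differentiable (by simp)) (sqDist z x)).hasDerivAt i

theorem fderiv_apply_coord {f : E n → E L} {x : E n} (hf : DifferentiableAt ℝ f x) (u : E n)
    (c : Fin L) : (∇ f x u) c = ∇ (fun y => f y c) x u := by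
  have h1 := (EuclideanSpace.proj (𝕜 := ℝ) c : E L →L[ℝ] ℝ).hasFDerivAt.comp x hf.hasFDerivAt
  exact (congrArg (fun A : E n →L[ℝ] ℝ => A u) h1.fderiv).symm

/-- The vector field `T(|x - z|²) (x - z)`. -/
def radialField (T : ℝ → ℝ) (z x : E n) : E n := T (sqDist z x) • (x - z)

variable {T : ℝ → ℝ}

theorem contDiff_radialField (hT : ContDiff ℝ ∞ T) (z : E n) : ContDiff ℝ ∞ (radialField T z) :=
  (hT.comp (contDiff_sqDist z)).smul (contDiff_id.sub contDiff_const)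

theorem jac_radialField (hT : ContDiff ℝ ∞ T) (z x : E n) (i k : Fin n) :
    jac (radialField T z) x i k = (if k = i then T (sqDist z x) else 0)
      + 2 * deriv T (sqDist z x) * (x i - z i) * (x k - z k) := by
  rw [jac, fderiv_apply_coord (((contDiff_radialField hT z).differentiable (by simp)) x)]
  have h1 : (fun y => radialField T z y k) = fun y => T (sqDist z y) * (y k - z k) := by
    funext y; simp [radialField]
  have h2 : DifferentiableAt ℝ (fun y => T (sqDist z y)) x :=
    ((hT.comp (contDiff_sqDist z)).differentiable (by simp)) x
  rw [h1, fderiv_fun_mul h2 (hasFDerivAt_coord_sub z k x).differentiableAt]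
  simp only [add_apply, smul_apply, fderiv_coord_sub, fderiv_comp_sqDist hT, smul_eq_mul]
  split_ifs <;> ring

theorem sum_fderiv_jac_radialField (hT : ContDiff ℝ ∞ T) (z x : E n) (k : Fin n) :
    ∑ i, ∇ (fun y => jac (radialField T z) y i k) x (e i)
      = (x k - z k) * (4 * sqDist z x * deriv (deriv T) (sqDist z x)
        + (2 * n + 4) * deriv T (sqDist z x)) := by
  have hT' : ContDiff ℝ ∞ (deriv T) := (contDiff_infty_iff_deriv.1 hT).2
  have key : ∀ i, ∇ (fun y => jac (radialField T z) y i k) x (e i)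
      = (if k = i then 2 * deriv T (sqDist z x) * (x i - z i) else 0)
        + 4 * deriv (deriv T) (sqDist z x) * (x k - z k) * (x i - z i) ^ 2
        + 2 * deriv T (sqDist z x) * (x k - z k)
        + (if k = i then 2 * deriv T (sqDist z x) * (x i - z i) else 0) := fun i => by
    have h1 : (fun y => jac (radialField T z) y i k) = fun y => (if k = i then (1 : ℝ) else 0)
        * T (sqDist z y) + 2 * (deriv T (sqDist z y) * ((y i - z i) * (y k - z k))) := by
      funext y; rw [jac_radialField hT]; split_ifs <;> ring
    have d1 : DifferentiableAt ℝ (fun y => T (sqDist z y)) x :=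
      ((hT.comp (contDiff_sqDist z)).differentiable (by simp)) x
    have d2 : DifferentiableAt ℝ (fun y => deriv T (sqDist z y)) x :=
      ((hT'.comp (contDiff_sqDist z)).differentiable (by simp)) x
    have d3 := fun k => (hasFDerivAt_coord_sub z k x).differentiableAt
    rw [h1, fderiv_fun_add (d1.const_mul _) ((d2.fun_mul ((d3 i).fun_mul (d3 k))).const_mul _),
      fderiv_const_mul d1, fderiv_const_mul (d2.fun_mul ((d3 i).fun_mul (d3 k))),
      fderiv_fun_mul d2 ((d3 i).fun_mul (d3 k)), fderiv_fun_mul (d3 i) (d3 k)]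
    simp only [add_apply, smul_apply, fderiv_coord_sub,
      fderiv_comp_sqDist hT, fderiv_comp_sqDist hT', smul_eq_mul, if_true]
    split_ifs <;> ring
  rw [sum_congr rfl fun i _ => key i]
  simp only [sum_add_distrib, Finset.sum_ite_eq, Finset.mem_univ, if_true,
    ← mul_sum, sum_const, card_univ, Fintype.card_fin, nsmul_eq_mul]
  rw [show ∑ i, (x i - z i) ^ 2 = sqDist z x from rfl]
  ring

theorem variationTerm_radialField (hT : ContDiff ℝ ∞ T) (z x : E n) (p : Grad n L) (h : Hess n L) :
    2 * inner ℝ (∑ i, h i i x) (variationTerm (radialField T z) p h x x)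
        - (∑ i, jac (radialField T z) x i i) * ‖∑ i, h i i x‖ ^ 2
      = variationForm ((4 - n) * T (sqDist z x) + sqDist z x * (-2 * deriv T (sqDist z x)))
          (-2 * deriv T (sqDist z x)) (-2 * deriv (deriv T) (sqDist z x)) (fun k => x k - z k)
          (fun i => p i x) (fun i j => h i j x) := by
  have e1 : variationTerm (radialField T z) p h x x
      = (2 * T (sqDist z x)) • lapH (fun i j => h i j x)
        + (4 * deriv T (sqDist z x)) • radH (fun k => x k - z k) (fun i j => h i j x)
        + (4 * sqDist z x * deriv (deriv T) (sqDist z x)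
        + (2 * n + 4) * deriv T (sqDist z x)) • radP (fun k => x k - z k) fun i => p i x := by
    rw [variationTerm]
    congr 1
    · have : ∀ k l, (jac (radialField T z) x k l + jac (radialField T z) x l k) • h k l x
          = (if k = l then (2 * T (sqDist z x)) • h k l x else 0) + (4 * deriv T (sqDist z x)) •
            (((x k - z k) * (x l - z l)) • h k l x) := fun k l => by
        rw [jac_radialField hT, jac_radialField hT, smul_smul]
        by_cases hkl : k = l
        · simp only [hkl, if_true, ← add_smul]; congr 1; ring
        · simp only [hkl, Ne.symm hkl, if_false, zero_add]; congr 1; ring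
      simp only [this, sum_add_distrib, Finset.sum_ite_eq, Finset.mem_univ, if_true,
        ← smul_sum, lapH, radH]
    · simp only [sum_fderiv_jac_radialField hT, radP, smul_sum, smul_smul]
      exact sum_congr rfl fun k _ => by rw [mul_comm]
  have e2 : ∑ i, jac (radialField T z) x i i
      = n * T (sqDist z x) + 2 * sqDist z x * deriv T (sqDist z x) := by
    simp only [jac_radialField hT, if_true, sum_add_distrib, sum_const,
      card_univ, Fintype.card_fin, nsmul_eq_mul]
    congr 1
    rw [sqDist, mul_sum, Finset.sum_mul]
    exact sum_congr rfl fun i _ => by ring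
  rw [e1, e2, show ∑ i, h i i x = lapH fun i j => h i j x from rfl, ← real_inner_self_eq_norm_sq]
  simp only [inner_add_right, inner_smul_right, variationForm]
  rw [show ∑ k, (x k - z k) ^ 2 = sqDist z x from rfl]
  ring

theorem isTestFunction_radialField (hT : ContDiff ℝ ∞ T) {Ω : Set (E n)} {z : E n} {ρ : ℝ}
    (hρ : 0 < ρ) (hz : closedBall z ρ ⊆ Ω) (hT0 : ∀ q, ρ ^ 2 < q → T q = 0) :
    IsTestFunction Ω (radialField T z) := by
  have h1 : tsupport (radialField T z) ⊆ closedBall z ρ := by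
    refine closure_minimal (fun x hx => ?_) isClosed_closedBall
    by_contra h0
    refine hx ?_
    rw [mem_closedBall, dist_eq_norm, not_le] at h0
    have : ρ ^ 2 < sqDist z x := by
      rw [sqDist_eq]; exact pow_lt_pow_left₀ h0 hρ.le (by norm_num)
    simp [radialField, hT0 _ this]
  exact ⟨contDiff_radialField hT z, (isCompact_closedBall z ρ).of_isClosed_subset
    (isClosed_tsupport _) h1, h1.trans hz⟩

/-- The monotonicity identity for maps which are critical for domain variations. -/
theorem SobolevTwo.integral_monotonicityForm_eq_zero {Ω : Set (E n)} (hΩ : IsOpen Ω)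
    {u : E n → E L} {p : Grad n L} {h : Hess n L}
    (S : SobolevTwo Ω u p h) (hT : ContDiff ℝ ∞ T) {z : E n} {ρ : ℝ} (hρ : 0 < ρ)
    (hz : closedBall z ρ ⊆ Ω) (hT0 : ∀ q, ρ ^ 2 < q → T q = 0)
    (hst : ∀ Y : E n → E n, IsTestFunction Ω Y →
      HasDerivAt (fun t : ℝ => hessianEnergy Ω fun x => u (x + t • Y x)) 0 0)
    {Z M : ℝ → ℝ} (hZ : ∀ q, Z q = -2 * deriv T q) (hM : ∀ q, M q = (4 - n) * T q + q * Z q) :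
    IntegrableOn (fun x => monotonicityForm (M (sqDist z x)) (Z (sqDist z x))
        (deriv Z (sqDist z x)) (deriv (deriv Z) (sqDist z x))
        (fun k => x k - z k) (fun i => p i x) (fun i j => h i j x)) (closedBall z ρ) ∧
    ∫ x in closedBall z ρ, monotonicityForm (M (sqDist z x)) (Z (sqDist z x))
        (deriv Z (sqDist z x)) (deriv (deriv Z) (sqDist z x))
        (fun k => x k - z k) (fun i => p i x) (fun i j => h i j x) = 0 := by
  have hT' : ContDiff ℝ ∞ (deriv T) := (contDiff_infty_iff_deriv.1 hT).2
  have eZ : Z = fun q => -2 * deriv T q := funext hZ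
  have eM : M = fun q => (4 - n) * T q + q * Z q := funext hM
  have cZ : ContDiff ℝ ∞ Z := by rw [eZ]; exact contDiff_const.mul hT'
  have cM : ContDiff ℝ ∞ M := by
    rw [eM]; exact (contDiff_const.mul hT).add (contDiff_id.mul cZ)
  have dZ : ∀ q, deriv Z q = -2 * deriv (deriv T) q := fun q => by
    rw [eZ, deriv_const_mul _ ((hT'.differentiable (by simp)) q)]
  have T1 : ∀ q, ρ ^ 2 < q → deriv T q = 0 := fun q hq => by
    have : T =ᶠ[𝓝 q] fun _ => 0 := by
      filter_upwards [isOpen_Ioi.mem_nhds hq] with s hs using hT0 s hs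
    rw [this.deriv_eq]; simp
  have Z0 : ∀ q, ρ ^ 2 < q → Z q = 0 := fun q hq => by rw [hZ, T1 q hq, mul_zero]
  have M0 : ∀ q, ρ ^ 2 < q → M q = 0 := fun q hq => by rw [hM, hT0 q hq, Z0 q hq]; simp
  have dM : ∀ q, deriv M q = ((n - 2) * Z q + 2 * q * deriv Z q) / 2 := fun q => by
    have h1 := (((hT.differentiable (by simp)) q).hasDerivAt.const_mul (4 - (n : ℝ))).add
      ((hasDerivAt_id q).mul ((cZ.differentiable (by simp)) q).hasDerivAt)
    rw [eM]
    have h2 := h1.deriv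
    refine Eq.trans (by rfl) (h2.trans ?_)
    rw [hZ]; simp only [id]; ring
  obtain ⟨i1, i2⟩ := S.integral_forms_eq hΩ cZ cM dM hρ hz Z0 M0
  refine ⟨i1, i2.symm.trans ?_⟩
  have hY := isTestFunction_radialField hT hρ hz hT0
  have fv := S.first_variation hΩ hY (hst _ hY)
  have hJ := isTestFunction_jac hY
  have hm : ∀ {b : E n → ℝ} {f : E n → E L}, IsTestFunction Ω b → MemLp f 2 (volume.restrict Ω) →
      MemLp (fun x => b x • f x) 2 (volume.restrict Ω) := fun hb hf =>
    (memLp_testFunction_smul hΩ.measurableSet hb hf).restrict Ω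
  have mD : MemLp (fun x => ∑ i, h i i x) 2 (volume.restrict Ω) :=
    memLp_finsetSum _ fun i _ => S.memLp_hess i i
  have mV : MemLp (fun x => variationTerm (radialField T z) p h x x) 2 (volume.restrict Ω) := by
    refine MemLp.add (memLp_finsetSum _ fun k _ => memLp_finsetSum _ fun l _ => ?_)
      (memLp_finsetSum _ fun k _ => ?_)
    · simp only [add_smul]
      exact (hm (hJ k l) (S.memLp_hess k l)).add (hm (hJ l k) (S.memLp_hess k l))
    · exact hm (IsTestFunction.sum _ fun i _ => (hJ i k).fderiv_apply (e i)) (S.memLp_grad k)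
  have hdiv := IsTestFunction.sum Finset.univ fun i _ => hJ i i
  obtain ⟨B, hB⟩ := hdiv.exists_norm_le
  have j1 : IntegrableOn (fun x => 2 * inner ℝ (∑ i, h i i x)
      (variationTerm (radialField T z) p h x x)) Ω :=
    (integrable_inner_of_memLp mD mV).const_mul 2
  have j2 : IntegrableOn (fun x => (∑ i, jac (radialField T z) x i i) * ‖∑ i, h i i x‖ ^ 2) Ω :=
    integrableOn_mul_of_bound hdiv.contDiff.continuous hB mD.norm.integrable_sq
  rw [← sub_eq_zero, ← integral_sub j1 j2] at fv
  simp only [variationTerm_radialField hT] at fv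
  rw [← fv]
  have hq : ∀ x ∉ closedBall z ρ, ρ ^ 2 < sqDist z x := fun x hx => by
    rw [sqDist_eq]
    rw [mem_closedBall, dist_eq_norm, not_le] at hx
    exact pow_lt_pow_left₀ hx hρ.le (by norm_num)
  have T2 : ∀ q, ρ ^ 2 < q → deriv (deriv T) q = 0 := fun q hq => by
    have : deriv T =ᶠ[𝓝 q] fun _ => 0 := by
      filter_upwards [isOpen_Ioi.mem_nhds hq] with s hs using T1 s hs
    rw [this.deriv_eq]; simp
  simp only [hM, hZ, dZ]
  refine (setIntegral_eq_of_subset_of_forall_sdiff_eq_zero hΩ.measurableSet hz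
    fun x hx => ?_).symm
  simp [variationForm, hT0 _ (hq x hx.2), T1 _ (hq x hx.2), T2 _ (hq x hx.2)]

end RadialVariation

/-- A smooth step from `0` on `(-∞, 1]` to `1` on `[3, ∞)`. -/
def step (τ : ℝ) : ℝ := Real.smoothTransition ((τ - 1) / 2)

theorem contDiff_step : ContDiff ℝ ∞ step :=
  Real.smoothTransition.contDiff.comp ((contDiff_id.sub contDiff_const).div_const 2)

theorem monotone_step : Monotone step := fun _ _ h => Real.smoothTransition.monotone (by linarith)

theorem step_of_le {τ : ℝ} (h : τ ≤ 1) : step τ = 0 :=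
  Real.smoothTransition.zero_of_nonpos (by linarith)

theorem step_of_ge {τ : ℝ} (h : 3 ≤ τ) : step τ = 1 :=
  Real.smoothTransition.one_of_one_le (by linarith)

theorem step_nonneg (τ : ℝ) : 0 ≤ step τ := Real.smoothTransition.nonneg _

/-- The profile `τ^{-(n-2)/2}`, cut off near `0`. -/
def profileZ (n : ℕ) (τ : ℝ) : ℝ := τ ^ (-((n : ℝ) - 2) / 2) * step τ

theorem contDiff_profileZ (n : ℕ) : ContDiff ℝ ∞ (profileZ n) := by
  rw [contDiff_iff_contDiffAt]
  intro τ
  rcases lt_or_ge τ 1 with h | h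
  · have : profileZ n =ᶠ[𝓝 τ] fun _ => 0 := by
      filter_upwards [isOpen_Iio.mem_nhds h] with s hs
      rw [profileZ, step_of_le (le_of_lt hs), mul_zero]
    exact contDiffAt_const.congr_of_eventuallyEq this
  · exact (contDiffAt_id.rpow_const_of_ne (by simp only [id]; positivity)).mul
      contDiff_step.contDiffAt

theorem profileZ_nonneg (n : ℕ) {τ : ℝ} : 0 ≤ profileZ n τ := by
  rcases lt_or_ge τ 1 with h | h
  · rw [profileZ, step_of_le h.le, mul_zero]
  · exact mul_nonneg (Real.rpow_nonneg (by linarith) _) (step_nonneg _)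

theorem profileZ_of_le (n : ℕ) {τ : ℝ} (h : τ ≤ 1) : profileZ n τ = 0 := by
  rw [profileZ, step_of_le h, mul_zero]

theorem profileZ_of_ge (n : ℕ) {τ : ℝ} (h : 3 ≤ τ) : profileZ n τ = τ ^ (-((n : ℝ) - 2) / 2) := by
  rw [profileZ, step_of_ge h, mul_one]

/-- `2 τ^{-(n-4)/2} step'(τ)`. -/
theorem profileZ_weight (n : ℕ) (τ : ℝ) :
    ∃ b, 0 ≤ b ∧ (n - 2) * profileZ n τ + 2 * τ * deriv (profileZ n) τ = b ∧
      (τ < 1 ∨ 4 ≤ τ → b = 0) := by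
  have hd : 0 ≤ deriv step τ := monotone_step.deriv_nonneg
  rcases lt_or_ge τ 1 with h | h
  · have : profileZ n =ᶠ[𝓝 τ] fun _ => 0 := by
      filter_upwards [isOpen_Iio.mem_nhds h] with s hs
      rw [profileZ, step_of_le (le_of_lt hs), mul_zero]
    refine ⟨0, le_rfl, ?_, fun _ => rfl⟩
    rw [this.deriv_eq, profileZ_of_le n h.le]; simp
  · have hτ : 0 < τ := by linarith
    have h1 : HasDerivAt (profileZ n) _ τ :=
      (Real.hasDerivAt_rpow_const (p := -((n : ℝ) - 2) / 2) (Or.inl hτ.ne')).mul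
        ((contDiff_step.differentiable (by simp)) τ).hasDerivAt
    refine ⟨2 * τ * (τ ^ (-((n : ℝ) - 2) / 2) * deriv step τ), by positivity, ?_, ?_⟩
    · rw [h1.deriv, profileZ]
      have : τ * τ ^ (-((n : ℝ) - 2) / 2 - 1) = τ ^ (-((n : ℝ) - 2) / 2) := by
        rw [Real.rpow_sub_one hτ.ne']; field_simp
      linear_combination (2 * (-((n : ℝ) - 2) / 2) * step τ) * this
    · rintro (h2 | h2)
      · linarith
      · have : step =ᶠ[𝓝 τ] fun _ => 1 := by
          filter_upwards [isOpen_Ioi.mem_nhds (show 3 < τ by linarith)] with s hs using step_of_ge (le_of_lt hs)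
        rw [this.deriv_eq]; simp

/-- A primitive of `-profileZ / 2`, vanishing at infinity. -/
def profileT (n : ℕ) (τ : ℝ) : ℝ :=
  4 ^ (-((n : ℝ) - 4) / 2) / (n - 4) - (∫ s in (4 : ℝ)..τ, profileZ n s) / 2

theorem hasDerivAt_profileT (n : ℕ) (τ : ℝ) : HasDerivAt (profileT n) (-profileZ n τ / 2) τ := by
  have hc := (contDiff_profileZ n).continuous
  have h := (intervalIntegral.integral_hasDerivAt_right (hc.intervalIntegrable 4 τ)
    (hc.stronglyMeasurableAtFilter _ _) hc.continuousAt).div_const 2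
  refine (h.const_sub _).congr_deriv ?_
  ring

theorem deriv_profileT (n : ℕ) : deriv (profileT n) = fun τ => -profileZ n τ / 2 :=
  funext fun τ => (hasDerivAt_profileT n τ).deriv

theorem contDiff_profileT (n : ℕ) : ContDiff ℝ ∞ (profileT n) := by
  rw [contDiff_infty_iff_deriv, deriv_profileT]
  exact ⟨fun τ => (hasDerivAt_profileT n τ).differentiableAt,
    ((contDiff_profileZ n).neg).div_const 2⟩

theorem profileT_of_ge (hn : 5 ≤ n) {τ : ℝ} (h : 4 ≤ τ) :
    profileT n τ = τ ^ (-((n : ℝ) - 4) / 2) / (n - 4) := by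
  have hn' : (5 : ℝ) ≤ n := by exact_mod_cast hn
  have h1 : ∫ s in (4 : ℝ)..τ, profileZ n s = ∫ s in (4 : ℝ)..τ, s ^ (-((n : ℝ) - 2) / 2) := by
    refine intervalIntegral.integral_congr fun s hs => ?_
    rw [uIcc_of_le h] at hs
    exact profileZ_of_ge n (by linarith [hs.1])
  rw [profileT, h1, integral_rpow (Or.inr ⟨by linarith, by
    rw [uIcc_of_le h]; intro h0; linarith [h0.1]⟩)]
  have e : -((n : ℝ) - 2) / 2 + 1 = -((n : ℝ) - 4) / 2 := by ring
  have hn4 : (n : ℝ) - 4 ≠ 0 := by linarith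
  rw [e]
  field_simp
  ring

/-- The coefficient `(4 - n) T + τ Z`. -/
def profileM (n : ℕ) (τ : ℝ) : ℝ := (4 - n) * profileT n τ + τ * profileZ n τ

theorem contDiff_profileM (n : ℕ) : ContDiff ℝ ∞ (profileM n) :=
  (contDiff_const.mul (contDiff_profileT n)).add (contDiff_id.mul (contDiff_profileZ n))

theorem profileM_of_ge (hn : 5 ≤ n) {τ : ℝ} (h : 4 ≤ τ) : profileM n τ = 0 := by
  have hn' : (5 : ℝ) ≤ n := by exact_mod_cast hn
  have hn4 : (n : ℝ) - 4 ≠ 0 := by linarith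
  have hτ : 0 < τ := by linarith
  rw [profileM, profileT_of_ge hn h, profileZ_of_ge n (by linarith)]
  have : τ * τ ^ (-((n : ℝ) - 2) / 2) = τ ^ (-((n : ℝ) - 4) / 2) := by
    rw [show -((n : ℝ) - 4) / 2 = -((n : ℝ) - 2) / 2 + 1 by ring, Real.rpow_add_one hτ.ne']; ring
  rw [this]; field_simp; ring

theorem monotone_profileM (n : ℕ) : Monotone (profileM n) := by
  refine monotone_of_deriv_nonneg ((contDiff_profileM n).differentiable (by simp)) fun τ => ?_
  have h1 : HasDerivAt (profileM n) _ τ := ((hasDerivAt_profileT n τ).const_mul (4 - (n : ℝ))).add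
      ((hasDerivAt_id τ).mul (((contDiff_profileZ n).differentiable (by simp)) τ).hasDerivAt)
  obtain ⟨b, hb, hb', -⟩ := profileZ_weight n τ
  rw [h1.deriv]
  simp only [id]
  linarith

theorem profileM_nonpos (hn : 5 ≤ n) (τ : ℝ) : profileM n τ ≤ 0 :=
  (monotone_profileM n (le_max_left τ 4)).trans (profileM_of_ge hn (le_max_right τ 4)).le

theorem exists_profileM_le (hn : 5 ≤ n) : ∃ c > 0, ∀ τ ≤ 1, profileM n τ ≤ -c := by
  have hn' : (5 : ℝ) ≤ n := by exact_mod_cast hn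
  refine ⟨-profileM n 1, ?_, fun τ hτ => by simpa using monotone_profileM n hτ⟩
  have h1 : profileT n 4 ≤ profileT n 1 := by
    refine antitone_of_deriv_nonpos ((contDiff_profileT n).differentiable (by simp))
      (fun τ => ?_) (by norm_num)
    rw [deriv_profileT]
    have := profileZ_nonneg n (τ := τ)
    linarith
  have h2 : 0 < profileT n 4 := by
    rw [profileT_of_ge hn le_rfl]
    have : (0 : ℝ) < n - 4 := by linarith
    positivity
  rw [profileM, profileZ_of_le n le_rfl]
  nlinarith

/-- `4 (n - 2) Z' + 8 τ Z''`. -/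
def profileW (n : ℕ) (τ : ℝ) : ℝ :=
  4 * (n - 2) * deriv (profileZ n) τ + 8 * τ * deriv (deriv (profileZ n)) τ

theorem profileW_of_le (n : ℕ) {τ : ℝ} (h : τ < 1) : profileW n τ = 0 := by
  have h0 : ∀ s < 1, deriv (profileZ n) s = 0 := fun s hs => by
    have : profileZ n =ᶠ[𝓝 s] fun _ => 0 := by
      filter_upwards [isOpen_Iio.mem_nhds hs] with s hs using profileZ_of_le n (le_of_lt hs)
    rw [this.deriv_eq]; simp
  have : deriv (profileZ n) =ᶠ[𝓝 τ] fun _ => 0 := by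
    filter_upwards [isOpen_Iio.mem_nhds h] with s hs using h0 s hs
  rw [profileW, this.deriv_eq, h0 τ h]; simp

theorem profileW_of_ge (n : ℕ) {τ : ℝ} (h : 4 ≤ τ) :
    profileW n τ = 4 * (n - 2) * τ ^ (-(n : ℝ) / 2) := by
  have d1 : ∀ s > 3, deriv (profileZ n) s = -((n : ℝ) - 2) / 2 * s ^ (-(n : ℝ) / 2) := fun s hs => by
    have : profileZ n =ᶠ[𝓝 s] fun s => s ^ (-((n : ℝ) - 2) / 2) := by
      filter_upwards [isOpen_Ioi.mem_nhds hs] with s hs using profileZ_of_ge n (le_of_lt hs)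
    rw [this.deriv_eq, (Real.hasDerivAt_rpow_const (Or.inl (by linarith : s ≠ 0))).deriv]
    congr 2; ring
  have : deriv (profileZ n) =ᶠ[𝓝 τ] fun s => -((n : ℝ) - 2) / 2 * s ^ (-(n : ℝ) / 2) := by
    filter_upwards [isOpen_Ioi.mem_nhds (show 3 < τ by linarith)] with s hs using d1 s hs
  have hτ : τ ≠ 0 := by linarith
  rw [profileW, this.deriv_eq, d1 τ (by linarith),
    ((Real.hasDerivAt_rpow_const (Or.inl hτ)).const_mul (-((n : ℝ) - 2) / 2)).deriv]
  have : τ * τ ^ (-(n : ℝ) / 2 - 1) = τ ^ (-(n : ℝ) / 2) := by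
    rw [Real.rpow_sub_one hτ]; field_simp
  linear_combination (8 * (-((n : ℝ) - 2) / 2) * (-(n : ℝ) / 2)) * this

section PointwiseBounds

variable {F : Type*} [NormedAddCommGroup F]

/-- `∑ ‖pᵢ‖²`. -/
def normSq₁ (p : Fin n → F) : ℝ := ∑ i, ‖p i‖ ^ 2

/-- `∑ ‖hᵢⱼ‖²`. -/
def normSq₂ (h : Fin n → Fin n → F) : ℝ := ∑ i, ∑ j, ‖h i j‖ ^ 2

theorem normSq₁_nonneg (p : Fin n → F) : 0 ≤ normSq₁ p := sum_nonneg fun _ _ => sq_nonneg _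

theorem normSq₂_nonneg (h : Fin n → Fin n → F) : 0 ≤ normSq₂ h :=
  sum_nonneg fun _ _ => sum_nonneg fun _ _ => sq_nonneg _

theorem norm_lapH_sq_le (h : Fin n → Fin n → F) : ‖lapH h‖ ^ 2 ≤ n * normSq₂ h := by
  have h1 : ‖lapH h‖ ≤ ∑ i, 1 * ‖h i i‖ := by
    simpa [lapH] using norm_sum_le Finset.univ fun i => h i i
  refine (pow_le_pow_left₀ (norm_nonneg _) h1 2).trans ?_
  refine (Finset.sum_mul_sq_le_sq_mul_sq _ _ _).trans ?_
  simp only [one_pow, sum_const, card_univ, Fintype.card_fin, nsmul_eq_mul, mul_one]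
  refine mul_le_mul_of_nonneg_left (sum_le_sum fun i _ => ?_) (Nat.cast_nonneg n)
  exact single_le_sum (f := fun j => ‖h i j‖ ^ 2) (fun _ _ => sq_nonneg _) (Finset.mem_univ i)

theorem norm_lapH_le (h : Fin n → Fin n → F) : ‖lapH h‖ ≤ n * √(normSq₂ h) := by
  refine abs_le_of_sq_le_sq' ?_ (by positivity) |>.2
  rw [mul_pow, sq_sqrt (normSq₂_nonneg h)]
  refine (norm_lapH_sq_le h).trans (mul_le_mul_of_nonneg_right ?_ (normSq₂_nonneg h))
  rcases Nat.eq_zero_or_pos n with h0 | h0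
  · simp [h0]
  · have : (1 : ℝ) ≤ n := by exact_mod_cast h0
    nlinarith

variable [InnerProductSpace ℝ F]

theorem norm_sum_smul_sq_le (X : Fin n → ℝ) (p : Fin n → F) :
    ‖∑ k, X k • p k‖ ^ 2 ≤ (∑ k, X k ^ 2) * normSq₁ p := by
  have h1 : ‖∑ k, X k • p k‖ ≤ ∑ k, |X k| * ‖p k‖ :=
    (norm_sum_le _ _).trans (sum_le_sum fun k _ => by rw [norm_smul, norm_eq_abs])
  refine (pow_le_pow_left₀ (norm_nonneg _) h1 2).trans ?_
  refine (Finset.sum_mul_sq_le_sq_mul_sq _ _ _).trans ?_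
  simp only [sq_abs, normSq₁, le_refl]

theorem norm_radP_sq_le (X : Fin n → ℝ) (p : Fin n → F) :
    ‖radP X p‖ ^ 2 ≤ (∑ k, X k ^ 2) * normSq₁ p := norm_sum_smul_sq_le X p

theorem normSq₁_radV_le (X : Fin n → ℝ) (p : Fin n → F) (h : Fin n → Fin n → F) :
    normSq₁ (radV X p h) ≤ 2 * normSq₁ p + 2 * ((∑ k, X k ^ 2) * normSq₂ h) := by
  rw [normSq₂, normSq₁, normSq₁, mul_sum, mul_sum, mul_sum, ← sum_add_distrib]
  refine sum_le_sum fun j _ => ?_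
  have h1 := norm_sum_smul_sq_le X (h j)
  have h2 : ‖radV X p h j‖ ≤ ‖p j‖ + ‖∑ k, X k • h j k‖ := norm_add_le _ _
  have h3 : ‖radV X p h j‖ ^ 2 ≤ (‖p j‖ + ‖∑ k, X k • h j k‖) ^ 2 :=
    pow_le_pow_left₀ (norm_nonneg _) h2 2
  rw [normSq₁] at h1
  nlinarith [sq_nonneg (‖p j‖ - ‖∑ k, X k • h j k‖)]

theorem abs_sum_inner_le (p V : Fin n → F) :
    |∑ j, inner ℝ (p j) (V j)| ≤ √(normSq₁ p) * √(normSq₁ V) := by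
  refine (Finset.abs_sum_le_sum_abs _ _).trans ?_
  refine le_trans (sum_le_sum fun j _ => abs_real_inner_le_norm (p j) (V j)) ?_
  exact Real.sum_mul_le_sqrt_mul_sqrt _ _ _

/-- The error density in the energy inequality at scale `r`. -/
def crossForm (r : ℝ) (X : Fin n → ℝ) (p : Fin n → F) (h : Fin n → Fin n → F) : ℝ :=
  √(normSq₂ h) * ‖radP X p‖ + √(normSq₁ p) * √(normSq₁ (radV X p h)) + (r ^ 2)⁻¹ * ‖radP X p‖ ^ 2

theorem crossForm_nonneg (r : ℝ) (X : Fin n → ℝ) (p : Fin n → F) (h : Fin n → Fin n → F) :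
    0 ≤ crossForm r X p h := by
  unfold crossForm; positivity

/-- The integrand of the monotonicity identity for the profile at scale `r`, divided by
`r^{2-n}`. -/
def scaledForm (n : ℕ) (r τ : ℝ) (X : Fin n → ℝ) (p : Fin n → F) (h : Fin n → Fin n → F) : ℝ :=
  r ^ 2 * profileM n τ * normSq₂ h - 4 * profileZ n τ * normSq₁ (radV X p h)
    - (r ^ 2)⁻¹ * profileW n τ * ‖radP X p‖ ^ 2
    - 3 * ((n - 2) * profileZ n τ + 2 * τ * deriv (profileZ n) τ) * (inner ℝ (lapH h) (radP X p)
      + ∑ j, inner ℝ (p j) (radV X p h j) + normSq₁ p)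

theorem exists_profile_bound (n : ℕ) : ∃ C, 0 ≤ C ∧ ∀ τ ∈ Icc (0 : ℝ) 4,
    |profileM n τ| ≤ C ∧ |profileZ n τ| ≤ C ∧ |profileW n τ| ≤ C ∧
      |(n - 2) * profileZ n τ + 2 * τ * deriv (profileZ n) τ| ≤ C := by
  have h1 := contDiff_profileZ n
  have h2 := (contDiff_infty_iff_deriv.1 h1).2
  have h3 := (contDiff_infty_iff_deriv.1 h2).2
  have cW : Continuous (profileW n) := (continuous_const.mul h2.continuous).add
      ((continuous_const.mul continuous_id).mul h3.continuous)
  have cX : Continuous fun τ => (n - 2) * profileZ n τ + 2 * τ * deriv (profileZ n) τ :=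
    (continuous_const.mul h1.continuous).add
      ((continuous_const.mul continuous_id).mul h2.continuous)
  obtain ⟨C1, b1⟩ := isCompact_Icc.exists_bound_of_continuousOn
    (contDiff_profileM n).continuous.continuousOn (s := Icc (0 : ℝ) 4)
  obtain ⟨C2, b2⟩ := isCompact_Icc.exists_bound_of_continuousOn
    h1.continuous.continuousOn (s := Icc (0 : ℝ) 4)
  obtain ⟨C3, b3⟩ := isCompact_Icc.exists_bound_of_continuousOn
    cW.continuousOn (s := Icc (0 : ℝ) 4)
  obtain ⟨C4, b4⟩ := isCompact_Icc.exists_bound_of_continuousOn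
    cX.continuousOn (s := Icc (0 : ℝ) 4)
  refine ⟨|C1| + |C2| + |C3| + |C4|, by positivity, fun τ hτ => ⟨?_, ?_, ?_, ?_⟩⟩
  · have := b1 τ hτ; rw [norm_eq_abs] at this
    linarith [le_abs_self C1, abs_nonneg C2, abs_nonneg C3, abs_nonneg C4]
  · have := b2 τ hτ; rw [norm_eq_abs] at this
    linarith [le_abs_self C2, abs_nonneg C1, abs_nonneg C3, abs_nonneg C4]
  · have := b3 τ hτ; rw [norm_eq_abs] at this
    linarith [le_abs_self C3, abs_nonneg C1, abs_nonneg C2, abs_nonneg C4]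
  · have := b4 τ hτ; rw [norm_eq_abs] at this
    linarith [le_abs_self C4, abs_nonneg C1, abs_nonneg C2, abs_nonneg C3]

/-- The size of `scaledForm` at distances comparable to `r`. -/
theorem exists_abs_scaledForm_le (n : ℕ) : ∃ C, 0 ≤ C ∧ ∀ (r : ℝ) (X : Fin n → ℝ) (p : Fin n → F)
    (h : Fin n → Fin n → F), 0 < r → (∑ k, X k ^ 2) ≤ 4 * r ^ 2 →
    |scaledForm n r ((∑ k, X k ^ 2) / r ^ 2) X p h| ≤ C * (r ^ 2 * normSq₂ h + normSq₁ p) := by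
  obtain ⟨B, hB, hb⟩ := exists_profile_bound n
  refine ⟨B * (60 + 12 * n), by positivity, fun r X p h hr hX => ?_⟩
  set q := ∑ k, X k ^ 2
  have q0 : 0 ≤ q := sum_nonneg fun _ _ => sq_nonneg _
  have hr2 : 0 < r ^ 2 := by positivity
  obtain ⟨b1, b2, b3, b4⟩ := hb (q / r ^ 2) ⟨by positivity, by rw [div_le_iff₀ hr2]; exact hX⟩
  set H := normSq₂ h
  set P := normSq₁ p
  have H0 : 0 ≤ H := normSq₂_nonneg h
  have P0 : 0 ≤ P := normSq₁_nonneg p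
  have i1 : ‖radP X p‖ ^ 2 ≤ 4 * r ^ 2 * P :=
    (norm_radP_sq_le X p).trans (mul_le_mul_of_nonneg_right hX P0)
  have i2 : normSq₁ (radV X p h) ≤ 2 * P + 8 * (r ^ 2 * H) := by
    have := normSq₁_radV_le X p h
    have := mul_le_mul_of_nonneg_right hX H0
    linarith
  have V0 := normSq₁_nonneg (radV X p h)
  have i3 := norm_lapH_sq_le h
  have i4 : |inner ℝ (lapH h) (radP X p)| ≤ n * (r ^ 2 * H) + 4 * P := by
    refine (abs_real_inner_le_norm _ _).trans ?_
    have e1 : ‖lapH h‖ * ‖radP X p‖ = (r * ‖lapH h‖) * (r⁻¹ * ‖radP X p‖) := by field_simp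
    have e2 : (r⁻¹ * ‖radP X p‖) ^ 2 ≤ 4 * P := by
      rw [mul_pow, inv_pow, inv_mul_le_iff₀ hr2]; linarith
    have e3 : (r * ‖lapH h‖) ^ 2 ≤ n * (r ^ 2 * H) := by
      rw [mul_pow]; nlinarith
    rw [e1]
    nlinarith [sq_nonneg (r * ‖lapH h‖ - r⁻¹ * ‖radP X p‖), sq_nonneg (r * ‖lapH h‖),
      sq_nonneg (r⁻¹ * ‖radP X p‖)]
  have i5 : |∑ j, inner ℝ (p j) (radV X p h j)| ≤ 3 * P + 8 * (r ^ 2 * H) := by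
    refine (abs_sum_inner_le _ _).trans ?_
    have s1 := sq_sqrt P0
    have s2 := sq_sqrt V0
    nlinarith [sq_nonneg (√P - √(normSq₁ (radV X p h)))]
  have j1 : |r ^ 2 * profileM n (q / r ^ 2) * H| ≤ B * (r ^ 2 * H) := by
    rw [abs_mul, abs_mul, abs_of_pos hr2, abs_of_nonneg H0]
    nlinarith [mul_nonneg hr2.le H0]
  have j2 : |4 * profileZ n (q / r ^ 2) * normSq₁ (radV X p h)| ≤ B * (8 * P + 32 * (r ^ 2 * H)) := by
    rw [abs_mul, abs_mul, abs_of_nonneg V0, abs_of_pos (by norm_num : (0 : ℝ) < 4)]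
    calc 4 * |profileZ n (q / r ^ 2)| * normSq₁ (radV X p h)
        ≤ 4 * B * (2 * P + 8 * (r ^ 2 * H)) := by gcongr
      _ = _ := by ring
  have j3 : |(r ^ 2)⁻¹ * profileW n (q / r ^ 2) * ‖radP X p‖ ^ 2| ≤ B * (4 * P) := by
    rw [abs_mul, abs_mul, abs_of_pos (inv_pos.2 hr2), abs_of_nonneg (sq_nonneg ‖radP X p‖)]
    calc (r ^ 2)⁻¹ * |profileW n (q / r ^ 2)| * ‖radP X p‖ ^ 2
        ≤ (r ^ 2)⁻¹ * B * (4 * r ^ 2 * P) := by gcongr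
      _ = _ := by field_simp
  have j4 : |3 * ((n - 2) * profileZ n (q / r ^ 2) + 2 * (q / r ^ 2) * deriv (profileZ n) (q / r ^ 2))
      * (inner ℝ (lapH h) (radP X p) + ∑ j, inner ℝ (p j) (radV X p h j) + P)|
      ≤ B * (24 * P + (24 + 3 * n) * (r ^ 2 * H)) := by
    rw [abs_mul, abs_mul, abs_of_pos (by norm_num : (0 : ℝ) < 3)]
    have : |inner ℝ (lapH h) (radP X p) + ∑ j, inner ℝ (p j) (radV X p h j) + P|
        ≤ 8 * P + (8 + n) * (r ^ 2 * H) := by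
      refine (abs_add_three _ _ _).trans ?_
      rw [abs_of_nonneg P0]
      linarith
    calc _ ≤ 3 * B * (8 * P + (8 + n) * (r ^ 2 * H)) := by gcongr
      _ = _ := by ring
  have hn0 : (0 : ℝ) ≤ n := Nat.cast_nonneg n
  have hHr := mul_nonneg hr2.le H0
  rw [scaledForm]
  calc _ ≤ B * (r ^ 2 * H) + B * (8 * P + 32 * (r ^ 2 * H)) + B * (4 * P)
        + B * (24 * P + (24 + 3 * n) * (r ^ 2 * H)) := by
        refine (abs_sub _ _).trans (add_le_add ((abs_sub _ _).trans (add_le_add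
          ((abs_sub _ _).trans (add_le_add j1 j2)) j3)) j4)
    _ = B * (36 * P + (57 + 3 * n) * (r ^ 2 * H)) := by ring
    _ ≤ B * ((60 + 12 * n) * P + (60 + 12 * n) * (r ^ 2 * H)) := by
        gcongr <;> linarith
    _ = _ := by ring

/-- Lower bounds for `-scaledForm` in the three regions. -/
theorem exists_le_neg_scaledForm (hn : 5 ≤ n) : ∃ c > 0, ∃ C, 0 ≤ C ∧
    ∀ (r : ℝ) (X : Fin n → ℝ) (p : Fin n → F) (h : Fin n → Fin n → F), 0 < r →
    ((∑ k, X k ^ 2) < r ^ 2 →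
      c * (r ^ 2 * normSq₂ h) ≤ -scaledForm n r ((∑ k, X k ^ 2) / r ^ 2) X p h) ∧
    (r ^ 2 ≤ (∑ k, X k ^ 2) → (∑ k, X k ^ 2) < 4 * r ^ 2 →
      -(C * crossForm r X p h) ≤ -scaledForm n r ((∑ k, X k ^ 2) / r ^ 2) X p h) ∧
    (4 * r ^ 2 ≤ (∑ k, X k ^ 2) →
      ((∑ k, X k ^ 2) / r ^ 2) ^ (-((n : ℝ) - 2) / 2) * normSq₁ (radV X p h)
        + (r ^ 2)⁻¹ * ((∑ k, X k ^ 2) / r ^ 2) ^ (-(n : ℝ) / 2) * ‖radP X p‖ ^ 2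
        ≤ -scaledForm n r ((∑ k, X k ^ 2) / r ^ 2) X p h) := by
  obtain ⟨B, hB, hb⟩ := exists_profile_bound n
  obtain ⟨c, hc, hc'⟩ := exists_profileM_le hn
  have hn' : (5 : ℝ) ≤ n := by exact_mod_cast hn
  refine ⟨c, hc, B * (1 + 3 * n + 3), by positivity, fun r X p h hr => ?_⟩
  have hr2 : 0 < r ^ 2 := by positivity
  set q := ∑ k, X k ^ 2
  have q0 : 0 ≤ q := sum_nonneg fun _ _ => sq_nonneg _
  have H0 := normSq₂_nonneg h
  have P0 := normSq₁_nonneg p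
  have V0 := normSq₁_nonneg (radV X p h)
  obtain ⟨b, w1, w2, w3⟩ := profileZ_weight n (q / r ^ 2)
  rw [scaledForm, w2]
  refine ⟨fun h1 => ?_, fun h1 h2 => ?_, fun h1 => ?_⟩
  · have t1 : q / r ^ 2 < 1 := by rwa [div_lt_one hr2]
    rw [profileZ_of_le n t1.le, profileW_of_le n t1, w3 (Or.inl t1)]
    have := mul_le_mul_of_nonneg_right (hc' _ t1.le) (mul_nonneg hr2.le H0)
    nlinarith
  · have t2 : q / r ^ 2 ∈ Icc (0 : ℝ) 4 := ⟨by positivity, by rw [div_le_iff₀ hr2]; exact h2.le⟩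
    obtain ⟨-, -, b3, b4⟩ := hb _ t2
    rw [w2, abs_of_nonneg w1] at b4
    have m1 := mul_nonneg (mul_nonneg hr2.le H0) (neg_nonneg.2 (profileM_nonpos hn (q / r ^ 2)))
    have m2 := mul_nonneg (profileZ_nonneg n (τ := q / r ^ 2)) V0
    have m3 : -(B * ((r ^ 2)⁻¹ * ‖radP X p‖ ^ 2))
        ≤ (r ^ 2)⁻¹ * profileW n (q / r ^ 2) * ‖radP X p‖ ^ 2 := by
      have := mul_le_mul_of_nonneg_right (neg_le_of_abs_le b3)
        (by positivity : 0 ≤ (r ^ 2)⁻¹ * ‖radP X p‖ ^ 2)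
      linarith
    have m4 : -(n * (√(normSq₂ h) * ‖radP X p‖)) ≤ inner ℝ (lapH h) (radP X p) := by
      have := (abs_real_inner_le_norm (lapH h) (radP X p)).trans
        (mul_le_mul_of_nonneg_right (norm_lapH_le h) (norm_nonneg (radP X p)))
      have := neg_le_of_abs_le this
      linarith
    have m5 := neg_le_of_abs_le (abs_sum_inner_le p (radV X p h))
    have c1 : 0 ≤ √(normSq₂ h) * ‖radP X p‖ := by positivity
    have c2 : 0 ≤ √(normSq₁ p) * √(normSq₁ (radV X p h)) := by positivity
    have c3 : 0 ≤ (r ^ 2)⁻¹ * ‖radP X p‖ ^ 2 := by positivity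
    have m6 : -(B * (n * (√(normSq₂ h) * ‖radP X p‖) + √(normSq₁ p) * √(normSq₁ (radV X p h))))
        ≤ b * (inner ℝ (lapH h) (radP X p) + ∑ j, inner ℝ (p j) (radV X p h j) + normSq₁ p) := by
      have e1 : b * -(n * (√(normSq₂ h) * ‖radP X p‖) + √(normSq₁ p) * √(normSq₁ (radV X p h)))
          ≤ b * (inner ℝ (lapH h) (radP X p) + ∑ j, inner ℝ (p j) (radV X p h j) + normSq₁ p) :=
        mul_le_mul_of_nonneg_left (by linarith) w1
      have e2 := mul_le_mul_of_nonneg_right b4 (by positivity :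
        0 ≤ n * (√(normSq₂ h) * ‖radP X p‖) + √(normSq₁ p) * √(normSq₁ (radV X p h)))
      linarith
    have m7 : B * ((r ^ 2)⁻¹ * ‖radP X p‖ ^ 2) + 3 * (B * (n * (√(normSq₂ h) * ‖radP X p‖)
        + √(normSq₁ p) * √(normSq₁ (radV X p h)))) ≤ B * (1 + 3 * n + 3) * crossForm r X p h := by
      rw [crossForm, mul_assoc, show 3 * (B * (n * (√(normSq₂ h) * ‖radP X p‖)
        + √(normSq₁ p) * √(normSq₁ (radV X p h)))) = B * (3 * n * (√(normSq₂ h) * ‖radP X p‖)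
        + 3 * (√(normSq₁ p) * √(normSq₁ (radV X p h)))) by ring, ← mul_add]
      refine mul_le_mul_of_nonneg_left ?_ hB
      nlinarith [mul_nonneg (by linarith : (0 : ℝ) ≤ n) c2, mul_nonneg (by linarith : (0 : ℝ) ≤ n) c3]
    linarith
  · have t1 : 4 ≤ q / r ^ 2 := by rwa [le_div_iff₀ hr2]
    rw [profileM_of_ge hn t1, profileZ_of_ge n (by linarith), profileW_of_ge n t1, w3 (Or.inr t1)]
    have τ0 : 0 ≤ q / r ^ 2 := by linarith
    have a1 := mul_nonneg (Real.rpow_nonneg τ0 (-((n : ℝ) - 2) / 2)) V0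
    have a2 : 0 ≤ (r ^ 2)⁻¹ * (q / r ^ 2) ^ (-(n : ℝ) / 2) * ‖radP X p‖ ^ 2 := by positivity
    nlinarith

end PointwiseBounds

section Densities

/-- The density of the Hessian energy. -/
def hessDens (h : Hess n L) (x : E n) : ℝ := normSq₂ fun i j => h i j x

/-- The density of the Dirichlet energy. -/
def gradDens (p : Grad n L) (x : E n) : ℝ := normSq₁ fun i => p i x

/-- `|(x - z)ⁱ pᵢ|²`. -/
def radDens (z : E n) (p : Grad n L) (x : E n) : ℝ := ‖radP (fun k => x k - z k) fun i => p i x‖ ^ 2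

/-- `∑ⱼ |pⱼ + (x - z)ⁱ hⱼᵢ|²`. -/
def growthDens (z : E n) (p : Grad n L) (h : Hess n L) (x : E n) : ℝ :=
  normSq₁ (radV (fun k => x k - z k) (fun i => p i x) fun i j => h i j x)

/-- The integrand of the monotone quantity. -/
def weightDens (z : E n) (p : Grad n L) (h : Hess n L) (x : E n) : ℝ :=
  ‖x - z‖ ^ (2 - (n : ℤ)) * growthDens z p h x + ‖x - z‖ ^ (-(n : ℤ)) * radDens z p x

/-- The error density at scale `r`. -/
def crossDens (r : ℝ) (z : E n) (p : Grad n L) (h : Hess n L) (x : E n) : ℝ :=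
  crossForm r (fun k => x k - z k) (fun i => p i x) fun i j => h i j x

/-- The energy inequality in the ball `B_R(z)`, with constant `C` and initial energy `η`. -/
def EnergyInequality (z : E n) (R C η : ℝ) (p : Grad n L) (h : Hess n L) : Prop :=
  ∀ r, 0 < r → r ≤ R / 8 → r ^ (4 - (n : ℤ)) * (∫ x in ball z r, hessDens h x)
      + ∫ x in ball z (R / 4) \ ball z (2 * r), weightDens z p h x
    ≤ C * η + C * (r ^ (2 - (n : ℤ)) * ∫ x in ball z (2 * r) \ ball z r, crossDens r z p h x)

theorem hessDens_nonneg (h : Hess n L) (x : E n) : 0 ≤ hessDens h x := normSq₂_nonneg _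

theorem gradDens_nonneg (p : Grad n L) (x : E n) : 0 ≤ gradDens p x := normSq₁_nonneg _

theorem radDens_nonneg (z : E n) (p : Grad n L) (x : E n) : 0 ≤ radDens z p x := sq_nonneg _

theorem growthDens_nonneg (z : E n) (p : Grad n L) (h : Hess n L)
    (x : E n) : 0 ≤ growthDens z p h x := normSq₁_nonneg _

theorem weightDens_nonneg (z : E n) (p : Grad n L) (h : Hess n L)
    (x : E n) : 0 ≤ weightDens z p h x :=
  add_nonneg (mul_nonneg (zpow_nonneg (norm_nonneg _) _) (growthDens_nonneg _ _ _ _))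
    (mul_nonneg (zpow_nonneg (norm_nonneg _) _) (radDens_nonneg _ _ _))

theorem crossDens_nonneg (r : ℝ) (z : E n) (p : Grad n L)
    (h : Hess n L) (x : E n) : 0 ≤ crossDens r z p h x := crossForm_nonneg _ _ _ _

theorem radDens_le (z : E n) (p : Grad n L) (x : E n) :
    radDens z p x ≤ ‖x - z‖ ^ 2 * gradDens p x := by
  rw [← sqDist_eq]; exact norm_radP_sq_le _ _

theorem growthDens_le (z : E n) (p : Grad n L) (h : Hess n L)
    (x : E n) : growthDens z p h x ≤ 2 * gradDens p x + 2 * (‖x - z‖ ^ 2 * hessDens h x) := by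
  rw [← sqDist_eq]; exact normSq₁_radV_le _ _ _

variable {s : Set (E n)} {p : Grad n L} {h : Hess n L} {z : E n} {R : ℝ}

theorem integrableOn_hessDens (mh : ∀ i j, MemLp (h i j) 2 (volume.restrict s)) :
    IntegrableOn (hessDens h) s := by
  unfold hessDens normSq₂
  exact integrable_finsetSum _ fun i _ => integrable_finsetSum _ fun j _ => (mh i j).norm.integrable_sq

theorem integrableOn_gradDens (mp : ∀ i, MemLp (p i) 2 (volume.restrict s)) :
    IntegrableOn (gradDens p) s := by
  unfold gradDens normSq₁
  exact integrable_finsetSum _ fun i _ => (mp i).norm.integrable_sq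

theorem memLp_coord_smul (hs : MeasurableSet s) (hsR : s ⊆ ball z R) {f : E n → E L}
    (hf : MemLp f 2 (volume.restrict s)) (k : Fin n) :
    MemLp (fun x => (x k - z k) • f x) 2 (volume.restrict s) := by
  have hc : Continuous fun x : E n => x k - z k := by fun_prop
  refine MemLp.of_le_mul hf (hc.aestronglyMeasurable.smul hf.1) (c := R) ?_
  refine (ae_restrict_iff' hs).2 (.of_forall fun x hx => ?_)
  rw [norm_smul]
  refine mul_le_mul_of_nonneg_right ?_ (norm_nonneg _)
  have h1 := PiLp.norm_apply_le (x - z) k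
  have h2 := hsR hx
  rw [mem_ball, dist_eq_norm] at h2
  exact h1.trans h2.le

theorem memLp_radP (hs : MeasurableSet s) (hsR : s ⊆ ball z R)
    (mp : ∀ i, MemLp (p i) 2 (volume.restrict s)) :
    MemLp (fun x => radP (fun k => x k - z k) fun i => p i x) 2 (volume.restrict s) :=
  memLp_finsetSum _ fun i _ => memLp_coord_smul hs hsR (mp i) i

theorem memLp_radV (hs : MeasurableSet s) (hsR : s ⊆ ball z R)
    (mp : ∀ i, MemLp (p i) 2 (volume.restrict s))
    (mh : ∀ i j, MemLp (h i j) 2 (volume.restrict s)) (j : Fin n) :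
    MemLp (fun x => radV (fun k => x k - z k) (fun i => p i x) (fun i j => h i j x) j) 2
      (volume.restrict s) :=
  (mp j).add (memLp_finsetSum _ fun i _ => memLp_coord_smul hs hsR (mh j i) i)

theorem integrableOn_radDens (hs : MeasurableSet s) (hsR : s ⊆ ball z R)
    (mp : ∀ i, MemLp (p i) 2 (volume.restrict s)) : IntegrableOn (radDens z p) s :=
  (memLp_radP hs hsR mp).norm.integrable_sq

theorem integrableOn_growthDens (hs : MeasurableSet s) (hsR : s ⊆ ball z R)
    (mp : ∀ i, MemLp (p i) 2 (volume.restrict s))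
    (mh : ∀ i j, MemLp (h i j) 2 (volume.restrict s)) : IntegrableOn (growthDens z p h) s := by
  unfold growthDens normSq₁
  exact integrable_finsetSum _ fun j _ => (memLp_radV hs hsR mp mh j).norm.integrable_sq

theorem memLp_sqrt {α : Type*} [MeasurableSpace α] {μ : Measure α} {f : α → ℝ}
    (hf : Integrable f μ) (h0 : ∀ x, 0 ≤ f x) : MemLp (fun x => √(f x)) 2 μ := by
  rw [memLp_two_iff_integrable_sq hf.1.aemeasurable.sqrt.aestronglyMeasurable]
  simpa only [sq_sqrt (h0 _)] using hf

theorem integrableOn_crossDens (hs : MeasurableSet s) (hsR : s ⊆ ball z R)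
    (mp : ∀ i, MemLp (p i) 2 (volume.restrict s))
    (mh : ∀ i j, MemLp (h i j) 2 (volume.restrict s)) (r : ℝ) :
    IntegrableOn (crossDens r z p h) s := by
  have h1 := memLp_sqrt (integrableOn_hessDens mh) (hessDens_nonneg h)
  have h2 := memLp_sqrt (integrableOn_gradDens mp) (gradDens_nonneg p)
  have h3 := memLp_sqrt (integrableOn_growthDens hs hsR mp mh) (growthDens_nonneg z p h)
  exact ((h1.integrable_mul (memLp_radP hs hsR mp).norm).add (h2.integrable_mul h3)).add
    ((integrableOn_radDens hs hsR mp).const_mul _)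

theorem integrableOn_zpow_norm_mul {ρ : ℝ} (hρ : 0 < ρ) (hs : MeasurableSet s)
    (hsρ : ∀ x ∈ s, ρ ≤ ‖x - z‖) {f : E n → ℝ} (hf : IntegrableOn f s) {k : ℤ} (hk : k ≤ 0) :
    IntegrableOn (fun x => ‖x - z‖ ^ k * f x) s := by
  refine Integrable.bdd_mul (c := ρ ^ k) hf ?_ ?_
  · exact ((measurable_norm.comp (measurable_id.sub_const z)).pow_const k).aestronglyMeasurable
  · refine (ae_restrict_iff' hs).2 (.of_forall fun x hx => ?_)
    rw [norm_eq_abs, abs_of_nonneg (zpow_nonneg (norm_nonneg _) _)]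
    have h1 := hsρ x hx
    obtain ⟨m, rfl⟩ : ∃ m : ℕ, k = -(m : ℤ) := ⟨k.natAbs, by omega⟩
    rw [zpow_neg, zpow_neg, zpow_natCast, zpow_natCast]
    gcongr

theorem integrableOn_weightDens (hn : 2 ≤ n) (hs : MeasurableSet s) (hsR : s ⊆ ball z R)
    {ρ : ℝ} (hρ : 0 < ρ) (hsρ : ∀ x ∈ s, ρ ≤ ‖x - z‖)
    (mp : ∀ i, MemLp (p i) 2 (volume.restrict s))
    (mh : ∀ i j, MemLp (h i j) 2 (volume.restrict s)) : IntegrableOn (weightDens z p h) s :=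
  (integrableOn_zpow_norm_mul hρ hs hsρ (integrableOn_growthDens hs hsR mp mh) (by omega)).add
    (integrableOn_zpow_norm_mul hρ hs hsρ (integrableOn_radDens hs hsR mp) (by omega))

end Densities

/-- `r^{4-n} T(q / r²)`. -/
def scaledT (n : ℕ) (r q : ℝ) : ℝ := r ^ (4 - (n : ℤ)) * profileT n (q / r ^ 2)

theorem deriv_scale {f : ℝ → ℝ} (hf : ContDiff ℝ ∞ f) (c a : ℝ) :
    deriv (fun q => c * f (q / a)) = fun q => c / a * deriv f (q / a) := by
  funext q
  have h1 := (((hf.differentiable (by simp)) (q / a)).hasDerivAt.comp q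
    ((hasDerivAt_id q).div_const a)).const_mul c
  have h2 := h1.deriv
  refine Eq.trans (by rfl) (h2.trans ?_)
  ring

theorem rpow_div_sq {s r : ℝ} (hs : 0 < s) (hr : 0 < r) (m : ℕ) :
    (s ^ 2 / r ^ 2) ^ (-(m : ℝ) / 2) = s ^ (-(m : ℤ)) * r ^ m := by
  rw [← div_pow, ← Real.rpow_natCast (s / r) 2, ← Real.rpow_mul (by positivity)]
  rw [show ((2 : ℕ) : ℝ) * (-(m : ℝ) / 2) = -(m : ℝ) by push_cast; ring, Real.rpow_neg (by positivity),
    Real.rpow_natCast, div_pow, zpow_neg, zpow_natCast]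
  field_simp

theorem monotonicityForm_scaled {F : Type*} [NormedAddCommGroup F]
    [InnerProductSpace ℝ F] {r ρ : ℝ} (hr : 0 < r) (hρ : 0 < ρ) (X : Fin n → ℝ) (p : Fin n → F)
    (h : Fin n → Fin n → F) {T Z M : ℝ → ℝ} (hT : T = fun q => scaledT n r q - scaledT n ρ q)
    (hZ : Z = fun q => -2 * deriv T q) (hM : M = fun q => (4 - n) * T q + q * Z q) {q : ℝ}
    (hq : q = ∑ k, X k ^ 2) :
    monotonicityForm (M q) (Z q) (deriv Z q) (deriv (deriv Z) q) X p h
      = r ^ (2 - (n : ℤ)) * scaledForm n r (q / r ^ 2) X p h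
        - ρ ^ (2 - (n : ℤ)) * scaledForm n ρ (q / ρ ^ 2) X p h := by
  have cT := contDiff_profileT n
  have cZ := contDiff_profileZ n
  have cZ' := (contDiff_infty_iff_deriv.1 cZ).2
  have hd : ∀ {f : ℝ → ℝ}, ContDiff ℝ ∞ f → ∀ c a q, DifferentiableAt ℝ (fun q => c * f (q / a)) q :=
    fun hf c a q => ((contDiff_const.mul (hf.comp (contDiff_id.div_const a))).differentiable
      (by simp)) q
  have e4 : ∀ a : ℝ, 0 < a → a ^ (4 - (n : ℤ)) = a ^ (2 - (n : ℤ)) * a ^ 2 := fun a ha => by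
    rw [← zpow_natCast a 2, ← zpow_add₀ ha.ne']; congr 1; push_cast; ring
  have z1 : Z = fun q => r ^ (2 - (n : ℤ)) * profileZ n (q / r ^ 2)
      - ρ ^ (2 - (n : ℤ)) * profileZ n (q / ρ ^ 2) := by
    rw [hZ, hT]
    funext q
    unfold scaledT
    rw [deriv_fun_sub (hd cT _ _ _) (hd cT _ _ _), deriv_scale cT, deriv_scale cT, deriv_profileT,
      e4 r hr, e4 ρ hρ]
    field_simp
    ring
  have z2 : deriv Z = fun q => r ^ (2 - (n : ℤ)) / r ^ 2 * deriv (profileZ n) (q / r ^ 2)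
      - ρ ^ (2 - (n : ℤ)) / ρ ^ 2 * deriv (profileZ n) (q / ρ ^ 2) := by
    rw [z1]
    funext q
    rw [deriv_fun_sub (hd cZ _ _ _) (hd cZ _ _ _), deriv_scale cZ, deriv_scale cZ]
  have z3 : deriv (deriv Z) q = r ^ (2 - (n : ℤ)) / r ^ 2 / r ^ 2
        * deriv (deriv (profileZ n)) (q / r ^ 2)
      - ρ ^ (2 - (n : ℤ)) / ρ ^ 2 / ρ ^ 2 * deriv (deriv (profileZ n)) (q / ρ ^ 2) := by
    rw [z2, deriv_fun_sub (hd cZ' _ _ _) (hd cZ' _ _ _), deriv_scale cZ', deriv_scale cZ']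
  have m1 : M q = r ^ (2 - (n : ℤ)) * (r ^ 2 * profileM n (q / r ^ 2))
      - ρ ^ (2 - (n : ℤ)) * (ρ ^ 2 * profileM n (q / ρ ^ 2)) := by
    rw [hM]
    simp only [z1, hT, scaledT, profileM, e4 r hr, e4 ρ hρ]
    field_simp
    ring
  rw [z3, z2, m1, z1, monotonicityForm, scaledForm, scaledForm, profileW, profileW, normSq₂,
    normSq₁, normSq₁, ← hq]
  simp only [real_inner_self_eq_norm_sq]
  field_simp
  ring

theorem scaledT_of_ge (hn : 5 ≤ n) {r q : ℝ} (hr : 0 < r) (hq : 4 * r ^ 2 ≤ q) :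
    scaledT n r q = √q ^ (-((n - 4 : ℕ) : ℤ)) / (n - 4) := by
  have hr2 : 0 < r ^ 2 := by positivity
  have hq0 : 0 < q := by linarith
  have e1 : q / r ^ 2 = √q ^ 2 / r ^ 2 := by rw [sq_sqrt hq0.le]
  have e2 : -((n : ℝ) - 4) / 2 = -((n - 4 : ℕ) : ℝ) / 2 := by
    rw [Nat.cast_sub (by omega)]; norm_num
  have e3 : r ^ (4 - (n : ℤ)) * r ^ (n - 4) = 1 := by
    rw [← zpow_natCast r (n - 4), ← zpow_add₀ hr.ne', Nat.cast_sub (by omega)]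
    simp
  rw [scaledT, profileT_of_ge hn (by rw [le_div_iff₀ hr2]; exact hq), e1, e2,
    rpow_div_sq (Real.sqrt_pos.2 hq0) hr]
  linear_combination (√q ^ (-((n - 4 : ℕ) : ℤ)) / (n - 4)) * e3

theorem contDiff_scaledT (n : ℕ) (r : ℝ) : ContDiff ℝ ∞ (scaledT n r) :=
  contDiff_const.mul ((contDiff_profileT n).comp (contDiff_id.div_const _))

/-- The energy inequality in interior balls. -/
theorem exists_interior_energyInequality (hn : 5 ≤ n) (L : ℕ) : ∃ C, 0 ≤ C ∧
    ∀ {Ω : Set (E n)} {u : E n → E L} {p : Grad n L} {h : Hess n L},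
    IsOpen Ω → SobolevTwo Ω u p h → (∀ Y : E n → E n, IsTestFunction Ω Y →
      HasDerivAt (fun t : ℝ => hessianEnergy Ω fun x => u (x + t • Y x)) 0 0) →
    ∀ (z : E n) (R η : ℝ), 0 < R → ball z R ⊆ Ω →
      R ^ (4 - (n : ℤ)) * (∫ x in ball z R, hessDens h x)
        + R ^ (2 - (n : ℤ)) * (∫ x in ball z R, gradDens p x) ≤ η →
      EnergyInequality z R C η p h := by
  obtain ⟨c, hc, C1, hC1, b1⟩ := exists_le_neg_scaledForm (F := E L) hn
  obtain ⟨C2, hC2, b2⟩ := exists_abs_scaledForm_le (F := E L) n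
  have hc' : 0 < min c 1 := lt_min hc one_pos
  refine ⟨(min c 1)⁻¹ * (C1 + C2 * 4 ^ (n - 2)), by positivity, ?_⟩
  intro Ω u p h hΩ S hst z R η hR hzR hη r hr hrR
  have e4 : ∀ a : ℝ, 0 < a → a ^ (4 - (n : ℤ)) = a ^ (2 - (n : ℤ)) * a ^ 2 := fun a ha => by
    rw [← zpow_natCast a 2, ← zpow_add₀ ha.ne']; congr 1; push_cast; ring
  set ρ := R / 4 with hρd
  have hρ : 0 < ρ := by positivity
  have h2ρ : 0 < 2 * ρ := by positivity
  set K := closedBall z (2 * ρ) with hKd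
  have hKR : K ⊆ ball z R := closedBall_subset_ball (by rw [hρd]; linarith)
  have hKm : MeasurableSet K := isClosed_closedBall.measurableSet
  set T := fun q => scaledT n r q - scaledT n ρ q with hT
  have cT : ContDiff ℝ ∞ T := (contDiff_scaledT n r).sub (contDiff_scaledT n ρ)
  have T0 : ∀ q, (2 * ρ) ^ 2 < q → T q = 0 := fun q hq => by
    have h1 : 4 * ρ ^ 2 ≤ q := by nlinarith
    have h2 : 4 * r ^ 2 ≤ q := by
      have : r ^ 2 ≤ ρ ^ 2 := by gcongr; rw [hρd]; linarith
      linarith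
    rw [hT]
    simp only [scaledT_of_ge hn hr h2, scaledT_of_ge hn hρ h1, sub_self]
  set Z := fun q => -2 * deriv T q with hZ
  set M := fun q => (4 - (n : ℝ)) * T q + q * Z q with hM
  obtain ⟨iF, F0⟩ := S.integral_monotonicityForm_eq_zero hΩ cT h2ρ (hKR.trans hzR) T0 hst
    (fun q => rfl : ∀ q, Z q = _) (fun q => rfl : ∀ q, M q = _)
  have S' := S.mono (hKR.trans hzR)
  have SR := S.mono hzR
  set G := fun x => monotonicityForm (M (sqDist z x)) (Z (sqDist z x))
        (deriv Z (sqDist z x)) (deriv (deriv Z) (sqDist z x))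
        (fun k => x k - z k) (fun i => p i x) (fun i j => h i j x)
  have eG : ∀ x, G x = r ^ (2 - (n : ℤ)) * scaledForm n r (sqDist z x / r ^ 2) (fun k => x k - z k)
        (fun i => p i x) (fun i j => h i j x)
      - ρ ^ (2 - (n : ℤ)) * scaledForm n ρ (sqDist z x / ρ ^ 2) (fun k => x k - z k)
        (fun i => p i x) (fun i j => h i j x) := fun x =>
    monotonicityForm_scaled hr hρ _ _ _ hT hZ hM rfl
  set N := r ^ (2 - (n : ℤ)) with hN
  set N' := ρ ^ (2 - (n : ℤ)) with hN'
  have N0 : 0 < N := zpow_pos hr _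
  have N0' : 0 < N' := zpow_pos hρ _
  set U1 := ball z r with hU1
  set U2 := ball z (2 * r) \ ball z r
  set U3 := ball z ρ \ ball z (2 * r)
  have m1 : MeasurableSet U1 := measurableSet_ball
  have m2 : MeasurableSet U2 := measurableSet_ball.diff m1
  have m3 : MeasurableSet U3 := measurableSet_ball.diff measurableSet_ball
  have k1 : U1 ⊆ K := ball_subset_closedBall.trans
    (closedBall_subset_closedBall (by rw [hρd]; linarith))
  have k2 : U2 ⊆ K := sdiff_subset.trans (ball_subset_closedBall.trans
    (closedBall_subset_closedBall (by rw [hρd]; linarith)))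
  have k3 : U3 ⊆ K := sdiff_subset.trans (ball_subset_closedBall.trans
    (closedBall_subset_closedBall (by linarith)))
  have iH : IntegrableOn (hessDens h) K := integrableOn_hessDens S'.memLp_hess
  have iP : IntegrableOn (gradDens p) K := integrableOn_gradDens S'.memLp_grad
  have iC : IntegrableOn (crossDens r z p h) K :=
    integrableOn_crossDens hKm hKR S'.memLp_grad S'.memLp_hess r
  have iW : IntegrableOn (weightDens z p h) U3 := by
    refine integrableOn_weightDens (by omega) m3 (k3.trans hKR) (by positivity : 0 < 2 * r)
      (fun x hx => ?_) (S'.mono k3).memLp_grad (S'.mono k3).memLp_hess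
    have := hx.2
    rwa [mem_ball, dist_eq_norm, not_lt] at this
  have i1 : IntegrableOn (U1.indicator fun x => c * (N * r ^ 2) * hessDens h x) K :=
    (iH.const_mul _).indicator m1
  have i2 : IntegrableOn (U2.indicator fun x => C1 * N * crossDens r z p h x) K :=
    (iC.const_mul _).indicator m2
  have i3 : IntegrableOn (U3.indicator (weightDens z p h)) K := by
    rw [IntegrableOn, integrable_indicator_iff m3, IntegrableOn, Measure.restrict_restrict m3,
      inter_eq_self_of_subset_left k3]
    exact iW
  have i4 : IntegrableOn (fun x => C2 * N' * (ρ ^ 2 * hessDens h x + gradDens p x)) K :=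
    ((iH.const_mul _).add iP).const_mul _
  have key : ∀ x ∈ K, U1.indicator (fun x => c * (N * r ^ 2) * hessDens h x) x
      - U2.indicator (fun x => C1 * N * crossDens r z p h x) x + U3.indicator (weightDens z p h) x
      ≤ -G x + C2 * N' * (ρ ^ 2 * hessDens h x + gradDens p x) := fun x hx => by
    have hs := sqDist_eq z x
    rw [hKd, mem_closedBall, dist_eq_norm] at hx
    have hq : sqDist z x ≤ 4 * ρ ^ 2 := by
      rw [hs]; nlinarith [norm_nonneg (x - z)]
    have t1 := b2 ρ (fun k => x k - z k) (fun i => p i x) (fun i j => h i j x) hρ hq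
    have t2 := mul_le_mul_of_nonneg_left (neg_le_of_abs_le t1) N0'.le
    have t3 : -(N * scaledForm n r (sqDist z x / r ^ 2) (fun k => x k - z k)
        (fun i => p i x) (fun i j => h i j x))
        ≤ -G x + C2 * N' * (ρ ^ 2 * hessDens h x + gradDens p x) := by
      rw [eG]
      simp only [hessDens, gradDens]
      change N' * -_ ≤ N' * scaledForm n ρ (sqDist z x / ρ ^ 2) _ _ _ at t2
      linarith
    refine le_trans ?_ t3
    obtain ⟨s1, s2, s3⟩ := b1 r (fun k => x k - z k) (fun i => p i x) (fun i j => h i j x) hr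
    change sqDist z x < r ^ 2 → _ ≤ -scaledForm n r (sqDist z x / r ^ 2) _ _ _ at s1
    change r ^ 2 ≤ sqDist z x → sqDist z x < _ → _ ≤ -scaledForm n r (sqDist z x / r ^ 2) _ _ _ at s2
    change _ ≤ sqDist z x → (sqDist z x / r ^ 2) ^ _ * _ + _ * (sqDist z x / r ^ 2) ^ _ * _ ≤
      -scaledForm n r (sqDist z x / r ^ 2) _ _ _ at s3
    rcases lt_or_ge ‖x - z‖ r with c1 | c1
    · have u1 : x ∈ U1 := by rw [hU1, mem_ball, dist_eq_norm]; exact c1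
      have u2 : x ∉ U2 := fun hx => hx.2 u1
      have u3 : x ∉ U3 := fun hx => hx.2 (ball_subset_ball (by linarith) u1)
      rw [indicator_of_mem u1, indicator_of_notMem u2, indicator_of_notMem u3]
      have := mul_le_mul_of_nonneg_left (s1 (by rw [hs]; gcongr)) N0.le
      simp only [hessDens]
      linarith
    · have u1 : x ∉ U1 := by rw [hU1, mem_ball, dist_eq_norm, not_lt]; exact c1
      rcases lt_or_ge ‖x - z‖ (2 * r) with c2 | c2
      · have u2' : x ∈ ball z (2 * r) := by rw [mem_ball, dist_eq_norm]; exact c2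
        have u2 : x ∈ U2 := ⟨u2', u1⟩
        have u3 : x ∉ U3 := fun hx => hx.2 u2'
        rw [indicator_of_notMem u1, indicator_of_mem u2, indicator_of_notMem u3]
        have := mul_le_mul_of_nonneg_left (s2 (by rw [hs]; gcongr) (by rw [hs]; nlinarith)) N0.le
        simp only [crossDens]
        linarith
      · have u2' : x ∉ ball z (2 * r) := by
          rw [mem_ball, dist_eq_norm, not_lt]; exact c2
        have u2 : x ∉ U2 := fun hx => u2' hx.1
        rw [indicator_of_notMem u1, indicator_of_notMem u2]
        have hs0 : 0 < ‖x - z‖ := by linarith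
        have w1 : (sqDist z x / r ^ 2) ^ (-((n : ℝ) - 2) / 2) = ‖x - z‖ ^ (2 - (n : ℤ)) * N⁻¹ := by
          rw [hs, show -((n : ℝ) - 2) / 2 = -((n - 2 : ℕ) : ℝ) / 2 by
            rw [Nat.cast_sub (by omega)]; norm_num, rpow_div_sq hs0 hr, hN, ← zpow_neg,
            ← zpow_natCast r, Nat.cast_sub (by omega)]
          congr 2 <;> push_cast <;> ring
        have w2 : (r ^ 2)⁻¹ * (sqDist z x / r ^ 2) ^ (-(n : ℝ) / 2) = ‖x - z‖ ^ (-(n : ℤ)) * N⁻¹ := by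
          rw [hs, rpow_div_sq hs0 hr, hN, ← zpow_neg, ← zpow_natCast r, ← zpow_natCast r, ← zpow_neg,
            mul_left_comm, ← zpow_add₀ hr.ne']
          congr 2; push_cast; ring
        have := mul_le_mul_of_nonneg_left (s3 (by rw [hs]; nlinarith)) N0.le
        rw [w1, w2] at this
        have e5 : U3.indicator (weightDens z p h) x ≤ weightDens z p h x :=
          indicator_le_self' (fun _ _ => weightDens_nonneg _ _ _ _) x
        refine (by linarith : _ ≤ weightDens z p h x).trans ?_
        rw [← mul_neg]
        refine le_trans (le_of_eq ?_) this
        simp only [weightDens, growthDens, radDens]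
        field_simp
  have hint := setIntegral_mono_on ((i1.sub i2).add i3) (iF.neg.add i4) hKm key
  have j1 : ∫ x in K, (U1.indicator (fun x => c * (N * r ^ 2) * hessDens h x) x
      - U2.indicator (fun x => C1 * N * crossDens r z p h x) x + U3.indicator (weightDens z p h) x)
      = c * (N * r ^ 2) * (∫ x in U1, hessDens h x) - C1 * N * (∫ x in U2, crossDens r z p h x)
        + ∫ x in U3, weightDens z p h x := by
    have i12 : IntegrableOn (fun x => U1.indicator (fun x => c * (N * r ^ 2) * hessDens h x) x
      - U2.indicator (fun x => C1 * N * crossDens r z p h x) x) K := i1.sub i2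
    rw [integral_add i12 i3, integral_sub i1 i2, setIntegral_indicator m1,
      setIntegral_indicator m2, setIntegral_indicator m3, inter_eq_self_of_subset_right k1,
      inter_eq_self_of_subset_right k2, inter_eq_self_of_subset_right k3, integral_const_mul,
      integral_const_mul]
  have j2 : ∫ x in K, (-G x + C2 * N' * (ρ ^ 2 * hessDens h x + gradDens p x))
      = C2 * N' * (ρ ^ 2 * (∫ x in K, hessDens h x) + ∫ x in K, gradDens p x) := by
    have i5 : IntegrableOn (fun x => -G x) K := iF.neg
    have i6 : IntegrableOn (fun x => ρ ^ 2 * hessDens h x) K := iH.const_mul _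
    rw [integral_add i5 i4, integral_neg, F0, integral_const_mul, integral_add i6 iP, integral_const_mul]
    simp
  have hint' := (j1.symm.trans_le hint).trans_eq j2
  have l1 : ∫ x in K, hessDens h x ≤ ∫ x in ball z R, hessDens h x :=
    setIntegral_mono_set (integrableOn_hessDens SR.memLp_hess)
      (.of_forall fun x => hessDens_nonneg h x) hKR.eventuallyLE
  have l2 : ∫ x in K, gradDens p x ≤ ∫ x in ball z R, gradDens p x :=
    setIntegral_mono_set (integrableOn_gradDens SR.memLp_grad)
      (.of_forall fun x => gradDens_nonneg p x) hKR.eventuallyLE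
  have n1 : N' = 4 ^ (n - 2) * R ^ (2 - (n : ℤ)) := by
    rw [hN', hρd, div_zpow, div_eq_mul_inv, ← zpow_neg, ← zpow_natCast, Nat.cast_sub (by omega)]
    rw [mul_comm]; congr 2; push_cast; ring
  have R0 : 0 < R ^ (2 - (n : ℤ)) := zpow_pos hR _
  rw [e4 R hR] at hη
  have hH0 : 0 ≤ ∫ x in ball z R, hessDens h x := integral_nonneg (hessDens_nonneg h)
  have l3 : N' * (ρ ^ 2 * (∫ x in K, hessDens h x) + ∫ x in K, gradDens p x) ≤ 4 ^ (n - 2) * η := by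
    have q1 : ρ ^ 2 * (∫ x in K, hessDens h x) ≤ R ^ 2 * ∫ x in ball z R, hessDens h x := by
      have : ρ ^ 2 ≤ R ^ 2 := by rw [hρd]; gcongr; linarith
      gcongr
      exact integral_nonneg (hessDens_nonneg h)
    calc _ ≤ N' * (R ^ 2 * (∫ x in ball z R, hessDens h x)
          + ∫ x in ball z R, gradDens p x) := by gcongr
      _ = 4 ^ (n - 2) * (R ^ (2 - (n : ℤ)) * R ^ 2 * (∫ x in ball z R, hessDens h x)
          + R ^ (2 - (n : ℤ)) * ∫ x in ball z R, gradDens p x) := by rw [n1]; ring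
      _ ≤ _ := by gcongr
  rw [e4 r hr, ← hN]
  have f1 : 0 ≤ ∫ x in U1, hessDens h x := integral_nonneg (hessDens_nonneg h)
  have f2 : 0 ≤ ∫ x in U2, crossDens r z p h x := integral_nonneg (crossDens_nonneg r z p h)
  have f3 : 0 ≤ ∫ x in U3, weightDens z p h x := integral_nonneg (weightDens_nonneg z p h)
  have η0 : 0 ≤ η := by
    refine le_trans ?_ hη
    have : 0 ≤ ∫ x in ball z R, gradDens p x := integral_nonneg (gradDens_nonneg p)
    positivity
  have g1 : min c 1 * (N * r ^ 2 * (∫ x in U1, hessDens h x)) ≤ c * (N * r ^ 2 * ∫ x in U1, hessDens h x) := by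
    gcongr; exact min_le_left _ _
  have g2 : min c 1 * (∫ x in U3, weightDens z p h x) ≤ 1 * ∫ x in U3, weightDens z p h x := by
    gcongr; exact min_le_right _ _
  have g3 : 0 ≤ N * ∫ x in U2, crossDens r z p h x := by positivity
  have g4 : (0 : ℝ) ≤ C2 * 4 ^ (n - 2) := by positivity
  rw [mul_assoc (min c 1)⁻¹, mul_assoc (min c 1)⁻¹, ← mul_add, le_inv_mul_iff₀ hc']
  have l4 := mul_le_mul_of_nonneg_left l3 hC2
  nlinarith [mul_nonneg hC1 η0, mul_nonneg g4 g3]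

section IntegrationByParts

theorem integrableOn_testFunction_mul {O : Set (E n)} {ζ : E n → ℝ} (hζ : IsTestFunction O ζ)
    {s : Set (E n)} {f : E n → ℝ} (hf : IntegrableOn f s) :
    IntegrableOn (fun x => ζ x * f x) s := by
  obtain ⟨B, hB⟩ := hζ.exists_norm_le
  exact integrableOn_mul_of_bound hζ.contDiff.continuous hB hf

theorem setIntegral_testFunction_mul {O : Set (E n)} (hO : IsOpen O) {ζ : E n → ℝ}
    {K : Set (E n)} (hK : tsupport ζ ⊆ K) (hKO : K ⊆ O) (f : E n → ℝ) :
    ∫ x in O, ζ x * f x = ∫ x in K, ζ x * f x :=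
  (setIntegral_eq_of_subset_of_forall_sdiff_eq_zero hO.measurableSet hKO fun x hx => by
    rw [image_eq_zero_of_notMem_tsupport fun h => hx.2 (hK h), zero_mul])

theorem integral_testFunction_inner {O : Set (E n)} (hO : IsOpen O) {a b : E n → E L}
    {ga gb : Grad n L} (ma : MemLp a 2 (volume.restrict O))
    (mb : MemLp b 2 (volume.restrict O)) (mga : ∀ i, MemLp (ga i) 2 (volume.restrict O))
    (mgb : ∀ i, MemLp (gb i) 2 (volume.restrict O)) (wa : ∀ i, HasWeakPartial O i a (ga i))
    (wb : ∀ i, HasWeakPartial O i b (gb i)) {ζ : E n → ℝ} (hζ : IsTestFunction O ζ) (i : Fin n) :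
    (∫ x in O, ζ x * inner ℝ (ga i x) (b x)) + (∫ x in O, ζ x * inner ℝ (a x) (gb i x))
      + (∫ x in O, ∇ ζ x (e i) * inner ℝ (a x) (b x)) = 0 := by
  set K := tsupport ζ
  have hK : IsCompact K := hζ.hasCompactSupport
  have hKO : K ⊆ O := hζ.tsupport_subset
  have le := Measure.restrict_mono hKO (le_rfl : (volume : Measure (E n)) ≤ volume)
  have key : ∀ f : E n → E L, ContDiff ℝ ∞ f → MemLp f 2 (volume.restrict K) := fun f hf => by
    obtain ⟨C, hC⟩ := hK.exists_bound_of_continuousOn hf.continuous.continuousOn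
    have : IsFiniteMeasure (volume.restrict K) := ⟨by simpa using hK.measure_lt_top⟩
    exact MemLp.of_bound hf.continuous.aestronglyMeasurable C
      ((ae_restrict_iff' hK.measurableSet).2 (Eventually.of_forall hC))
  obtain ⟨u, u1, u2, u3, u4⟩ := exists_smooth_approx_one hO hK hKO ma mga wa
  obtain ⟨v, v1, v2, v3, v4⟩ := exists_smooth_approx_one hO hK hKO mb mgb wb
  have tu : TendstoLTwo K u a := ⟨fun m => key _ (u1 m), ma.mono_measure le, u3⟩
  have tv : TendstoLTwo K v b := ⟨fun m => key _ (v1 m), mb.mono_measure le, v3⟩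
  have tu' : TendstoLTwo K (fun m x => ∇ (u m) x (e i)) (ga i) :=
    ⟨fun m => key _ (contDiff_fderiv_apply (u1 m) _), (mga i).mono_measure le, u4 i⟩
  have tv' : TendstoLTwo K (fun m x => ∇ (v m) x (e i)) (gb i) :=
    ⟨fun m => key _ (contDiff_fderiv_apply (v1 m) _), (mgb i).mono_measure le, v4 i⟩
  have hζ' := hζ.fderiv_apply (e i)
  have hsub : tsupport (fun x => ∇ ζ x (e i)) ⊆ K := tsupport_fderiv_apply_subset ℝ _
  rw [setIntegral_testFunction_mul hO le_rfl hKO, setIntegral_testFunction_mul hO le_rfl hKO,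
    setIntegral_testFunction_mul hO hsub hKO]
  have t1 := tu'.mul_inner hK tv hζ.contDiff.continuous
  have t2 := tu.mul_inner hK tv' hζ.contDiff.continuous
  have t3 := tu.mul_inner hK tv hζ'.contDiff.continuous
  refine tendsto_nhds_unique ((t1.tendsto.add t2.tendsto).add t3.tendsto)
    (tendsto_const_nhds.congr fun m => ?_)
  have i12 : IntegrableOn (fun x => ζ x * inner ℝ (∇ (u m) x (e i)) (v m x)
    + ζ x * inner ℝ (u m x) (∇ (v m) x (e i))) K := (t1.integrable m).add (t2.integrable m)
  rw [← integral_add (t1.integrable m) (t2.integrable m), ← integral_add i12 (t3.integrable m)]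
  have cf : ContDiff ℝ ∞ fun x => ζ x * inner ℝ (u m x) (v m x) :=
    hζ.contDiff.mul ((u1 m).inner ℝ (v1 m))
  have hc : HasCompactSupport fun x => ζ x * inner ℝ (u m x) (v m x) :=
    hζ.hasCompactSupport.mul_right
  have h0 := integral_fderiv_apply_eq_zero (cf.of_le (by simp)) hc (e i)
  have e1 : ∀ x, ∇ (fun x => ζ x * inner ℝ (u m x) (v m x)) x (e i)
      = ζ x * inner ℝ (∇ (u m) x (e i)) (v m x) + ζ x * inner ℝ (u m x) (∇ (v m) x (e i))
        + ∇ ζ x (e i) * inner ℝ (u m x) (v m x) := fun x => by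
    have d1 := (hζ.contDiff.differentiable (by simp)) x
    have d2 := ((u1 m).differentiable (by simp)) x
    have d3 := ((v1 m).differentiable (by simp)) x
    rw [fderiv_fun_mul d1 (d2.inner ℝ d3)]
    simp only [add_apply, smul_apply, smul_eq_mul, fderiv_inner_apply ℝ d2 d3]
    ring
  simp only [e1] at h0
  rw [setIntegral_eq_integral_of_forall_compl_eq_zero fun x hx => ?_, h0]
  rw [image_eq_zero_of_notMem_tsupport hx,
    image_eq_zero_of_notMem_tsupport (f := fun x => ∇ ζ x (e i)) fun h => hx (hsub h)]
  simp

variable {O : Set (E n)} {w : E n → E L} {p : Grad n L} {h : Hess n L}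

theorem SobolevTwo.integral_mul_gradDens (hO : IsOpen O) (S : SobolevTwo O w p h) {ζ : E n → ℝ}
    (hζ : IsTestFunction O ζ) :
    ∫ x in O, ζ x * gradDens p x = - (∫ x in O, ζ x * inner ℝ (w x) (lapH fun i j => h i j x))
      + (∫ x in O, (∑ i, ∇ (fun y => ∇ ζ y (e i)) x (e i)) * ‖w x‖ ^ 2) / 2 := by
  have h1 : ∀ i, ∫ x in O, ζ x * ‖p i x‖ ^ 2 = - (∫ x in O, ζ x * inner ℝ (w x) (h i i x))
      + (∫ x in O, ∇ (fun y => ∇ ζ y (e i)) x (e i) * ‖w x‖ ^ 2) / 2 := fun i => by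
    have e1 := integral_testFunction_inner hO S.memLp (S.memLp_grad i) S.memLp_grad (S.memLp_hess i)
      S.weak_grad (S.weak_hess i) hζ i
    have e2 := integral_testFunction_inner hO S.memLp S.memLp S.memLp_grad S.memLp_grad
      S.weak_grad S.weak_grad (hζ.fderiv_apply (e i)) i
    simp only [real_inner_self_eq_norm_sq, fun x => real_inner_comm (w x) (p i x)] at e1 e2
    linarith
  have j1 : ∀ i, IntegrableOn (fun x => ζ x * ‖p i x‖ ^ 2) O := fun i =>
    integrableOn_testFunction_mul hζ (S.memLp_grad i).norm.integrable_sq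
  have j2 : ∀ i, IntegrableOn (fun x => ζ x * inner ℝ (w x) (h i i x)) O := fun i =>
    integrableOn_testFunction_mul hζ (integrable_inner_of_memLp S.memLp (S.memLp_hess i i))
  have j3 : ∀ i, IntegrableOn (fun x => ∇ (fun y => ∇ ζ y (e i)) x (e i) * ‖w x‖ ^ 2) O := fun i =>
    integrableOn_testFunction_mul ((hζ.fderiv_apply (e i)).fderiv_apply (e i))
      S.memLp.norm.integrable_sq
  simp only [gradDens, normSq₁, lapH, inner_sum, mul_sum, Finset.sum_mul]
  rw [integral_finsetSum _ fun i _ => j1 i, integral_finsetSum _ fun i _ => j2 i,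
    integral_finsetSum _ fun i _ => j3 i, sum_congr rfl fun i _ => h1 i,
    sum_add_distrib, Finset.sum_neg_distrib, Finset.sum_div]

theorem SobolevTwo.integral_radial_gradDens (hO : IsOpen O) (S : SobolevTwo O w p h)
    {ψ : E n → ℝ} (hψ : IsTestFunction O ψ) (z : E n) :
    ∫ x in O, (n * ψ x + ∑ i, (x i - z i) * ∇ ψ x (e i)) * gradDens p x
      = -2 * ∫ x in O, ψ x * ∑ k, inner ℝ (p k x) (∑ i, (x i - z i) • h k i x) := by
  have cX : ∀ i, ContDiff ℝ ∞ fun x : E n => x i - z i := fun i =>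
    (contDiff_euclidean.1 contDiff_id i).sub contDiff_const
  have hψ' : ∀ i, IsTestFunction O fun x => (x i - z i) * ψ x := fun i => hψ.mul_left (cX i)
  have hf : ∀ i x, ∇ (fun x => (x i - z i) * ψ x) x (e i)
      = ψ x + (x i - z i) * ∇ ψ x (e i) := fun i x => by
    rw [fderiv_fun_mul (((cX i).differentiable (by simp)) x)
      ((hψ.contDiff.differentiable (by simp)) x)]
    simp only [add_apply, smul_apply, smul_eq_mul, fderiv_coord_sub, if_true]
    ring
  have h1 : ∀ i k, ∫ x in O, (ψ x + (x i - z i) * ∇ ψ x (e i)) * ‖p k x‖ ^ 2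
      = -2 * ∫ x in O, (x i - z i) * ψ x * inner ℝ (p k x) (h k i x) := fun i k => by
    have e1 := integral_testFunction_inner hO (S.memLp_grad k) (S.memLp_grad k) (S.memLp_hess k)
      (S.memLp_hess k) (S.weak_hess k) (S.weak_hess k) (hψ' i) i
    simp only [hf, real_inner_self_eq_norm_sq, fun x => real_inner_comm (p k x) (h k i x)] at e1
    linarith
  have j1 : ∀ i k, IntegrableOn (fun x => (ψ x + (x i - z i) * ∇ ψ x (e i))
      * ‖p k x‖ ^ 2) O := fun i k => by
    simp only [← hf]
    exact integrableOn_testFunction_mul ((hψ' i).fderiv_apply (e i))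
      (S.memLp_grad k).norm.integrable_sq
  have j2 : ∀ i k, IntegrableOn (fun x => (x i - z i) * ψ x * inner ℝ (p k x) (h k i x)) O :=
    fun i k => integrableOn_testFunction_mul (hψ' i)
      (integrable_inner_of_memLp (S.memLp_grad k) (S.memLp_hess k i))
  have e1 : ∀ x, (n * ψ x + ∑ i, (x i - z i) * ∇ ψ x (e i)) * gradDens p x
      = ∑ i, ∑ k, (ψ x + (x i - z i) * ∇ ψ x (e i)) * ‖p k x‖ ^ 2 := fun x => by
    simp only [← mul_sum, ← Finset.sum_mul, sum_add_distrib, sum_const,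
      card_univ, Fintype.card_fin, nsmul_eq_mul, gradDens, normSq₁]
  have e2 : ∀ x, ψ x * ∑ k, inner ℝ (p k x) (∑ i, (x i - z i) • h k i x)
      = ∑ i, ∑ k, (x i - z i) * ψ x * inner ℝ (p k x) (h k i x) := fun x => by
    rw [sum_comm]
    simp only [inner_sum, inner_smul_right, mul_sum]
    exact sum_congr rfl fun k _ => sum_congr rfl fun i _ => by ring
  simp only [e1, e2]
  rw [integral_finsetSum _ fun i _ => integrable_finsetSum _ fun k _ => j1 i k,
    integral_finsetSum _ fun i _ => integrable_finsetSum _ fun k _ => j2 i k, mul_sum]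
  refine sum_congr rfl fun i _ => ?_
  rw [integral_finsetSum _ fun k _ => j1 i k, integral_finsetSum _ fun k _ => j2 i k, mul_sum]
  exact sum_congr rfl fun k _ => h1 i k

end IntegrationByParts

theorem integral_mul_le_sqrt_mul_sqrt {α : Type*} [MeasurableSpace α] {μ : Measure α}
    {f g : α → ℝ} (hf : Integrable f μ) (hg : Integrable g μ) (hf0 : ∀ x, 0 ≤ f x)
    (hg0 : ∀ x, 0 ≤ g x) :
    ∫ x, √(f x) * √(g x) ∂μ ≤ √(∫ x, f x ∂μ) * √(∫ x, g x ∂μ) := by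
  have h := integral_mul_le_Lp_mul_Lq_of_nonneg (μ := μ) Real.HolderConjugate.two_two
    (f := fun x => √(f x)) (g := fun x => √(g x))
    (.of_forall fun x => sqrt_nonneg _)
    (.of_forall fun x => sqrt_nonneg _) (by simpa using memLp_sqrt hf hf0)
    (by simpa using memLp_sqrt hg hg0)
  have e : ∀ y : ℝ, 0 ≤ y → √y ^ (2 : ℝ) = y := fun y hy => by
    rw [Real.rpow_two, sq_sqrt hy]
  simp only [e _ (hf0 _), e _ (hg0 _)] at h
  rwa [Real.sqrt_eq_rpow (∫ x, f x ∂μ), Real.sqrt_eq_rpow (∫ x, g x ∂μ)]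

theorem volume_real_ball (z : E n) {r : ℝ} (hr : 0 < r) :
    volume.real (ball z r) = r ^ n * volume.real (ball (0 : E n) 1) := by
  rw [Measure.real, Measure.addHaar_ball_of_pos _ _ hr, ENNReal.toReal_mul,
    toReal_ofReal (by positivity), Measure.real]
  simp

theorem sum_fderiv_fderiv_comp_sqDist {f : ℝ → ℝ} (hf : ContDiff ℝ ∞ f) (z x : E n) :
    ∑ i, ∇ (fun y => ∇ (fun y => f (sqDist z y)) y (e i)) x (e i)
      = 4 * sqDist z x * deriv (deriv f) (sqDist z x) + 2 * n * deriv f (sqDist z x) := by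
  have hf' : ContDiff ℝ ∞ (deriv f) := (contDiff_infty_iff_deriv.1 hf).2
  have d1 : DifferentiableAt ℝ (fun y => deriv f (sqDist z y)) x :=
    ((hf'.comp (contDiff_sqDist z)).differentiable (by simp)) x
  have key : ∀ i, ∇ (fun y => ∇ (fun y => f (sqDist z y)) y (e i)) x (e i)
      = 4 * deriv (deriv f) (sqDist z x) * (x i - z i) ^ 2 + 2 * deriv f (sqDist z x) := fun i => by
    have d2 := (hasFDerivAt_coord_sub z i x).differentiableAt
    simp only [fderiv_comp_sqDist hf]
    rw [fderiv_fun_mul d1 (d2.const_mul 2), fderiv_const_mul d2]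
    simp only [add_apply, smul_apply, fderiv_coord_sub, fderiv_comp_sqDist hf', smul_eq_mul,
      if_true]
    ring
  rw [sum_congr rfl fun i _ => key i, sum_add_distrib, ← mul_sum,
    show ∑ i, (x i - z i) ^ 2 = sqDist z x from rfl]
  simp only [sum_const, card_univ, Fintype.card_fin, nsmul_eq_mul]
  ring

theorem isTestFunction_of_sqDist {ψ : E n → ℝ} (hψ : ContDiff ℝ ∞ ψ) {z : E n} {a R : ℝ}
    (ha : a < R ^ 2) (hR : 0 < R) (h0 : ∀ x, a < sqDist z x → ψ x = 0) :
    IsTestFunction (ball z R) ψ := by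
  have h1 : tsupport ψ ⊆ {x | sqDist z x ≤ a} := by
    refine closure_minimal (fun x hx => ?_)
      (isClosed_le (contDiff_sqDist z).continuous continuous_const)
    by_contra h2
    exact hx (h0 x (not_le.1 h2))
  have h2 : tsupport ψ ⊆ ball z R := fun x hx => by
    have := h1 hx
    rw [mem_ofPred_eq, sqDist_eq] at this
    rw [mem_ball, dist_eq_norm]
    exact lt_of_pow_lt_pow_left₀ 2 hR.le (this.trans_lt ha)
  exact ⟨hψ, (isCompact_closedBall z R).of_isClosed_subset (isClosed_tsupport _)
    (h2.trans ball_subset_closedBall), h2⟩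

theorem exists_step_bound : ∃ B, 0 ≤ B ∧ ∀ τ ∈ Icc (0 : ℝ) 4,
    |deriv step τ| ≤ B ∧ |deriv (deriv step) τ| ≤ B := by
  have h2 := (contDiff_infty_iff_deriv.1 contDiff_step).2
  have h3 := (contDiff_infty_iff_deriv.1 h2).2
  obtain ⟨C1, b1⟩ := isCompact_Icc.exists_bound_of_continuousOn
    h2.continuous.continuousOn (s := Icc (0 : ℝ) 4)
  obtain ⟨C2, b2⟩ := isCompact_Icc.exists_bound_of_continuousOn
    h3.continuous.continuousOn (s := Icc (0 : ℝ) 4)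
  exact ⟨max C1 C2, ((norm_nonneg _).trans (b1 0 (by simp))).trans (le_max_left _ _),
    fun τ hτ => ⟨(b1 τ hτ).trans (le_max_left _ _), (b2 τ hτ).trans (le_max_right _ _)⟩⟩

theorem step_le_one (τ : ℝ) : step τ ≤ 1 := Real.smoothTransition.le_one _

theorem zpow_four_sub (n : ℕ) {a : ℝ} (ha : 0 < a) :
    a ^ (4 - (n : ℤ)) = a ^ (2 - (n : ℤ)) * a ^ 2 := by
  rw [← zpow_natCast a 2, ← zpow_add₀ ha.ne']; congr 1; push_cast; ring

theorem zpow_two_sub (n : ℕ) {a : ℝ} (ha : 0 < a) : a ^ (2 - (n : ℤ)) = a ^ 2 / a ^ n := by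
  rw [zpow_sub₀ ha.ne']; norm_cast

/-- Interpolation of the gradient between bounded functions and the Hessian. -/
theorem exists_interpolation (n L : ℕ) {K₀ : ℝ} (hK₀ : 0 ≤ K₀) : ∃ C, 0 ≤ C ∧
    ∀ {w : E n → E L} {p : Grad n L} {h : Hess n L} {z : E n} {r : ℝ},
    0 < r → SobolevTwo (ball z (2 * r)) w p h →
    (∀ᵐ x ∂(volume.restrict (ball z (2 * r))), ‖w x‖ ≤ K₀) →
    r ^ (2 - (n : ℤ)) * (∫ x in ball z r, gradDens p x)
      ≤ C * (√((2 * r) ^ (4 - (n : ℤ)) * ∫ x in ball z (2 * r), hessDens h x) + 1) := by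
  obtain ⟨B, hB, hb⟩ := exists_step_bound
  set κ := volume.real (ball (0 : E n) 1) with hκ
  have κ0 : 0 ≤ κ := measureReal_nonneg
  refine ⟨K₀ * n * √ (κ * 4 ^ n) + (16 + 2 * n) * B * K₀ ^ 2 * (2 ^ n * κ), by positivity, ?_⟩
  intro w p h z r hr S hw
  set O := ball z (2 * r) with hO
  have hOm : MeasurableSet O := measurableSet_ball
  have hr2 : 0 < r ^ 2 := by positivity
  set f : ℝ → ℝ := fun q => 1 + (-1) * step (q / r ^ 2) with hf
  have cf : ContDiff ℝ ∞ f :=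
    contDiff_const.add (contDiff_const.mul (contDiff_step.comp (contDiff_id.div_const _)))
  have f1 : deriv f = fun q => -1 / r ^ 2 * deriv step (q / r ^ 2) := by
    funext q; rw [hf, deriv_const_add, deriv_scale contDiff_step]
  have f2 : deriv (deriv f) = fun q => -1 / r ^ 2 / r ^ 2 * deriv (deriv step) (q / r ^ 2) := by
    funext q; rw [f1, deriv_scale (contDiff_infty_iff_deriv.1 contDiff_step).2]
  set ζ : E n → ℝ := fun x => f (sqDist z x) with hζd
  have hζ : IsTestFunction O ζ := by
    refine isTestFunction_of_sqDist (cf.comp (contDiff_sqDist z)) (a := 3 * r ^ 2) (by nlinarith)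
      (by positivity) fun x hx => ?_
    change 1 + -1 * step (sqDist z x / r ^ 2) = 0
    rw [step_of_ge (by rw [le_div_iff₀ hr2]; linarith)]; ring
  have ζ0 : ∀ x, 0 ≤ ζ x := fun x => by
    simp only [hζd, hf]; linarith [step_le_one (sqDist z x / r ^ 2)]
  have ζ1 : ∀ x, ζ x ≤ 1 := fun x => by
    simp only [hζd, hf]; linarith [step_nonneg (sqDist z x / r ^ 2)]
  have hΔ : ∀ x ∈ O, |∑ i, ∇ (fun y => ∇ ζ y (e i)) x (e i)|
      ≤ (16 + 2 * n) * B / r ^ 2 := fun x hx => by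
    have hq0 : 0 ≤ sqDist z x := by rw [sqDist_eq]; positivity
    have hq : sqDist z x ≤ 4 * r ^ 2 := by
      rw [hO, mem_ball, dist_eq_norm] at hx
      rw [sqDist_eq]; nlinarith [norm_nonneg (x - z)]
    obtain ⟨c1, c2⟩ := hb (sqDist z x / r ^ 2) ⟨by positivity, by rwa [div_le_iff₀ hr2]⟩
    rw [hζd, sum_fderiv_fderiv_comp_sqDist cf, f2, f1]
    have d1 : |4 * sqDist z x * (-1 / r ^ 2 / r ^ 2 * deriv (deriv step) (sqDist z x / r ^ 2))|
        ≤ 16 * B / r ^ 2 := by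
      rw [abs_mul, abs_mul, abs_mul, abs_of_nonneg hq0, abs_of_pos (by norm_num : (0 : ℝ) < 4),
        abs_div, abs_div, abs_neg, abs_one, abs_of_pos hr2]
      calc 4 * sqDist z x * (1 / r ^ 2 / r ^ 2 * |deriv (deriv step) (sqDist z x / r ^ 2)|)
          ≤ 4 * (4 * r ^ 2) * (1 / r ^ 2 / r ^ 2 * B) := by gcongr
        _ = _ := by field_simp; ring
    have d2 : |2 * n * (-1 / r ^ 2 * deriv step (sqDist z x / r ^ 2))| ≤ 2 * n * B / r ^ 2 := by
      rw [abs_mul, abs_mul, abs_mul, abs_of_nonneg (Nat.cast_nonneg n : (0 : ℝ) ≤ n),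
        abs_of_pos (by norm_num : (0 : ℝ) < 2), abs_div, abs_neg, abs_one, abs_of_pos hr2]
      calc 2 * n * (1 / r ^ 2 * |deriv step (sqDist z x / r ^ 2)|)
          ≤ 2 * n * (1 / r ^ 2 * B) := by gcongr
        _ = _ := by ring
    refine (abs_add_le _ _).trans ((add_le_add d1 d2).trans_eq ?_)
    ring
  have iH := integrableOn_hessDens S.memLp_hess
  have iP := integrableOn_gradDens S.memLp_grad
  have hfin : volume O ≠ ⊤ := isBounded_ball.measure_lt_top.ne
  have : IsFiniteMeasure (volume.restrict O) := ⟨by simpa using hfin.lt_top⟩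
  have i1 : Integrable (fun _ : E n => (1 : ℝ)) (volume.restrict O) := integrable_const _
  have iS : IntegrableOn (fun x => √(hessDens h x)) O := by
    have := (memLp_sqrt iH (hessDens_nonneg h)).integrable_mul (memLp_sqrt i1 fun _ => zero_le_one)
    exact this.congr (.of_forall fun x => by simp)
  have id := S.integral_mul_gradDens isOpen_ball hζ
  have b0 : ∫ x in ball z r, gradDens p x ≤ ∫ x in O, ζ x * gradDens p x := by
    have hsub : ball z r ⊆ O := ball_subset_ball (by linarith)
    have e1 : ∫ x in ball z r, gradDens p x = ∫ x in ball z r, ζ x * gradDens p x := by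
      refine setIntegral_congr_fun measurableSet_ball fun x hx => ?_
      rw [mem_ball, dist_eq_norm] at hx
      have : sqDist z x / r ^ 2 ≤ 1 := by
        rw [div_le_one hr2, sqDist_eq]; gcongr
      simp only [hζd, hf, step_of_le this]; ring
    rw [e1]
    exact setIntegral_mono_set (integrableOn_testFunction_mul hζ iP)
      (.of_forall fun x => mul_nonneg (ζ0 x) (gradDens_nonneg p x)) hsub.eventuallyLE
  have b1 : -(∫ x in O, ζ x * inner ℝ (w x) (lapH fun i j => h i j x))
      ≤ K₀ * n * ∫ x in O, √(hessDens h x) := by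
    rw [← integral_neg, ← integral_const_mul]
    refine integral_mono_ae ?_ (iS.const_mul _) ?_
    · exact (integrableOn_testFunction_mul hζ (integrable_inner_of_memLp S.memLp
        (memLp_finsetSum _ fun i _ => S.memLp_hess i i))).neg
    · filter_upwards [hw] with x hx
      have c1 := abs_real_inner_le_norm (w x) (lapH fun i j => h i j x)
      have c2 := norm_lapH_le fun i j => h i j x
      have c3 : ‖w x‖ * ‖lapH fun i j => h i j x‖ ≤ K₀ * (n * √(hessDens h x)) :=
        mul_le_mul hx c2 (norm_nonneg _) hK₀
      have c4 := neg_abs_le (inner ℝ (w x) (lapH fun i j => h i j x))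
      have c5 : 0 ≤ K₀ * (n * √(hessDens h x)) := by positivity
      have c6 := mul_le_mul_of_nonneg_left (by linarith : -(K₀ * (n * √(hessDens h x)))
        ≤ inner ℝ (w x) (lapH fun i j => h i j x)) (ζ0 x)
      have c7 := mul_le_mul_of_nonneg_right (ζ1 x) c5
      linarith
  have b2 : ∫ x in O, √(hessDens h x) ≤ √(∫ x in O, hessDens h x) * √((2 * r) ^ n * κ) := by
    have := integral_mul_le_sqrt_mul_sqrt iH i1 (hessDens_nonneg h) fun _ => zero_le_one
    have e0 := volume_real_ball z (by positivity : 0 < 2 * r)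
    rw [← hκ] at e0
    rw [← e0]
    simpa using this
  have b3 : ∫ x in O, (∑ i, ∇ (fun y => ∇ ζ y (e i)) x (e i)) * ‖w x‖ ^ 2
      ≤ (16 + 2 * n) * B / r ^ 2 * K₀ ^ 2 * ((2 * r) ^ n * κ) := by
    have : ∫ x in O, (16 + 2 * n) * B / r ^ 2 * K₀ ^ 2
        = (16 + 2 * n) * B / r ^ 2 * K₀ ^ 2 * ((2 * r) ^ n * κ) := by
      rw [integral_const, measureReal_restrict_apply_univ, volume_real_ball z (by positivity),
        smul_eq_mul, mul_comm]
    rw [← this]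
    refine integral_mono_ae ?_ (integrable_const _) ?_
    · exact integrableOn_testFunction_mul (IsTestFunction.sum _ fun i _ =>
        (hζ.fderiv_apply (e i)).fderiv_apply (e i)) S.memLp.norm.integrable_sq
    · filter_upwards [hw, ae_restrict_mem hOm] with x hx hxO
      have c1 : ‖w x‖ ^ 2 ≤ K₀ ^ 2 := pow_le_pow_left₀ (norm_nonneg _) hx 2
      exact mul_le_mul ((le_abs_self _).trans (hΔ x hxO)) c1 (sq_nonneg _) (by positivity)
  set I := ∫ x in O, hessDens h x
  have I0 : 0 ≤ I := integral_nonneg (hessDens_nonneg h)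
  have N0 : 0 < r ^ (2 - (n : ℤ)) := zpow_pos hr _
  have b4 : ∫ x in ball z r, gradDens p x ≤ K₀ * n * (√I * √((2 * r) ^ n * κ))
      + (16 + 2 * n) * B / r ^ 2 * K₀ ^ 2 * ((2 * r) ^ n * κ) := by
    have c1 : K₀ * n * ∫ x in O, √(hessDens h x) ≤ K₀ * n * (√I * √((2 * r) ^ n * κ)) := by gcongr
    have c2 : 0 ≤ (16 + 2 * n) * B / r ^ 2 * K₀ ^ 2 * ((2 * r) ^ n * κ) := by positivity
    linarith
  have e1 : r ^ (2 - (n : ℤ)) * (√I * √((2 * r) ^ n * κ))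
      ≤ √(κ * 4 ^ n) * √((2 * r) ^ (4 - (n : ℤ)) * I) := by
    rw [← sqrt_mul I0, ← sqrt_mul (by positivity), ← Real.sqrt_sq N0.le, ← sqrt_mul (by positivity)]
    refine sqrt_le_sqrt ?_
    have hr2' : 0 < 2 * r := by positivity
    rw [zpow_four_sub n hr2', zpow_two_sub n hr2', zpow_two_sub n hr, mul_pow 2 r n]
    have h4 : (4 : ℝ) ^ n = 2 ^ n * 2 ^ n := by rw [← mul_pow]; norm_num
    rw [h4]
    have : (r ^ 2 / r ^ n) ^ 2 * (I * (2 ^ n * r ^ n * κ))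
        = 2 ^ n * (r ^ 4 / r ^ n * I * κ) := by field_simp
    rw [this]
    have h5 : κ * (2 ^ n * 2 ^ n) * ((2 * r) ^ 2 / (2 ^ n * r ^ n) * (2 * r) ^ 2 * I)
        = 16 * (2 ^ n * (r ^ 4 / r ^ n * I * κ)) := by field_simp; ring
    rw [h5]
    have : 0 ≤ 2 ^ n * (r ^ 4 / r ^ n * I * κ) := by positivity
    linarith
  have e2 : r ^ (2 - (n : ℤ)) * ((16 + 2 * n) * B / r ^ 2 * K₀ ^ 2 * ((2 * r) ^ n * κ))
      = (16 + 2 * n) * B * K₀ ^ 2 * (2 ^ n * κ) := by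
    rw [zpow_two_sub n hr, mul_pow]; field_simp
  set s := √((2 * r) ^ (4 - (n : ℤ)) * I)
  have s0 : 0 ≤ s := sqrt_nonneg _
  calc r ^ (2 - (n : ℤ)) * (∫ x in ball z r, gradDens p x)
      ≤ r ^ (2 - (n : ℤ)) * (K₀ * n * (√I * √((2 * r) ^ n * κ))
      + (16 + 2 * n) * B / r ^ 2 * K₀ ^ 2 * ((2 * r) ^ n * κ)) := by gcongr
    _ = K₀ * n * (r ^ (2 - (n : ℤ)) * (√I * √((2 * r) ^ n * κ)))
      + (16 + 2 * n) * B * K₀ ^ 2 * (2 ^ n * κ) := by rw [mul_add, e2]; ring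
    _ ≤ K₀ * n * (√(κ * 4 ^ n) * s) + (16 + 2 * n) * B * K₀ ^ 2 * (2 ^ n * κ) := by gcongr
    _ ≤ _ := by
      have q1 : 0 ≤ K₀ * n * √ (κ * 4 ^ n) := by positivity
      have q2 : 0 ≤ (16 + 2 * n) * B * K₀ ^ 2 * (2 ^ n * κ) := by positivity
      nlinarith [mul_nonneg q2 s0]

theorem rpow_sq_neg_half {s : ℝ} (hs : 0 < s) (k : ℕ) : (s ^ 2) ^ (-(k : ℝ) / 2) = (s ^ k)⁻¹ := by
  have h := rpow_div_sq hs one_pos k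
  simpa [zpow_neg] using h

theorem deriv_step_of_lt {τ : ℝ} (h : τ < 1) : deriv step τ = 0 := by
  have : step =ᶠ[𝓝 τ] fun _ => 0 := by
    filter_upwards [isOpen_Iio.mem_nhds h] with s hs using step_of_le (le_of_lt hs)
  rw [this.deriv_eq]; simp

/-- The Dirichlet energy decays at small scales, up to the Hessian energy. -/
theorem exists_gradient_contraction (hn : 3 ≤ n) (L : ℕ) : ∃ C, 0 ≤ C ∧
    ∀ {w : E n → E L} {p : Grad n L} {h : Hess n L} {z : E n} {r R : ℝ},
    0 < r → r ≤ R / 2 → SobolevTwo (ball z R) w p h →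
    r ^ (2 - (n : ℤ)) * (∫ x in ball z r, gradDens p x)
      ≤ C * (r ^ (4 - (n : ℤ)) * (∫ x in ball z R, hessDens h x)
        + r / R * (R ^ (2 - (n : ℤ)) * ∫ x in ball z R, gradDens p x)) := by
  obtain ⟨B, hB, hb⟩ := exists_step_bound
  obtain ⟨k, rfl⟩ : ∃ k, n = k + 1 := ⟨n - 1, by omega⟩
  have hk : 2 ≤ k := by omega
  have hkR : (2 : ℝ) ≤ k := by exact_mod_cast hk
  refine ⟨2 ^ (k + 2) + 2 ^ (k + 1) * (8 * B * 2 ^ k), by positivity, ?_⟩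
  intro w p h z r R hr hrR S
  have hR : 0 < R := by linarith
  set O := ball z R with hO
  set a : ℝ := -(k : ℝ) / 2 with ha
  set f : ℝ → ℝ := fun q => (q + r ^ 2) ^ a * (1 - step (q / (R ^ 2 / 4))) with hf
  have hr2 : 0 < r ^ 2 := by positivity
  have hR4 : 0 < R ^ 2 / 4 := by positivity
  have q0 : ∀ x, 0 ≤ sqDist z x := fun x => by rw [sqDist_eq]; positivity
  have df : ∀ q, 0 ≤ q → HasDerivAt f (a * (q + r ^ 2) ^ (a - 1) * (1 - step (q / (R ^ 2 / 4)))
      - (q + r ^ 2) ^ a * (deriv step (q / (R ^ 2 / 4)) / (R ^ 2 / 4))) q := fun q hq => by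
    have h1 : HasDerivAt (fun q => (q + r ^ 2) ^ a) _ q :=
      ((hasDerivAt_id q).add_const (r ^ 2)).rpow_const (p := a)
        (Or.inl (by simp only [id]; positivity))
    have h2 := (((contDiff_step.differentiable (by simp)) (q / (R ^ 2 / 4))).hasDerivAt.comp q
      ((hasDerivAt_id q).div_const (R ^ 2 / 4))).const_sub 1
    refine (h1.mul h2).congr_deriv ?_
    simp only [id, Function.comp]
    ring
  set ψ : E (k + 1) → ℝ := fun x => f (sqDist z x) with hψd
  have hψ : IsTestFunction O ψ := by
    refine isTestFunction_of_sqDist ?_ (a := 3 * (R ^ 2 / 4)) (by nlinarith) hR fun x hx => ?_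
    · exact (((contDiff_sqDist z).add contDiff_const).rpow_const_of_ne fun x =>
        (by have := q0 x; positivity)).mul (contDiff_const.sub (contDiff_step.comp
          ((contDiff_sqDist z).div_const _)))
    · simp only [hψd, hf]
      rw [step_of_ge (by rw [le_div_iff₀ hR4]; linarith)]; ring
  have P0 : ∀ x, 0 < (sqDist z x + r ^ 2) ^ a := fun x =>
    Real.rpow_pos_of_pos (by have := q0 x; positivity) _
  have ψ0 : ∀ x, 0 ≤ ψ x := fun x =>
    mul_nonneg (P0 x).le (by linarith [step_le_one (sqDist z x / (R ^ 2 / 4))])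
  have ψP : ∀ x, ψ x ≤ (sqDist z x + r ^ 2) ^ a := fun x =>
    mul_le_of_le_one_right (P0 x).le (by linarith [step_nonneg (sqDist z x / (R ^ 2 / 4))])
  have ha0 : a ≤ 0 := by rw [ha]; linarith
  set D := 8 * B * ((R / 2) ^ k)⁻¹ with hD
  have D0 : 0 ≤ D := by positivity
  have lower : ∀ x ∈ O, ψ x ≤ ((k + 1 : ℕ) : ℝ) * ψ x
      + (∑ i, (x i - z i) * ∇ ψ x (e i)) + D := fun x hx => by
    have hq := q0 x
    have e1 : ∑ i, (x i - z i) * ∇ ψ x (e i) = 2 * sqDist z x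
        * (a * (sqDist z x + r ^ 2) ^ (a - 1) * (1 - step (sqDist z x / (R ^ 2 / 4)))
      - (sqDist z x + r ^ 2) ^ a * (deriv step (sqDist z x / (R ^ 2 / 4)) / (R ^ 2 / 4))) := by
      simp only [hψd, fderiv_comp_sqDist_of_hasDerivAt (df _ hq)]
      rw [sqDist, mul_sum, Finset.sum_mul]
      exact sum_congr rfl fun i _ => by ring
    rw [e1]
    set q := sqDist z x with hqd
    set τ := q / (R ^ 2 / 4) with hτ
    set χ := 1 - step τ
    set P := (q + r ^ 2) ^ a
    have χ0 : 0 ≤ χ := by linarith [step_le_one τ]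
    have e2 : (q + r ^ 2) ^ (a - 1) = P / (q + r ^ 2) := Real.rpow_sub_one (by positivity) _
    have e3 : ψ x = P * χ := rfl
    have PP : 0 < P := P0 x
    have e4 : 2 * q * (a * (P / (q + r ^ 2)) * χ) = -(k : ℝ) * (q / (q + r ^ 2)) * (P * χ) := by
      rw [ha]; field_simp
    have e5 : q / (q + r ^ 2) ≤ 1 := by rw [div_le_one (by positivity)]; linarith
    have e6 : 2 * q * (P * (deriv step τ / (R ^ 2 / 4))) = 2 * (P * (τ * deriv step τ)) := by
      rw [hτ]; field_simp
    have e7 : P * (τ * deriv step τ) ≤ D / 2 := by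
      rcases lt_or_ge τ 1 with h1 | h1
      · rw [deriv_step_of_lt h1]; simp; positivity
      · have hx' : q < R ^ 2 := by
          rw [hO, mem_ball, dist_eq_norm] at hx
          rw [hqd, sqDist_eq]; gcongr
        have h4 : τ ≤ 4 := by rw [hτ, div_le_iff₀ hR4]; linarith
        have h5 := (le_abs_self _).trans (hb τ ⟨by linarith, h4⟩).1
        have h6 : P ≤ ((R / 2) ^ k)⁻¹ := by
          rw [← rpow_sq_neg_half (by positivity)]
          refine Real.rpow_le_rpow_of_nonpos (by positivity) ?_ ha0
          rw [hτ, le_div_iff₀ hR4] at h1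
          nlinarith
        have h7 : τ * deriv step τ ≤ 4 * B :=
          (mul_le_mul_of_nonneg_left h5 (by linarith)).trans (by gcongr)
        calc P * (τ * deriv step τ) ≤ P * (4 * B) := by gcongr
          _ ≤ ((R / 2) ^ k)⁻¹ * (4 * B) := by gcongr
          _ = D / 2 := by rw [hD]; ring
    have e8 : (k : ℝ) * (q / (q + r ^ 2)) * (P * χ) ≤ k * (P * χ) := by
      have : 0 ≤ P * χ := by positivity
      have : (k : ℝ) * (q / (q + r ^ 2)) ≤ k * 1 := by gcongr
      nlinarith
    have e9 : 2 * q * (a * (P / (q + r ^ 2)) * χ - P * (deriv step τ / (R ^ 2 / 4)))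
        = -(k : ℝ) * (q / (q + r ^ 2)) * (P * χ) - 2 * (P * (τ * deriv step τ)) := by
      rw [mul_sub (2 * q), e4, e6]
    rw [e3, e2, e9]
    push_cast
    linarith
  have iH : IntegrableOn (hessDens h) O := integrableOn_hessDens S.memLp_hess
  have iP : IntegrableOn (gradDens p) O := integrableOn_gradDens S.memLp_grad
  have iψP := integrableOn_testFunction_mul hψ iP
  have ident := S.integral_radial_gradDens isOpen_ball hψ z
  set S₀ : E (k + 1) → ℝ := fun x => ∑ i, inner ℝ (p i x) (∑ j, (x j - z j) • h i j x)
  have iS₀ : IntegrableOn S₀ O := integrable_finsetSum _ fun i _ =>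
    integrable_inner_of_memLp (S.memLp_grad i) (memLp_finsetSum _ fun j _ =>
      memLp_coord_smul measurableSet_ball le_rfl (S.memLp_hess i j) j)
  have upper : ∀ x, -2 * (ψ x * S₀ x)
      ≤ 1 / 2 * (ψ x * gradDens p x) + 2 * (r ^ 2 * (r ^ k)⁻¹) * hessDens h x := fun x => by
    have h1 := abs_sum_inner_le (fun i => p i x) fun i => ∑ j, (x j - z j) • h i j x
    have h2 : normSq₁ (fun i => ∑ j, (x j - z j) • h i j x) ≤ sqDist z x * hessDens h x := by
      rw [normSq₁, hessDens, normSq₂, mul_sum]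
      exact sum_le_sum fun i _ => norm_sum_smul_sq_le _ _
    have h3 : -2 * S₀ x ≤ 1 / 2 * gradDens p x + 2 * (sqDist z x * hessDens h x) := by
      have g1 := sq_sqrt (normSq₁_nonneg fun i => p i x)
      have g2 := sq_sqrt (normSq₁_nonneg fun i => ∑ j, (x j - z j) • h i j x)
      have g3 := neg_le_of_abs_le h1
      have g4 := sq_nonneg (√(normSq₁ fun i => p i x)
        - 2 * √(normSq₁ fun i => ∑ j, (x j - z j) • h i j x))
      change -_ ≤ S₀ x at g3
      change _ = gradDens p x at g1
      nlinarith
    have h4 : ψ x * sqDist z x ≤ r ^ 2 * (r ^ k)⁻¹ := by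
      have hq := q0 x
      have g1 : r ^ 2 * (r ^ k)⁻¹ = (r ^ 2) ^ (a + 1) := by
        rw [Real.rpow_add_one hr2.ne', rpow_sq_neg_half hr]; ring
      have g2 : (sqDist z x + r ^ 2) ^ a * (sqDist z x + r ^ 2) = (sqDist z x + r ^ 2) ^ (a + 1) := by
        rw [Real.rpow_add_one (by positivity)]
      rw [g1]
      calc ψ x * sqDist z x ≤ (sqDist z x + r ^ 2) ^ a * (sqDist z x + r ^ 2) :=
            mul_le_mul (ψP x) (by linarith) hq (P0 x).le
        _ = _ := g2
        _ ≤ _ := Real.rpow_le_rpow_of_nonpos hr2 (by linarith) (by rw [ha]; linarith)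
    have h5 := mul_le_mul_of_nonneg_left h3 (ψ0 x)
    have h6 := mul_le_mul_of_nonneg_right h4 (hessDens_nonneg h x)
    linarith
  set I := ∫ x in O, hessDens h x with hI
  set J := ∫ x in O, gradDens p x with hJ
  have j1 : ∫ x in O, ψ x * gradDens p x ≤ (∫ x in O, (((k + 1 : ℕ) : ℝ) * ψ x
      + ∑ i, (x i - z i) * ∇ ψ x (e i)) * gradDens p x) + D * J := by
    have t1 : IsTestFunction O fun x => ((k + 1 : ℕ) : ℝ) * ψ x
        + ∑ i, (x i - z i) * ∇ ψ x (e i) := by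
      have cX : ∀ i, ContDiff ℝ ∞ fun x : E (k + 1) => x i - z i := fun i =>
        (contDiff_euclidean.1 contDiff_id i).sub contDiff_const
      have := (IsTestFunction.sum (Finset.univ : Finset (Option (Fin (k + 1))))
        (b := fun o x => match o with
          | none => ((k + 1 : ℕ) : ℝ) * ψ x
          | some i => (x i - z i) * ∇ ψ x (e i)) fun o _ => by
        cases o with
        | none => exact hψ.mul_left contDiff_const
        | some i => exact (hψ.fderiv_apply (e i)).mul_left (cX i))
      simpa [Fintype.sum_option] using this
    have i2 := integrableOn_testFunction_mul t1 iP
    have i3 : IntegrableOn (fun x => D * gradDens p x) O := iP.const_mul D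
    rw [hJ, ← integral_const_mul, ← integral_add i2 i3]
    refine setIntegral_mono_on iψP (i2.add i3) measurableSet_ball fun x hx => ?_
    have := mul_le_mul_of_nonneg_right (lower x hx) (gradDens_nonneg p x)
    linarith
  have j2 : -2 * (∫ x in O, ψ x * S₀ x) ≤ 1 / 2 * (∫ x in O, ψ x * gradDens p x)
      + 2 * (r ^ 2 * (r ^ k)⁻¹) * I := by
    have i2 : IntegrableOn (fun x => 1 / 2 * (ψ x * gradDens p x)) O := iψP.const_mul _
    have i3 : IntegrableOn (fun x => 2 * (r ^ 2 * (r ^ k)⁻¹) * hessDens h x) O := iH.const_mul _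
    rw [hI, ← integral_const_mul, ← integral_const_mul, ← integral_const_mul, ← integral_add i2 i3]
    exact integral_mono ((integrableOn_testFunction_mul hψ iS₀).const_mul _) (i2.add i3) upper
  have j3 : ((2 * r) ^ k)⁻¹ * (∫ x in ball z r, gradDens p x) ≤ ∫ x in O, ψ x * gradDens p x := by
    have hsub : ball z r ⊆ O := ball_subset_ball (by linarith)
    rw [← integral_const_mul]
    refine le_trans ?_ (setIntegral_mono_set iψP (.of_forall fun x =>
      mul_nonneg (ψ0 x) (gradDens_nonneg p x)) hsub.eventuallyLE)
    refine setIntegral_mono_on ((iP.mono_set hsub).const_mul _) (iψP.mono_set hsub)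
      measurableSet_ball fun x hx => ?_
    refine mul_le_mul_of_nonneg_right ?_ (gradDens_nonneg p x)
    rw [mem_ball, dist_eq_norm] at hx
    have hq : sqDist z x ≤ r ^ 2 := by rw [sqDist_eq]; gcongr
    have hτ : sqDist z x / (R ^ 2 / 4) ≤ 1 := by
      rw [div_le_one hR4]; nlinarith
    simp only [hψd, hf]
    rw [step_of_le hτ, sub_zero, mul_one, ← rpow_sq_neg_half (by positivity)]
    exact Real.rpow_le_rpow_of_nonpos (by have := q0 x; positivity) (by nlinarith) ha0
  have j4 : ((2 * r) ^ k)⁻¹ * (∫ x in ball z r, gradDens p x)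
      ≤ 4 * (r ^ 2 * (r ^ k)⁻¹) * I + 2 * D * J := by linarith
  set G := ∫ x in ball z r, gradDens p x
  have I0 : 0 ≤ I := integral_nonneg (hessDens_nonneg h)
  have J0 : 0 ≤ J := integral_nonneg (gradDens_nonneg p)
  have z2 : ∀ a : ℝ, 0 < a → a ^ (2 - ((k + 1 : ℕ) : ℤ)) = a * (a ^ k)⁻¹ := fun a ha => by
    rw [zpow_two_sub (k + 1) ha, pow_succ]; field_simp; try ring
  rw [zpow_four_sub (k + 1) hr, z2 r hr, z2 R hR]
  have j5 := mul_le_mul_of_nonneg_left j4 (by positivity : 0 ≤ 2 ^ k * r)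
  have l1 : 2 ^ k * r * (((2 * r) ^ k)⁻¹ * G) = r * (r ^ k)⁻¹ * G := by
    rw [mul_pow]; field_simp
  have l2 : 2 ^ k * r * (4 * (r ^ 2 * (r ^ k)⁻¹) * I + 2 * D * J)
      = 2 ^ (k + 2) * (r * (r ^ k)⁻¹ * r ^ 2 * I)
        + 2 ^ (k + 1) * (8 * B * 2 ^ k) * (r / R * (R * (R ^ k)⁻¹ * J)) := by
    rw [hD, div_pow]; field_simp; ring
  rw [l1, l2] at j5
  refine j5.trans ?_
  have t1 : 0 ≤ r * (r ^ k)⁻¹ * r ^ 2 * I := by positivity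
  have t2 : 0 ≤ r / R * (R * (R ^ k)⁻¹ * J) := by positivity
  have t3 : (0 : ℝ) ≤ 2 ^ (k + 1) * (8 * B * 2 ^ k) := by positivity
  have t4 : (0 : ℝ) ≤ 2 ^ (k + 2) := by positivity
  nlinarith [mul_nonneg t3 t1, mul_nonneg t4 t2]

/-- An energy inequality along a geometric sequence of scales forces linear decay in the initial
energy. -/
theorem exists_bound_of_discrete_energyInequality {C H : ℝ} (hC : 1 ≤ C) (hH : 0 ≤ H) {m : ℕ}
    (hm : 1 ≤ m) : ∃ C', 0 ≤ C' ∧ ∀ {a g S D : ℕ → ℝ} {η : ℝ}, 0 ≤ η → η ≤ H → (∀ k, 0 ≤ a k) →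
    (∀ k, 0 ≤ g k) → (∀ k, 0 ≤ S k) → Monotone S → a 0 ≤ C * η → g 0 ≤ C * η →
    (∀ k, a (k + 1) ≤ C * a k) → (∀ k, g (k + 1) ≤ C * g k) →
    (∀ k, a (k + 1) + S k ≤ C * (η + D k)) →
    (∀ k, D k ≤ C * √(S (k + 1) - S k) * (√(a k) + √(g k))) →
    (∀ k, D k ≤ C * √(g k) * (√(a k) + √(g k))) →
    (∀ k, g (k + 1) ≤ C * (√(a k) + 1)) → (∀ k, g (k + m) ≤ 1 / 4 * g k + C * a k) →
    ∀ k, a k ≤ C' * η ∧ g k ≤ C' * η := by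
  have hC0 : 0 ≤ C := by linarith
  set K := C + C ^ 5 + 2 * C ^ 6 with hK
  have K0 : 0 ≤ K := by positivity
  set X := 4 * K + C ^ (m + 1) with hX
  have hCm : C ≤ C ^ (m + 1) := le_self_pow₀ hC (by omega)
  have X0 : 0 ≤ X := by positivity
  have hXY : X ≤ 4 * C * X := by nlinarith
  refine ⟨4 * C * X, by positivity, ?_⟩
  intro a g S D η hη hηH a0 g0 S0 mS ha0 hg0 da dg EI D1 D2 I Con
  set T := 8 * C ^ 4 * (1 + H) with hT
  have C4 : 1 ≤ C ^ 4 := one_le_pow₀ hC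
  have hCC : C ≤ C ^ 4 := le_self_pow₀ hC (by norm_num)
  have hCC2 : C ^ 2 ≤ C ^ 4 := pow_le_pow_right₀ hC (by norm_num)
  have hCC3 : C ^ 3 ≤ C ^ 4 := pow_le_pow_right₀ hC (by norm_num)
  have T8 : 8 * C ^ 4 ≤ T := by rw [hT]; nlinarith
  have T1 : 1 ≤ T := by linarith
  have T0 : 0 ≤ T := by linarith
  have CT : C ≤ T := by linarith
  have CHT : C ^ 2 * H ≤ T := by
    have : C ^ 2 * H ≤ C ^ 4 * H := by gcongr
    have : 0 ≤ C ^ 4 * H := by positivity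
    rw [hT]; nlinarith
  have CHT' : C * H ≤ T := by
    have : C * H ≤ C ^ 2 * H := by gcongr; nlinarith
    linarith
  have TT : T ≤ T ^ 4 := le_self_pow₀ T1 (by norm_num)
  have CηH : C * η ≤ C * H := by gcongr
  have sg : ∀ k, a k ≤ T ^ 4 → √(a k) ≤ T ^ 2 := fun k hk =>
    Real.sqrt_le_iff.2 ⟨by positivity, by nlinarith⟩
  have g1 : ∀ k, a k ≤ T ^ 4 → √(g (k + 1)) ≤ 2 * C * T := fun k hk => by
    have h1 := sg k hk
    have h2 := I k
    have h3 : C * (√(a k) + 1) ≤ C * (T ^ 2 + 1) := by gcongr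
    refine Real.sqrt_le_iff.2 ⟨by positivity, ?_⟩
    have h4 : 1 ≤ T ^ 2 := one_le_pow₀ T1
    have h5 : C * T ^ 2 ≤ C ^ 2 * T ^ 2 := by gcongr; nlinarith
    nlinarith
  have aT : ∀ k, a k ≤ T ^ 4 ∧ a (k + 1) ≤ T ^ 4 := by
    intro k
    induction k with
    | zero =>
      refine ⟨by linarith, ?_⟩
      have := da 0
      have : C * a 0 ≤ C * (C * H) := by gcongr; linarith
      simp only [zero_add] at *
      nlinarith
    | succ k ih =>
      refine ⟨ih.2, ?_⟩
      have h1 := g1 k ih.1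
      have h2 := sg (k + 1) ih.2
      have h3 := EI (k + 1)
      have h4 := D2 (k + 1)
      have h5 : C * √(g (k + 1)) * (√(a (k + 1)) + √(g (k + 1)))
          ≤ C * (2 * C * T) * (T ^ 2 + 2 * C * T) := by gcongr
      have h6 : C * (η + D (k + 1)) ≤ C * (H + C * (2 * C * T) * (T ^ 2 + 2 * C * T)) := by
        gcongr; linarith
      have h7 : T ≤ T ^ 3 := le_self_pow₀ T1 (by norm_num)
      have h8 : T ^ 2 ≤ T ^ 3 := pow_le_pow_right₀ T1 (by norm_num)
      have h9 : C ^ 3 * T ^ 3 ≤ C ^ 4 * T ^ 3 := by gcongr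
      have h10 : C ^ 4 * T ^ 2 ≤ C ^ 4 * T ^ 3 := by gcongr
      have h11 : T ^ 3 * (8 * C ^ 4) ≤ T ^ 3 * T := by gcongr
      have h12 : 1 * T ^ 3 ≤ C ^ 4 * T ^ 3 := by gcongr
      have h13 : C * (H + C * (2 * C * T) * (T ^ 2 + 2 * C * T))
          = C * H + 2 * (C ^ 3 * T ^ 3) + 4 * (C ^ 4 * T ^ 2) := by ring
      have h14 : T ^ 4 = T ^ 3 * T := by ring
      have h15 : 0 ≤ C ^ 4 * T ^ 3 := by positivity
      have := S0 (k + 1)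
      rw [h13] at h6
      rw [h14]
      linarith
  have aB : ∀ k, √(a k) ≤ T ^ 2 := fun k => sg k (aT k).1
  have gB : ∀ k, √(g k) ≤ 2 * C * T := fun k => by
    cases k with
    | zero =>
      refine Real.sqrt_le_iff.2 ⟨by positivity, ?_⟩
      have : T ≤ T ^ 2 := le_self_pow₀ T1 (by norm_num)
      have : 1 * T ^ 2 ≤ C ^ 2 * T ^ 2 := by gcongr; exact one_le_pow₀ hC
      nlinarith
    | succ k => exact g1 k (aT k).1
  set W := T ^ 2 + 2 * C * T with hW
  have W0 : 0 ≤ W := by positivity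
  have SB : BddAbove (range S) := ⟨C * (H + C * (2 * C * T) * W), by
    rintro _ ⟨k, rfl⟩
    have h5 : C * √(g k) * (√(a k) + √(g k)) ≤ C * (2 * C * T) * W := by
      rw [hW]; gcongr <;> first | exact aB k | exact gB k
    have h6 : C * (η + D k) ≤ C * (H + C * (2 * C * T) * W) := by
      gcongr; exact (D2 k).trans h5
    linarith [EI k, a0 (k + 1)]⟩
  have Slim := tendsto_atTop_ciSup mS SB
  have diff : Tendsto (fun k => C * (η + C * √(S (k + 1) - S k) * W)) atTop (𝓝 (C * η)) := by
    have h1 := ((tendsto_add_atTop_iff_nat 1).2 Slim).sub Slim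
    rw [sub_self] at h1
    have h2 := h1.sqrt
    rw [Real.sqrt_zero] at h2
    have h3 := (((h2.const_mul C).mul_const W).const_add η).const_mul C
    simpa using h3
  have Sη : ∀ k, S k ≤ C * η := fun k => by
    refine ge_of_tendsto diff ?_
    filter_upwards [eventually_ge_atTop k] with j hj
    have h5 : C * √(S (j + 1) - S j) * (√(a j) + √(g j)) ≤ C * √(S (j + 1) - S j) * W := by
      rw [hW]; gcongr <;> first | exact aB j | exact gB j
    have h6 : C * (η + D j) ≤ C * (η + C * √(S (j + 1) - S j) * W) := by
      gcongr; exact (D1 j).trans h5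
    linarith [EI j, a0 (j + 1), mS hj]
  have step : ∀ k, a (k + 1) ≤ K * η + 1 / 4 * a k + g k / (8 * C) := fun k => by
    set x := √(S (k + 1) - S k) with hx
    have x2 : x ^ 2 ≤ C * η := by
      rw [hx, sq_sqrt (by linarith [mS (Nat.le_succ k)])]
      linarith [Sη (k + 1), S0 k]
    have hy := sq_sqrt (a0 k)
    have hu := sq_sqrt (g0 k)
    set y := √(a k)
    set v := √(g k)
    have h1 := EI k
    have h2 : C * D k ≤ C * (C * x * (y + v)) := by gcongr; exact D1 k
    have h3 : C ^ 2 * x * y ≤ C ^ 4 * x ^ 2 + 1 / 4 * y ^ 2 := by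
      nlinarith [sq_nonneg (C ^ 2 * x - y / 2)]
    have h4 : C ^ 2 * x * v ≤ 2 * C ^ 5 * x ^ 2 + v ^ 2 / (8 * C) := by
      have h : 0 ≤ (4 * C ^ 3 * x - v) ^ 2 / (8 * C) := by positivity
      have h' : (4 * C ^ 3 * x - v) ^ 2 / (8 * C)
          = 2 * C ^ 5 * x ^ 2 - C ^ 2 * x * v + v ^ 2 / (8 * C) := by
        field_simp; ring
      linarith
    have h5 : C ^ 4 * x ^ 2 ≤ C ^ 4 * (C * η) := by gcongr
    have h6 : 2 * C ^ 5 * x ^ 2 ≤ 2 * C ^ 5 * (C * η) := by gcongr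
    have := S0 k
    rw [hK]
    rw [hy] at h3
    rw [hu] at h4
    nlinarith
  have gC : ∀ k, g k ≤ C ^ k * (C * η) := fun k => by
    induction k with
    | zero => simpa using hg0
    | succ k ih =>
      refine (dg k).trans ?_
      rw [pow_succ', mul_assoc]
      gcongr
  have main : ∀ k, a k ≤ X * η ∧ g k ≤ 4 * C * X * η := by
    intro k
    induction k using Nat.strong_induction_on with
    | _ k ih =>
      constructor
      · cases k with
        | zero => exact ha0.trans (by gcongr; linarith)
        | succ k =>
          obtain ⟨h1, h2⟩ := ih k (by omega)
          have h3 : g k / (8 * C) ≤ 1 / 2 * (X * η) := by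
            rw [div_le_iff₀ (by positivity)]; linarith
          have h4 : 4 * K * η ≤ X * η := by
            gcongr; rw [hX]; linarith [hC0.trans hCm]
          linarith [step k]
      · rcases lt_or_ge k m with hk | hk
        · refine (gC k).trans ?_
          have h1 : C ^ k * C ≤ C ^ (m + 1) := by
            rw [← pow_succ]; exact pow_le_pow_right₀ hC (by omega)
          have h2 : C ^ k * C ≤ 4 * C * X := by linarith
          nlinarith
        · obtain ⟨j, rfl⟩ := Nat.exists_eq_add_of_le' hk
          obtain ⟨h1, h2⟩ := ih j (by omega)
          have h3 : C * a j ≤ C * (X * η) := by gcongr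
          have h4 : 0 ≤ C * X * η := by positivity
          linarith [Con j]
  exact fun k => ⟨(main k).1.trans (by gcongr), (main k).2⟩

section Decay

variable {w : E n → E L} {p : Grad n L} {h : Hess n L}
  {z : E n} {r ρ R c : ℝ}

/-- The scale invariant Hessian energy in a ball. -/
def scaledHess (z : E n) (r : ℝ) (h : Hess n L) : ℝ :=
  r ^ (4 - (n : ℤ)) * ∫ x in ball z r, hessDens h x

/-- The scale invariant Dirichlet energy in a ball. -/
def scaledGrad (z : E n) (r : ℝ) (p : Grad n L) : ℝ :=
  r ^ (2 - (n : ℤ)) * ∫ x in ball z r, gradDens p x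

theorem scaledHess_nonneg (hr : 0 < r) : 0 ≤ scaledHess z r h :=
  mul_nonneg (zpow_nonneg hr.le _) (integral_nonneg (hessDens_nonneg h))

theorem scaledGrad_nonneg (hr : 0 < r) : 0 ≤ scaledGrad z r p :=
  mul_nonneg (zpow_nonneg hr.le _) (integral_nonneg (gradDens_nonneg p))

theorem zpow_sub_le_pow_mul (j n : ℕ) (hr : 0 < r) (hrρ : r ≤ ρ) (hρ : ρ ≤ c * r) :
    r ^ ((j : ℤ) - n) ≤ c ^ n * ρ ^ ((j : ℤ) - n) := by
  have hρ0 : 0 < ρ := by linarith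
  have hc : 0 < c := pos_of_mul_pos_left (hρ0.trans_le hρ) hr.le
  rw [zpow_sub₀ hr.ne', zpow_sub₀ hρ0.ne', zpow_natCast, zpow_natCast, zpow_natCast, zpow_natCast,
    ← mul_div_assoc, div_le_div_iff₀ (by positivity) (by positivity)]
  calc r ^ j * ρ ^ n ≤ ρ ^ j * (c * r) ^ n := by gcongr
    _ = c ^ n * ρ ^ j * r ^ n := by rw [mul_pow]; ring

theorem scaledHess_le (hi : IntegrableOn (hessDens h) (ball z ρ)) (hr : 0 < r)
    (hrρ : r ≤ ρ) (hρ : ρ ≤ c * r) : scaledHess z r h ≤ c ^ n * scaledHess z ρ h := by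
  rw [scaledHess, scaledHess, ← mul_assoc]
  have h1 := zpow_sub_le_pow_mul 4 n hr hrρ hρ
  push_cast at h1
  exact mul_le_mul h1 (setIntegral_mono_set hi (.of_forall (hessDens_nonneg h))
    (ball_subset_ball hrρ).eventuallyLE) (integral_nonneg (hessDens_nonneg h))
    ((zpow_nonneg hr.le _).trans h1)

theorem scaledGrad_le (hi : IntegrableOn (gradDens p) (ball z ρ)) (hr : 0 < r)
    (hrρ : r ≤ ρ) (hρ : ρ ≤ c * r) : scaledGrad z r p ≤ c ^ n * scaledGrad z ρ p := by
  rw [scaledGrad, scaledGrad, ← mul_assoc]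
  have h1 := zpow_sub_le_pow_mul 2 n hr hrρ hρ
  push_cast at h1
  exact mul_le_mul h1 (setIntegral_mono_set hi (.of_forall (gradDens_nonneg p))
    (ball_subset_ball hrρ).eventuallyLE) (integral_nonneg (gradDens_nonneg p))
    ((zpow_nonneg hr.le _).trans h1)

/-- The error terms in the energy inequality, estimated in two ways. -/
theorem crossDens_annulus_le (hn : 2 ≤ n) (hr : 0 < r)
    (mp : ∀ i, MemLp (p i) 2 (volume.restrict (ball z (2 * r))))
    (mh : ∀ i j, MemLp (h i j) 2 (volume.restrict (ball z (2 * r)))) :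
    r ^ (2 - (n : ℤ)) * (∫ x in ball z (2 * r) \ ball z r, crossDens r z p h x)
      ≤ 2 ^ (n + 1) * √(∫ x in ball z (2 * r) \ ball z r, weightDens z p h x)
        * (√(scaledHess z (2 * r) h) + √(scaledGrad z (2 * r) p)) ∧
    r ^ (2 - (n : ℤ)) * (∫ x in ball z (2 * r) \ ball z r, crossDens r z p h x)
      ≤ 2 ^ (n + 1) * √(scaledGrad z (2 * r) p)
        * (√(scaledHess z (2 * r) h) + √(scaledGrad z (2 * r) p)) := by
  set s := ball z (2 * r) \ ball z r
  have sB : s ⊆ ball z (2 * r) := sdiff_subset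
  have ms : MeasurableSet s := measurableSet_ball.diff measurableSet_ball
  have mp' := fun i => (mp i).mono_measure (Measure.restrict_mono sB le_rfl)
  have mh' := fun i j => (mh i j).mono_measure (Measure.restrict_mono sB le_rfl)
  have dist1 : ∀ x ∈ s, r ≤ ‖x - z‖ := fun x hx => by
    have := hx.2; rwa [mem_ball, dist_eq_norm, not_lt] at this
  have dist2 : ∀ x ∈ s, ‖x - z‖ ≤ 2 * r := fun x hx => by
    have := hx.1; rw [mem_ball, dist_eq_norm] at this; exact this.le
  have iH := integrableOn_hessDens mh'
  have iP := integrableOn_gradDens mp'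
  have iR := integrableOn_radDens ms sB mp'
  have iG := integrableOn_growthDens ms sB mp' mh'
  have iW := integrableOn_weightDens hn ms sB hr dist1 mp' mh'
  set ρ := 2 * r with hρ
  have ρ0 : 0 < ρ := by positivity
  set N := ρ ^ (n - 2) with hN
  have N0 : 0 < N := by positivity
  have zn : ρ ^ n = N * ρ ^ 2 := by rw [hN, ← pow_add]; congr 1; omega
  have zN : ρ ^ (2 - (n : ℤ)) = N⁻¹ := by
    rw [hN, ← zpow_natCast, ← zpow_neg]; congr 1; omega
  have z4 : ρ ^ (4 - (n : ℤ)) = N⁻¹ * ρ ^ 2 := by rw [zpow_four_sub n ρ0, zN]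
  have zr : r ^ (2 - (n : ℤ)) = 2 ^ (n - 2) * N⁻¹ := by
    rw [hN, hρ, mul_pow, mul_inv, ← mul_assoc, mul_inv_cancel₀ (by positivity), one_mul,
      ← zpow_natCast r, ← zpow_neg]; congr 1; omega
  have r2 : (r ^ 2)⁻¹ = 4 * (ρ ^ 2)⁻¹ := by rw [hρ]; field_simp; norm_num
  set a := scaledHess z ρ h with ha
  set g := scaledGrad z ρ p with hg
  set α := ∫ x in s, weightDens z p h x with hα
  have a0 : 0 ≤ a := scaledHess_nonneg ρ0
  have g0 : 0 ≤ g := scaledGrad_nonneg ρ0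
  have α0 : 0 ≤ α := integral_nonneg (weightDens_nonneg z p h)
  set Hh := ∫ x in s, hessDens h x
  set P := ∫ x in s, gradDens p x
  set Q := ∫ x in s, radDens z p x
  set G := ∫ x in s, growthDens z p h x
  have Hle : Hh ≤ N * (ρ ^ 2)⁻¹ * a := by
    have h1 : Hh ≤ ∫ x in ball z ρ, hessDens h x :=
      setIntegral_mono_set (integrableOn_hessDens mh) (.of_forall (hessDens_nonneg h))
        sB.eventuallyLE
    rw [ha, scaledHess, z4]
    refine h1.trans (le_of_eq ?_)
    field_simp
  have Ple : P ≤ N * g := by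
    have h1 : P ≤ ∫ x in ball z ρ, gradDens p x :=
      setIntegral_mono_set (integrableOn_gradDens mp) (.of_forall (gradDens_nonneg p))
        sB.eventuallyLE
    rw [hg, scaledGrad, zN]
    refine h1.trans (le_of_eq ?_)
    field_simp
  have Q1 : Q ≤ N * ρ ^ 2 * g := by
    have h1 : Q ≤ ∫ x in s, ρ ^ 2 * gradDens p x :=
      setIntegral_mono_on iR (iP.const_mul _) ms fun x hx => (radDens_le z p x).trans
        (mul_le_mul_of_nonneg_right (by have := dist2 x hx; gcongr) (gradDens_nonneg p x))
    rw [integral_const_mul] at h1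
    have := mul_le_mul_of_nonneg_left Ple (sq_nonneg ρ)
    linarith
  have G1 : G ≤ N * (2 * g + 2 * a) := by
    have i1 : IntegrableOn (fun x => 2 * gradDens p x) s := iP.const_mul _
    have i2 : IntegrableOn (fun x => 2 * ρ ^ 2 * hessDens h x) s := iH.const_mul _
    have h1 : G ≤ ∫ x in s, (2 * gradDens p x + 2 * ρ ^ 2 * hessDens h x) := by
      refine setIntegral_mono_on iG (i1.add i2) ms fun x hx => (growthDens_le z p h x).trans ?_
      have h2 : ‖x - z‖ ^ 2 ≤ ρ ^ 2 := by have := dist2 x hx; gcongr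
      have := mul_le_mul_of_nonneg_right h2 (hessDens_nonneg h x)
      linarith
    rw [integral_add i1 i2, integral_const_mul, integral_const_mul] at h1
    have h3 := mul_le_mul_of_nonneg_left Hle (sq_nonneg ρ)
    have h4 : ρ ^ 2 * (N * (ρ ^ 2)⁻¹ * a) = N * a := by field_simp
    linarith
  have zp : ∀ x ∈ s, ∀ m : ℕ, 1 ≤ ρ ^ m * ‖x - z‖ ^ (-(m : ℤ)) := fun x hx m => by
    have h1 := dist2 x hx
    have h2 : 0 < ‖x - z‖ := hr.trans_le (dist1 x hx)
    rw [zpow_neg, zpow_natCast, ← div_eq_mul_inv, one_le_div (by positivity)]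
    gcongr
  have Q2 : Q ≤ N * ρ ^ 2 * α := by
    rw [hα, ← integral_const_mul]
    refine setIntegral_mono_on iR (iW.const_mul _) ms fun x hx => ?_
    have h1 := mul_le_mul_of_nonneg_right (zp x hx n) (radDens_nonneg z p x)
    have h2 : 0 ≤ ‖x - z‖ ^ (2 - (n : ℤ)) * growthDens z p h x :=
      mul_nonneg (zpow_nonneg (norm_nonneg _) _) (growthDens_nonneg _ _ _ _)
    rw [weightDens, mul_add, ← zn]
    have := mul_nonneg (pow_nonneg ρ0.le n) h2
    linarith
  have G2 : G ≤ N * α := by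
    rw [hα, ← integral_const_mul]
    refine setIntegral_mono_on iG (iW.const_mul _) ms fun x hx => ?_
    have h1 := mul_le_mul_of_nonneg_right (zp x hx (n - 2)) (growthDens_nonneg z p h x)
    have h2 : 0 ≤ ‖x - z‖ ^ (-(n : ℤ)) * radDens z p x :=
      mul_nonneg (zpow_nonneg (norm_nonneg _) _) (radDens_nonneg _ _ _)
    rw [show -((n - 2 : ℕ) : ℤ) = 2 - (n : ℤ) by omega, ← hN] at h1
    rw [weightDens, mul_add]
    have := mul_nonneg N0.le h2
    linarith
  have cross : (∫ x in s, crossDens r z p h x) ≤ √Hh * √Q + √P * √G + 4 * (ρ ^ 2)⁻¹ * Q := by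
    have mQ := memLp_sqrt iR (radDens_nonneg z p)
    have i1 : IntegrableOn (fun x => √(hessDens h x) * √(radDens z p x)) s :=
      (memLp_sqrt iH (hessDens_nonneg h)).integrable_mul mQ
    have i2 : IntegrableOn (fun x => √(gradDens p x) * √(growthDens z p h x)) s :=
      (memLp_sqrt iP (gradDens_nonneg p)).integrable_mul (memLp_sqrt iG (growthDens_nonneg z p h))
    have i3 : IntegrableOn (fun x => 4 * (ρ ^ 2)⁻¹ * radDens z p x) s := iR.const_mul _
    have i12 : IntegrableOn (fun x => √(hessDens h x) * √(radDens z p x)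
      + √(gradDens p x) * √(growthDens z p h x)) s := i1.add i2
    have e1 : ∀ x, crossDens r z p h x = √(hessDens h x) * √(radDens z p x)
        + √(gradDens p x) * √(growthDens z p h x) + 4 * (ρ ^ 2)⁻¹ * radDens z p x := fun x => by
      rw [crossDens, crossForm, radDens, Real.sqrt_sq (norm_nonneg _), r2]; rfl
    simp only [e1]
    rw [integral_add i12 i3, integral_add i1 i2, integral_const_mul]
    have b1 := integral_mul_le_sqrt_mul_sqrt iH iR (hessDens_nonneg h) (radDens_nonneg z p)
    have b2 := integral_mul_le_sqrt_mul_sqrt iP iG (gradDens_nonneg p) (growthDens_nonneg z p h)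
    linarith
  have sN := sq_sqrt N0.le
  set ν := √N
  have ν0 : 0 ≤ ν := sqrt_nonneg _
  have sH : √Hh ≤ ν * ρ⁻¹ * √a := by
    refine (sqrt_le_sqrt Hle).trans_eq ?_
    rw [sqrt_mul (by positivity), sqrt_mul N0.le, Real.sqrt_inv, Real.sqrt_sq ρ0.le]
  have sP : √P ≤ ν * √g := by
    refine (sqrt_le_sqrt Ple).trans_eq ?_
    rw [sqrt_mul N0.le]
  have sQ : ∀ μ : ℝ, Q ≤ N * ρ ^ 2 * μ → √Q ≤ ν * ρ * √μ := fun μ hμ => by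
    refine (sqrt_le_sqrt hμ).trans_eq ?_
    rw [sqrt_mul (by positivity), sqrt_mul N0.le, Real.sqrt_sq ρ0.le]
  have Q0 : 0 ≤ Q := integral_nonneg (radDens_nonneg z p)
  have t1 : ∀ μ : ℝ, Q ≤ N * ρ ^ 2 * μ → √Hh * √Q ≤ N * (√a * √μ) := fun μ hμ => by
    refine (mul_le_mul sH (sQ μ hμ) (sqrt_nonneg _) (by positivity)).trans_eq ?_
    rw [← sN]; field_simp
  have t2 : ∀ μ : ℝ, Q ≤ N * ρ ^ 2 * μ → 4 * (ρ ^ 2)⁻¹ * Q ≤ 4 * (N * (√g * √μ)) := fun μ hμ => by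
    have h1 := mul_le_mul (sQ g Q1) (sQ μ hμ) (sqrt_nonneg _) (by positivity)
    rw [Real.mul_self_sqrt Q0] at h1
    refine (mul_le_mul_of_nonneg_left h1 (by positivity)).trans_eq ?_
    rw [← sN]; field_simp
  have p2 : (2 : ℝ) ^ (n + 1) = 8 * 2 ^ (n - 2) := by
    rw [show n + 1 = n - 2 + 3 by omega, pow_add]; ring
  have fin : ∀ μ b : ℝ, 0 ≤ b → √Hh * √Q + √P * √G + 4 * (ρ ^ 2)⁻¹ * Q ≤ 8 * (N * b) →
      r ^ (2 - (n : ℤ)) * (∫ x in s, crossDens r z p h x) ≤ 2 ^ (n + 1) * b := fun μ b _ hb => by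
    rw [zr, p2]
    have h1 := mul_le_mul_of_nonneg_left (cross.trans hb)
      (by positivity : (0 : ℝ) ≤ 2 ^ (n - 2) * N⁻¹)
    refine h1.trans (le_of_eq ?_)
    field_simp
  have sa := sqrt_nonneg a
  have sg := sqrt_nonneg g
  have sα := sqrt_nonneg α
  constructor
  · rw [mul_assoc]
    refine fin α _ (by positivity) ?_
    have h1 := t1 α Q2
    have h2 := t2 α Q2
    have h3 : √P * √G ≤ N * (√g * √α) := by
      have h4 : √G ≤ ν * √α := by
        refine (sqrt_le_sqrt G2).trans_eq ?_
        rw [sqrt_mul N0.le]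
      refine (mul_le_mul sP h4 (sqrt_nonneg _) (by positivity)).trans_eq ?_
      rw [← sN]; ring
    have h5 : 0 ≤ N * (√a * √α) := by positivity
    have h6 : 0 ≤ N * (√g * √α) := by positivity
    linarith
  · rw [mul_assoc]
    refine fin g _ (by positivity) ?_
    have h1 := t1 g Q1
    have h2 := t2 g Q1
    have h3 : √P * √G ≤ N * (√g * (2 * (√g + √a))) := by
      have h4 : √G ≤ ν * (2 * (√g + √a)) := by
        refine (sqrt_le_sqrt G1).trans ?_
        rw [sqrt_mul N0.le]
        refine mul_le_mul_of_nonneg_left (Real.sqrt_le_iff.2 ⟨by positivity, ?_⟩) ν0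
        have h5 := mul_nonneg sa sg
        rw [show (2 * (√g + √a)) ^ 2 = 4 * (√g ^ 2 + √a ^ 2) + 8 * (√a * √g) by ring,
          sq_sqrt a0, sq_sqrt g0]
        linarith
      refine (mul_le_mul sP h4 (sqrt_nonneg _) (by positivity)).trans_eq ?_
      rw [← sN]; ring
    have h5 : 0 ≤ N * (√g * √a) := by positivity
    have h6 : 0 ≤ N * (√g * √g) := by positivity
    linarith

/-- Small energy on a ball implies small scale invariant energy on all concentric balls. -/
theorem exists_energy_decay (hn : 5 ≤ n) (L : ℕ) {K₀ C₀ H : ℝ} (hK₀ : 0 ≤ K₀) (hH : 0 ≤ H) :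
    ∃ C', 0 ≤ C' ∧ ∀ {w : E n → E L} {p : Grad n L} {h : Hess n L}
    {z : E n} {R η : ℝ}, 0 < R → SobolevTwo (ball z R) w p h →
    (∀ᵐ x ∂(volume.restrict (ball z R)), ‖w x‖ ≤ K₀) → η ≤ H →
    scaledHess z R h + scaledGrad z R p ≤ η → EnergyInequality z R C₀ η p h →
    ∀ r, 0 < r → r ≤ R → scaledHess z r h + scaledGrad z r p ≤ C' * η := by
  obtain ⟨C1, hC1, b1⟩ := exists_interpolation n L hK₀
  obtain ⟨C2, hC2, b2⟩ := exists_gradient_contraction (n := n) (by omega) L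
  obtain ⟨m, hm⟩ : ∃ m : ℕ, C2 * (1 / 2) ^ m ≤ 1 / 4 := by
    have h1 := ((tendsto_pow_atTop_nhds_zero_of_lt_one (r := (1 / 2 : ℝ)) (by norm_num)
      (by norm_num)).const_mul C2).eventually_le_const (u := 1 / 4) (by norm_num)
    exact h1.exists
  have hm' : C2 * (1 / 2) ^ (m + 1) ≤ 1 / 4 := by
    refine le_trans (mul_le_mul_of_nonneg_left ?_ hC2) hm
    rw [pow_succ]
    nlinarith [pow_pos (by norm_num : (0 : ℝ) < 1 / 2) m]
  set M : ℝ := 1 + |C₀| + C1 + 4 ^ n + 2 ^ (n + 1) + C2 * (2 ^ (m + 1)) ^ n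
  have q1 : 0 ≤ C2 * ((2 : ℝ) ^ (m + 1)) ^ n := by positivity
  have q2 : (0 : ℝ) ≤ 4 ^ n := by positivity
  have q3 : (0 : ℝ) ≤ 2 ^ (n + 1) := by positivity
  have q4 := abs_nonneg C₀
  have q5 : (2 : ℝ) ^ n ≤ 4 ^ n := by gcongr; norm_num
  have hM1 : 1 ≤ M := by linarith
  obtain ⟨C', hC', b3⟩ := exists_bound_of_discrete_energyInequality hM1 hH (Nat.le_add_left 1 m)
  refine ⟨2 ^ n * (2 * C') + 4 ^ n, by positivity, ?_⟩
  intro w p h z R η hR S hw hηH hη EI r hr hrR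
  have iH : IntegrableOn (hessDens h) (ball z R) := integrableOn_hessDens S.memLp_hess
  have iP : IntegrableOn (gradDens p) (ball z R) := integrableOn_gradDens S.memLp_grad
  have η0 : 0 ≤ η := by
    linarith [scaledHess_nonneg (z := z) (h := h) hR,
    scaledGrad_nonneg (z := z) (p := p) hR]
  set s : ℕ → ℝ := fun k => R / 4 * (1 / 2) ^ k with hs
  have s0 : ∀ k, 0 < s k := fun k => by positivity
  have sR : ∀ k, s k ≤ R / 4 := fun k =>
    mul_le_of_le_one_right (by positivity) (pow_le_one₀ (by norm_num) (by norm_num))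
  have ss : ∀ k, 2 * s (k + 1) = s k := fun k => by simp only [hs, pow_succ]; ring
  have sub : ∀ k, ball z (s k) ⊆ ball z R := fun k => ball_subset_ball (by linarith [sR k])
  have iW : ∀ k, IntegrableOn (weightDens z p h) (ball z (R / 4) \ ball z (s k)) := fun k => by
    have hsub : ball z (R / 4) \ ball z (s k) ⊆ ball z R :=
      sdiff_subset.trans (ball_subset_ball (by linarith))
    refine integrableOn_weightDens (by omega)
      (measurableSet_ball.diff measurableSet_ball) hsub (s0 k)
      (fun x hx => ?_) (S.mono hsub).memLp_grad (S.mono hsub).memLp_hess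
    have := hx.2
    rwa [mem_ball, dist_eq_norm, not_lt] at this
  have main := b3 (a := fun k => scaledHess z (s k) h) (g := fun k => scaledGrad z (s k) p)
    (S := fun k => ∫ x in ball z (R / 4) \ ball z (s k), weightDens z p h x)
    (D := fun k => s (k + 1) ^ (2 - (n : ℤ)) *
      ∫ x in ball z (s k) \ ball z (s (k + 1)), crossDens (s (k + 1)) z p h x)
    η0 hηH (fun k => scaledHess_nonneg (s0 k)) (fun k => scaledGrad_nonneg (s0 k))
    (fun k => integral_nonneg (weightDens_nonneg z p h))
    (monotone_nat_of_le_succ fun k => setIntegral_mono_set (iW (k + 1))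
      (.of_forall (weightDens_nonneg z p h)) (LE.le.eventuallyLE
        (sdiff_subset_sdiff_right (ball_subset_ball (by linarith [ss k, s0 (k + 1)])))))
    ?_ ?_ ?_ ?_ ?_ ?_ ?_ ?_ ?_
  · rcases le_or_gt r (R / 4) with h4 | h4
    · obtain ⟨k, hk1, hk2⟩ := exists_nat_pow_near_of_lt_one (x := r / (R / 4)) (y := (1 / 2 : ℝ))
        (by positivity) ((div_le_one (by positivity)).2 h4) (by norm_num) (by norm_num)
      rw [lt_div_iff₀ (by positivity)] at hk1
      rw [div_le_iff₀ (by positivity)] at hk2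
      have e1 : r ≤ s k := by simp only [hs]; linarith
      have e2 : s k ≤ 2 * r := by
        simp only [hs]; rw [pow_succ] at hk1; linarith
      obtain ⟨m1, m2⟩ := main k
      have c1 := scaledHess_le (iH.mono_set (sub k)) hr e1 e2
      have c2 := scaledGrad_le (iP.mono_set (sub k)) hr e1 e2
      have c3 : (0 : ℝ) ≤ 2 ^ n := by positivity
      have c4 := mul_le_mul_of_nonneg_left m1 c3
      have c5 := mul_le_mul_of_nonneg_left m2 c3
      have c6 : 0 ≤ 4 ^ n * η := by positivity
      linarith
    · have c1 := scaledHess_le iH hr hrR (by linarith : R ≤ 4 * r)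
      have c2 := scaledGrad_le iP hr hrR (by linarith : R ≤ 4 * r)
      have c3 := mul_le_mul_of_nonneg_left hη q2
      have c6 : 0 ≤ 2 ^ n * (2 * C') * η := by positivity
      linarith
  · have c1 := scaledHess_le iH (s0 0) (by linarith [sR 0]) (c := 4) (by simp [hs]; linarith)
    have c2 : 4 ^ n * scaledHess z R h ≤ M * η := by
      refine mul_le_mul (by linarith) ?_ (scaledHess_nonneg hR) (by linarith)
      linarith [scaledGrad_nonneg (z := z) (p := p) hR]
    linarith
  · have c1 := scaledGrad_le iP (s0 0) (by linarith [sR 0]) (c := 4) (by simp [hs]; linarith)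
    have c2 : 4 ^ n * scaledGrad z R p ≤ M * η := by
      refine mul_le_mul (by linarith) ?_ (scaledGrad_nonneg hR) (by linarith)
      linarith [scaledHess_nonneg (z := z) (h := h) hR]
    linarith
  · intro k
    refine (scaledHess_le (iH.mono_set (sub k)) (s0 (k + 1)) (by linarith [ss k, s0 (k + 1)])
      (c := 2) (ss k).ge).trans ?_
    exact mul_le_mul_of_nonneg_right (by linarith) (scaledHess_nonneg (s0 k))
  · intro k
    refine (scaledGrad_le (iP.mono_set (sub k)) (s0 (k + 1)) (by linarith [ss k, s0 (k + 1)])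
      (c := 2) (ss k).ge).trans ?_
    exact mul_le_mul_of_nonneg_right (by linarith) (scaledGrad_nonneg (s0 k))
  · intro k
    have e1 := EI (s (k + 1)) (s0 _) (by linarith [ss k, sR k])
    rw [ss k] at e1
    refine e1.trans ?_
    rw [← mul_add]
    refine mul_le_mul_of_nonneg_right (by linarith [le_abs_self C₀]) (add_nonneg η0 ?_)
    exact mul_nonneg (zpow_nonneg (s0 _).le _) (integral_nonneg (crossDens_nonneg _ _ _ _))
  · intro k
    have Sk := S.mono (sub k)
    rw [← ss k] at Sk
    have e1 := (crossDens_annulus_le (by omega) (s0 (k + 1)) Sk.memLp_grad Sk.memLp_hess).1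
    rw [ss k] at e1
    have e2 : (∫ x in ball z (R / 4) \ ball z (s (k + 1)), weightDens z p h x)
        - (∫ x in ball z (R / 4) \ ball z (s k), weightDens z p h x)
        = ∫ x in ball z (s k) \ ball z (s (k + 1)), weightDens z p h x := by
      have d1 : ball z (s (k + 1)) ⊆ ball z (s k) :=
        ball_subset_ball (by linarith [ss k, s0 (k + 1)])
      have d2 : ball z (s k) ⊆ ball z (R / 4) := ball_subset_ball (sR k)
      rw [← setIntegral_sdiff (measurableSet_ball.diff measurableSet_ball)
        (iW (k + 1)) (sdiff_subset_sdiff_right d1)]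
      congr 2
      ext x
      simp only [Set.mem_sdiff]
      constructor
      · rintro ⟨⟨h1, h2⟩, h3⟩
        exact ⟨by_contra fun h => h3 ⟨h1, h⟩, h2⟩
      · rintro ⟨h1, h2⟩
        exact ⟨⟨d2 h1, h2⟩, fun h => h.2 h1⟩
    rw [e2]
    refine e1.trans ?_
    gcongr
    linarith
  · intro k
    have Sk := S.mono (sub k)
    rw [← ss k] at Sk
    have e1 := (crossDens_annulus_le (by omega) (s0 (k + 1)) Sk.memLp_grad Sk.memLp_hess).2
    rw [ss k] at e1
    refine e1.trans ?_
    gcongr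
    linarith
  · intro k
    have Sk := S.mono (sub k)
    have wk := ae_mono (Measure.restrict_mono (sub k) le_rfl) hw
    rw [← ss k] at Sk wk
    have e1 := b1 (s0 (k + 1)) Sk wk
    rw [ss k] at e1
    refine e1.trans ?_
    refine mul_le_mul_of_nonneg_right (by linarith) (by positivity)
  · intro k
    have sm : s k = 2 ^ (m + 1) * s (k + (m + 1)) := by
      have h2 : (2 : ℝ) ^ (m + 1) * (1 / 2) ^ (m + 1) = 1 := by rw [← mul_pow]; norm_num
      simp only [hs]
      rw [pow_add (1 / 2 : ℝ) k]
      linear_combination -(R / 4 * (1 / 2) ^ k) * h2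
    have e1 := b2 (s0 (k + (m + 1))) (by
      rw [sm, pow_succ]
      nlinarith [s0 (k + (m + 1)), one_le_pow₀ (by norm_num : (1 : ℝ) ≤ 2) (n := m)])
      (S.mono (sub k))
    have e2 : s (k + (m + 1)) / s k = (1 / 2) ^ (m + 1) := by
      have h2 : (2 : ℝ) ^ (m + 1) * (1 / 2) ^ (m + 1) = 1 := by rw [← mul_pow]; norm_num
      rw [div_eq_iff (s0 k).ne', sm]
      linear_combination -(s (k + (m + 1))) * h2
    have e3 := zpow_sub_le_pow_mul 4 n (s0 (k + (m + 1))) (ρ := s k) (c := 2 ^ (m + 1))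
      (by rw [sm]; exact le_mul_of_one_le_left (s0 _).le (one_le_pow₀ (by norm_num))) sm.le
    push_cast at e3
    have e4 := mul_le_mul_of_nonneg_right e3
      (integral_nonneg (μ := volume.restrict (ball z (s k))) (hessDens_nonneg h))
    have e5 := mul_le_mul_of_nonneg_left e4 hC2
    rw [e2] at e1
    have g0 := scaledGrad_nonneg (z := z) (p := p) (s0 k)
    have a0 := scaledHess_nonneg (z := z) (h := h) (s0 k)
    have e6 := mul_le_mul_of_nonneg_right hm' g0
    have e7 : C2 * (2 ^ (m + 1)) ^ n * scaledHess z (s k) h ≤ M * scaledHess z (s k) h :=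
      mul_le_mul_of_nonneg_right (by linarith) a0
    simp only [scaledHess, scaledGrad] at *
    linarith

end Decay

section Polar

variable {G : E n → ℝ} {z : E n} {a b : ℝ}

theorem finrank_E : Module.finrank ℝ (E n) = n := by simp [E]

/-- Integration in polar coordinates. -/
theorem integral_polar (hn : 1 ≤ n) (hG : Integrable G) :
    (∀ᵐ ρ ∂(volume.restrict (Ioi (0 : ℝ))), Integrable
      (fun ξ : sphere (0 : E n) 1 => G (ρ • (ξ : E n))) (volume : Measure (E n)).toSphere) ∧
    IntegrableOn (fun ρ => ρ ^ (n - 1) * ∫ ξ : sphere (0 : E n) 1, G (ρ • (ξ : E n))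
      ∂(volume : Measure (E n)).toSphere) (Ioi 0) ∧
    ∫ ρ in Ioi (0 : ℝ), ρ ^ (n - 1) * ∫ ξ : sphere (0 : E n) 1, G (ρ • (ξ : E n))
      ∂(volume : Measure (E n)).toSphere = ∫ x, G x := by
  have : Nontrivial (E n) := Module.nontrivial_of_finrank_pos (R := ℝ) (by rw [finrank_E]; omega)
  set σ := (volume : Measure (E n)).toSphere
  have mp := (volume : Measure (E n)).measurePreserving_homeomorphUnitSphereProd
  rw [finrank_E] at mp
  have me := (homeomorphUnitSphereProd (E n)).measurableEmbedding
  set Φ : sphere (0 : E n) 1 × Ioi (0 : ℝ) → ℝ := fun q => G (q.2.1 • (q.1 : E n)) with hΦ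
  have e1 : Φ ∘ homeomorphUnitSphereProd (E n) = G ∘ Subtype.val := by
    funext x
    simp only [hΦ, Function.comp]
    congr 1
    have h0 : ‖(x : E n)‖ ≠ 0 := norm_ne_zero_iff.2 x.2
    simp [smul_smul, h0]
  have iΦ : Integrable Φ (σ.prod (Measure.volumeIoiPow (n - 1))) := by
    rw [← mp.integrable_comp_emb me, e1, ← integrableOn_iff_comap_subtypeVal (by measurability)]
    exact hG.integrableOn
  have md : Measurable fun r : Ioi (0 : ℝ) => ofReal (r.1 ^ (n - 1)) := by fun_prop
  have pos : ∀ r : Ioi (0 : ℝ), 0 < r.1 ^ (n - 1) := fun r => pow_pos r.2 _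
  have cm : (Measure.comap (Subtype.val : Ioi (0 : ℝ) → ℝ) volume).map Subtype.val
      = volume.restrict (Ioi 0) := map_comap_subtype_coe measurableSet_Ioi _
  have emb : MeasurableEmbedding (Subtype.val : Ioi (0 : ℝ) → ℝ) :=
    MeasurableEmbedding.subtype_coe measurableSet_Ioi
  refine ⟨?_, ?_, ?_⟩
  · have h1 := iΦ.prod_left_ae
    rw [Measure.volumeIoiPow, ae_withDensity_iff md] at h1
    rw [← cm, emb.ae_map_iff]
    filter_upwards [h1] with ρ hρ using hρ (by simpa using pow_pos ρ.2 _)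
  · have h1 := iΦ.integral_prod_right
    rw [Measure.volumeIoiPow, integrable_withDensity_iff_integrable_smul' md (by simp)] at h1
    rw [integrableOn_iff_comap_subtypeVal measurableSet_Ioi]
    refine h1.congr (.of_forall fun ρ => ?_)
    simp only [toReal_ofReal (pos ρ).le, Function.comp, smul_eq_mul, hΦ]
  · have h1 := integral_prod_symm Φ iΦ
    rw [Measure.volumeIoiPow, integral_withDensity_eq_integral_toReal_smul md (by simp)] at h1
    rw [← integral_subtype_comap measurableSet_Ioi fun ρ : ℝ => ρ ^ (n - 1) *
      ∫ ξ : sphere (0 : E n) 1, G (ρ • (ξ : E n)) ∂σ]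
    have h2 : ∫ x, G x = ∫ q, Φ q ∂(σ.prod (Measure.volumeIoiPow (n - 1))) := by
      refine Eq.trans ?_ (mp.integral_comp me Φ)
      refine Eq.trans ?_ (integral_congr_ae (.of_forall fun x => (congrFun e1 x).symm))
      have h3 := integral_subtype_comap (μ := (volume : Measure (E n)))
        (measurableSet_singleton (0 : E n)).compl G
      rw [restrict_compl_singleton] at h3
      exact h3.symm
    rw [h2, Measure.volumeIoiPow, h1]
    refine integral_congr_ae (.of_forall fun ρ => ?_)
    simp only [toReal_ofReal (pos ρ).le, smul_eq_mul, hΦ]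

theorem sphereIntegral_univ (hn : 1 ≤ n) (z : E n) (ρ : ℝ) (G : E n → ℝ) :
    sphereIntegral univ z ρ G = ρ ^ (n - 1) * ∫ ξ : sphere (0 : E n) 1, G (z + ρ • (ξ : E n))
      ∂(volume : Measure (E n)).toSphere := by
  rw [sphereIntegral, indicator_univ, ← zpow_natCast, Nat.cast_sub hn, Nat.cast_one]

theorem indicator_add_smul_sphere {ρ : ℝ} (hρ : 0 < ρ) (ξ : sphere (0 : E n) 1) :
    (ball z b \ ball z a).indicator G (z + ρ • (ξ : E n))
      = (Ico a b).indicator (fun ρ => G (z + ρ • (ξ : E n))) ρ := by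
  have h1 : dist (z + ρ • (ξ : E n)) z = ρ := by
    rw [dist_eq_norm, add_sub_cancel_left, norm_smul, norm_eq_abs, abs_of_pos hρ,
      mem_sphere_zero_iff_norm.1 ξ.2, mul_one]
  by_cases h : ρ ∈ Ico a b
  · rw [indicator_of_mem h, indicator_of_mem]
    exact ⟨by rw [mem_ball, h1]; exact h.2, by rw [mem_ball, h1]; exact not_lt.2 h.1⟩
  · rw [indicator_of_notMem h, indicator_of_notMem]
    rintro ⟨g1, g2⟩
    rw [mem_ball, h1] at g1 g2
    exact h ⟨not_lt.1 g2, g1⟩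

/-- Integrals over annuli in polar coordinates. -/
theorem integral_annulus_polar (hn : 1 ≤ n) (ha : 0 < a)
    (hG : IntegrableOn G (ball z b \ ball z a)) :
    (∀ᵐ ρ : ℝ, a ≤ ρ → ρ < b → Integrable (fun ξ : sphere (0 : E n) 1 =>
      G (z + ρ • (ξ : E n))) (volume : Measure (E n)).toSphere) ∧
    IntegrableOn (fun ρ => sphereIntegral univ z ρ G) (Ico a b) ∧
    ∫ ρ in Ico a b, sphereIntegral univ z ρ G = ∫ x in ball z b \ ball z a, G x := by
  set A := ball z b \ ball z a with hA
  have mA : MeasurableSet A := measurableSet_ball.diff measurableSet_ball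
  have hi : Integrable (fun x => A.indicator G (z + x)) :=
    ((integrable_indicator_iff mA).2 hG).comp_add_left z
  obtain ⟨h1, h2, h3⟩ := integral_polar hn hi
  have sub : Ico a b ⊆ Ioi 0 := fun ρ hρ => ha.trans_le hρ.1
  have e1 : ∀ ρ ∈ Ioi (0 : ℝ), ρ ^ (n - 1) * ∫ ξ : sphere (0 : E n) 1,
      A.indicator G (z + ρ • (ξ : E n)) ∂(volume : Measure (E n)).toSphere
      = (Ico a b).indicator (fun ρ => sphereIntegral univ z ρ G) ρ := fun ρ hρ => by
    simp only [hA, indicator_add_smul_sphere hρ]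
    by_cases h : ρ ∈ Ico a b
    · simp only [indicator_of_mem h, sphereIntegral_univ hn]
    · simp only [indicator_of_notMem h, integral_zero, mul_zero]
  refine ⟨?_, ?_, ?_⟩
  · rw [ae_restrict_iff' measurableSet_Ioi] at h1
    filter_upwards [h1] with ρ hρ g1 g2
    have hρ0 : 0 < ρ := ha.trans_le g1
    refine (hρ hρ0).congr (.of_forall fun ξ => ?_)
    simp only [hA, indicator_add_smul_sphere hρ0]
    rw [indicator_of_mem (show ρ ∈ Ico a b from ⟨g1, g2⟩)]
  · have h4 := (integrableOn_congr_fun e1 measurableSet_Ioi).1 h2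
    rw [IntegrableOn, integrable_indicator_iff measurableSet_Ico, IntegrableOn,
      Measure.restrict_restrict measurableSet_Ico, inter_eq_self_of_subset_left sub] at h4
    exact h4
  · rw [setIntegral_congr_fun measurableSet_Ioi e1, setIntegral_indicator measurableSet_Ico,
      inter_eq_self_of_subset_right sub] at h3
    rw [h3, integral_add_left_eq_self (A.indicator G) z, integral_indicator mA]

/-- A radius at which the sphere integral does not exceed its mean. -/
theorem exists_sphereIntegral_le (hn : 1 ≤ n) (ha : 0 < a) (hab : a < b)
    (hG : IntegrableOn G (ball z b \ ball z a)) {P : ℝ → Prop} (hP : ∀ᵐ ρ : ℝ, P ρ) :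
    ∃ ρ ∈ Ico a b, P ρ ∧ Integrable (fun ξ : sphere (0 : E n) 1 =>
      G (z + ρ • (ξ : E n))) (volume : Measure (E n)).toSphere ∧
      sphereIntegral univ z ρ G ≤ (b - a)⁻¹ * ∫ x in ball z b \ ball z a, G x := by
  obtain ⟨h1, h2, h3⟩ := integral_annulus_polar hn ha hG
  have hμ : volume (Ico a b) ≠ 0 := by
    rw [Real.volume_Ico]; simpa using hab
  have h4 := measure_le_setAverage_pos hμ (by rw [Real.volume_Ico]; simp) h2
  rw [setAverage_eq, h3, measureReal_def, Real.volume_Ico, toReal_ofReal (by linarith),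
    smul_eq_mul] at h4
  obtain ⟨ρ, ⟨h5, h6⟩, h7, h8⟩ := ((frequently_ae_mem_iff.2 h4.ne').and_eventually
    (hP.and h1)).exists
  exact ⟨ρ, h5, h7, h8 h5.1 h5.2, h6⟩

end Polar

section BoundaryEnergyInequality

variable {Ω O : Set (E n)} {w : E n → E L} {z : E n} {r ρ R : ℝ}

/-- The first weak derivatives of `w` in `O`, set to zero outside `Ω`. -/
def extGrad (Ω O : Set (E n)) (w : E n → E L) (i : Fin n) : E n → E L :=
  Ω.indicator (weakPartial O i w)

/-- The second weak derivatives of `w` in `O`, set to zero outside `Ω`. -/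
def extHess (Ω O : Set (E n)) (w : E n → E L) (i j : Fin n) : E n → E L :=
  Ω.indicator (weakPartial₂ O i j w)

theorem norm_weakGrad_sq (O : Set (E n)) (w : E n → E L) (y : E n) :
    ‖weakGrad O w y‖ ^ 2 = gradDens (fun i => weakPartial O i w) y := by
  rw [PiLp.norm_sq_eq_of_L2]; rfl

theorem norm_weakHess_sq (O : Set (E n)) (w : E n → E L) (y : E n) :
    ‖weakHess O w y‖ ^ 2 = hessDens (fun i j => weakPartial₂ O i j w) y := by
  rw [PiLp.norm_sq_eq_of_L2, Fintype.sum_prod_type]; rfl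

theorem extGrad_of_mem {y : E n} (hy : y ∈ Ω) :
    (fun i => extGrad Ω O w i y) = fun i => weakPartial O i w y :=
  funext fun _ => indicator_of_mem hy _

theorem extHess_of_mem {y : E n} (hy : y ∈ Ω) :
    (fun i j => extHess Ω O w i j y) = fun i j => weakPartial₂ O i j w y :=
  funext fun _ => funext fun _ => indicator_of_mem hy _

theorem extGrad_of_notMem {y : E n} (hy : y ∉ Ω) : (fun i => extGrad Ω O w i y) = 0 :=
  funext fun _ => indicator_of_notMem hy _

theorem extHess_of_notMem {y : E n} (hy : y ∉ Ω) : (fun i j => extHess Ω O w i j y) = 0 :=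
  funext fun _ => funext fun _ => indicator_of_notMem hy _

theorem monoE_eq (hΩ : MeasurableSet Ω) (z : E n) (r : ℝ) :
    monoE Ω O w z r = scaledHess z r (extHess Ω O w) := by
  rw [monoE, scaledHess, inter_comm, ← setIntegral_indicator hΩ]
  congr 2
  funext y
  by_cases hy : y ∈ Ω
  · rw [indicator_of_mem hy, norm_weakHess_sq, hessDens, hessDens, extHess_of_mem hy]
  · rw [indicator_of_notMem hy, hessDens, extHess_of_notMem hy]; simp [normSq₂]

theorem monoA_eq (hΩ : MeasurableSet Ω) (z : E n) (r R : ℝ) :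
    monoA Ω O w z r R = 4 * ∫ y in ball z R \ ball z r,
      (‖y - z‖ ^ (2 - (n : ℤ)) * growthDens z (extGrad Ω O w) (extHess Ω O w) y
        + ((n : ℝ) - 2) * (‖y - z‖ ^ (-(n : ℤ)) * radDens z (extGrad Ω O w) y)) := by
  rw [monoA, inter_comm, ← setIntegral_indicator hΩ]
  congr 2
  funext y
  by_cases hy : y ∈ Ω
  · rw [indicator_of_mem hy, growthDens, radDens, extGrad_of_mem hy, extHess_of_mem hy,
      show (2 - (n : ℤ)) = -((n : ℤ) - 2) by ring, zpow_neg, zpow_neg, div_eq_inv_mul,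
      div_eq_inv_mul]
    rfl
  · rw [indicator_of_notMem hy, growthDens, radDens, extGrad_of_notMem hy, extHess_of_notMem hy]
    simp [normSq₁, radV, radP]

/-- `⟨pᵢ, Vᵢ⟩` with `Vᵢ = pᵢ + (x - z)ʲ hᵢⱼ`. -/
def growthInner (z : E n) (p : Grad n L) (h : Hess n L) (x : E n) : ℝ :=
  ∑ i, inner ℝ (p i x) (radV (fun k => x k - z k) (fun i => p i x) (fun i j => h i j x) i)

/-- `⟨Δw, (x - z)ⁱ wᵢ⟩`. -/
def lapInner (z : E n) (p : Grad n L) (h : Hess n L) (x : E n) : ℝ :=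
  inner ℝ (lapH fun i j => h i j x) (radP (fun k => x k - z k) fun i => p i x)

theorem monoB_add_monoC (hn : 3 ≤ n) (hρ : 0 < ρ) (i1 : Integrable (fun ξ : sphere (0 : E n) 1 =>
      radDens z (extGrad Ω O w) (z + ρ • (ξ : E n))) (volume : Measure (E n)).toSphere)
    (i2 : Integrable (fun ξ : sphere (0 : E n) 1 =>
      growthInner z (extGrad Ω O w) (extHess Ω O w) (z + ρ • (ξ : E n)))
      (volume : Measure (E n)).toSphere)
    (i3 : Integrable (fun ξ : sphere (0 : E n) 1 =>
      gradDens (extGrad Ω O w) (z + ρ • (ξ : E n))) (volume : Measure (E n)).toSphere)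
    (i4 : Integrable (fun ξ : sphere (0 : E n) 1 =>
      lapInner z (extGrad Ω O w) (extHess Ω O w) (z + ρ • (ξ : E n)))
      (volume : Measure (E n)).toSphere) :
    monoB Ω O w z ρ + monoC Ω O w z ρ = ∫ ξ : sphere (0 : E n) 1,
      (4 * radDens z (extGrad Ω O w) (z + ρ • (ξ : E n))
        - 4 * ρ ^ 2 * growthInner z (extGrad Ω O w) (extHess Ω O w) (z + ρ • (ξ : E n))
        + 2 * ρ ^ 2 * lapInner z (extGrad Ω O w) (extHess Ω O w) (z + ρ • (ξ : E n)))
      ∂(volume : Measure (E n)).toSphere := by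
  set p := extGrad Ω O w with hp
  set h := extHess Ω O w with hh
  have key : ∀ y ∈ Ω, growthInner z p h y - gradDens p y
      = ∑ i, inner ℝ (weakPartial O i w y) (radialDerivGrad O w z y i) := fun y hy => by
    rw [growthInner, gradDens, hp, hh, extGrad_of_mem hy, extHess_of_mem hy, normSq₁,
      ← sum_sub_distrib]
    refine sum_congr rfl fun i _ => ?_
    have h1 : extGrad Ω O w i y = weakPartial O i w y := indicator_of_mem hy _
    rw [h1, radV, inner_add_right, real_inner_self_eq_norm_sq, add_sub_cancel_left]
    rfl
  have zero : ∀ y ∉ Ω, growthInner z p h y = 0 ∧ gradDens p y = 0 ∧ radDens z p y = 0 ∧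
      lapInner z p h y = 0 := fun y hy => by
    have h1 : ∀ i, extGrad Ω O w i y = 0 := fun i => indicator_of_notMem hy _
    have h2 : ∀ i j, extHess Ω O w i j y = 0 := fun i j => indicator_of_notMem hy _
    simp [growthInner, gradDens, radDens, lapInner, hp, hh, h1, h2, normSq₁, radP, radV, lapH]
  have eB : ∀ y, Ω.indicator (fun y => 2 * (‖radialDeriv O w z y‖ ^ 2 / ρ ^ ((n : ℤ) - 1))
      - (∑ i, inner ℝ (weakPartial O i w y) (radialDerivGrad O w z y i)) / ρ ^ ((n : ℤ) - 3)
      - 2 * (‖weakGrad O w y‖ ^ 2 / ρ ^ ((n : ℤ) - 3))) y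
      = 2 * (ρ ^ ((n : ℤ) - 1))⁻¹ * radDens z p y - (ρ ^ ((n : ℤ) - 3))⁻¹ * growthInner z p h y
        - (ρ ^ ((n : ℤ) - 3))⁻¹ * gradDens p y := fun y => by
    by_cases hy : y ∈ Ω
    · rw [indicator_of_mem hy, ← key y hy, norm_weakGrad_sq]
      have h1 : gradDens (fun i => weakPartial O i w) y = gradDens p y := by
        rw [gradDens, gradDens, hp, extGrad_of_mem hy]
      have h2 : ‖radialDeriv O w z y‖ ^ 2 = radDens z p y := by
        rw [radDens, hp, extGrad_of_mem hy]; rfl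
      rw [h1, h2]; ring
    · obtain ⟨g1, g2, g3, g4⟩ := zero y hy
      rw [indicator_of_notMem hy, g1, g2, g3]; ring
  have eC : ∀ y, Ω.indicator (fun y => inner ℝ (weakLaplacian O w y) (ρ⁻¹ • radialDeriv O w z y)
      - ∑ i, inner ℝ (weakPartial O i w y) (ρ⁻¹ • radialDerivGrad O w z y i)) y
      = ρ⁻¹ * lapInner z p h y - ρ⁻¹ * growthInner z p h y + ρ⁻¹ * gradDens p y := fun y => by
    by_cases hy : y ∈ Ω
    · have k1 := key y hy
      have h2 : inner ℝ (weakLaplacian O w y) (radialDeriv O w z y) = lapInner z p h y := by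
        rw [lapInner, hp, hh, extGrad_of_mem hy, extHess_of_mem hy]; rfl
      rw [indicator_of_mem hy]
      simp only [inner_smul_right, h2]
      rw [← mul_sum, ← k1]; ring
    · obtain ⟨g1, g2, g3, g4⟩ := zero y hy
      rw [indicator_of_notMem hy, g1, g2, g4]; ring
  rw [monoB, monoC, sphereIntegral, sphereIntegral]
  simp only [eB, eC]
  set σ := (volume : Measure (E n)).toSphere
  set F1 := fun ξ : sphere (0 : E n) 1 => radDens z p (z + ρ • (ξ : E n))
  set F2 := fun ξ : sphere (0 : E n) 1 => growthInner z p h (z + ρ • (ξ : E n))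
  set F3 := fun ξ : sphere (0 : E n) 1 => gradDens p (z + ρ • (ξ : E n))
  set F4 := fun ξ : sphere (0 : E n) 1 => lapInner z p h (z + ρ • (ξ : E n))
  obtain ⟨m, rfl⟩ : ∃ m, n = m + 3 := ⟨n - 3, by omega⟩
  have z1 : ρ ^ (((m + 3 : ℕ) : ℤ) - 1) = ρ ^ m * ρ ^ 2 := by
    rw [← pow_add, ← zpow_natCast]; congr 1; push_cast; ring
  have z3 : ρ ^ (((m + 3 : ℕ) : ℤ) - 3) = ρ ^ m := by
    rw [← zpow_natCast]; congr 1; push_cast; ring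
  have z4 : ρ ^ (4 - ((m + 3 : ℕ) : ℤ)) = ρ * (ρ ^ m)⁻¹ := by
    rw [← zpow_natCast, ← zpow_neg]
    nth_rewrite 2 [← zpow_one ρ]
    rw [← zpow_add₀ hρ.ne']; congr 1; push_cast; ring
  rw [z1, z3, z4]
  simp only [← integral_const_mul]
  rw [← integral_add]
  · refine integral_congr_ae (.of_forall fun ξ => ?_)
    simp only
    field_simp
    ring
  · exact ((((i1.const_mul _).sub (i2.const_mul _)).sub (i3.const_mul _)).const_mul _).const_mul _
  · exact ((((i4.const_mul _).sub (i2.const_mul _)).add (i3.const_mul _)).const_mul _).const_mul _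

theorem abs_growthInner_add_lapInner_le (hn : 1 ≤ n) (hr : 0 < r) (hrρ : r ≤ ρ)
    (p : Grad n L) (h : Hess n L) (z x : E n) :
    |4 * radDens z p x - 4 * ρ ^ 2 * growthInner z p h x + 2 * ρ ^ 2 * lapInner z p h x|
      ≤ 4 * n * ρ ^ 2 * crossDens r z p h x := by
  have hn' : (1 : ℝ) ≤ n := by exact_mod_cast hn
  have hρ : 0 < ρ := hr.trans_le hrρ
  set X := fun k => x k - z k
  set P := fun i => p i x
  set H := fun i j => h i j x
  have h1 : |growthInner z p h x| ≤ √(normSq₁ P) * √(normSq₁ (radV X P H)) := abs_sum_inner_le _ _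
  have h2 : |lapInner z p h x| ≤ n * (√(normSq₂ H) * ‖radP X P‖) := by
    refine (abs_real_inner_le_norm _ _).trans ?_
    rw [← mul_assoc]
    exact mul_le_mul_of_nonneg_right (norm_lapH_le _) (norm_nonneg _)
  have h3 : radDens z p x ≤ ρ ^ 2 * ((r ^ 2)⁻¹ * ‖radP X P‖ ^ 2) := by
    rw [← mul_assoc]
    refine le_mul_of_one_le_left (sq_nonneg _) ?_
    rw [← div_eq_mul_inv, one_le_div (by positivity)]
    gcongr
  have h4 : 0 ≤ radDens z p x := radDens_nonneg _ _ _
  set t1 := √(normSq₁ P) * √(normSq₁ (radV X P H))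
  set t2 := √(normSq₂ H) * ‖radP X P‖
  set t3 := (r ^ 2)⁻¹ * ‖radP X P‖ ^ 2
  have e1 : crossDens r z p h x = t2 + t1 + t3 := rfl
  have p1 : 0 ≤ t1 := by positivity
  have p2 : 0 ≤ t2 := by positivity
  have p3 : 0 ≤ t3 := by positivity
  rw [e1]
  have g1 := abs_le.1 h1
  have g2 := abs_le.1 h2
  have q1 : ρ ^ 2 * t1 ≤ n * (ρ ^ 2 * t1) := le_mul_of_one_le_left (by positivity) hn'
  have q3 : ρ ^ 2 * t3 ≤ n * (ρ ^ 2 * t3) := le_mul_of_one_le_left (by positivity) hn'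
  have q2 : 0 ≤ n * (ρ ^ 2 * t2) := by positivity
  have k1 := mul_le_mul_of_nonneg_left g1.1 (sq_nonneg ρ)
  have k2 := mul_le_mul_of_nonneg_left g1.2 (sq_nonneg ρ)
  have k3 := mul_le_mul_of_nonneg_left g2.1 (sq_nonneg ρ)
  have k4 := mul_le_mul_of_nonneg_left g2.2 (sq_nonneg ρ)
  have q0 : 0 ≤ ρ ^ 2 * t3 := by positivity
  rw [abs_le]
  constructor <;> linarith

theorem integrableOn_growthInner {s : Set (E n)} {p : Grad n L}
    {h : Hess n L} (hs : MeasurableSet s) (hsR : s ⊆ ball z R)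
    (mp : ∀ i, MemLp (p i) 2 (volume.restrict s))
    (mh : ∀ i j, MemLp (h i j) 2 (volume.restrict s)) : IntegrableOn (growthInner z p h) s :=
  integrable_finsetSum _ fun i _ => integrable_inner_of_memLp (mp i) (memLp_radV hs hsR mp mh i)

theorem integrableOn_lapInner {s : Set (E n)} {p : Grad n L}
    {h : Hess n L} (hs : MeasurableSet s) (hsR : s ⊆ ball z R)
    (mp : ∀ i, MemLp (p i) 2 (volume.restrict s))
    (mh : ∀ i j, MemLp (h i j) 2 (volume.restrict s)) : IntegrableOn (lapInner z p h) s :=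
  integrable_inner_of_memLp (memLp_finsetSum _ fun i _ => mh i i) (memLp_radP hs hsR mp)

/-- Radii at which the boundary terms of the monotonicity inequality are controlled. -/
theorem exists_radius_boundaryTerm_le (hn : 3 ≤ n) (hr : 0 < r) (hrR : 2 * r ≤ R)
    (mp : ∀ i, MemLp (extGrad Ω O w i) 2 (volume.restrict (ball z R)))
    (mh : ∀ i j, MemLp (extHess Ω O w i j) 2 (volume.restrict (ball z R)))
    {P : ℝ → Prop} (hP : ∀ᵐ ρ : ℝ, P ρ) :
    ∃ ρ ∈ Ico r (2 * r), P ρ ∧ |monoB Ω O w z ρ + monoC Ω O w z ρ|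
      ≤ 4 * n * (r ^ (2 - (n : ℤ)) * ∫ x in ball z (2 * r) \ ball z r,
        crossDens r z (extGrad Ω O w) (extHess Ω O w) x) := by
  set p := extGrad Ω O w
  set h := extHess Ω O w
  set s := ball z (2 * r) \ ball z r
  have ms : MeasurableSet s := measurableSet_ball.diff measurableSet_ball
  have sR : s ⊆ ball z R := sdiff_subset.trans (ball_subset_ball hrR)
  have mp' := fun i => (mp i).mono_measure (Measure.restrict_mono sR le_rfl)
  have mh' := fun i j => (mh i j).mono_measure (Measure.restrict_mono sR le_rfl)
  have a1 := (integral_annulus_polar (by omega) hr (integrableOn_radDens ms sR mp')).1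
  have a2 := (integral_annulus_polar (by omega) hr (integrableOn_growthInner ms sR mp' mh')).1
  have a3 := (integral_annulus_polar (by omega) hr (integrableOn_gradDens mp')).1
  have a4 := (integral_annulus_polar (by omega) hr (integrableOn_lapInner ms sR mp' mh')).1
  obtain ⟨ρ, hρ, ⟨hPρ, b1, b2, b3, b4⟩, i5, le5⟩ := exists_sphereIntegral_le (by omega) hr
    (by linarith) (integrableOn_crossDens ms sR mp' mh' r)
    (hP.and (a1.and (a2.and (a3.and a4))))
  refine ⟨ρ, hρ, hPρ, ?_⟩
  have hρ0 : 0 < ρ := hr.trans_le hρ.1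
  have i1 := b1 hρ.1 hρ.2
  have i2 := b2 hρ.1 hρ.2
  have i3 := b3 hρ.1 hρ.2
  have i4 := b4 hρ.1 hρ.2
  rw [monoB_add_monoC hn hρ0 i1 i2 i3 i4]
  have c1 := (((i1.const_mul 4).sub (i2.const_mul (4 * ρ ^ 2))).add (i4.const_mul (2 * ρ ^ 2)))
  have c2 := integral_mono c1.abs (i5.const_mul (4 * n * ρ ^ 2)) fun ξ =>
    abs_growthInner_add_lapInner_le (by omega) hr hρ.1 p h z (z + ρ • (ξ : E n))
  refine abs_integral_le_integral_abs.trans (c2.trans ?_)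
  rw [integral_const_mul]
  rw [sphereIntegral_univ (by omega)] at le5
  set I := ∫ ξ : sphere (0 : E n) 1, crossDens r z p h (z + ρ • (ξ : E n))
    ∂(volume : Measure (E n)).toSphere with hI
  set J := ∫ x in s, crossDens r z p h x
  have I0 : 0 ≤ I := integral_nonneg fun _ => crossDens_nonneg _ _ _ _ _
  obtain ⟨m, rfl⟩ : ∃ m, n = m + 3 := ⟨n - 3, by omega⟩
  have z1 : r ^ (2 - ((m + 3 : ℕ) : ℤ)) = (r ^ (m + 1))⁻¹ := by
    rw [← zpow_natCast, ← zpow_neg]; congr 1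
  rw [z1, mul_assoc]
  refine mul_le_mul_of_nonneg_left ?_ (by positivity)
  rw [show 2 * r - r = r by ring, show m + 3 - 1 = m + 2 by omega] at le5
  have k1 : r ^ m * (ρ ^ 2 * I) ≤ r⁻¹ * J := by
    refine le_trans ?_ le5
    rw [← mul_assoc, pow_add]
    have := hρ.1
    gcongr
  have k2 := mul_le_mul_of_nonneg_left k1 (by positivity : 0 ≤ (r ^ m)⁻¹)
  have k3 : (r ^ m)⁻¹ * (r ^ m * (ρ ^ 2 * I)) = ρ ^ 2 * I := by field_simp
  have k4 : (r ^ m)⁻¹ * (r⁻¹ * J) = (r ^ (m + 1))⁻¹ * J := by rw [pow_succ]; field_simp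
  rw [k3, k4] at k2
  exact k2

/-- The boundary monotonicity inequality yields the energy inequality at boundary points. -/
theorem exists_boundary_energyInequality (hn : 5 ≤ n) (L : ℕ) : ∃ C, 0 ≤ C ∧
    ∀ {Ω O : Set (E n)} {w : E n → E L} {R₀ C₀ : ℝ}, MeasurableSet Ω →
    BoundaryMonotonicity Ω O w R₀ C₀ → ∀ z ∈ frontier Ω, ∀ {R η : ℝ}, 0 < R → R ≤ R₀ →
    |C₀| * R ≤ 1 → |C₀| * R ≤ η →
    (∀ i, MemLp (extGrad Ω O w i) 2 (volume.restrict (ball z R))) →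
    (∀ i j, MemLp (extHess Ω O w i j) 2 (volume.restrict (ball z R))) →
    scaledHess z R (extHess Ω O w) + scaledGrad z R (extGrad Ω O w) ≤ η →
    EnergyInequality z R C η (extGrad Ω O w) (extHess Ω O w) := by
  refine ⟨2 ^ n * (3 + 3 * 2 ^ n + 12 * n * 2 ^ (n + 2) + 12 * n), by positivity, ?_⟩
  intro Ω O w R₀ C₀ hΩ hmono z hz R η hR hRR₀ hC1 hCη mp mh hη r hr hrR
  set p := extGrad Ω O w
  set h := extHess Ω O w
  have a0 : 0 ≤ scaledHess z R h := scaledHess_nonneg hR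
  have g0 : 0 ≤ scaledGrad z R p := scaledGrad_nonneg hR
  have η0 : 0 ≤ η := by linarith
  obtain ⟨ρ, hρ, hP, k1⟩ := exists_radius_boundaryTerm_le (by omega) hr (by linarith) mp mh
    (hmono z hz)
  have h2R : 2 * (R / 2) = R := by ring
  obtain ⟨S, hS, hQ, k2⟩ := exists_radius_boundaryTerm_le (r := R / 2) (by omega) (by linarith)
    h2R.le mp mh hP
  have hρ0 : 0 < ρ := hr.trans_le hρ.1
  have hS0 : 0 < S := lt_of_lt_of_le (by linarith) hS.1
  rw [h2R] at k2 hS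
  have key := hQ hρ0 (by linarith [hρ.2, hS.1]) (by linarith [hS.2])
  rw [monoE_eq hΩ, monoE_eq hΩ, monoA_eq hΩ] at key
  set D := r ^ (2 - (n : ℤ)) * ∫ x in ball z (2 * r) \ ball z r, crossDens r z p h x with hD
  set BC := |monoB Ω O w z ρ + monoC Ω O w z ρ|
  set BC' := |monoB Ω O w z S + monoC Ω O w z S| with hBC'
  have cross : BC' ≤ 4 * n * (2 ^ (n + 2) * η) := by
    refine k2.trans (mul_le_mul_of_nonneg_left ?_ (by positivity))
    have mp2 := mp
    have mh2 := mh
    rw [← h2R] at mp2 mh2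
    have h1 := (crossDens_annulus_le (by omega) (by linarith : 0 < R / 2) mp2 mh2).2
    rw [h2R] at h1
    refine h1.trans ?_
    have s1 : √(scaledGrad z R p) ≤ √η := sqrt_le_sqrt (by linarith)
    have s2 : √(scaledHess z R h) ≤ √η := sqrt_le_sqrt (by linarith)
    calc 2 ^ (n + 1) * √(scaledGrad z R p) * (√(scaledHess z R h) + √(scaledGrad z R p))
        ≤ 2 ^ (n + 1) * √η * (√η + √η) := by gcongr
      _ = 2 ^ (n + 2) * (√η * √η) := by ring
      _ = 2 ^ (n + 2) * η := by rw [Real.mul_self_sqrt η0]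
  have expb : ∀ t, 0 ≤ t → t ≤ R → Real.exp (C₀ * t) ≤ 3 := fun t h0 h1 => by
    have : C₀ * t ≤ 1 := by
      calc C₀ * t ≤ |C₀| * R := mul_le_mul (le_abs_self _) h1 h0 (abs_nonneg _)
        _ ≤ 1 := hC1
    refine (Real.exp_le_exp.2 this).trans ?_
    linarith [Real.exp_one_lt_d9]
  have E1 := expb ρ hρ0.le (by linarith [hρ.2])
  have E2 := expb S hS0.le hS.2.le
  have E1' := Real.exp_pos (C₀ * ρ)
  have E2' := Real.exp_pos (C₀ * S)
  have iH : IntegrableOn (hessDens h) (ball z R) := integrableOn_hessDens mh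
  have t1 : scaledHess z r h ≤ 2 ^ n * scaledHess z ρ h :=
    scaledHess_le (iH.mono_set (ball_subset_ball (by linarith [hρ.2]))) hr hρ.1 hρ.2.le
  have t2 : scaledHess z S h ≤ 2 ^ n * scaledHess z R h :=
    scaledHess_le iH hS0 hS.2.le (by linarith [hS.1])
  set A := ball z (R / 4) \ ball z (2 * r)
  set A' := ball z S \ ball z ρ with hA'
  have AA : A ⊆ A' := sdiff_subset_sdiff (ball_subset_ball (by linarith [hS.1]))
    (ball_subset_ball hρ.2.le)
  have mA' : MeasurableSet A' := measurableSet_ball.diff measurableSet_ball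
  have A'R : A' ⊆ ball z R := sdiff_subset.trans (ball_subset_ball hS.2.le)
  have dist1 : ∀ x ∈ A', ρ ≤ ‖x - z‖ := fun x hx => by
    have := hx.2; rwa [mem_ball, dist_eq_norm, not_lt] at this
  have mp' := fun i => (mp i).mono_measure (Measure.restrict_mono A'R le_rfl)
  have mh' := fun i j => (mh i j).mono_measure (Measure.restrict_mono A'R le_rfl)
  have iW := integrableOn_weightDens (by omega) mA' A'R hρ0 dist1 mp' mh'
  have iG := integrableOn_zpow_norm_mul hρ0 mA' dist1
    (integrableOn_growthDens mA' A'R mp' mh') (by omega : 2 - (n : ℤ) ≤ 0)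
  have iQ := integrableOn_zpow_norm_mul hρ0 mA' dist1
    (integrableOn_radDens mA' A'R mp') (by omega : -(n : ℤ) ≤ 0)
  have hn' : (5 : ℝ) ≤ n := by exact_mod_cast hn
  set W := ∫ x in A, weightDens z p h x
  have t3 : W ≤ ∫ y in A', (‖y - z‖ ^ (2 - (n : ℤ)) * growthDens z p h y
        + ((n : ℝ) - 2) * (‖y - z‖ ^ (-(n : ℤ)) * radDens z p y)) := by
    refine (setIntegral_mono_set iW (.of_forall (weightDens_nonneg z p h))
      (LE.le.eventuallyLE AA)).trans (integral_mono iW (iG.add (iQ.const_mul _)) fun x => ?_)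
    have h1 : 0 ≤ ‖x - z‖ ^ (-(n : ℤ)) * radDens z p x :=
      mul_nonneg (zpow_nonneg (norm_nonneg _) _) (radDens_nonneg _ _ _)
    have h2 : 1 * (‖x - z‖ ^ (-(n : ℤ)) * radDens z p x)
        ≤ ((n : ℝ) - 2) * (‖x - z‖ ^ (-(n : ℤ)) * radDens z p x) :=
      mul_le_mul_of_nonneg_right (by linarith) h1
    rw [weightDens]
    linarith
  have W0 : 0 ≤ W := integral_nonneg (weightDens_nonneg z p h)
  have u1 : C₀ * S * Real.exp (C₀ * S) ≤ 3 * η := by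
    have h1 : C₀ * S ≤ |C₀| * R := mul_le_mul (le_abs_self _) hS.2.le hS0.le (abs_nonneg _)
    calc C₀ * S * Real.exp (C₀ * S) ≤ η * Real.exp (C₀ * S) :=
          mul_le_mul_of_nonneg_right (h1.trans hCη) E2'.le
      _ ≤ η * 3 := mul_le_mul_of_nonneg_left E2 η0
      _ = 3 * η := by ring
  have u2 : Real.exp (C₀ * S) * scaledHess z S h ≤ 3 * (2 ^ n * η) := by
    refine mul_le_mul E2 (t2.trans ?_) (scaledHess_nonneg hS0) (by norm_num)
    exact mul_le_mul_of_nonneg_left (by linarith) (by positivity)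
  have u3 : Real.exp (C₀ * S) * (monoB Ω O w z S + monoC Ω O w z S)
      ≤ 3 * (4 * n * (2 ^ (n + 2) * η)) :=
    (mul_le_mul_of_nonneg_left (le_abs_self _) E2'.le).trans
      (mul_le_mul E2 cross (abs_nonneg _) (by norm_num))
  have u4 : -(3 * (4 * n * D)) ≤ Real.exp (C₀ * ρ) * (monoB Ω O w z ρ + monoC Ω O w z ρ) := by
    have h1 := mul_le_mul_of_nonneg_left (neg_abs_le (monoB Ω O w z ρ + monoC Ω O w z ρ)) E1'.le
    have h2 : Real.exp (C₀ * ρ) * BC ≤ 3 * (4 * n * D) :=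
      mul_le_mul E1 k1 (abs_nonneg _) (by norm_num)
    linarith
  have tot : scaledHess z ρ h + W ≤ (3 + 3 * 2 ^ n + 12 * n * 2 ^ (n + 2)) * η + 12 * n * D := by
    linarith
  have D0 : 0 ≤ D := mul_nonneg (zpow_nonneg hr.le _) (integral_nonneg (crossDens_nonneg _ _ _ _))
  have c2 : (1 : ℝ) ≤ 2 ^ n := one_le_pow₀ (by norm_num)
  have v1 : W ≤ 2 ^ n * W := le_mul_of_one_le_left W0 c2
  have v2 := mul_le_mul_of_nonneg_left tot (by positivity : (0 : ℝ) ≤ 2 ^ n)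
  have v3 : 0 ≤ 2 ^ n * (12 * n) * η := by positivity
  have v4 : 0 ≤ 2 ^ n * (3 + 3 * 2 ^ n + 12 * n * 2 ^ (n + 2)) * D := by positivity
  change scaledHess z r h + W ≤ _
  linarith

end BoundaryEnergyInequality

theorem sq_lintegral_le {α : Type*} [MeasurableSpace α] (μ : Measure α) {g : α → ℝ≥0∞}
    (hg : AEMeasurable g μ) : (∫⁻ x, g x ∂μ) ^ 2 ≤ μ univ * ∫⁻ x, g x ^ 2 ∂μ := by
  have h := ENNReal.lintegral_mul_le_Lp_mul_Lq μ Real.HolderConjugate.two_two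
    (aemeasurable_const (b := 1)) hg
  simp only [Pi.mul_apply, one_mul, ENNReal.one_rpow, lintegral_one] at h
  refine (pow_le_pow_left' h 2).trans_eq ?_
  rw [mul_pow, ← ENNReal.rpow_natCast, ← ENNReal.rpow_natCast, ← ENNReal.rpow_mul,
    ← ENNReal.rpow_mul]
  norm_num

/-- Lebesgue measure on the unit ball, normalized. -/
def unitBallMeasure (n : ℕ) : Measure (E n) := ProbabilityTheory.cond volume (ball 0 1)

instance : IsProbabilityMeasure (unitBallMeasure n) :=
  ProbabilityTheory.cond_isProbabilityMeasure_of_finite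
    (measure_ball_pos _ _ one_pos).ne' measure_ball_lt_top.ne

theorem lintegral_comp_add_smul {g : E n → ℝ≥0∞} (hg : Measurable g) (x : E n) {s : ℝ}
    (hs : 0 < s) : ∫⁻ y, g (x + s • y) = ofReal (s ^ n)⁻¹ * ∫⁻ y, g y := by
  have h1 : ∫⁻ y, g (x + s • y) = ∫⁻ y, g (x + y) ∂(Measure.map (s • ·) volume) :=
    (lintegral_map (f := fun y => g (x + y)) (by fun_prop) (by fun_prop)).symm
  rw [h1, Measure.map_addHaar_smul _ hs.ne', lintegral_smul_measure, finrank_E,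
    abs_of_pos (by positivity), lintegral_add_left_eq_self, smul_eq_mul]

theorem lintegral_unitBallMeasure {g : E n → ℝ≥0∞} (hg : Measurable g) (x : E n) {s : ℝ}
    (hs : 0 < s) : ∫⁻ y, g (x + s • y) ∂(unitBallMeasure n) = (volume (ball (0 : E n) 1))⁻¹ *
        (ofReal (s ^ n)⁻¹ * ∫⁻ y in ball x s, g y) := by
  rw [unitBallMeasure, ProbabilityTheory.cond, lintegral_smul_measure, smul_eq_mul,
    ← lintegral_indicator measurableSet_ball, ← lintegral_indicator measurableSet_ball,
    ← lintegral_comp_add_smul (hg.indicator measurableSet_ball) x hs]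
  congr 1
  refine lintegral_congr fun y => ?_
  have : x + s • y ∈ ball x s ↔ y ∈ ball (0 : E n) 1 := by
    rw [mem_ball, dist_eq_norm, add_sub_cancel_left, norm_smul, norm_eq_abs,
      abs_of_pos hs, mem_ball_zero_iff]
    exact mul_lt_iff_lt_one_right hs
  by_cases hy : y ∈ ball (0 : E n) 1
  · rw [indicator_of_mem hy, indicator_of_mem (this.2 hy)]
  · rw [indicator_of_notMem hy, indicator_of_notMem (mt this.1 hy)]

/-- A compactly supported function is bounded by the averages of its gradient along rays. -/
theorem enorm_le_lintegral_fderiv (hn : 1 ≤ n) {F : E n → ℝ} (hF : ContDiff ℝ ∞ F)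
    (hc : HasCompactSupport F) (x : E n) :
    ‖F x‖ₑ ≤ ∫⁻ s in Ioi (0 : ℝ), ∫⁻ y, ‖∇ F (x + s • y)‖ₑ ∂(unitBallMeasure n) := by
  have : Nontrivial (E n) := Module.nontrivial_of_finrank_pos (R := ℝ) (by rw [finrank_E]; omega)
  have cD : Continuous (∇ F) := hF.continuous_fderiv (by simp)
  have hm : Measurable fun q : ℝ × E n => ‖∇ F (x + q.1 • q.2)‖ₑ := by fun_prop
  rw [lintegral_lintegral_swap hm.aemeasurable]
  have h1 : ∀ᵐ y ∂(unitBallMeasure n), ‖F x‖ₑ ≤ ∫⁻ s in Ioi (0 : ℝ), ‖∇ F (x + s • y)‖ₑ := by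
    have h2 : ∀ᵐ y ∂(unitBallMeasure n), y ∈ ball (0 : E n) 1 :=
      ProbabilityTheory.ae_cond_mem measurableSet_ball
    have h3 : ∀ᵐ y ∂(unitBallMeasure n), y ≠ 0 := by
      refine ProbabilityTheory.cond_absolutelyContinuous ?_
      simp
    filter_upwards [h2, h3] with y hy hy0
    obtain ⟨R, hR⟩ := hc.isBounded.subset_closedBall 0
    have ny : 0 < ‖y‖ := norm_pos_iff.2 hy0
    set S := (|R| + 1 + ‖x‖) / ‖y‖ with hS
    have S0 : 0 ≤ S := by positivity
    have FS : F (x + S • y) = 0 := by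
      refine image_eq_zero_of_notMem_tsupport fun h => ?_
      have h4 := hR h
      rw [mem_closedBall_zero_iff] at h4
      have h5 : ‖S • y‖ = |R| + 1 + ‖x‖ := by
        rw [norm_smul, norm_eq_abs, abs_of_nonneg S0, hS]; field_simp
      have h6 := norm_sub_le (x + S • y) x
      rw [add_sub_cancel_left, h5] at h6
      linarith [le_abs_self R]
    have h7 := enorm_sub_le_lintegral_deriv_of_contDiffOn_Icc (f := fun s : ℝ => F (x + s • y))
      (a := 0) (b := S) (ContDiff.contDiffOn ((hF.comp (by fun_prop)).of_le (by simp))) S0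
    simp only [FS, zero_smul, add_zero, zero_sub, enorm_neg] at h7
    refine h7.trans ?_
    rw [← setLIntegral_congr Ioc_ae_eq_Icc]
    refine (lintegral_mono fun s => ?_).trans
      (lintegral_mono_set (Ioc_subset_Ioi_self : Ioc (0 : ℝ) S ⊆ Ioi 0))
    have hd : HasDerivAt (fun s : ℝ => F (x + s • y)) (∇ F (x + s • y) y) s := by
      have h8 : HasDerivAt (fun s : ℝ => x + s • y) y s := by
        simpa using ((hasDerivAt_id s).smul_const y).const_add x
      exact ((hF.differentiable (by simp)) _).hasFDerivAt.comp_hasDerivAt s h8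
    rw [hd.deriv, ← ofReal_norm, ← ofReal_norm]
    refine ofReal_le_ofReal ((ContinuousLinearMap.le_opNorm _ _).trans ?_)
    exact mul_le_of_le_one_right (norm_nonneg _) (mem_ball_zero_iff.1 hy).le
  calc ‖F x‖ₑ = ∫⁻ _, ‖F x‖ₑ ∂(unitBallMeasure n) := by simp
    _ ≤ _ := lintegral_mono_ae h1

/-- A weak type estimate for functions whose gradient lies in a Morrey space. -/
theorem exists_weak_type (hn : 4 ≤ n) : ∃ C, 0 ≤ C ∧ ∀ {F : E n → ℝ} {Λ M : ℝ}, ContDiff ℝ ∞ F →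
    HasCompactSupport F → 0 < Λ → 0 < M →
    (∀ x s, 0 < s → ∫⁻ y in ball x s, ‖∇ F y‖ₑ ^ 2 ≤ ofReal (Λ * s ^ (n - 4))) →
    ofReal (M ^ 4) * volume {x | M ≤ F x} ≤ ofReal (C * Λ) * ∫⁻ y, ‖∇ F y‖ₑ ^ 2 := by
  set v := volume.real (ball (0 : E n) 1)
  have v0 : 0 < v := ENNReal.toReal_pos (measure_ball_pos _ _ one_pos).ne'
    measure_ball_lt_top.ne
  refine ⟨16 * v⁻¹, by positivity, ?_⟩
  intro F Λ M hF hc hΛ hM hb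
  have cD : Continuous (∇ F) := hF.continuous_fderiv (by simp)
  set g : E n → ℝ≥0∞ := fun x => ‖∇ F x‖ₑ
  have mg : Measurable g := by fun_prop
  set k := √(v⁻¹ * Λ)
  have k2 : k ^ 2 = v⁻¹ * Λ := sq_sqrt (by positivity)
  have k0 : 0 < k := Real.sqrt_pos.2 (by positivity)
  set δ := 2 * k / M with hδ
  have δ0 : 0 < δ := by positivity
  set m : E n → ℝ → ℝ≥0∞ := fun x s => ∫⁻ y, g (x + s • y) ∂(unitBallMeasure n)
  have far : ∀ x s, 0 < s → m x s ≤ ofReal (k * s ^ (-2 : ℝ)) := fun x s hs => by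
    have h1 : m x s ^ 2 ≤ ofReal (k * s ^ (-2 : ℝ)) ^ 2 := by
      refine (sq_lintegral_le _ (by fun_prop)).trans ?_
      rw [measure_univ, one_mul, lintegral_unitBallMeasure (mg.pow_const 2) x hs,
        ← ofReal_pow (by positivity)]
      refine (mul_le_mul_right (mul_le_mul_right (hb x s hs) _) _).trans_eq ?_
      rw [← ENNReal.ofReal_toReal (measure_ball_lt_top (μ := volume) (x := (0 : E n)) (r := 1)).ne,
        show (volume (ball (0 : E n) 1)).toReal = v from rfl,
        ← ENNReal.ofReal_inv_of_pos v0, ← ofReal_mul (by positivity),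
        ← ofReal_mul (by positivity)]
      congr 1
      rw [mul_pow, k2, Real.rpow_neg hs.le, show (2 : ℝ) = ((2 : ℕ) : ℝ) by norm_num,
        Real.rpow_natCast]
      obtain ⟨j, rfl⟩ : ∃ j, n = j + 4 := ⟨n - 4, by omega⟩
      rw [Nat.add_sub_cancel, pow_add]
      field_simp
    exact (ENNReal.pow_le_pow_left_iff two_ne_zero).1 h1
  have tail : ∀ x, ∫⁻ s in Ioi δ, m x s ≤ ofReal (M / 2) := fun x => by
    refine (setLIntegral_mono' measurableSet_Ioi fun s hs => far x s (δ0.trans hs)).trans ?_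
    rw [← ofReal_integral_eq_lintegral_ofReal
      ((integrableOn_Ioi_rpow_of_lt (by norm_num) δ0).const_mul k)
      ((ae_restrict_iff' measurableSet_Ioi).2 (.of_forall fun s hs =>
        mul_nonneg k0.le (Real.rpow_nonneg (δ0.trans hs).le _)))]
    refine ofReal_le_ofReal (le_of_eq ?_)
    rw [integral_const_mul, integral_Ioi_rpow_of_lt (by norm_num) δ0]
    norm_num
    rw [Real.rpow_neg_one, hδ]
    field_simp
  set κ := (volume.restrict (Ioc 0 δ)).prod (unitBallMeasure n) with hκ
  set T : E n → ℝ≥0∞ := fun x => ∫⁻ q, g (x + q.1 • q.2) ∂κ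
  have mT2 : Measurable fun q : E n × (ℝ × E n) => g (q.1 + q.2.1 • q.2.2) := by fun_prop
  have mT : Measurable T := mT2.lintegral_prod_right'
  have upper : ∀ x, ‖F x‖ₑ ≤ T x + ofReal (M / 2) := fun x => by
    refine (enorm_le_lintegral_fderiv (by omega) hF hc x).trans ?_
    rw [← Ioc_union_Ioi_eq_Ioi δ0.le]
    refine (lintegral_union_le _ _ _).trans (add_le_add (le_of_eq ?_) (tail x))
    exact (lintegral_prod (fun q : ℝ × E n => g (x + q.1 • q.2)) (by fun_prop)).symm
  have T2 : ∫⁻ x, T x ^ 2 ≤ ofReal (δ ^ 2) * ∫⁻ y, g y ^ 2 := by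
    have κu : κ univ = ofReal δ := by
      rw [hκ, ← univ_prod_univ, Measure.prod_prod]; simp
    calc ∫⁻ x, T x ^ 2 ≤ ∫⁻ x, ofReal δ * ∫⁻ q, g (x + q.1 • q.2) ^ 2 ∂κ :=
          lintegral_mono fun x => κu ▸ sq_lintegral_le κ (by fun_prop)
      _ = ofReal δ * ∫⁻ q, (∫⁻ x, g (x + q.1 • q.2) ^ 2) ∂κ := by
          rw [lintegral_const_mul' _ _ ofReal_ne_top,
            lintegral_lintegral_swap (mT2.pow_const 2).aemeasurable]
      _ = ofReal δ * ∫⁻ _, (∫⁻ x, g x ^ 2) ∂κ := by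
          congr 1
          exact lintegral_congr fun q => lintegral_add_right_eq_self (fun x => g x ^ 2) _
      _ = _ := by
          rw [lintegral_const, κu, pow_two δ, ofReal_mul δ0.le]; ring
  have sub : {x | M ≤ F x} ⊆ {x | ofReal (M / 2) ^ 2 ≤ T x ^ 2} := fun x hx => by
    have h1 : ofReal (M / 2) + ofReal (M / 2) ≤ T x + ofReal (M / 2) := by
      refine le_trans ?_ (upper x)
      rw [← ofReal_add (by positivity) (by positivity), add_halves, ← ofReal_norm]
      exact ofReal_le_ofReal (le_trans hx (le_abs_self _))
    exact pow_le_pow_left' ((ENNReal.add_le_add_iff_right ofReal_ne_top).1 h1) 2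
  have h1 := (mul_le_mul_right (measure_mono (μ := volume) sub) _).trans
    ((mul_meas_ge_le_lintegral (mT.pow_const 2) (ofReal (M / 2) ^ 2)).trans T2)
  have h2 := mul_le_mul_right h1 (ofReal (4 * M ^ 2))
  rw [← mul_assoc, ← mul_assoc, ← ofReal_pow (by positivity),
    ← ofReal_mul (by positivity), ← ofReal_mul (by positivity)] at h2
  rw [show M ^ 4 = 4 * M ^ 2 * (M / 2) ^ 2 by ring]
  refine h2.trans (le_of_eq ?_)
  congr 2
  rw [hδ, div_pow, mul_pow, k2]
  field_simp
  norm_num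

/-- `∑ᵢ |pᵢ|²` with values in `[0, ∞]`. -/
def egradDens (p : Grad n L) (x : E n) : ℝ≥0∞ := ∑ i, ‖p i x‖ₑ ^ 2

theorem egradDens_eq (p : Grad n L) (x : E n) : egradDens p x = ofReal (gradDens p x) := by
  rw [egradDens, gradDens, normSq₁, ofReal_sum_of_nonneg fun i _ => by positivity]
  refine sum_congr rfl fun i _ => ?_
  rw [ofReal_pow (norm_nonneg _), ofReal_norm]

theorem deriv_step_of_gt {τ : ℝ} (h : 3 < τ) : deriv step τ = 0 := by
  have : step =ᶠ[𝓝 τ] fun _ => 1 := by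
    filter_upwards [isOpen_Ioi.mem_nhds h] with s hs using step_of_ge (le_of_lt hs)
  rw [this.deriv_eq]; simp

theorem norm_apply_sq_le_gradDens (A : E n →L[ℝ] E L) (v : E n) :
    ‖A v‖ ^ 2 ≤ ‖v‖ ^ 2 * normSq₁ fun i => A (e i) := by
  have h1 : v = ∑ i, v i • e i := by
    ext j
    simp [e, Finset.sum_apply, Pi.single_apply]
  have h2 := norm_sum_smul_sq_le (fun i => v i) fun i => A (e i)
  rw [EuclideanSpace.norm_sq_eq v]
  simp only [norm_eq_abs, sq_abs]
  refine le_trans (le_of_eq ?_) h2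
  conv_lhs => rw [h1]
  rw [map_sum]
  simp only [map_smul]

/-- A Sobolev inequality in the scale of Morrey spaces, for smooth functions. -/
theorem exists_morrey_sobolev_smooth (hn : 4 ≤ n) (L : ℕ) : ∃ C, 0 ≤ C ∧
    ∀ {f : E n → E L} {Λ : ℝ}, ContDiff ℝ ∞ f → HasCompactSupport f → 0 < Λ →
    (∀ x s, 0 < s → ∫⁻ y in ball x s, egradDens (fun i y => ∇ f y (e i)) y
      ≤ ofReal (Λ * s ^ (n - 4))) →
    ∫⁻ y, ‖f y‖ₑ ^ 4 ≤ ofReal (C * Λ) * ∫⁻ y, egradDens (fun i y => ∇ f y (e i)) y := by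
  obtain ⟨C, hC, hw⟩ := exists_weak_type hn
  obtain ⟨B, hB, hb⟩ := exists_step_bound
  set B' := 16 * (B + 1) ^ 2 with hB'
  have B0 : 0 < B' := by positivity
  refine ⟨256 * (C * B' * B'), by positivity, ?_⟩
  intro f Λ hf hc hΛ hM
  set D : E n → ℝ≥0∞ := egradDens fun i y => ∇ f y (e i) with hD
  have cD : ∀ i, Continuous fun y => ∇ f y (e i) := fun i =>
    (contDiff_fderiv_apply hf (e i)).continuous
  have mD : Measurable D := by
    rw [hD]; unfold egradDens
    exact Finset.measurable_sum _ fun i _ => (cD i).measurable.enorm.pow_const 2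
  have mf : Measurable fun x => ‖f x‖ := hf.continuous.norm.measurable
  set a : ℤ → ℝ := fun j => 2 ^ j with ha
  have a0 : ∀ j, 0 < a j := fun j => by positivity
  set A : ℤ → Set (E n) := fun j => {x | ‖f x‖ ∈ Ico (a j) (a (j + 1))}
  have mA : ∀ j, MeasurableSet (A j) := fun j => mf measurableSet_Ico
  have a1 : ∀ j, a (j + 1) = 2 * a j := fun j => by
    simp only [ha]; rw [zpow_add_one₀ two_ne_zero]; ring
  have dA : Pairwise (Function.onFun Disjoint A) := fun i j hij => by
    refine disjoint_left.2 fun x hi hj => hij ?_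
    have h1 : a i < a (j + 1) := hi.1.trans_lt hj.2
    have h2 : a j < a (i + 1) := hj.1.trans_lt hi.2
    have h3 := (zpow_lt_zpow_iff_right₀ (one_lt_two : (1 : ℝ) < 2)).1 h1
    have h4 := (zpow_lt_zpow_iff_right₀ (one_lt_two : (1 : ℝ) < 2)).1 h2
    omega
  have weak : ∀ j, ofReal (a j ^ 4) * volume {x | 2 * a j ≤ ‖f x‖}
      ≤ ofReal (C * B' * B' * Λ) * ∫⁻ y in A j, D y := fun j => by
    set F : E n → ℝ := fun x => a j * step (‖f x‖ ^ 2 / a j ^ 2) with hF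
    have cF : ContDiff ℝ ∞ F := contDiff_const.mul (contDiff_step.comp ((hf.norm_sq ℝ).div_const _))
    have sF : HasCompactSupport F := hc.comp_left (g := fun y => a j * step (‖y‖ ^ 2 / a j ^ 2))
      (by simp [step_of_le])
    have dF : ∀ x, ‖∇ F x‖ₑ ^ 2 ≤ (A j).indicator (fun y => ofReal B' * D y) x := fun x => by
      set τ := ‖f x‖ ^ 2 / a j ^ 2 with hτ
      have τ0 : 0 ≤ τ := by positivity
      have fx : ‖f x‖ ^ 2 = τ * a j ^ 2 := by
        have := (a0 j).ne'
        rw [hτ]; field_simp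
      have h1 : ∇ F x = (a j * (deriv step τ * (2 / a j ^ 2))) •
          (innerSL ℝ (f x)).comp (∇ f x) := by
        have g1 := ((hf.differentiable (by simp)) x).hasFDerivAt.norm_sq
        have g2 : HasDerivAt (fun t => a j * step (t / a j ^ 2))
            (a j * (deriv step τ * (1 / a j ^ 2))) (‖f x‖ ^ 2) :=
          (HasDerivAt.comp (h₂ := step) (h := fun t => t / a j ^ 2) (‖f x‖ ^ 2)
            ((contDiff_step.differentiable (by simp)) τ).hasDerivAt
            ((hasDerivAt_id _).div_const _)).const_mul _
        refine (g2.comp_hasFDerivAt x g1).fderiv.trans ?_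
        ext v
        simp
        ring
      by_cases hx : x ∈ A j
      · rw [indicator_of_mem hx, hD, egradDens_eq, ← ofReal_mul B0.le, ← ofReal_norm,
          ← ofReal_pow (norm_nonneg _)]
        refine ofReal_le_ofReal ?_
        have τ4 : τ ≤ 4 := by
          rw [hτ, div_le_iff₀ (by positivity)]
          have := hx.2.le
          rw [a1] at this
          nlinarith [norm_nonneg (f x), a0 j]
        set G := gradDens (fun i y => ∇ f y (e i)) x
        have G0 : 0 ≤ G := gradDens_nonneg _ _
        have h2 : ‖∇ F x‖ ≤ √(B' * G) := by
          refine ContinuousLinearMap.opNorm_le_bound _ (sqrt_nonneg _) fun v => ?_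
          have h3 := norm_apply_sq_le_gradDens (∇ f x) v
          have h4 := (hb τ ⟨τ0, τ4⟩).1
          rw [h1]
          refine abs_le_of_sq_le_sq' ?_ (by positivity) |>.2
          rw [mul_pow, sq_sqrt (by positivity), smul_apply, norm_smul,
            ContinuousLinearMap.comp_apply, innerSL_apply_apply]
          have h5 : (‖(inner ℝ (f x) (∇ f x v) : ℝ)‖) ^ 2 ≤ τ * a j ^ 2 * (‖v‖ ^ 2 * G) := by
            rw [← fx]
            refine (pow_le_pow_left₀ (norm_nonneg _) (norm_inner_le_norm _ _) 2).trans ?_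
            rw [mul_pow]
            exact mul_le_mul_of_nonneg_left h3 (by positivity)
          rw [mul_pow]
          calc ‖a j * (deriv step τ * (2 / a j ^ 2))‖ ^ 2
                * ‖(inner ℝ (f x) (∇ f x v) : ℝ)‖ ^ 2
              ≤ ‖a j * (deriv step τ * (2 / a j ^ 2))‖ ^ 2 * (τ * a j ^ 2 * (‖v‖ ^ 2 * G)) :=
                mul_le_mul_of_nonneg_left h5 (by positivity)
            _ = 4 * τ * |deriv step τ| ^ 2 * (G * ‖v‖ ^ 2) := by
                rw [norm_eq_abs, sq_abs, sq_abs]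
                have := (a0 j).ne'
                field_simp
                ring
            _ ≤ 4 * 4 * (B + 1) ^ 2 * (G * ‖v‖ ^ 2) := by gcongr; linarith
            _ = B' * G * ‖v‖ ^ 2 := by rw [hB']; ring
        calc ‖∇ F x‖ ^ 2 ≤ √(B' * G) ^ 2 := by gcongr
          _ = B' * G := sq_sqrt (by positivity)
      · have h2 : deriv step τ = 0 := by
          rcases lt_or_ge ‖f x‖ (a j) with h | h
          · refine deriv_step_of_lt ?_
            rw [hτ, div_lt_one (by positivity)]
            gcongr
          · refine deriv_step_of_gt ?_
            have h3 : a (j + 1) ≤ ‖f x‖ := not_lt.1 fun h' => hx ⟨h, h'⟩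
            rw [a1] at h3
            rw [hτ, lt_div_iff₀ (by have := a0 j; positivity)]
            nlinarith [a0 j]
        rw [h1, h2, zero_mul, mul_zero, zero_smul, ← ofReal_norm, norm_zero]
        simp
    have lF : ∀ s : Set (E n), ∫⁻ y in s, ‖∇ F y‖ₑ ^ 2
        ≤ ofReal B' * ∫⁻ y in s ∩ A j, D y := fun s => by
      refine (lintegral_mono dF).trans_eq ?_
      rw [setLIntegral_indicator (mA j), lintegral_const_mul' _ _ ofReal_ne_top, inter_comm]
    have h1 := hw cF sF (mul_pos B0 hΛ) (a0 j) fun x s hs => (lF _).trans (by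
      rw [mul_assoc, ofReal_mul B0.le]
      exact mul_le_mul_right ((lintegral_mono_set inter_subset_left).trans (hM x s hs)) _)
    have h2 : {x | 2 * a j ≤ ‖f x‖} ⊆ {x | a j ≤ F x} := fun x hx => by
      have h3 : 3 ≤ ‖f x‖ ^ 2 / a j ^ 2 := by
        rw [le_div_iff₀ (by have := a0 j; positivity)]
        have : 2 * a j ≤ ‖f x‖ := hx
        nlinarith [a0 j]
      rw [mem_ofPred_eq, hF]
      simp only
      rw [step_of_ge h3, mul_one]
    refine (mul_le_mul_right (measure_mono h2) _).trans (h1.trans ?_)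
    have h3 := lF univ
    rw [setLIntegral_univ, univ_inter] at h3
    refine (mul_le_mul_right h3 _).trans_eq ?_
    rw [← mul_assoc, ← ofReal_mul (by positivity)]
    congr 2; ring
  set S : ℤ → Set (E n) := fun j => {x | 2 * a j ≤ ‖f x‖}
  have mS : ∀ j, MeasurableSet (S j) := fun j => measurableSet_le measurable_const mf
  have point : ∀ x, ‖f x‖ₑ ^ 4
      ≤ ∑' j, (S j).indicator (fun _ => ofReal (256 * a j ^ 4)) x := fun x => by
    rcases eq_or_ne (f x) 0 with h0 | h0
    · simp [h0]
    obtain ⟨m, hm⟩ := exists_mem_Ico_zpow (norm_pos_iff.2 h0) (one_lt_two : (1 : ℝ) < 2)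
    have e1 : (2 : ℝ) ^ m = 2 * a (m - 1) := by rw [← a1, sub_add_cancel]
    have e2 : (2 : ℝ) ^ (m + 1) = 4 * a (m - 1) := by
      rw [zpow_add_one₀ two_ne_zero, e1]; ring
    rw [e1, e2] at hm
    refine le_trans ?_ (ENNReal.le_tsum (m - 1))
    rw [indicator_of_mem (show x ∈ S (m - 1) from hm.1), ← ofReal_norm,
      ← ofReal_pow (norm_nonneg _)]
    refine ofReal_le_ofReal ((pow_le_pow_left₀ (norm_nonneg _) hm.2.le 4).trans (le_of_eq ?_))
    ring
  calc ∫⁻ y, ‖f y‖ₑ ^ 4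
      ≤ ∫⁻ y, ∑' j, (S j).indicator (fun _ => ofReal (256 * a j ^ 4)) y := lintegral_mono point
    _ = ∑' j, ofReal (256 * a j ^ 4) * volume (S j) := by
        rw [lintegral_tsum fun j => (measurable_const.indicator (mS j)).aemeasurable]
        exact tsum_congr fun j => lintegral_indicator_const (mS j) _
    _ ≤ ∑' j, ofReal (256 * (C * B' * B') * Λ) * ∫⁻ y in A j, D y := by
        refine ENNReal.tsum_le_tsum fun j => ?_
        rw [ofReal_mul (by norm_num), mul_assoc]
        refine (mul_le_mul_right (weak j) _).trans_eq ?_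
        rw [← mul_assoc, ← ofReal_mul (by norm_num)]
        congr 2; ring
    _ = ofReal (256 * (C * B' * B') * Λ) * ∫⁻ y in ⋃ j, A j, D y := by
        rw [ENNReal.tsum_mul_left, lintegral_iUnion mA dA]
    _ ≤ _ := mul_le_mul_right (setLIntegral_le_lintegral _ _) _

/-- A Sobolev inequality in the scale of Morrey spaces. -/
theorem exists_morrey_sobolev (hn : 4 ≤ n) (L : ℕ) : ∃ C, 0 ≤ C ∧
    ∀ {f : E n → E L} {p : Grad n L} {Λ : ℝ}, HasCompactSupport f → MemLp f 2 volume →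
    (∀ i, MemLp (p i) 2 volume) → (∀ i, HasWeakPartial univ i f (p i)) → 0 < Λ →
    (∀ x s, 0 < s → ∫⁻ y in ball x s, egradDens p y ≤ ofReal (Λ * s ^ (n - 4))) →
    ∫⁻ y, ‖f y‖ₑ ^ 4 ≤ ofReal (C * Λ) * ∫⁻ y, egradDens p y := by
  obtain ⟨C, hC, hs⟩ := exists_morrey_sobolev_smooth hn L
  have n0 : (0 : ℝ) < n := by exact_mod_cast (by omega : 0 < n)
  refine ⟨C * n, by positivity, ?_⟩
  intro f p Λ hc hf hp hfp hΛ hM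
  have sum : ∀ (s : Set (E n)), ∫⁻ y in s, egradDens p y = ∑ i, ∫⁻ y in s, ‖p i y‖ₑ ^ 2 :=
    fun s => by
    unfold egradDens
    exact lintegral_finsetSum' _ fun i _ => (hp i).1.restrict.enorm.pow_const 2
  have mol : ∀ m (s : Set (E n)) (a : Fin n → ℝ≥0∞), (∀ i t, ∫⁻ y in s, ‖p i (y - t)‖ₑ ^ 2 ≤ a i) →
      ∫⁻ y in s, egradDens (fun i y => ∇ (mollify m f) y (e i)) y ≤ ∑ i, a i :=
    fun m s a ha => by
    unfold egradDens
    simp only [fderiv_mollify m (hfp _)]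
    rw [lintegral_finsetSum' _ fun i _ => ((contDiff_mollify m
      ((hp i).locallyIntegrable (by norm_num))).continuous.measurable.enorm.pow_const 2).aemeasurable]
    exact sum_le_sum fun i _ => lintegral_mollify_le m (hp i).1 s (ha i)
  have b1 : ∀ m, ∫⁻ y, ‖mollify m f y‖ₑ ^ 4 ≤ ofReal (C * (n * Λ)) *
      ∫⁻ y, egradDens p y := fun m => by
    refine (hs (contDiff_mollify m (hf.locallyIntegrable (by norm_num)))
      (hasCompactSupport_mollify m hc) (mul_pos n0 hΛ) fun x s hs => ?_).trans
      (mul_le_mul_right ?_ _)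
    · refine (mol m _ (fun _ => ofReal (Λ * s ^ (n - 4))) fun i t => ?_).trans_eq ?_
      · refine le_trans ?_ (hM (x - t) s hs)
        have h1 := (measurePreserving_sub_right (volume : Measure (E n)) t).setLIntegral_comp_preimage_emb
          (measurableEmbedding_subRight t) (fun y => ‖p i y‖ₑ ^ 2) (ball (x - t) s)
        have h2 : (fun y : E n => y - t) ⁻¹' ball (x - t) s = ball x s := by
          ext y; simp [dist_eq_norm]
        rw [h2] at h1
        rw [h1]
        exact lintegral_mono fun y => single_le_sum (f := fun i => ‖p i y‖ₑ ^ 2)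
          (fun _ _ => zero_le) (Finset.mem_univ i)
      · rw [sum_const, card_univ, Fintype.card_fin, nsmul_eq_mul, mul_assoc,
          ofReal_mul n0.le, ENNReal.ofReal_natCast]
    · have h1 := sum univ
      rw [setLIntegral_univ] at h1
      have h2 := mol m univ (fun i => ∫⁻ y in univ, ‖p i y‖ₑ ^ 2) fun i t => by
        simp only [setLIntegral_univ]
        exact (lintegral_sub_right_eq_self (fun y => ‖p i y‖ₑ ^ 2) t).le
      rw [setLIntegral_univ] at h2
      rw [h1]
      exact h2
  obtain ⟨ns, -, hns⟩ := (tendstoInMeasure_of_tendsto_eLpNorm two_ne_zero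
    (fun m => (contDiff_mollify m
      (hf.locallyIntegrable (by norm_num))).continuous.aestronglyMeasurable) hf.1
    (tendsto_eLpNorm_mollify hf)).exists_seq_tendsto_ae
  calc ∫⁻ y, ‖f y‖ₑ ^ 4 = ∫⁻ y, liminf (fun k => ‖mollify (ns k) f y‖ₑ ^ 4) atTop := by
        refine lintegral_congr_ae ?_
        filter_upwards [hns] with y hy
        exact (((ENNReal.continuous_pow 4).tendsto _).comp hy.enorm).liminf_eq.symm
    _ ≤ liminf (fun k => ∫⁻ y, ‖mollify (ns k) f y‖ₑ ^ 4) atTop :=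
        lintegral_liminf_le fun k => (contDiff_mollify _
          (hf.locallyIntegrable (by norm_num))).continuous.measurable.enorm.pow_const 4
    _ ≤ _ := by
        refine (liminf_le_of_frequently_le' (Eventually.of_forall fun k => b1 (ns k)).frequently).trans
          (le_of_eq ?_)
        congr 2; ring

/-- First and second derivatives of a function which is `C²` up to the boundary are bounded. -/
theorem exists_bound_fderiv_of_contDiffOn {F : Type*} [NormedAddCommGroup F] [NormedSpace ℝ F]
    {φ : E n → F} {s V K : Set (E n)} (hφ : ContDiffOn ℝ 2 φ s)
    (hV : IsOpen V) (hVs : V ⊆ s) (hK : IsCompact K) (hKs : K ⊆ s) :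
    ∃ B, 0 ≤ B ∧ ∀ y ∈ K ∩ V, ‖∇ φ y‖ ≤ B ∧ ‖∇ (∇ φ) y‖ ≤ B := by
  refine hK.induction_on (p := fun t => ∃ B, 0 ≤ B ∧ ∀ y ∈ t ∩ V,
    ‖∇ φ y‖ ≤ B ∧ ‖∇ (∇ φ) y‖ ≤ B) ⟨0, le_rfl, by simp⟩ ?_ ?_ ?_
  · rintro t t' h ⟨B, hB, hb⟩
    exact ⟨B, hB, fun y hy => hb y ⟨h hy.1, hy.2⟩⟩
  · rintro t t' ⟨B, hB, hb⟩ ⟨B', hB', hb'⟩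
    refine ⟨max B B', hB.trans (le_max_left _ _), fun y ⟨hy, hyV⟩ => ?_⟩
    rcases hy with hy | hy
    · exact ⟨(hb y ⟨hy, hyV⟩).1.trans (le_max_left _ _), (hb y ⟨hy, hyV⟩).2.trans (le_max_left _ _)⟩
    · exact ⟨(hb' y ⟨hy, hyV⟩).1.trans (le_max_right _ _),
        (hb' y ⟨hy, hyV⟩).2.trans (le_max_right _ _)⟩
  intro x hx
  have hxs := hKs hx
  have h2 : ContDiffWithinAt ℝ (1 + 1) φ s x := by
    rw [one_add_one_eq_two]; exact hφ x hxs
  obtain ⟨u, hu, -, f', hf', hc'⟩ := (contDiffWithinAt_succ_iff_hasFDerivWithinAt (by simp)).1 h2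
  rw [insert_eq_of_mem hxs] at hu
  have xu : x ∈ u := mem_of_mem_nhdsWithin hxs hu
  obtain ⟨u', hu', -, f'', hf'', hc''⟩ := (contDiffWithinAt_succ_iff_hasFDerivWithinAt
    (n := 0) (by simp)).1 (by simpa using hc')
  rw [insert_eq_of_mem xu] at hu'
  have xu' : x ∈ u' := mem_of_mem_nhdsWithin xu hu'
  have le1 : 𝓝[s] x ≤ 𝓝[u] x := nhdsWithin_le_of_mem hu
  have le2 : 𝓝[s] x ≤ 𝓝[u'] x := le1.trans (nhdsWithin_le_of_mem hu')
  have b1 : ∀ᶠ y in 𝓝[s] x, ‖f' y‖ ≤ ‖f' x‖ + 1 :=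
    le1 (hc'.continuousWithinAt.norm.eventually_le_const (lt_add_one _))
  have b2 : ∀ᶠ y in 𝓝[s] x, ‖f'' y‖ ≤ ‖f'' x‖ + 1 :=
    le2 (hc''.continuousWithinAt.norm.eventually_le_const (lt_add_one _))
  obtain ⟨O, hO, xO, hOs⟩ := mem_nhdsWithin.1 (Filter.inter_mem (Filter.inter_mem hu (le1 hu'))
    (Filter.inter_mem b1 b2))
  have hOV : IsOpen (O ∩ V) := hO.inter hV
  have sub : ∀ y ∈ O ∩ V, y ∈ u ∧ y ∈ u' ∧ ‖f' y‖ ≤ ‖f' x‖ + 1 ∧ ‖f'' y‖ ≤ ‖f'' x‖ + 1 :=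
    fun y hy => ⟨(hOs ⟨hy.1, hVs hy.2⟩).1.1, (hOs ⟨hy.1, hVs hy.2⟩).1.2,
      (hOs ⟨hy.1, hVs hy.2⟩).2.1, (hOs ⟨hy.1, hVs hy.2⟩).2.2⟩
  have d1 : ∀ y ∈ O ∩ V, ∇ φ y = f' y := fun y hy => ((hf' y (sub y hy).1).hasFDerivAt
    (mem_of_superset (hOV.mem_nhds hy) fun y hy => (sub y hy).1)).fderiv
  refine ⟨O, mem_nhdsWithin_of_mem_nhds (hO.mem_nhds xO), ‖f' x‖ + 1 + (‖f'' x‖ + 1),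
    by positivity, fun y hy => ?_⟩
  have d2 : ∇ (∇ φ) y = f'' y := by
    have h3 : ∇ φ =ᶠ[𝓝 y] f' := by
      filter_upwards [hOV.mem_nhds hy] with y' hy' using d1 y' hy'
    rw [h3.fderiv_eq]
    exact ((hf'' y (sub y hy).2.1).hasFDerivAt
      (mem_of_superset (hOV.mem_nhds hy) fun y hy => (sub y hy).2.1)).fderiv
  obtain ⟨-, -, h3, h4⟩ := sub y hy
  rw [d1 y hy, d2]
  exact ⟨by linarith [norm_nonneg (f'' x)], by linarith [norm_nonneg (f' x)]⟩

theorem enorm_integral_smul_le {μ : Measure (E n)} {ζ : E n → ℝ} {M : ℝ} (hζ : ∀ x, ‖ζ x‖ ≤ M)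
    {F : E n → E L} (hF : AEStronglyMeasurable F μ) :
    ‖∫ x, ζ x • F x ∂μ‖ₑ ≤ ofReal M * μ univ ^ (1 / 2 : ℝ) * eLpNorm F 2 μ := by
  refine (enorm_integral_le_lintegral_enorm _).trans ?_
  have h1 : ∫⁻ x, ‖ζ x • F x‖ₑ ∂μ ≤ ofReal M * ∫⁻ x, ‖F x‖ₑ ∂μ := by
    rw [← lintegral_const_mul' _ _ ofReal_ne_top]
    refine lintegral_mono fun x => ?_
    rw [enorm_smul, ← ofReal_norm (ζ x)]
    exact mul_le_mul_left (ofReal_le_ofReal (hζ x)) _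
  have h2 := eLpNorm_le_eLpNorm_mul_rpow_measure_univ (p := 1) (q := 2) (by norm_num) hF
  rw [eLpNorm_one_eq_lintegral_enorm] at h2
  refine h1.trans ((mul_le_mul_right h2 _).trans_eq ?_)
  norm_num
  ring

/-- The neighbourhood `{x | dist(x, ∂Ω) < δ}` of `∂Ω`. -/
def boundaryNhd (Ω : Set (E n)) (δ : ℝ) : Set (E n) := {x | infDist x (frontier Ω) < δ}

theorem isOpen_boundaryNhd (Ω : Set (E n)) (δ : ℝ) : IsOpen (boundaryNhd Ω δ) :=
  isOpen_lt (continuous_infDist_pt _) continuous_const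

theorem boundaryNhd_inter (Ω : Set (E n)) (δ : ℝ) : boundaryNhd Ω δ ∩ Ω = collar Ω δ :=
  inter_comm _ _

theorem isOpen_collar {Ω : Set (E n)} (hΩ : IsOpen Ω) (δ : ℝ) : IsOpen (collar Ω δ) := by
  rw [← boundaryNhd_inter]; exact (isOpen_boundaryNhd Ω δ).inter hΩ

theorem collar_subset {Ω : Set (E n)} {δ δ' : ℝ} (h : δ ≤ δ') : collar Ω δ ⊆ collar Ω δ' :=
  fun _ hx => ⟨hx.1, hx.2.trans_le h⟩

theorem setIntegral_smul_indicator {Ω U : Set (E n)} (hΩ : MeasurableSet Ω) (ζ : E n → ℝ)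
    (f : E n → E L) : ∫ x in U, ζ x • Ω.indicator f x = ∫ x in U ∩ Ω, ζ x • f x := by
  rw [← setIntegral_indicator hΩ]
  congr 1
  funext x
  by_cases hx : x ∈ Ω <;> simp [hx]

theorem memLp_indicator_boundaryNhd {Ω : Set (E n)} (hΩ : IsOpen Ω) {δ : ℝ} {f : E n → E L}
    (hf : MemLp f 2 (volume.restrict (collar Ω δ))) :
    MemLp (Ω.indicator f) 2 (volume.restrict (boundaryNhd Ω δ)) := by
  rw [memLp_indicator_iff_restrict hΩ.measurableSet, Measure.restrict_restrict hΩ.measurableSet,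
    inter_comm, boundaryNhd_inter]
  exact hf

/-- Functions with zero trace can be extended by zero. -/
theorem hasWeakPartial_indicator {Ω : Set (E n)} (hΩ : IsOpen Ω) (hb : Bornology.IsBounded Ω)
    {δ δ' : ℝ} (hδ' : 0 < δ') (hδδ' : δ' ≤ δ) {i : Fin n} {f g : E n → E L}
    (hf : MemLp f 2 (volume.restrict (collar Ω δ))) (hg : MemLp g 2 (volume.restrict (collar Ω δ)))
    (H : HasWeakPartial (collar Ω δ) i f g)
    (happ : ∀ η : ℝ≥0∞, 0 < η → ∃ V : E n → E L, IsTestFunction Ω V ∧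
      eLpNorm (fun x => f x - V x) 2 (volume.restrict (collar Ω δ')) ≤ η ∧
      eLpNorm (fun x => g x - ∇ V x (e i)) 2 (volume.restrict (collar Ω δ')) ≤ η) :
    HasWeakPartial (boundaryNhd Ω δ) i (Ω.indicator f) (Ω.indicator g) := by
  refine ⟨locallyIntegrableOn_of_memLp (memLp_indicator_boundaryNhd hΩ hf),
    locallyIntegrableOn_of_memLp (memLp_indicator_boundaryNhd hΩ hg), fun ψ hψ => ?_⟩
  rw [setIntegral_smul_indicator hΩ.measurableSet, setIntegral_smul_indicator hΩ.measurableSet,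
    boundaryNhd_inter]
  set A := collar Ω δ
  set A' := collar Ω δ' with hA'
  have oA : IsOpen A := isOpen_collar hΩ δ
  have cK : IsCompact (frontier Ω) := isCompact_of_isClosed_isBounded isClosed_frontier
    (hb.closure.subset frontier_subset_closure)
  have KU : frontier Ω ⊆ boundaryNhd Ω δ' := fun x hx => by
    rw [boundaryNhd, mem_ofPred_eq, infDist_zero_of_mem hx]; exact hδ'
  obtain ⟨χ, hχ, χ1, -⟩ := exists_cutoff (isOpen_boundaryNhd Ω δ') cK KU
  set ψ1 := fun x => ψ x * χ x with hψ1
  set ψ2 := fun x => (1 - χ x) * ψ x with hψ2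
  have t1 : IsTestFunction (boundaryNhd Ω δ') ψ1 := hχ.mul_left hψ.contDiff
  have t2 : IsTestFunction (boundaryNhd Ω δ) ψ2 := hψ.mul_left (contDiff_const.sub hχ.contDiff)
  have z2 : ∀ x ∈ frontier Ω, ∀ᶠ y in 𝓝 x, ψ2 y = 0 := fun x hx => by
    filter_upwards [χ1 x hx] with y hy
    simp [hψ2, hy]
  set κ := Ω.indicator ψ2 with hκ
  have zκ : ∀ x ∉ Ω, ∀ᶠ y in 𝓝 x, κ y = 0 := fun x hx => by
    by_cases hc : x ∈ closure Ω
    · filter_upwards [z2 x ⟨hc, by rwa [hΩ.interior_eq]⟩] with y hy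
      by_cases h : y ∈ Ω <;> simp [hκ, h, hy]
    · filter_upwards [isClosed_closure.isOpen_compl.mem_nhds hc] with y hy
      exact indicator_of_notMem (fun h => hy (subset_closure h)) _
  have eκ : ∀ x ∈ Ω, κ =ᶠ[𝓝 x] ψ2 := fun x hx => by
    filter_upwards [hΩ.mem_nhds hx] with y hy using indicator_of_mem hy _
  have tκ : IsTestFunction A κ := by
    have ts : tsupport κ ⊆ tsupport ψ2 :=
      closure_mono fun x hx => (Function.mem_support.2 fun h => hx (by simp [hκ, h]))
    refine ⟨contDiff_iff_contDiffAt.2 fun x => ?_, t2.hasCompactSupport.of_isClosed_subset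
      (isClosed_tsupport _) ts, fun x hx => ⟨?_, t2.tsupport_subset (ts hx)⟩⟩
    · by_cases hx : x ∈ Ω
      · exact t2.contDiff.contDiffAt.congr_of_eventuallyEq (eκ x hx)
      · exact (contDiffAt_const (c := (0:ℝ))).congr_of_eventuallyEq (zκ x hx)
    · by_contra h
      exact notMem_tsupport_iff_eventuallyEq.2 (zκ x h) hx
  have e2 : ∫ x in A, ∇ ψ2 x (e i) • f x = - ∫ x in A, ψ2 x • g x := by
    have h := H.integral_eq κ tκ
    rw [setIntegral_congr_fun oA.measurableSet (g := fun x => ∇ ψ2 x (e i) • f x)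
      fun x hx => by simp only [(eκ x hx.1).fderiv_eq]] at h
    rw [h, setIntegral_congr_fun oA.measurableSet (g := fun x => ψ2 x • g x)
      fun x hx => by simp only [(eκ x hx.1).eq_of_nhds]]
  have t1' : IsTestFunction (boundaryNhd Ω δ) ψ1 := t1.mono fun x hx => lt_of_lt_of_le hx hδδ'
  have sAA : A' ⊆ A := collar_subset hδδ'
  have fin : volume A < ⊤ := (hb.subset fun x hx => hx.1).measure_lt_top
  have mem1 : ∀ {ζ : E n → ℝ} {F : E n → E L}, IsTestFunction (boundaryNhd Ω δ) ζ →
      MemLp F 2 (volume.restrict A) → IntegrableOn (fun x => ζ x • F x) A := fun hζ hF => by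
    have : IsFiniteMeasure (volume.restrict A) := ⟨by simpa using fin⟩
    obtain ⟨M, hM⟩ := hζ.exists_norm_le
    exact (hF.integrable (by norm_num)).bdd_smul M hζ.contDiff.continuous.aestronglyMeasurable
      (Eventually.of_forall hM)
  have e1 : ∫ x in A, ∇ ψ1 x (e i) • f x = - ∫ x in A, ψ1 x • g x := by
    have dψ := t1.fderiv_apply (e i)
    have red : ∀ {ζ : E n → ℝ} (F : E n → E L), IsTestFunction (boundaryNhd Ω δ') ζ →
        ∫ x in A, ζ x • F x = ∫ x in A', ζ x • F x := fun F hζ =>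
      setIntegral_eq_of_subset_of_forall_sdiff_eq_zero oA.measurableSet sAA fun x hx => by
        rw [hζ.eq_zero fun h => hx.2 ⟨hx.1.1, h⟩, zero_smul]
    obtain ⟨M1, hM1⟩ := dψ.exists_norm_le
    obtain ⟨M2, hM2⟩ := t1.exists_norm_le
    set μ := volume.restrict A' with hμ
    have fin' : μ univ ^ (1 / 2 : ℝ) ≠ ⊤ := ENNReal.rpow_ne_top_of_nonneg (by norm_num)
      (by rw [hμ, Measure.restrict_apply_univ]; exact ((measure_mono sAA).trans_lt fin).ne)
    set c := ofReal M1 * μ univ ^ (1 / 2 : ℝ) + ofReal M2 * μ univ ^ (1 / 2 : ℝ)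
      with hc
    have c_top : c ≠ ⊤ := by
      rw [hc]; exact ENNReal.add_ne_top.2 ⟨ENNReal.mul_ne_top ofReal_ne_top fin',
        ENNReal.mul_ne_top ofReal_ne_top fin'⟩
    have hle : ∀ η : ℝ≥0∞, 0 < η → ‖(∫ x in A, ∇ ψ1 x (e i) • f x)
        + ∫ x in A, ψ1 x • g x‖ₑ ≤ c * η := fun η hη => by
      obtain ⟨V, hV, h1, h2⟩ := happ η hη
      have dV := hV.fderiv_apply (e i)
      have memV : ∀ {W : E n → E L}, IsTestFunction Ω W → MemLp W 2 (volume.restrict A) :=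
        fun hW => (hW.contDiff.continuous.memLp_of_hasCompactSupport hW.hasCompactSupport).restrict A
      have hV0 : (∫ x in A, ∇ ψ1 x (e i) • V x) + ∫ x in A, ψ1 x • ∇ V x (e i) = 0 := by
        have sV : ∀ {ζ : E n → ℝ} {W : E n → E L}, IsTestFunction (boundaryNhd Ω δ) ζ →
            IsTestFunction Ω W → ∀ x ∉ A, ζ x • W x = 0 := fun hζ hW x hx => by
          by_cases h : x ∈ Ω
          · rw [hζ.eq_zero fun h' => hx ⟨h, h'⟩, zero_smul]
          · rw [hW.eq_zero h, smul_zero]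
        have d1 := t1'.fderiv_apply (e i)
        have w1 := (hasWeakPartial_of_contDiffOn isOpen_univ
          (hV.contDiff.contDiffOn.of_le (by simp)) i).integral_eq ψ1 (t1.mono (subset_univ _))
        rw [setIntegral_univ, setIntegral_univ] at w1
        rw [setIntegral_eq_integral_of_forall_compl_eq_zero (sV d1 hV),
          setIntegral_eq_integral_of_forall_compl_eq_zero (sV t1' dV), w1, neg_add_cancel]
      have e3 : (∫ x in A, ∇ ψ1 x (e i) • f x) + ∫ x in A, ψ1 x • g x
          = (∫ x in A', ∇ ψ1 x (e i) • (f x - V x)) + ∫ x in A', ψ1 x • (g x - ∇ V x (e i)) := by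
        rw [← red _ dψ, ← red _ t1]
        simp only [smul_sub]
        rw [integral_sub (mem1 (t1'.fderiv_apply (e i)) hf) (mem1 (t1'.fderiv_apply (e i)) (memV hV)),
          integral_sub (mem1 t1' hg) (mem1 t1' (memV dV)), sub_add_sub_comm, hV0, sub_zero]
      rw [e3, hc, add_mul]
      refine (enorm_add_le _ _).trans (add_le_add ?_ ?_)
      · exact (enorm_integral_smul_le hM1 ((hf.mono_measure (Measure.restrict_mono sAA le_rfl)).1.sub
          hV.contDiff.continuous.aestronglyMeasurable)).trans (mul_le_mul_right h1 _)
      · exact (enorm_integral_smul_le hM2 ((hg.mono_measure (Measure.restrict_mono sAA le_rfl)).1.sub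
          dV.contDiff.continuous.aestronglyMeasurable)).trans (mul_le_mul_right h2 _)
    have lim : Tendsto (fun η => c * η) (𝓝[>] 0) (𝓝 (c * 0)) :=
      ((ENNReal.continuous_const_mul c_top).tendsto 0).mono_left nhdsWithin_le_nhds
    have h0 := ge_of_tendsto lim (eventually_mem_nhdsWithin.mono fun η hη => hle η hη)
    rw [mul_zero, nonpos_iff_eq_zero, enorm_eq_zero] at h0
    exact eq_neg_of_add_eq_zero_left h0
  have dsum : ∀ x, ∇ ψ x (e i) = ∇ ψ1 x (e i) + ∇ ψ2 x (e i) := fun x => by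
    have h1 : ψ = fun x => ψ1 x + ψ2 x := by funext y; simp only [hψ1, hψ2]; ring
    conv_lhs => rw [h1]
    rw [fderiv_fun_add ((t1.contDiff.differentiable (by simp)) x)
      ((t2.contDiff.differentiable (by simp)) x)]
    rfl
  have psum : ∀ x, ψ x = ψ1 x + ψ2 x := fun x => by simp only [hψ1, hψ2]; ring
  have i1 := mem1 (t1'.fderiv_apply (e i)) hf
  have i2 := mem1 (t2.fderiv_apply (e i)) hf
  simp only [dsum, add_smul]
  rw [integral_add i1 i2, e1, e2, ← neg_add, ← integral_add (mem1 t1' hg) (mem1 t2 hg)]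
  simp only [psum, add_smul]

theorem weakPartial_ae_eq {O : Set (E n)} (hO : IsOpen O) {i : Fin n} {f g : E n → E L}
    (h : HasWeakPartial O i f g) : weakPartial O i f =ᵐ[volume.restrict O] g :=
  hasWeakPartial_unique hO (hasWeakPartial_weakPartial h) h

theorem MemW22.sobolevTwo {Ω : Set (E n)} {u : E n → E L} (hu : MemW22 Ω u) :
    SobolevTwo Ω u (fun i => weakPartial Ω i u) fun i j => weakPartial₂ Ω i j u where
  memLp := hu.memLp
  memLp_grad i := hu.memLp_grad.of_le (hu.hasWeakPartial i).locallyIntegrable'.aestronglyMeasurable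
    (.of_forall fun x => PiLp.norm_apply_le (weakGrad Ω u x) i)
  memLp_hess i j := hu.memLp_hess.of_le
    (hu.hasWeakPartial₂ i j).locallyIntegrable'.aestronglyMeasurable
    (.of_forall fun x => PiLp.norm_apply_le (weakHess Ω u x) (i, j))
  weak_grad := hu.hasWeakPartial
  weak_hess := hu.hasWeakPartial₂

theorem eLpNorm_le_w22Norm {O : Set (E n)} (hO : IsOpen O) {i j : Fin n} {f g h : E n → E L}
    (hg : HasWeakPartial O i f g) (hh : HasWeakPartial O j g h) :
    eLpNorm f 2 (volume.restrict O) ≤ w22Norm O f ∧ eLpNorm g 2 (volume.restrict O) ≤ w22Norm O f ∧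
      eLpNorm h 2 (volume.restrict O) ≤ w22Norm O f := by
  refine ⟨le_self_add.trans le_self_add, ?_, ?_⟩
  · rw [← eLpNorm_congr_ae (weakPartial_ae_eq hO hg)]
    exact (eLpNorm_mono fun x => PiLp.norm_apply_le (weakGrad O f x) i).trans
      (le_add_self.trans le_self_add)
  · rw [← eLpNorm_congr_ae (weakPartial₂_ae_eq hO hg hh)]
    exact (eLpNorm_mono fun x => PiLp.norm_apply_le (weakHess O f x) (i, j)).trans le_add_self

theorem sum_norm_sq_le_of_norm_sub_le {ι : Type*} [Fintype ι] {a b : ι → E L} {B : ℝ}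
    (h : ∀ i, ‖a i - b i‖ ≤ B) :
    ∑ i, ‖a i‖ ^ 2 ≤ 2 * ∑ i, ‖b i‖ ^ 2 + Fintype.card ι * (2 * B ^ 2) := by
  have h1 : ∀ i, ‖a i‖ ^ 2 ≤ 2 * ‖b i‖ ^ 2 + 2 * B ^ 2 := fun i => by
    have h2 : ‖a i‖ ≤ ‖b i‖ + B := by
      have := norm_add_le (b i) (a i - b i)
      rw [add_sub_cancel] at this
      linarith [h i]
    nlinarith [norm_nonneg (a i), sq_nonneg (‖b i‖ - B)]
  refine (sum_le_sum fun i _ => h1 i).trans_eq ?_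
  rw [sum_add_distrib, mul_sum]
  simp

/-- If `u = φ` and `∂u/∂ν = ∂φ/∂ν` on `∂Ω`, then the extension of `u - φ` by zero is in `W^{2,2}`
near `∂Ω`. -/
theorem exists_sobolevTwo_extension {Ω : Set (E n)} (hΩ : IsOpen Ω) (hb : Bornology.IsBounded Ω)
    {δ : ℝ} (hδ : 0 < δ) {N : Set (E L)} (hN : IsCompact N) {φ : E n → E L}
    (hφ : IsSmoothBoundaryMap Ω N δ φ) :
    ∃ B, 0 ≤ B ∧ ∀ u : E n → E L, MemW22 Ω u → HasDirichletData Ω δ φ u →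
      SobolevTwo (boundaryNhd Ω (δ / 2)) (Ω.indicator fun x => u x - φ x)
          (extGrad Ω (collar Ω δ) fun x => u x - φ x)
          (extHess Ω (collar Ω δ) fun x => u x - φ x) ∧
        ∀ᵐ x ∂(volume.restrict (boundaryNhd Ω (δ / 2))),
          (gradDens (extGrad Ω (collar Ω δ) fun x => u x - φ x) x
            ≤ 2 * gradDens (extGrad Ω Ω u) x + B ∧
          gradDens (extGrad Ω Ω u) x
            ≤ 2 * gradDens (extGrad Ω (collar Ω δ) fun x => u x - φ x) x + B) ∧
          hessDens (extHess Ω (collar Ω δ) fun x => u x - φ x) x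
            ≤ 2 * hessDens (extHess Ω Ω u) x + B ∧
          hessDens (extHess Ω Ω u) x
            ≤ 2 * hessDens (extHess Ω (collar Ω δ) fun x => u x - φ x) x + B := by
  set O := collar Ω δ
  set O' := collar Ω (δ / 2) with hO'
  have oO : IsOpen O := isOpen_collar hΩ δ
  have oO' : IsOpen O' := isOpen_collar hΩ _
  have sO : O' ⊆ O := collar_subset (by linarith)
  have sOc : O ⊆ closedCollar Ω δ := fun x hx => ⟨subset_closure hx.1, hx.2⟩
  have cφ := hφ.1.mono sOc
  have le2 : (2 : WithTop ℕ∞) ≤ ((⊤ : ℕ∞) : WithTop ℕ∞) :=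
    WithTop.coe_le_coe.2 (le_top (a := (2 : ℕ∞)))
  obtain ⟨B, hB, hB'⟩ := exists_bound_fderiv_of_contDiffOn (hφ.1.of_le le2) oO sOc
    (K := {x | x ∈ closure Ω ∧ infDist x (frontier Ω) ≤ δ / 2})
    (isCompact_of_isClosed_isBounded (isClosed_closure.inter
      (isClosed_le (continuous_infDist_pt _) continuous_const)) (hb.closure.subset fun x hx => hx.1))
    fun x hx => ⟨hx.1, hx.2.trans_lt (by linarith)⟩
  have hB'' : ∀ x ∈ O', ‖∇ φ x‖ ≤ B ∧ ‖∇ (∇ φ) x‖ ≤ B := fun x hx =>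
    hB' x ⟨⟨subset_closure hx.1, hx.2.le⟩, sO hx⟩
  have ne : ∀ i : Fin n, ‖(e i : E n)‖ = 1 := fun i => by simp [e]
  have b1 : ∀ x ∈ O', ∀ i, ‖∇ φ x (e i)‖ ≤ B := fun x hx i => by
    simpa [ne] using (∇ φ x).le_of_opNorm_le (hB'' x hx).1 (e i)
  have c1 : ∀ i, ContDiffOn ℝ 1 (fun x => ∇ φ x (e i)) O := fun i =>
    (cφ.fderiv_of_isOpen oO (m := 1) (le_of_eq_of_le one_add_one_eq_two le2)).clm_apply contDiffOn_const
  have b2 : ∀ x ∈ O', ∀ i j, ‖∇ (fun y => ∇ φ y (e i)) x (e j)‖ ≤ B := by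
    intro x hx i j
    have hd : DifferentiableAt ℝ (∇ φ) x :=
      ((cφ.fderiv_of_isOpen oO (m := 1) (le_of_eq_of_le one_add_one_eq_two le2)).contDiffAt (oO.mem_nhds (sO hx))).differentiableAt
        (by simp)
    rw [(hd.hasFDerivAt.clm_apply (hasFDerivAt_const _ _)).fderiv]
    have := (∇ (∇ φ) x (e j)).le_of_opNorm_le
      ((∇ (∇ φ) x).le_of_opNorm_le (hB'' x hx).2 (e j)) (e i)
    simpa [ne] using this
  have fin : IsFiniteMeasure (volume.restrict O') := ⟨by
    simpa using (hb.subset fun x hx => hx.1).measure_lt_top⟩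
  have m1 : ∀ i, MemLp (fun x => ∇ φ x (e i)) 2 (volume.restrict O') := fun i =>
    MemLp.of_bound (((c1 i).continuousOn.mono sO).aestronglyMeasurable oO'.measurableSet) B
      ((ae_restrict_iff' oO'.measurableSet).2 (.of_forall fun x hx => b1 x hx i))
  have m2 : ∀ i j, MemLp (fun x => ∇ (fun y => ∇ φ y (e i)) x (e j)) 2
      (volume.restrict O') := fun i j =>
    MemLp.of_bound (((((c1 i).continuousOn_fderiv_of_isOpen oO le_rfl).clm_apply
      continuousOn_const).mono sO).aestronglyMeasurable oO'.measurableSet) B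
      ((ae_restrict_iff' oO'.measurableSet).2 (.of_forall fun x hx => b2 x hx i j))
  obtain ⟨D, hD⟩ := hN.isBounded.exists_norm_le
  have m0 : MemLp φ 2 (volume.restrict O') :=
    MemLp.of_bound ((cφ.continuousOn.mono sO).aestronglyMeasurable oO'.measurableSet) D
      ((ae_restrict_iff' oO'.measurableSet).2 (.of_forall fun x hx => hD _ (hφ.2 x (sOc (sO hx)))))
  refine ⟨n * (n * (2 * B ^ 2)) + n * (2 * B ^ 2), by positivity, fun u hu hd => ?_⟩
  have Su := hu.sobolevTwo
  set w := fun x => u x - φ x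
  set p : Grad n L := fun i x => weakPartial Ω i u x - ∇ φ x (e i) with hp
  set h : Hess n L := fun i j x => weakPartial₂ Ω i j u x
    - ∇ (fun y => ∇ φ y (e i)) x (e j) with hh
  have sΩ : O ⊆ Ω := fun x hx => hx.1
  have w1 : ∀ i, HasWeakPartial O i w (p i) := fun i =>
    ((Su.weak_grad i).mono sΩ).sub (hasWeakPartial_of_contDiffOn oO (cφ.of_le (by simp)) i)
  have w2 : ∀ i j, HasWeakPartial O j (p i) (h i j) := fun i j =>
    ((Su.weak_hess i j).mono sΩ).sub (hasWeakPartial_of_contDiffOn oO (c1 i) j)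
  have mm : volume.restrict O' ≤ volume.restrict Ω := Measure.restrict_mono (sO.trans sΩ) le_rfl
  have lw : MemLp w 2 (volume.restrict O') := (Su.memLp.mono_measure mm).sub m0
  have lp : ∀ i, MemLp (p i) 2 (volume.restrict O') := fun i =>
    ((Su.memLp_grad i).mono_measure mm).sub (m1 i)
  have lh : ∀ i j, MemLp (h i j) 2 (volume.restrict O') := fun i j =>
    ((Su.memLp_hess i j).mono_measure mm).sub (m2 i j)
  obtain ⟨δ', δ'0, δ'δ, happ⟩ := hd
  set δ'' := min δ' (δ / 2) with hδ''
  have δ''0 : 0 < δ'' := lt_min δ'0 (by linarith)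
  set A := collar Ω δ'
  have oA : IsOpen A := isOpen_collar hΩ _
  have sA : A ⊆ O := collar_subset δ'δ.le
  have ms : volume.restrict (collar Ω δ'') ≤ volume.restrict A :=
    Measure.restrict_mono (collar_subset (min_le_left _ _)) le_rfl
  have happ' : ∀ (i j : Fin n) (η : ℝ≥0∞), 0 < η → ∃ v : E n → E L, IsTestFunction Ω v ∧
      eLpNorm (fun x => w x - v x) 2 (volume.restrict (collar Ω δ'')) ≤ η ∧
      eLpNorm (fun x => p i x - ∇ v x (e i)) 2 (volume.restrict (collar Ω δ'')) ≤ η ∧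
      eLpNorm (fun x => h i j x - ∇ (fun y => ∇ v y (e i)) x (e j)) 2
        (volume.restrict (collar Ω δ'')) ≤ η := by
    intro i j η hη
    obtain ⟨v, hv, hvη⟩ := happ η hη
    obtain ⟨h1, h2, h3⟩ := eLpNorm_le_w22Norm oA
      (((w1 i).mono sA).sub (hasWeakPartial_of_contDiffOn oA
        (hv.contDiff.contDiffOn.of_le (by simp)) i))
      (((w2 i j).mono sA).sub (hasWeakPartial_of_contDiffOn oA
        ((hv.fderiv_apply (e i)).contDiff.contDiffOn.of_le (by simp)) j))
    exact ⟨v, hv, (eLpNorm_mono_measure _ ms).trans (h1.trans hvη.le),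
      (eLpNorm_mono_measure _ ms).trans (h2.trans hvη.le),
      (eLpNorm_mono_measure _ ms).trans (h3.trans hvη.le)⟩
  have leδ : δ'' ≤ δ / 2 := min_le_right _ _
  have mU : MeasurableSet (boundaryNhd Ω (δ / 2)) := (isOpen_boundaryNhd Ω _).measurableSet
  have S0 : SobolevTwo (boundaryNhd Ω (δ / 2)) (Ω.indicator w) (fun i => Ω.indicator (p i))
      fun i j => Ω.indicator (h i j) := by
    refine ⟨memLp_indicator_boundaryNhd hΩ lw, fun i => memLp_indicator_boundaryNhd hΩ (lp i),
      fun i j => memLp_indicator_boundaryNhd hΩ (lh i j), fun i => ?_, fun i j => ?_⟩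
    · refine hasWeakPartial_indicator hΩ hb δ''0 leδ lw (lp i) ((w1 i).mono sO) fun η hη => ?_
      obtain ⟨v, hv, h1, h2, -⟩ := happ' i i η hη
      exact ⟨v, hv, h1, h2⟩
    · refine hasWeakPartial_indicator hΩ hb δ''0 leδ (lp i) (lh i j) ((w2 i j).mono sO)
        fun η hη => ?_
      obtain ⟨v, hv, -, h1, h2⟩ := happ' i j η hη
      exact ⟨_, hv.fderiv_apply (e i), h1, h2⟩
  have ext : ∀ {f g : E n → E L}, f =ᵐ[volume.restrict O] g →
      Ω.indicator f =ᵐ[volume.restrict (boundaryNhd Ω (δ / 2))] Ω.indicator g := fun hfg => by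
    rw [EventuallyEq, ae_restrict_iff' oO.measurableSet] at hfg
    rw [EventuallyEq, ae_restrict_iff' mU]
    filter_upwards [hfg] with x hx hxU
    by_cases hxΩ : x ∈ Ω
    · simp only [indicator_of_mem hxΩ]; exact hx (sO ⟨hxΩ, hxU⟩)
    · simp only [indicator_of_notMem hxΩ]
  have ep : ∀ i, extGrad Ω O w i =ᵐ[volume.restrict (boundaryNhd Ω (δ / 2))] Ω.indicator (p i) :=
    fun i => ext (weakPartial_ae_eq oO (w1 i))
  have eh : ∀ i j, extHess Ω O w i j =ᵐ[volume.restrict (boundaryNhd Ω (δ / 2))]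
      Ω.indicator (h i j) := fun i j => ext (weakPartial₂_ae_eq oO (w1 i) (w2 i j))
  refine ⟨S0.congr (isOpen_boundaryNhd Ω _) EventuallyEq.rfl (fun i => (ep i).symm)
    fun i j => (eh i j).symm, ?_⟩
  filter_upwards [eventually_all.2 ep, eventually_all.2 fun i => eventually_all.2 (eh i),
    ae_restrict_mem mU] with x hx1 hx2 hxU
  have d1 : ∀ i, ‖extGrad Ω O w i x - extGrad Ω Ω u i x‖ ≤ B := fun i => by
    rw [hx1 i, extGrad]
    by_cases hxΩ : x ∈ Ω
    · simpa [hxΩ, hp] using b1 x ⟨hxΩ, hxU⟩ i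
    · simpa [hxΩ] using hB
  have d2 : ∀ i j, ‖extHess Ω O w i j x - extHess Ω Ω u i j x‖ ≤ B := fun i j => by
    rw [hx2 i j, extHess]
    by_cases hxΩ : x ∈ Ω
    · simpa [hxΩ, hh] using b2 x ⟨hxΩ, hxU⟩ i j
    · simpa [hxΩ] using hB
  have q1 : ∀ {a b : Fin n → E L}, (∀ i, ‖a i - b i‖ ≤ B) →
      normSq₁ a ≤ 2 * normSq₁ b + (n * (n * (2 * B ^ 2)) + n * (2 * B ^ 2)) := fun hab => by
    have := sum_norm_sq_le_of_norm_sub_le hab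
    rw [Fintype.card_fin] at this
    exact this.trans (by rw [normSq₁]; linarith [show (0:ℝ) ≤ n * (n * (2 * B ^ 2)) by positivity])
  have q2 : ∀ {a b : Fin n → Fin n → E L}, (∀ i j, ‖a i j - b i j‖ ≤ B) →
      normSq₂ a ≤ 2 * normSq₂ b + (n * (n * (2 * B ^ 2)) + n * (2 * B ^ 2)) := fun hab => by
    have := sum_le_sum fun i (_ : i ∈ Finset.univ) => sum_norm_sq_le_of_norm_sub_le (hab i)
    rw [sum_add_distrib, ← mul_sum] at this
    simp only [Fintype.card_fin, sum_const, card_univ, nsmul_eq_mul] at this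
    exact this.trans (by rw [normSq₂]; linarith [show (0:ℝ) ≤ n * (2 * B ^ 2) by positivity])
  exact ⟨⟨q1 d1, q1 fun i => by rw [norm_sub_rev]; exact d1 i⟩,
    q2 d2, q2 fun i j => by rw [norm_sub_rev]; exact d2 i j⟩

section Decay

variable {p p' : Grad n L} {h h' : Hess n L}
  {z z' : E n} {s ρ c B : ℝ}

/-- The scale invariant energy in a ball. -/
abbrev scaledEnergy (z : E n) (r : ℝ) (p : Grad n L)
    (h : Hess n L) : ℝ := scaledHess z r h + scaledGrad z r p

theorem scaledEnergy_le_of_ball_subset (mp : ∀ i, MemLp (p i) 2 (volume.restrict (ball z' ρ)))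
    (mh : ∀ i j, MemLp (h i j) 2 (volume.restrict (ball z' ρ))) (hs : 0 < s) (hsρ : s ≤ ρ)
    (hρ : ρ ≤ c * s) (hss : ball z s ⊆ ball z' ρ) :
    scaledEnergy z s p h ≤ c ^ n * scaledEnergy z' ρ p h := by
  have h4 := zpow_sub_le_pow_mul 4 n hs hsρ hρ
  have h2 := zpow_sub_le_pow_mul 2 n hs hsρ hρ
  push_cast at h4 h2
  rw [scaledEnergy, mul_add, scaledHess, scaledHess, scaledGrad, scaledGrad, ← mul_assoc, ← mul_assoc]
  have i1 := setIntegral_mono_set (integrableOn_hessDens mh)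
    (.of_forall (hessDens_nonneg h)) hss.eventuallyLE
  have i2 := setIntegral_mono_set (integrableOn_gradDens mp)
    (.of_forall (gradDens_nonneg p)) hss.eventuallyLE
  exact add_le_add
    (mul_le_mul h4 i1 (integral_nonneg (hessDens_nonneg h)) ((zpow_nonneg hs.le _).trans h4))
    (mul_le_mul h2 i2 (integral_nonneg (gradDens_nonneg p)) ((zpow_nonneg hs.le _).trans h2))

/-- The densities of `(p, h)` are controlled by those of `(p', h')`. -/
def DensLe (B : ℝ) (p : Grad n L) (h : Hess n L) (p' : Grad n L) (h' : Hess n L) (x : E n) : Prop :=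
  gradDens p x ≤ 2 * gradDens p' x + B ∧ hessDens h x ≤ 2 * hessDens h' x + B

theorem setIntegral_le_of_ae_le {f g : E n → ℝ} (hs : 0 < s)
    (hf : IntegrableOn f (ball z s)) (hg : IntegrableOn g (ball z s))
    (hfg : ∀ᵐ x ∂(volume.restrict (ball z s)), f x ≤ 2 * g x + B) :
    ∫ x in ball z s, f x ≤ 2 * (∫ x in ball z s, g x)
      + s ^ n * (volume.real (ball (0 : E n) 1) * B) := by
  have i1 : IntegrableOn (fun _ => B) (ball z s) := integrableOn_const (measure_ball_lt_top).ne
  have i2 : IntegrableOn (fun x => 2 * g x) (ball z s) := hg.const_mul 2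
  refine (integral_mono_ae hf (i2.add i1) hfg).trans_eq ?_
  simp only [Pi.add_apply]
  rw [integral_add i2 i1, integral_const_mul, setIntegral_const, volume_real_ball z hs, smul_eq_mul,
    mul_assoc]

theorem scaledEnergy_le_of_densLe (hs : 0 < s) (hs1 : s ≤ 1) (hB : 0 ≤ B)
    (mp : ∀ i, MemLp (p i) 2 (volume.restrict (ball z s)))
    (mh : ∀ i j, MemLp (h i j) 2 (volume.restrict (ball z s)))
    (mp' : ∀ i, MemLp (p' i) 2 (volume.restrict (ball z s)))
    (mh' : ∀ i j, MemLp (h' i j) 2 (volume.restrict (ball z s)))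
    (H : ∀ᵐ x ∂(volume.restrict (ball z s)), DensLe B p h p' h' x) :
    scaledEnergy z s p h ≤ 2 * scaledEnergy z s p' h'
      + 2 * volume.real (ball (0 : E n) 1) * B * s ^ 2 := by
  have i1 := setIntegral_le_of_ae_le hs (integrableOn_gradDens mp) (integrableOn_gradDens mp')
    (H.mono fun x hx => hx.1)
  have i2 := setIntegral_le_of_ae_le hs (integrableOn_hessDens mh) (integrableOn_hessDens mh')
    (H.mono fun x hx => hx.2)
  have j1 := mul_le_mul_of_nonneg_left i1 (zpow_nonneg hs.le (2 - (n : ℤ)))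
  have j2 := mul_le_mul_of_nonneg_left i2 (zpow_nonneg hs.le (4 - (n : ℤ)))
  have e1 : s ^ (2 - (n : ℤ)) * s ^ n = s ^ 2 := by
    rw [zpow_two_sub n hs]; field_simp
  set V := volume.real (ball (0 : E n) 1) * B
  have hV0 : 0 ≤ V := by positivity
  have e2 : s ^ (4 - (n : ℤ)) * s ^ n ≤ s ^ 2 := by
    rw [zpow_four_sub n hs, mul_right_comm, e1]
    exact mul_le_of_le_one_right (by positivity) (by nlinarith)
  rw [mul_add, ← mul_assoc (s ^ (2 - (n : ℤ))) (s ^ n), e1] at j1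
  rw [mul_add, ← mul_assoc (s ^ (4 - (n : ℤ))) (s ^ n)] at j2
  have e3 := mul_le_mul_of_nonneg_right e2 hV0
  rw [scaledEnergy, scaledEnergy, scaledHess, scaledHess, scaledGrad, scaledGrad, mul_assoc 2 _ B]
  linarith

/-- Small energy in one ball around a boundary point implies small scale invariant energy in all
nearby smaller balls. -/
theorem exists_decay_near_boundary (hn : 5 ≤ n) (L : ℕ) {K : ℝ} (hK : 0 ≤ K) : ∃ C, 0 ≤ C ∧
    ∀ {Ω O : Set (E n)} {u w : E n → E L} {R₀ C₀ B : ℝ}, IsOpen Ω → Bornology.IsBounded Ω →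
    BoundaryMonotonicity Ω O w R₀ C₀ → SobolevTwo Ω u (extGrad Ω Ω u) (extHess Ω Ω u) →
    (∀ Y : E n → E n, IsTestFunction Ω Y →
      HasDerivAt (fun t : ℝ => hessianEnergy Ω fun x => u (x + t • Y x)) 0 0) →
    (∀ᵐ x ∂(volume.restrict Ω), ‖u x‖ ≤ K) →
    ∀ x₀ ∈ frontier Ω, ∀ {R κ : ℝ}, 0 < R → R ≤ 1 → R ≤ R₀ → κ ≤ 1 → |C₀| * R ≤ κ → 0 ≤ B →
    2 * volume.real (ball (0 : E n) 1) * B * R ^ 2 ≤ κ →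
    SobolevTwo (ball x₀ R) (Ω.indicator w) (extGrad Ω O w) (extHess Ω O w) →
    (∀ᵐ x ∂(volume.restrict (ball x₀ R)), ‖Ω.indicator w x‖ ≤ 2 * K) →
    (∀ᵐ x ∂(volume.restrict (ball x₀ R)),
      DensLe B (extGrad Ω O w) (extHess Ω O w) (extGrad Ω Ω u) (extHess Ω Ω u) x ∧
      DensLe B (extGrad Ω Ω u) (extHess Ω Ω u) (extGrad Ω O w) (extHess Ω O w) x) →
    scaledEnergy x₀ R (extGrad Ω Ω u) (extHess Ω Ω u) ≤ κ →
    ∀ z ∈ ball x₀ (R / 8), ∀ s, 0 < s → s ≤ R / 8 →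
      scaledEnergy z s (extGrad Ω O w) (extHess Ω O w) ≤ C * κ ∧
      scaledEnergy z s (extGrad Ω Ω u) (extHess Ω Ω u) ≤ C * κ := by
  obtain ⟨Cb, hCb, hb⟩ := exists_boundary_energyInequality hn L
  obtain ⟨Ci, hCi, hi⟩ := exists_interior_energyInequality hn L
  obtain ⟨C1, hC1, h1⟩ := exists_energy_decay hn L (K₀ := 2 * K) (C₀ := Cb) (H := 2 ^ n * 3)
    (by positivity) (by positivity)
  set M := 2 ^ n * (C1 * (2 ^ n * 3)) with hM
  have hM0 : 0 ≤ M := by positivity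
  obtain ⟨C2, hC2, h2⟩ := exists_energy_decay hn L (K₀ := K) (C₀ := Ci) (H := 2 * M + 1)
    hK (by positivity)
  set M' := C2 * (2 * M + 1) with hM'
  have hM'0 : 0 ≤ M' := by positivity
  refine ⟨2 * (M + (2 * M' + 1)) + 1, by positivity, ?_⟩
  intro Ω O u w R₀ C₀ B hΩ hbd hmono Su hst huK x₀ hx₀ R κ hR hR1 hRR₀ hκ hC₀ hB hBR Sw hwK hD hE z hz
    s hs hsR
  set p := extGrad Ω O w
  set h := extHess Ω O w
  set p' := extGrad Ω Ω u with hp'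
  set h' := extHess Ω Ω u with hh'
  have hκ0 : 0 ≤ κ := (mul_nonneg (abs_nonneg _) hR.le).trans hC₀
  have gp' : ∀ (y : E n) (r : ℝ) i, MemLp (p' i) 2 (volume.restrict (ball y r)) := fun y r i =>
    ((memLp_indicator_iff_restrict hΩ.measurableSet).2 ((Su.memLp_grad i).ae_eq
      (indicator_ae_eq_restrict hΩ.measurableSet))).restrict _
  have gh' : ∀ (y : E n) (r : ℝ) i j, MemLp (h' i j) 2 (volume.restrict (ball y r)) :=
    fun y r i j => ((memLp_indicator_iff_restrict hΩ.measurableSet).2 ((Su.memLp_hess i j).ae_eq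
      (indicator_ae_eq_restrict hΩ.measurableSet))).restrict _
  have gp : ∀ {y : E n} {r : ℝ}, ball y r ⊆ ball x₀ R → ∀ i,
      MemLp (p i) 2 (volume.restrict (ball y r)) := fun hy i =>
    (Sw.mono hy).memLp_grad i
  have gh : ∀ {y : E n} {r : ℝ}, ball y r ⊆ ball x₀ R → ∀ i j,
      MemLp (h i j) 2 (volume.restrict (ball y r)) := fun hy i j =>
    (Sw.mono hy).memLp_hess i j
  have err : ∀ {r : ℝ}, 0 < r → r ≤ R →
      2 * volume.real (ball (0 : E n) 1) * B * r ^ 2 ≤ κ := fun hr hrR => by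
    refine le_trans ?_ hBR
    gcongr
  have to_w : ∀ {y : E n} {r : ℝ}, 0 < r → r ≤ R → ball y r ⊆ ball x₀ R →
      scaledEnergy y r p h ≤ 2 * scaledEnergy y r p' h' + κ := fun hr hrR hy =>
    (scaledEnergy_le_of_densLe hr (hrR.trans hR1) hB (gp hy) (gh hy) (gp' _ _) (gh' _ _)
      ((ae_restrict_of_ae_restrict_of_subset hy hD).mono fun x hx => hx.1)).trans
      (by linarith [err hr hrR])
  have to_u : ∀ {y : E n} {r : ℝ}, 0 < r → r ≤ R → ball y r ⊆ ball x₀ R →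
      scaledEnergy y r p' h' ≤ 2 * scaledEnergy y r p h + κ := fun hr hrR hy =>
    (scaledEnergy_le_of_densLe hr (hrR.trans hR1) hB (gp' _ _) (gh' _ _) (gp hy) (gh hy)
      ((ae_restrict_of_ae_restrict_of_subset hy hD).mono fun x hx => hx.2)).trans
      (by linarith [err hr hrR])
  have hEw : scaledEnergy x₀ R p h ≤ 3 * κ := by
    linarith [to_w hR le_rfl (Subset.refl _)]
  have hbdry : ∀ z' ∈ frontier Ω, dist z' x₀ ≤ R / 2 → ∀ r, 0 < r → r ≤ R / 2 →
      scaledEnergy z' r p h ≤ C1 * (2 ^ n * 3) * κ := by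
    intro z' hz' hd r hr hrR
    have hsub : ball z' (R / 2) ⊆ ball x₀ R := ball_subset_ball' (by linarith)
    have e0 : scaledEnergy z' (R / 2) p h ≤ 2 ^ n * 3 * κ := by
      refine (scaledEnergy_le_of_ball_subset (c := 2) (gp (Subset.refl _)) (gh (Subset.refl _))
        (by linarith) (by linarith) (by linarith) hsub).trans ?_
      rw [mul_assoc]
      gcongr
    have hR2 : |C₀| * (R / 2) ≤ κ := by linarith [mul_nonneg (abs_nonneg C₀) hR.le]
    have hκη : κ ≤ 2 ^ n * 3 * κ := by
      have : (1 : ℝ) ≤ 2 ^ n := one_le_pow₀ (by norm_num)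
      nlinarith
    have hEI := hb hΩ.measurableSet hmono z' hz' (R := R / 2) (by linarith) (by linarith)
      (hR2.trans hκ) (hR2.trans hκη) (gp hsub) (gh hsub) e0
    have := h1 (by linarith) (Sw.mono hsub) (ae_restrict_of_ae_restrict_of_subset hsub hwK)
      (mul_le_of_le_one_right (by positivity) hκ) e0 hEI r hr hrR
    linarith
  have cK : IsCompact (frontier Ω) := isCompact_of_isClosed_isBounded isClosed_frontier
    (hbd.closure.subset frontier_subset_closure)
  obtain ⟨z', hz', hdz⟩ := cK.exists_infDist_eq_dist ⟨x₀, hx₀⟩ z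
  set d := infDist z (frontier Ω) with hd
  have hdR : d < R / 8 := (infDist_le_dist_of_mem hx₀).trans_lt hz
  have hz'd : dist z' x₀ ≤ R / 4 := by
    have := dist_triangle z' z x₀
    rw [dist_comm z' z] at this
    have := mem_ball.1 hz
    linarith
  have hzsub : ∀ {r : ℝ}, r ≤ R / 8 → ball z r ⊆ ball x₀ R := fun hr =>
    ball_subset_ball' (by linarith [mem_ball.1 hz])
  have far : ∀ r, 0 < r → r ≤ R / 8 → d ≤ r → scaledEnergy z r p h ≤ M * κ := by
    intro r hr hrR hdr
    have hsub : ball z' (2 * r) ⊆ ball x₀ R := ball_subset_ball' (by linarith)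
    have e0 := scaledEnergy_le_of_ball_subset (c := 2) (gp hsub) (gh hsub) hr (by linarith) le_rfl
      (ball_subset_ball' (x := z) (by linarith))
    refine e0.trans ?_
    rw [hM, mul_assoc]
    gcongr
    exact hbdry z' hz' (by linarith) _ (by linarith) (by linarith)
  suffices hw : scaledEnergy z s p h ≤ (M + (2 * M' + 1)) * κ by
    have h3 := to_u hs (by linarith) (hzsub hsR)
    constructor
    · nlinarith
    · linarith
  have hκM : 0 ≤ M * κ := by positivity
  have hκM' : 0 ≤ M' * κ := by positivity
  rcases le_or_gt d s with hds | hsd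
  · linarith [far s hs hsR hds]
  have hd0 : 0 < d := hs.trans hsd
  have hfr : ball z d ∩ frontier Ω = ∅ := by
    rw [← disjoint_iff_inter_eq_empty, Set.disjoint_left]
    intro y hy hyf
    have := infDist_le_dist_of_mem (x := z) hyf
    rw [mem_ball, dist_comm] at hy
    linarith
  have hzd : z ∈ ball z d := mem_ball_self hd0
  have hcases : ball z d ⊆ Ω ∨ ball z d ⊆ (closure Ω)ᶜ := by
    refine (convex_ball z d).isPreconnected.subset_or_subset hΩ isClosed_closure.isOpen_compl
      (Set.disjoint_left.2 fun y hy h => h (subset_closure hy)) fun y hy => ?_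
    by_contra hc
    rw [mem_union, not_or] at hc
    exact (hfr ▸ (⟨hy, not_not.1 hc.2, by rw [hΩ.interior_eq]; exact hc.1⟩ :
      y ∈ ball z d ∩ frontier Ω) : y ∈ (∅ : Set (E n)))
  by_cases hzΩ : z ∈ Ω
  · have hsub := hcases.resolve_right fun h => h hzd (subset_closure hzΩ)
    have e1 := to_u hd0 (by linarith) (hzsub hdR.le)
    have e2 : scaledEnergy z d p' h' ≤ (2 * M + 1) * κ := by
      linarith [far d hd0 hdR.le le_rfl]
    have hEI := hi hΩ Su hst z d _ hd0 hsub e2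
    have e3 := h2 hd0 (Su.mono hsub) (ae_restrict_of_ae_restrict_of_subset hsub huK)
      (mul_le_of_le_one_right (by positivity) hκ) e2 hEI s hs hsd.le
    have e4 := to_w hs (by linarith) (hzsub hsR)
    have e5 : scaledEnergy z s p' h' ≤ M' * κ := by rw [hM', mul_assoc]; exact e3
    linarith
  · have hsub := hcases.resolve_left fun h => hzΩ (h hzd)
    have hz0 : ∀ y ∈ ball z s, gradDens p y = 0 ∧ hessDens h y = 0 := fun y hy => by
      have : y ∉ Ω := fun h => hsub (ball_subset_ball hsd.le hy) (subset_closure h)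
      rw [gradDens, hessDens, extGrad_of_notMem this, extHess_of_notMem this]
      simp [normSq₁, normSq₂]
    have e1 : scaledEnergy z s p h = 0 := by
      rw [scaledEnergy, scaledHess, scaledGrad,
        setIntegral_eq_zero_of_forall_eq_zero fun y hy => (hz0 y hy).2,
        setIntegral_eq_zero_of_forall_eq_zero fun y hy => (hz0 y hy).1]
      simp
    rw [e1]
    positivity

end Decay

theorem exists_scaled_cutoff (n : ℕ) : ∃ B, 0 ≤ B ∧ ∀ (y : E n) (r : ℝ), 0 < r →
    ∃ χ : E n → ℝ, IsTestFunction (ball y (2 * r)) χ ∧ (∀ x ∈ ball y r, χ x = 1) ∧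
      ∀ x, |χ x| ≤ 1 ∧ ∀ i, |∇ χ x (e i)| ≤ B / r := by
  obtain ⟨η, hη, h1, h2⟩ := exists_cutoff (isOpen_ball (x := (0 : E n)) (ε := 2))
    (isCompact_closedBall 0 1) (closedBall_subset_ball (by norm_num))
  obtain ⟨B, hB⟩ := (hη.contDiff.continuous_fderiv (by simp)).bounded_above_of_compact_support
    (hη.hasCompactSupport.fderiv (𝕜 := ℝ))
  have hB0 : 0 ≤ B := (norm_nonneg _).trans (hB 0)
  refine ⟨B, hB0, fun y r hr => ⟨fun x => η (r⁻¹ • (x - y)), ?_, fun x hx => ?_, fun x => ⟨?_, fun i => ?_⟩⟩⟩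
  · have hg : ContDiff ℝ ∞ fun x : E n => r⁻¹ • (x - y) := by fun_prop
    have ts : tsupport (fun x => η (r⁻¹ • (x - y))) ⊆ ball y (2 * r) := fun x hx => by
      have := hη.tsupport_subset (tsupport_comp_subset_preimage η hg.continuous hx)
      rw [mem_ball_zero_iff, norm_smul, norm_inv, Real.norm_of_nonneg hr.le,
        inv_mul_lt_iff₀ hr] at this
      rw [mem_ball, dist_eq_norm]; linarith
    exact ⟨hη.contDiff.comp hg, isCompact_of_isClosed_isBounded (isClosed_tsupport _)
      (isBounded_ball.subset ts), ts⟩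
  · refine (h1 _ ?_).self_of_nhds
    rw [mem_closedBall_zero_iff, norm_smul, norm_inv, Real.norm_of_nonneg hr.le,
      inv_mul_le_iff₀ hr, mul_one]
    exact (mem_ball_iff_norm.1 hx).le
  · rw [abs_of_nonneg (h2 _).1]; exact (h2 _).2
  · have hd := ((hη.contDiff.differentiable (by simp)) (r⁻¹ • (x - y))).hasFDerivAt.comp x
      (f := fun x => r⁻¹ • (x - y)) (((hasFDerivAt_id x).sub_const y).const_smul r⁻¹)
    have := (∇ η (r⁻¹ • (x - y))).le_of_opNorm_le (hB _) (r⁻¹ • e i)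
    rw [norm_smul, norm_inv, Real.norm_of_nonneg hr.le] at this
    rw [show (fun x => η (r⁻¹ • (x - y))) = η ∘ fun x => r⁻¹ • (x - y) from rfl, hd.fderiv]
    simpa [e, div_eq_mul_inv] using this

/-- A function whose gradient has a small Morrey norm is in `L⁴` on smaller balls. -/
theorem exists_morrey_sobolev_ball (hn : 5 ≤ n) (L : ℕ) : ∃ C, 0 ≤ C ∧
    ∀ {y : E n} {r κ : ℝ} {g : E n → E L} {q : Grad n L}, 0 < r → 0 < κ →
    MemLp g 2 (volume.restrict (ball y (8 * r))) →
    (∀ i, MemLp (q i) 2 (volume.restrict (ball y (8 * r)))) →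
    (∀ i, HasWeakPartial (ball y (8 * r)) i g (q i)) →
    (∀ x ∈ ball y (4 * r), ∀ s, 0 < s → s ≤ 2 * r → ∫ a in ball x s, ‖g a‖ ^ 2 ≤ κ * s ^ (n - 2) ∧
      ∫ a in ball x s, gradDens q a ≤ κ * s ^ (n - 4)) →
    ∫⁻ a in ball y r, ‖g a‖ₑ ^ 4 ≤ ofReal (C * κ ^ 2 * r ^ (n - 4)) := by
  obtain ⟨C, hC, hS⟩ := exists_morrey_sobolev (n := n) (by omega) L
  obtain ⟨B, hB, hχ⟩ := exists_scaled_cutoff n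
  set c := 2 + 8 * n * B ^ 2 with hc
  have hc0 : 0 < c := by positivity
  refine ⟨C * c ^ 2 * 2 ^ (n - 4), by positivity, ?_⟩
  intro y r κ g q hr hκ mg mq hq hint
  obtain ⟨χ, tχ, χ1, bχ⟩ := hχ y r hr
  set U := ball y (2 * r)
  set V := ball y (8 * r)
  have sUV : U ⊆ V := ball_subset_ball (by linarith)
  have tV := tχ.mono sUV
  have mV : MeasurableSet V := measurableSet_ball
  set p : Grad n L := fun i x => χ x • q i x + ∇ χ x (e i) • g x with hp
  set F : E n → ℝ := fun x => 2 * gradDens q x + 2 * n * (B / r) ^ 2 * ‖g x‖ ^ 2 with hF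
  have iF : IntegrableOn F V :=
    ((integrableOn_gradDens mq).const_mul 2).add (mg.norm.integrable_sq.const_mul _)
  have F0 : ∀ x, 0 ≤ F x := fun x => by
    have := gradDens_nonneg q x
    simp only [hF]; positivity
  have hpF : ∀ x, egradDens p x ≤ ofReal (F x) := fun x => by
    rw [egradDens_eq]
    refine ofReal_le_ofReal ?_
    have h1 : ∀ i, ‖p i x‖ ^ 2 ≤ 2 * ‖q i x‖ ^ 2 + 2 * (B / r) ^ 2 * ‖g x‖ ^ 2 := fun i => by
      have a1 : ‖χ x • q i x‖ ≤ ‖q i x‖ := by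
        rw [norm_smul]; exact mul_le_of_le_one_left (norm_nonneg _) (bχ x).1
      have a2 : ‖∇ χ x (e i) • g x‖ ≤ B / r * ‖g x‖ := by
        rw [norm_smul]; exact mul_le_mul_of_nonneg_right ((bχ x).2 i) (norm_nonneg _)
      have a3 : ‖p i x‖ ≤ ‖q i x‖ + B / r * ‖g x‖ := (norm_add_le _ _).trans (add_le_add a1 a2)
      nlinarith [norm_nonneg (p i x), sq_nonneg (‖q i x‖ - B / r * ‖g x‖)]
    rw [gradDens, normSq₁]
    refine (sum_le_sum fun i _ => h1 i).trans_eq ?_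
    rw [sum_add_distrib, ← mul_sum]
    simp [hF, gradDens, normSq₁]; ring
  have p0 : ∀ x ∉ U, egradDens p x = 0 := fun x hx => by
    simp [egradDens, hp, tχ.eq_zero hx, (tχ.fderiv_apply (e _)).eq_zero hx]
  have small : ∀ x ∈ ball y (4 * r), ∀ s, 0 < s → s ≤ 2 * r →
      ∫⁻ a in ball x s, egradDens p a ≤ ofReal (c * κ * s ^ (n - 4)) := by
    intro x hx s hs hsr
    have hxV : ball x s ⊆ V := ball_subset_ball' (by linarith [mem_ball.1 hx])
    refine (lintegral_mono hpF).trans ?_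
    rw [← ofReal_integral_eq_lintegral_ofReal (iF.mono_set hxV) (Eventually.of_forall F0)]
    refine ofReal_le_ofReal ?_
    have i1 := ((integrableOn_gradDens mq).mono_set hxV).const_mul 2
    have i2 := (mg.norm.integrable_sq.mono_measure
      (Measure.restrict_mono hxV le_rfl)).const_mul (2 * n * (B / r) ^ 2)
    simp only [hF]
    rw [integral_add i1 i2, integral_const_mul, integral_const_mul]
    obtain ⟨h1, h2⟩ := hint x hx s hs hsr
    have h3 : (B / r) ^ 2 * (κ * s ^ (n - 2)) ≤ 4 * B ^ 2 * (κ * s ^ (n - 4)) := by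
      rw [show n - 2 = n - 4 + 2 by omega, pow_add, div_pow, div_mul_eq_mul_div,
        div_le_iff₀ (by positivity)]
      have : s ^ 2 ≤ 4 * r ^ 2 := by nlinarith
      calc B ^ 2 * (κ * (s ^ (n - 4) * s ^ 2)) ≤ B ^ 2 * (κ * (s ^ (n - 4) * (4 * r ^ 2))) := by gcongr
        _ = _ := by ring
    have h4 : 2 * n * (B / r) ^ 2 * ∫ a in ball x s, ‖g a‖ ^ 2
        ≤ 2 * n * ((B / r) ^ 2 * (κ * s ^ (n - 2))) := by
      rw [← mul_assoc]; gcongr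
    have h5 : 2 * n * ((B / r) ^ 2 * (κ * s ^ (n - 2)))
        ≤ 2 * n * (4 * B ^ 2 * (κ * s ^ (n - 4))) := by gcongr
    rw [hc]; linarith
  have yU : y ∈ ball y (4 * r) := mem_ball_self (by linarith)
  have tot : ∀ s : Set (E n), ∫⁻ a in s, egradDens p a
      ≤ ofReal (c * κ * (2 * r) ^ (n - 4)) := fun s => by
    refine le_trans ?_ (small y yU (2 * r) (by linarith) le_rfl)
    rw [← lintegral_indicator measurableSet_ball]
    refine (setLIntegral_le_lintegral _ _).trans (lintegral_mono fun x => ?_)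
    by_cases hx : x ∈ U
    · rw [indicator_of_mem hx]
    · rw [p0 x hx]; exact zero_le
  have morrey : ∀ x s, 0 < s → ∫⁻ a in ball x s, egradDens p a ≤ ofReal (c * κ * s ^ (n - 4)) := by
    intro x s hs
    rcases le_or_gt s (2 * r) with hsr | hsr
    · by_cases hx : x ∈ ball y (4 * r)
      · exact small x hx s hs hsr
      · rw [setLIntegral_eq_zero measurableSet_ball fun a ha => p0 a fun haU => hx ?_]
        · exact zero_le
        · have := dist_triangle_left x y a
          rw [mem_ball] at *
          linarith
    · refine (tot _).trans (ofReal_le_ofReal ?_)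
      gcongr
  have key := hS (f := fun x => χ x • g x) tχ.hasCompactSupport.smul_right
    (memLp_testFunction_smul mV tV mg)
    (fun i => (memLp_testFunction_smul mV tV (mq i)).add
      (memLp_testFunction_smul mV (tV.fderiv_apply (e i)) mg))
    (fun i => (hq i).cutoff tV) (mul_pos hc0 hκ) morrey
  have h1 : ∫⁻ a in ball y r, ‖g a‖ₑ ^ 4 ≤ ∫⁻ a, ‖χ a • g a‖ₑ ^ 4 := by
    rw [setLIntegral_congr_fun (g := fun a => ‖χ a • g a‖ₑ ^ 4) measurableSet_ball
      fun a ha => by simp only [χ1 a ha, one_smul]]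
    exact setLIntegral_le_lintegral _ _
  have h2 := tot univ
  rw [Measure.restrict_univ] at h2
  refine h1.trans (key.trans ((mul_le_mul_right h2 _).trans_eq ?_))
  rw [← ofReal_mul (by positivity), mul_pow]
  congr 1
  ring

theorem morreyNorm_le {F : Type*} [NormedAddCommGroup F] {p lam a : ℝ} (hp : 0 < p) (ha : 0 ≤ a)
    {O : Set (E n)} {f : E n → F} (H : ∀ y r, 0 < r → ball y r ⊆ O →
      ∫⁻ x in ball y r, ‖f x‖ₑ ^ p ≤ ofReal (a ^ p * r ^ (n - lam))) :
    morreyNorm p lam O f ≤ ofReal a := by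
  rw [morreyNorm, one_div, ENNReal.rpow_inv_le_iff hp, ENNReal.ofReal_rpow_of_nonneg ha hp.le]
  refine iSup_le fun y => iSup_le fun r => iSup_le fun hr => iSup_le fun hy => ?_
  refine (mul_le_mul_right (H y r hr hy) _).trans_eq ?_
  rw [← ofReal_mul (by positivity), mul_left_comm, ← Real.rpow_add hr]
  simp

theorem memMorrey_of_le {F : Type*} [NormedAddCommGroup F] {p lam a : ℝ} (hp : 0 < p) (ha : 0 ≤ a)
    {O : Set (E n)} {f : E n → F} (hf : AEStronglyMeasurable f (volume.restrict O))
    (hO : ∫⁻ x in O, ‖f x‖ₑ ^ p < ⊤) (H : ∀ y r, 0 < r → ball y r ⊆ O →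
      ∫⁻ x in ball y r, ‖f x‖ₑ ^ p ≤ ofReal (a ^ p * r ^ (n - lam))) :
    MemMorrey p lam O f := by
  refine ⟨⟨hf, ?_⟩, (morreyNorm_le hp ha H).trans_lt ofReal_lt_top⟩
  rw [eLpNorm_lt_top_iff_lintegral_rpow_enorm_lt_top (by simpa using hp) ofReal_ne_top,
    toReal_ofReal hp.le]
  exact hO

theorem radius_le_of_ball_subset (hn : 0 < n) {y z : E n} {r ρ : ℝ} (hr : 0 < r) (hρ : 0 < ρ)
    (h : ball y r ⊆ ball z ρ) : r ≤ ρ := by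
  have h1 := measureReal_mono (μ := volume) h measure_ball_lt_top.ne
  rw [volume_real_ball y hr, volume_real_ball z hρ] at h1
  have hV : 0 < volume.real (ball (0 : E n) 1) :=
    ENNReal.toReal_pos (measure_ball_pos _ _ one_pos).ne' measure_ball_lt_top.ne
  exact (pow_le_pow_iff_left₀ hr.le hρ.le hn.ne').1 (le_of_mul_le_mul_right h1 hV)

/-- The scale invariant energies control the integrals of the densities. -/
theorem setIntegral_dens_le (hn : 5 ≤ n) {p : Grad n L} {h : Hess n L}
    {z : E n} {s κ : ℝ} (hs : 0 < s) (H : scaledEnergy z s p h ≤ κ) :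
    ∫ x in ball z s, gradDens p x ≤ κ * s ^ (n - 2) ∧
      ∫ x in ball z s, hessDens h x ≤ κ * s ^ (n - 4) := by
  have h1 := scaledHess_nonneg (z := z) (h := h) hs
  have h2 := scaledGrad_nonneg (z := z) (p := p) hs
  have aux : ∀ {j : ℕ} {I : ℝ}, j ≤ n → s ^ ((j : ℤ) - n) * I ≤ κ → I ≤ κ * s ^ (n - j) := by
    intro j I hj hI
    rw [← neg_sub (n : ℤ), ← Nat.cast_sub hj, zpow_neg, zpow_natCast, inv_mul_le_iff₀ (by positivity),
      mul_comm] at hI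
    exact hI
  exact ⟨aux (j := 2) (by omega) (by rw [scaledEnergy, scaledGrad] at *; push_cast; linarith),
    aux (j := 4) (by omega) (by rw [scaledEnergy, scaledHess] at *; push_cast; linarith)⟩

/-- `L⁴` bound of the gradient and `L²` bound of the Hessian in a ball. -/
theorem exists_lintegral_le_of_decay (hn : 5 ≤ n) (L : ℕ) {C : ℝ} (hC : 0 ≤ C) : ∃ D, 1 ≤ D ∧
    ∀ {Ω O : Set (E n)} {u w : E n → E L} {y : E n} {r B ε : ℝ}, IsOpen Ω → 0 < r → 0 < ε → 0 ≤ B →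
    volume.real (ball (0 : E n) 1) * B * r ^ 2 ≤ ε ^ 2 → B * r ^ 2 ≤ ε ^ 2 →
    SobolevTwo (ball y (8 * r)) (Ω.indicator w) (extGrad Ω O w) (extHess Ω O w) →
    (∀ i j, MemLp (extHess Ω Ω u i j) 2 (volume.restrict (ball y r))) →
    (∀ᵐ x ∂(volume.restrict (ball y r)),
      DensLe B (extGrad Ω Ω u) (extHess Ω Ω u) (extGrad Ω O w) (extHess Ω O w) x) →
    (∀ z ∈ ball y (4 * r), ∀ s, 0 < s → s ≤ 2 * r →
      scaledEnergy z s (extGrad Ω O w) (extHess Ω O w) ≤ C * ε ^ 2 ∧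
      scaledEnergy z s (extGrad Ω Ω u) (extHess Ω Ω u) ≤ C * ε ^ 2) →
    ∫⁻ x in Ω ∩ ball y r, ‖weakGrad Ω u x‖ₑ ^ 4 ≤ ofReal ((D * ε) ^ 4 * r ^ (n - 4)) ∧
      ∫⁻ x in Ω ∩ ball y r, ‖weakHess Ω u x‖ₑ ^ 2 ≤ ofReal ((D * ε) ^ 2 * r ^ (n - 4)) := by
  obtain ⟨M, hM, hS⟩ := exists_morrey_sobolev_ball hn L
  refine ⟨1 + C + (8 * n * (n * (M * (C + 1) ^ 2)) + 2), ?_, ?_⟩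
  · linarith [show 0 ≤ 8 * n * (n * (M * (C + 1) ^ 2)) by positivity]
  intro Ω O u w y r B ε hΩ hr hε hB hVB hB2 S mh hD H
  set D1 := 8 * n * (n * (M * (C + 1) ^ 2)) + 2 with hD1
  have hD10 : 0 ≤ D1 := by positivity
  set p := extGrad Ω O w
  set h := extHess Ω O w
  have mU : MeasurableSet (ball y r) := measurableSet_ball
  have sU : ball y r ⊆ ball y (8 * r) := ball_subset_ball (by linarith)
  have hx2 : ∀ {x}, x ∈ Ω → ‖weakHess Ω u x‖ₑ ^ 2
      = ofReal (hessDens (extHess Ω Ω u) x) := fun {x} hx => by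
    rw [← ofReal_norm, ← ofReal_pow (norm_nonneg _), norm_weakHess_sq, hessDens, hessDens,
      extHess_of_mem hx]
  have yU : y ∈ ball y (4 * r) := mem_ball_self (by linarith)
  constructor
  · have b1 : ∀ i, ∫⁻ x in ball y r, ‖p i x‖ₑ ^ 4
        ≤ ofReal (M * (C + 1) ^ 2 * ε ^ 4 * r ^ (n - 4)) := fun i => by
      refine (hS (κ := (C + 1) * ε ^ 2) hr (by positivity) (S.memLp_grad i) (S.memLp_hess i)
        (S.weak_hess i) fun z hz s hs hsr => ?_).trans (le_of_eq (by ring_nf))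
      have hzs : ball z s ⊆ ball y (8 * r) := ball_subset_ball' (by linarith [mem_ball.1 hz])
      have S' := S.mono hzs
      have hCs : C * ε ^ 2 ≤ (C + 1) * ε ^ 2 := by gcongr; linarith
      obtain ⟨h1, h2⟩ := setIntegral_dens_le hn hs ((H z hz s hs hsr).1.trans hCs)
      refine ⟨(integral_mono (S'.memLp_grad i).norm.integrable_sq
        (integrableOn_gradDens S'.memLp_grad) fun x => ?_).trans h1,
        (integral_mono (integrableOn_gradDens (S'.memLp_hess i))
        (integrableOn_hessDens S'.memLp_hess) fun x => ?_).trans h2⟩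
      · exact single_le_sum (f := fun i => ‖p i x‖ ^ 2) (fun _ _ => sq_nonneg _) (Finset.mem_univ i)
      · exact single_le_sum (f := fun i => ∑ j, ‖h i j x‖ ^ 2)
          (fun _ _ => sum_nonneg fun _ _ => sq_nonneg _) (Finset.mem_univ i)
    have b2 : ∀ᵐ x ∂(volume.restrict (ball y r)), x ∈ Ω → ‖weakGrad Ω u x‖ₑ ^ 4
        ≤ ofReal (8 * n) * (∑ i, ‖p i x‖ₑ ^ 4) + ofReal (2 * B ^ 2) := by
      filter_upwards [hD] with x hx hxΩ
      have e1 : ∑ i, ‖p i x‖ₑ ^ 4 = ofReal (∑ i, ‖p i x‖ ^ 4) := by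
        rw [ofReal_sum_of_nonneg fun i _ => by positivity]
        exact sum_congr rfl fun i _ => by rw [ofReal_pow (norm_nonneg _), ofReal_norm]
      rw [e1, ← ofReal_mul (by positivity), ← ofReal_add (by positivity)
        (by positivity), ← ofReal_norm, ← ofReal_pow (norm_nonneg _)]
      refine ofReal_le_ofReal ?_
      have h1 : ‖weakGrad Ω u x‖ ^ 2 ≤ 2 * gradDens p x + B := by
        rw [norm_weakGrad_sq, gradDens, ← extGrad_of_mem hxΩ]; exact hx.1
      have h2 : gradDens p x ^ 2 ≤ n * ∑ i, ‖p i x‖ ^ 4 := by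
        have := sq_sum_le_card_mul_sum_sq (s := Finset.univ) (f := fun i => ‖p i x‖ ^ 2)
        simp only [card_univ, Fintype.card_fin, ← pow_mul] at this
        exact this
      have h3 := pow_le_pow_left₀ (sq_nonneg _) h1 2
      rw [← pow_mul] at h3
      nlinarith [sq_nonneg (2 * gradDens p x - B)]
    have mp4 : ∀ i, AEMeasurable (fun x => ‖p i x‖ₑ ^ 4) (volume.restrict (ball y r)) :=
      fun i => ((S.mono sU).memLp_grad i).1.enorm.pow_const 4
    have b3 : ∫⁻ x in Ω ∩ ball y r, ‖weakGrad Ω u x‖ₑ ^ 4 ≤ ∫⁻ x in ball y r,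
        (ofReal (8 * n) * (∑ i, ‖p i x‖ₑ ^ 4) + ofReal (2 * B ^ 2)) := by
      refine (lintegral_mono_ae ?_).trans (lintegral_mono_set inter_subset_right)
      filter_upwards [ae_restrict_of_ae_restrict_of_subset inter_subset_right b2,
        ae_restrict_mem (hΩ.measurableSet.inter mU)] with x h1 h2 using h1 h2.1
    refine b3.trans ?_
    rw [lintegral_add_right _ measurable_const, lintegral_const_mul' _ _ ofReal_ne_top,
      lintegral_finsetSum' _ fun i _ => mp4 i, setLIntegral_const, ← ofReal_measureReal,
      volume_real_ball y hr]
    refine (add_le_add_left (mul_le_mul_right (sum_le_sum fun i _ => b1 i) _) _).trans ?_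
    rw [sum_const, card_univ, Fintype.card_fin, nsmul_eq_mul, ← ENNReal.ofReal_natCast,
      ← ofReal_mul (by positivity), ← ofReal_mul (by positivity),
      ← ofReal_mul (by positivity), ← ofReal_add (by positivity) (by positivity)]
    refine ofReal_le_ofReal ?_
    have hVB' := mul_le_mul hVB hB2 (by positivity) (by positivity)
    have e1 : 2 * B ^ 2 * (r ^ n * volume.real (ball (0 : E n) 1))
        = 2 * (volume.real (ball (0 : E n) 1) * B * r ^ 2 * (B * r ^ 2)) * r ^ (n - 4) := by
      rw [show r ^ n = r ^ (n - 4) * r ^ 4 by rw [← pow_add, Nat.sub_add_cancel (by omega)]]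
      ring
    have hD4 : D1 ≤ (1 + C + D1) ^ 4 := by
      have : 1 + C + D1 ≤ (1 + C + D1) ^ 4 := le_self_pow₀ (by linarith) (by norm_num)
      linarith
    calc _ = 8 * n * (n * (M * (C + 1) ^ 2)) * ε ^ 4 * r ^ (n - 4)
          + 2 * (volume.real (ball (0 : E n) 1) * B * r ^ 2 * (B * r ^ 2)) * r ^ (n - 4) := by
          rw [e1]; ring
      _ ≤ 8 * n * (n * (M * (C + 1) ^ 2)) * ε ^ 4 * r ^ (n - 4) + 2 * (ε ^ 2 * ε ^ 2) * r ^ (n - 4) := by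
          gcongr
      _ = D1 * (ε ^ 4 * r ^ (n - 4)) := by rw [hD1]; ring
      _ ≤ (1 + C + D1) ^ 4 * (ε ^ 4 * r ^ (n - 4)) := by gcongr
      _ = _ := by ring
  · rw [setLIntegral_congr_fun (hΩ.measurableSet.inter mU) fun x hx => hx2 hx.1]
    refine (lintegral_mono_set inter_subset_right).trans ?_
    rw [← ofReal_integral_eq_lintegral_ofReal (integrableOn_hessDens mh)
      (.of_forall (hessDens_nonneg _))]
    refine ofReal_le_ofReal ((setIntegral_dens_le hn hr (H y yU r hr (by linarith)).2).2.trans ?_)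
    rw [mul_pow]
    gcongr
    have : 1 + C + D1 ≤ (1 + C + D1) ^ 2 := le_self_pow₀ (by linarith) (by norm_num)
    linarith

end Biharmonic

end

open Biharmonic in
theorem lemma4p1 {n l L : ℕ} (hn : 5 ≤ n)
    (Ω : Set (Biharmonic.E n)) (hΩ : Biharmonic.IsBoundedSmoothDomain Ω)
    (N : Set (Biharmonic.E L)) (hN : Biharmonic.IsCompactSubmanifold l N) :
    ∃ ε₁ > (0 : ℝ), ∃ θ₀ ∈ Set.Ioo (0 : ℝ) 1, ∃ C > (0 : ℝ),
      ∀ (δ : ℝ) (φ : Biharmonic.E n → Biharmonic.E L),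
        0 < δ → Biharmonic.IsSmoothBoundaryMap Ω N δ φ →
        ∀ R₀ C₀ : ℝ, 0 < R₀ → R₀ ≤ δ →
        ∀ ε₀ : ℝ, 0 < ε₀ → ε₀ ≤ ε₁ →
        ∃ R₁ > (0 : ℝ),
          ∀ u : Biharmonic.E n → Biharmonic.E L,
            Biharmonic.IsGloballyStationary Ω N δ φ R₀ C₀ u →
            ∀ x₀ ∈ frontier Ω, ∀ R : ℝ, 0 < R → R ≤ R₁ →
              R ^ (4 - (n : ℤ)) * (∫ x in Ω ∩ Metric.ball x₀ R,
                  (‖Biharmonic.weakHess Ω u x‖ ^ 2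
                    + R ^ (-2 : ℤ) * ‖Biharmonic.weakGrad Ω u x‖ ^ 2)) ≤ ε₀ ^ 2 →
              Biharmonic.MemMorrey 4 4 (Ω ∩ Metric.ball x₀ (θ₀ * R)) (Biharmonic.weakGrad Ω u) ∧
              Biharmonic.MemMorrey 2 4 (Ω ∩ Metric.ball x₀ (θ₀ * R)) (Biharmonic.weakHess Ω u) ∧
              Biharmonic.morreyNorm 4 4 (Ω ∩ Metric.ball x₀ (θ₀ * R)) (Biharmonic.weakGrad Ω u)
                  + Biharmonic.morreyNorm 2 4 (Ω ∩ Metric.ball x₀ (θ₀ * R))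
                      (Biharmonic.weakHess Ω u)
                ≤ ENNReal.ofReal (C * ε₀) := by
  obtain ⟨K, hK⟩ := hN.isCompact.isBounded.exists_norm_le
  have hK' : ∀ a ∈ N, ‖a‖ ≤ max K 0 := fun a ha => (hK a ha).trans (le_max_left _ _)
  obtain ⟨C, hC, hdec⟩ := exists_decay_near_boundary hn L (le_max_right K 0)
  obtain ⟨D, hD, hmor⟩ := exists_lintegral_le_of_decay hn L hC
  refine ⟨1, one_pos, 1 / 64, by norm_num, 2 * D, by positivity, ?_⟩
  intro δ φ hδ hφ R₀ C₀ hR₀ hR₀δ ε hε hε1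
  obtain ⟨B, hB, hext⟩ := exists_sobolevTwo_extension hΩ.isOpen hΩ.isBounded hδ hN.isCompact hφ
  set V := volume.real (Metric.ball (0 : E n) 1) with hV
  have hV0 : 0 ≤ V := measureReal_nonneg
  have hT : 0 < |C₀| + 2 * V * B + B + 1 := by positivity
  refine ⟨min (min 1 (δ / 2)) (min R₀ (ε ^ 2 / (|C₀| + 2 * V * B + B + 1))), by positivity, ?_⟩
  intro u hu x₀ hx₀ R hR hRle hE
  obtain ⟨⟨hR1, hRδ⟩, hRR₀, hRT⟩ : (R ≤ 1 ∧ R ≤ δ / 2) ∧ R ≤ R₀ ∧ _ := by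
    simpa only [le_min_iff] using hRle
  rw [le_div_iff₀ hT] at hRT
  have hRR : R ^ 2 ≤ R := by nlinarith
  have t1 : 0 ≤ |C₀| * R := by positivity
  have t2 : 0 ≤ V * B * R := by positivity
  have t3 : 0 ≤ B * R := by positivity
  have hVB : V * B * R ^ 2 ≤ V * B * R := by gcongr
  have hBR : B * R ^ 2 ≤ B * R := by gcongr
  have hκ1 : ε ^ 2 ≤ 1 := pow_le_one₀ hε.le hε1
  have hbio := hu.stationary.1.1
  obtain ⟨S, hden⟩ := hext u hbio.1 hu.dirichlet
  have mΩ := hΩ.isOpen.measurableSet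
  have Su := hbio.1.sobolevTwo.congr hΩ.isOpen EventuallyEq.rfl
    (fun i => (indicator_ae_eq_restrict mΩ (f := weakPartial Ω i u)).symm)
    fun i j => (indicator_ae_eq_restrict mΩ (f := weakPartial₂ Ω i j u)).symm
  have hRU : Metric.ball x₀ R ⊆ boundaryNhd Ω (δ / 2) := fun x hx =>
    (Metric.infDist_le_dist_of_mem hx₀).trans_lt ((Metric.mem_ball.1 hx).trans_le hRδ)
  have SR := S.mono hRU
  have huN := hbio.2
  have huK : ∀ᵐ x ∂(volume.restrict Ω), ‖u x‖ ≤ max K 0 := huN.mono fun x hx => hK' _ hx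
  have hwK : ∀ᵐ x ∂(volume.restrict (Metric.ball x₀ R)),
      ‖Ω.indicator (fun x => u x - φ x) x‖ ≤ 2 * max K 0 := by
    filter_upwards [ae_restrict_of_ae ((ae_restrict_iff' mΩ).1 huK),
      ae_restrict_mem measurableSet_ball] with x hx hxR
    by_cases hxΩ : x ∈ Ω
    · rw [indicator_of_mem hxΩ]
      have h1 := hK' _ (hφ.2 x ⟨subset_closure hxΩ, (hRU hxR).trans (by linarith)⟩)
      linarith [norm_sub_le (u x) (φ x), hx hxΩ]
    · rw [indicator_of_notMem hxΩ, norm_zero]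
      positivity
  have hden' := ae_restrict_of_ae_restrict_of_subset hRU hden
  have hdl : ∀ᵐ x ∂(volume.restrict (Metric.ball x₀ R)), DensLe B _ _ _ _ x ∧ DensLe B _ _ _ _ x :=
    hden'.mono fun x hx => ⟨⟨hx.1.1, hx.2.1⟩, hx.1.2, hx.2.2⟩
  have gu : ∀ i, MemLp (extGrad Ω Ω u i) 2 volume := fun i =>
    (memLp_indicator_iff_restrict mΩ).2 (hbio.1.sobolevTwo.memLp_grad i)
  have gh : ∀ i j, MemLp (extHess Ω Ω u i j) 2 volume := fun i j =>
    (memLp_indicator_iff_restrict mΩ).2 (hbio.1.sobolevTwo.memLp_hess i j)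
  have hEu : scaledEnergy x₀ R (extGrad Ω Ω u) (extHess Ω Ω u) ≤ ε ^ 2 := by
    refine le_trans (le_of_eq ?_) hE
    have e1 : (Ω.indicator fun x => ‖weakHess Ω u x‖ ^ 2 + R ^ (-2 : ℤ) * ‖weakGrad Ω u x‖ ^ 2)
        = fun x => hessDens (extHess Ω Ω u) x + R ^ (-2 : ℤ) * gradDens (extGrad Ω Ω u) x := by
      funext x
      by_cases hx : x ∈ Ω
      · simp only [indicator_of_mem hx, norm_weakHess_sq, norm_weakGrad_sq, hessDens, gradDens,
          extHess_of_mem hx, extGrad_of_mem hx]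
      · simp only [indicator_of_notMem hx, hessDens, gradDens, extHess_of_notMem hx,
          extGrad_of_notMem hx]
        simp [normSq₁, normSq₂]
    rw [inter_comm, ← setIntegral_indicator mΩ, e1, integral_add
      (integrableOn_hessDens fun i j => (gh i j).restrict _)
      ((integrableOn_gradDens fun i => (gu i).restrict _).const_mul _), integral_const_mul, mul_add,
      ← mul_assoc, ← zpow_add₀ hR.ne', show 4 - (n : ℤ) + -2 = 2 - n by ring]
    rfl
  have key := hdec hΩ.isOpen hΩ.isBounded hu.monotonicity Su hu.stationary.2 huK x₀ hx₀ hR hR1 hRR₀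
    hκ1 (by linarith) hB (by linarith) SR hwK hdl hEu
  have bounds : ∀ y r, 0 < r → r ≤ 1 / 64 * R → dist y x₀ < 1 / 64 * R → _ := fun y r hr hrR hy =>
    have hsub : Metric.ball y (8 * r) ⊆ Metric.ball x₀ R := Metric.ball_subset_ball' (by linarith)
    have hr2 : r ^ 2 ≤ R ^ 2 := by gcongr; linarith
    hmor hΩ.isOpen hr hε hB ((mul_le_mul_of_nonneg_left hr2 (by positivity)).trans (by linarith))
      ((mul_le_mul_of_nonneg_left hr2 hB).trans (by linarith)) (SR.mono hsub)
      (fun i j => (gh i j).restrict _) (ae_restrict_of_ae_restrict_of_subset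
        ((Metric.ball_subset_ball (by linarith)).trans hsub) (hdl.mono fun x hx => hx.2))
      fun z hz s hs hsr => key z (by
        have := dist_triangle z y x₀
        rw [Metric.mem_ball] at *
        linarith) s hs (by linarith)
  set P := Ω ∩ Metric.ball x₀ (1 / 64 * R) with hP
  have hPR : 0 < 1 / 64 * R := by positivity
  have hPb : ∀ y r, 0 < r → Metric.ball y r ⊆ P → r ≤ 1 / 64 * R ∧ dist y x₀ < 1 / 64 * R ∧
      Ω ∩ Metric.ball y r = Metric.ball y r := fun y r hr hy =>
    ⟨radius_le_of_ball_subset (by omega) hr hPR (hy.trans inter_subset_right),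
      (hy (Metric.mem_ball_self hr)).2, inter_eq_right.2 (hy.trans inter_subset_left)⟩
  have mP : volume.restrict P ≤ volume.restrict Ω := Measure.restrict_mono inter_subset_left le_rfl
  obtain ⟨f1, f2⟩ := bounds x₀ _ hPR le_rfl (by simpa using hPR)
  have e4 : ∀ r : ℝ, r ^ ((n : ℝ) - 4) = r ^ (n - 4) := fun r => by
    rw [← Real.rpow_natCast, Nat.cast_sub (by omega)]; norm_cast
  have g4 : ∀ y r, 0 < r → Metric.ball y r ⊆ P → ∫⁻ x in Metric.ball y r, ‖weakGrad Ω u x‖ₑ ^ (4 : ℝ)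
      ≤ ENNReal.ofReal ((D * ε) ^ (4 : ℝ) * r ^ ((n : ℝ) - 4)) := fun y r hr hy => by
    obtain ⟨h1, h2, h3⟩ := hPb y r hr hy
    have := (bounds y r hr h1 h2).1
    rw [h3] at this
    rw [e4]
    exact_mod_cast this
  have g2 : ∀ y r, 0 < r → Metric.ball y r ⊆ P → ∫⁻ x in Metric.ball y r, ‖weakHess Ω u x‖ₑ ^ (2 : ℝ)
      ≤ ENNReal.ofReal ((D * ε) ^ (2 : ℝ) * r ^ ((n : ℝ) - 4)) := fun y r hr hy => by
    obtain ⟨h1, h2, h3⟩ := hPb y r hr hy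
    have := (bounds y r hr h1 h2).2
    rw [h3] at this
    rw [e4]
    exact_mod_cast this
  have hDε : 0 ≤ D * ε := by positivity
  refine ⟨memMorrey_of_le (by norm_num) hDε (hbio.1.memLp_grad.1.mono_measure mP) ?_ g4,
    memMorrey_of_le (by norm_num) hDε (hbio.1.memLp_hess.1.mono_measure mP) ?_ g2, ?_⟩
  · exact_mod_cast f1.trans_lt ENNReal.ofReal_lt_top
  · exact_mod_cast f2.trans_lt ENNReal.ofReal_lt_top
  · refine (add_le_add (morreyNorm_le (by norm_num) hDε g4)
      (morreyNorm_le (by norm_num) hDε g2)).trans (le_of_eq ?_)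
    rw [← ENNReal.ofReal_add hDε hDε]
    congr 1
    ring
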